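/- Let $p$ be a prime, $q=p^a$ with $a\ge 1$, and let $n,k\ge 1$ be integers with $\gcd(n+1,p)=1$; let $\zeta$ be a primitive $(n+1)$-th root of unity in $\overline{\mathbb F}_p$. Put $I_k=\{i=(i_0,\dots,i_n)\in\mathbb Z_{\ge 0}^{n+1}: i_0+\dots+i_n=k\}$, $w(i)=i_1+2i_2+\dots+n i_n$, and let $d_k(n,p)$ be the number of $i\in I_k$ with $\sum_j i_j\zeta^j=0$ in $\overline{\mathbb F}_p$. *Coefficients.* Let $\gamma\in\overline{\mathbb Q}_p$ be a root of $\sum_{j\ge0}T^{p^j}/p^j$ with $\mathrm{ord}_p\gamma=1/(p-1)$, fix a $q$-th root $\gamma^{1/q}$ (which fixes the fractional powers of $\gamma$ below), and let $\mathfrak O_q$ be the ring of integers of $\mathbb Q_q(\gamma^{1/q})$, where $\mathbb Q_q$ is the unramified extension of $\mathbb Q_p$ of degree $a$. For $u\in\mathbb Z^n$ let $m(u)=\max\{0,-u_1,\dots,-u_n\}$ and $w(u)=u_1+\dots+u_n+(n+1)m(u)$. For $r=0,1$ let $$\mathcal O_{p^r}=\Big\{\sum_{s\ge0}c_s\gamma^{s(n+1)/p^r}t^s: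 c_s\in\mathfrak O_q,\ c_s\to0\Big\},\qquad \mathcal C_{p^r}=\Big\{\sum_{u\in\mathbb Z^n}\xi(u)\gamma^{w(u)}t^{p^rm(u)}x^u:\ \xi(u)\in\mathcal O_{p^r},\ \xi(u)\to0 \text{ as } w(u)\to\infty\Big\},$$ where $\xi(u)\to0$ refers to the norm $\|\sum_s c_s\gamma^{s(n+1)/p^r}t^s\|=\sup_s|c_s|$. *Relative cohomology.* Let $\gamma_i=\sum_{j\le i}\gamma^{p^j}/p^j$, $K(t,x)=x_1+\dots+x_n+t/(x_1\cdots x_n)$ and $H(t,x)=\sum_{i\ge0}\gamma_iK(t^{p^i},x^{p^i})$. Put $D_{t^{p^r},l}=x_l\frac{\partial}{\partial x_l}+x_l\frac{\partial H(t^{p^r},x)}{\partial x_l}$ for $1\le l\le n$, $\partial_t=t\frac{\partial}{\partial t}+t\frac{\partial H(t,x)}{\partial t}$, and $H^n(\mathcal C_{p^r})=\mathcal C_{p^r}/\sum_lD_{t^{p^r},l}\mathcal C_{p^r}$ (the top cohomology of the Koszul complex). Let $e_j\in H^n(\mathcal C_{p^r})$ be the class of $\gamma^jx_1\cdots x_j$,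 $0\le j\le n$. Let $E(T)=\exp(\sum_jT^{p^j}/p^j)$, $\theta(T)=E(\gamma T)$, $F(t,x)=\theta(x_1)\cdots\theta(x_n)\,\theta(t/(x_1\cdots x_n))$, $\psi_x(\sum_u a(u)x^u)=\sum_u a(pu)x^u$, and let $\bar\alpha_1:H^n(\mathcal C_1)\to H^n(\mathcal C_p)$ be the map induced by $\alpha_1=\psi_x\circ F(t,x)$. *Symmetric powers.* Let $\mathcal S_{k,t^{p^r}}=\mathrm{Sym}^k_{\mathcal O_{p^r}}H^n(\mathcal C_{p^r})$ and $e^{i}=e_0^{i_0}\cdots e_n^{i_n}$ for $i\in I_k$. The map $\partial_t$ induces a map on $H^n(\mathcal C_1)$ and extends to $\mathcal S_{k,t}$ by $\partial_t(v_1\cdots v_k)=\sum_iv_1\cdots\hat v_i\cdots v_k\,\partial_t(v_i)$; put $H^1(\mathcal S_{k,t},\partial_t)=\mathcal S_{k,t}/\partial_t\mathcal S_{k,t}$. Let $\psi_t:\mathcal S_{k,t^p}\to\mathcal S_{k,t}$ be the map with $\psi_t\big(\sum_sa(s)t^s\cdot e^{i}\big)=\sum_sa(ps)t^s\cdot e^{i}$,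 and let $\bar\beta_{k,1}$ be the endomorphism of the $\mathfrak O_q$-module $H^1(\mathcal S_{k,t},\partial_t)$ induced by $\beta_{k,1}=\psi_t\circ\mathrm{Sym}^k(\bar\alpha_1)$. *Constant bases.* Let $\overline{\mathcal S}_k$ be the $k$-th symmetric power of the free $\mathbb F_q[t]$-module on $\bar e_0,\dots,\bar e_n$, and let $\nabla_{\bar G}$ be the $\mathbb F_q[t]$-linear derivation-type extension to $\overline{\mathcal S}_k$ of $\bar G(\bar e_j)=\bar e_{j+1}$ $(j<n)$, $\bar G(\bar e_n)=t\bar e_0$, that is, $\nabla_{\bar G}(\bar e^{i})=\sum_j i_j\,\bar e_0^{i_0}\cdots\bar e_j^{i_j-1}\cdots\bar e_n^{i_n}\,\bar G(\bar e_j)$. A subset $B_k\subseteq I_k$ is called a constant basis if the classes of $\bar e^{i}$, $i\in B_k$, form an $\mathbb F_q$-basis of $\overline{\mathcal S}_k/\nabla_{\bar G}\overline{\mathcal S}_k$. **Theorem 5.5.** Suppose $d_k(n,p)=0$, and let $B_k$ be a constant basis. Then the maps $\partial_t$, $\bar\alpha_1$, $\mathrm{Sym}^k(\bar\alpha_1)$,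 $\psi_t$ and $\bar\beta_{k,1}$ above are well defined, the classes of $e^{i}$, $i\in B_k$, form an $\mathfrak O_q$-basis of $H^1(\mathcal S_{k,t},\partial_t)$, and if $B(j,i)\in\mathfrak O_q$ are the coefficients in $$\bar\beta_{k,1}(e^{i})=\sum_{j\in B_k}B(j,i)\,e^{j}\qquad(i\in B_k),$$ then $\mathrm{ord}_pB(j,i)\ge w(j)$ for all $i,j\in B_k$. -/

import Mathlib

open Filter Topology

namespace HyperKloosterman

noncomputable section

/-! ### Combinatorial data -/

/-- `m(u) = max {0, -u_1, …, -u_n}`. -/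
def mfun {n : ℕ} (u : Fin n → ℤ) : ℕ := Finset.univ.sup fun i => (-(u i)).toNat

/-- `w(u) = u_1 + ⋯ + u_n + (n+1) m(u)`. -/
def wfun {n : ℕ} (u : Fin n → ℤ) : ℤ := ∑ i, u i + ((n : ℤ) + 1) * (mfun u : ℤ)

/-- `I_k`: the tuples `(i_0, …, i_n)` of nonnegative integers with `i_0 + ⋯ + i_n = k`. -/
abbrev Idx (n k : ℕ) : Type := {i : Fin (n + 1) → ℕ // ∑ j, i j = k}

/-- `w(i) = 0·i_0 + 1·i_1 + ⋯ + n·i_n`. -/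
def wt {n k : ℕ} (i : Idx n k) : ℕ := ∑ j : Fin (n + 1), (j : ℕ) * i.1 j

/-- `d_k(n,p)`: the number of `i ∈ I_k` with `∑ i_j ζ^j = 0` in the algebraic closure of `𝔽_p`,
where `ζ` is meant to be a primitive `(n+1)`-th root of unity. -/
def dk (p n k : ℕ) [Fact p.Prime] (ζ : AlgebraicClosure (ZMod p)) : ℕ :=
  Nat.card {i : Idx n k // ∑ j : Fin (n + 1), (i.1 j : AlgebraicClosure (ZMod p)) * ζ ^ (j : ℕ) = 0}

/-! ### The reduced symmetric power complex and the constant bases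

Let `F = 𝔽_q`. Over `F[t]`, the reduced relative cohomology is free on `ē_0, …, ē_n`, so its symmetric algebra is
the polynomial ring `F[t][ē_0, …, ē_n]`, and its `k`-th symmetric power consists of the
homogeneous polynomials of degree `k`. -/

/-- `S̄_k = Sym^k` of the free `F[t]`-module on `ē_0, …, ē_n`. -/
abbrev RedSym (F : Type) [Field F] (n k : ℕ) :
    Submodule (Polynomial F) (MvPolynomial (Fin (n + 1)) (Polynomial F)) :=
  MvPolynomial.homogeneousSubmodule (Fin (n + 1)) (Polynomial F) k

instance (F : Type) [Field F] (n k : ℕ) : AddCommGroup (RedSym F n k) :=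
  Submodule.addCommGroup (RedSym F n k)

/-- `Ḡ(ē_j) = ē_{j+1}` for `j < n` and `Ḡ(ē_n) = t ē_0`. -/
def redG (F : Type) [Field F] (n : ℕ) (j : Fin (n + 1)) :
    MvPolynomial (Fin (n + 1)) (Polynomial F) :=
  if j = Fin.last n then MvPolynomial.C Polynomial.X * MvPolynomial.X 0
  else MvPolynomial.X (j + 1)

/-- `∇_Ḡ`: the `F[t]`-linear derivation that extends `Ḡ`, that is
`ē^i ↦ ∑_j i_j ē_0^{i_0} ⋯ ē_j^{i_j - 1} ⋯ ē_n^{i_n} Ḡ(ē_j)`. -/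
def redNabla (F : Type) [Field F] (n : ℕ) :
    Derivation (Polynomial F) (MvPolynomial (Fin (n + 1)) (Polynomial F))
      (MvPolynomial (Fin (n + 1)) (Polynomial F)) :=
  MvPolynomial.mkDerivation _ (redG F n)

/-- The image `∇_Ḡ(S̄_k)`, inside `S̄_k`. -/
def redImage (F : Type) [Field F] (n k : ℕ) : Submodule (Polynomial F) (RedSym F n k) :=
  ((RedSym F n k).map (redNabla F n).toLinearMap).comap (RedSym F n k).subtype

/-- `H^1(Ω^•(S̄_k, ∇_Ḡ)) = S̄_k / ∇_Ḡ S̄_k`. -/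
abbrev RedH1 (F : Type) [Field F] (n k : ℕ) : Type := RedSym F n k ⧸ redImage F n k

/-- The constant vector `ē^i = ē_0^{i_0} ⋯ ē_n^{i_n}` of `S̄_k`. -/
def redMono (F : Type) [Field F] {n k : ℕ} (i : Idx n k) : RedSym F n k :=
  ⟨∏ j, MvPolynomial.X j ^ i.1 j, by
    have h := MvPolynomial.IsHomogeneous.prod Finset.univ
      (fun j : Fin (n + 1) =>
        (MvPolynomial.X j : MvPolynomial (Fin (n + 1)) (Polynomial F)) ^ i.1 j)
      (fun j => i.1 j) (fun j _ => by
        simpa using (MvPolynomial.isHomogeneous_X (Polynomial F) j).pow (i.1 j))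
    rw [i.2] at h
    exact h⟩

/-- The class of `ē^i` in `H^1(Ω^•(S̄_k, ∇_Ḡ))`. -/
def redCls (F : Type) [Field F] {n k : ℕ} (i : Idx n k) : RedH1 F n k :=
  (redImage F n k).mkQ (redMono F i)

/-- `B ⊆ I_k` is a constant basis: the classes of the `ē^i`, `i ∈ B`, form an `F`-basis of
`H^1(Ω^•(S̄_k, ∇_Ḡ))`. -/
def IsConstantBasis (F : Type) [Field F] {n k : ℕ} (B : Set (Idx n k)) : Prop :=
  LinearIndependent F (fun i : B => redCls F i.1) ∧
    Submodule.span F (Set.range fun i : B => redCls F i.1) = ⊤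

/-! ### Coefficients -/

/-- `γ` is a root of `∑ T^{p^j}/p^j` with `ord_p γ = 1/(p-1)`. -/
def IsDworkRoot (p : ℕ) [Fact p.Prime] (γ : PadicAlgCl p) : Prop :=
  HasSum (fun j : ℕ => γ ^ p ^ j / (p : PadicAlgCl p) ^ j) 0 ∧ ‖γ‖ ^ (p - 1) = (p : ℝ)⁻¹

/-- The field `ℚ_q(γ^{1/q})`, where `q = p^a` and `g = γ^{1/q}`; the unramified extension `ℚ_q` of
degree `a` of `ℚ_p` is generated by the `(q-1)`-th roots of unity. -/
def Lq (p a : ℕ) [Fact p.Prime] (g : PadicAlgCl p) : IntermediateField ℚ_[p] (PadicAlgCl p) :=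
  IntermediateField.adjoin ℚ_[p] (insert g {z : PadicAlgCl p | z ^ (p ^ a - 1) = 1})

/-- The ring of integers `𝔒_q` of `ℚ_q(γ^{1/q})`. -/
def Oq (p a : ℕ) [Fact p.Prime] (g : PadicAlgCl p) : Subring (PadicAlgCl p) where
  carrier := {x | x ∈ Lq p a g ∧ ‖x‖ ≤ 1}
  mul_mem' := fun hx hy => ⟨mul_mem hx.1 hy.1, by
    rw [norm_mul]; exact mul_le_one₀ hx.2 (norm_nonneg _) hy.2⟩
  one_mem' := ⟨one_mem _, by simp⟩
  add_mem' := fun hx hy => ⟨add_mem hx.1 hy.1,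
    (IsUltrametricDist.norm_add_le_max _ _).trans (max_le hx.2 hy.2)⟩
  zero_mem' := ⟨zero_mem _, by simp⟩
  neg_mem' := fun hx => ⟨neg_mem hx.1, by rw [norm_neg]; exact hx.2⟩

/-- `γ = g^q`, where `g = γ^{1/q}`. -/
def gam (p a : ℕ) [Fact p.Prime] (g : PadicAlgCl p) : PadicAlgCl p := g ^ p ^ a

/-- `γ^{s(n+1)/p^r} = g^{p^{a-r}(n+1)s}`, for `r ≤ a`. -/
def gpow (p a n r : ℕ) [Fact p.Prime] (g : PadicAlgCl p) (s : ℕ) : PadicAlgCl p :=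
  g ^ (p ^ (a - r) * ((n + 1) * s))

lemma gpow_add (p a n r : ℕ) [Fact p.Prime] (g : PadicAlgCl p) (s s' : ℕ) :
    gpow p a n r g (s + s') = gpow p a n r g s * gpow p a n r g s' := by
  unfold gpow
  rw [← pow_add]
  ring_nf

/-- The series `∑_s c_s γ^{s(n+1)/p^r} t^s`. -/
def tser (p a n r : ℕ) [Fact p.Prime] (g : PadicAlgCl p) (c : ℕ → PadicAlgCl p) :
    PowerSeries (PadicAlgCl p) :=
  PowerSeries.mk fun s => c s * gpow p a n r g s

/-- The product of two sequences as coefficients of power series. -/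
def conv {p : ℕ} [Fact p.Prime] (c d : ℕ → PadicAlgCl p) (s : ℕ) : PadicAlgCl p :=
  ∑ x ∈ Finset.HasAntidiagonal.antidiagonal s, c x.1 * d x.2

lemma tser_mul (p a n r : ℕ) [Fact p.Prime] (g : PadicAlgCl p) (c d : ℕ → PadicAlgCl p) :
    tser p a n r g c * tser p a n r g d = tser p a n r g (conv c d) := by
  ext s
  simp only [tser, PowerSeries.coeff_mul, PowerSeries.coeff_mk, conv, Finset.sum_mul]
  refine Finset.sum_congr rfl fun x hx => ?_
  rw [Finset.HasAntidiagonal.mem_antidiagonal] at hx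
  rw [← hx, gpow_add]
  ring

lemma conv_mem {p a : ℕ} [Fact p.Prime] {g : PadicAlgCl p} {c d : ℕ → PadicAlgCl p}
    (hc : ∀ s, c s ∈ Oq p a g) (hd : ∀ s, d s ∈ Oq p a g) (s : ℕ) : conv c d s ∈ Oq p a g :=
  sum_mem fun _ _ => mul_mem (hc _) (hd _)

lemma conv_le {p : ℕ} [Fact p.Prime] {c d : ℕ → PadicAlgCl p} {ε : ℝ} (hε : 0 ≤ ε) {s : ℕ}
    (h : ∀ x ∈ Finset.HasAntidiagonal.antidiagonal s, ‖c x.1‖ * ‖d x.2‖ ≤ ε) : ‖conv c d s‖ ≤ ε :=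
  IsUltrametricDist.norm_sum_le_of_forall_le_of_nonneg hε fun x hx => by
    rw [norm_mul]; exact h x hx

lemma conv_tendsto {p a : ℕ} [Fact p.Prime] {g : PadicAlgCl p} {c d : ℕ → PadicAlgCl p}
    (hc : ∀ s, c s ∈ Oq p a g) (hd : ∀ s, d s ∈ Oq p a g)
    (hc0 : Tendsto c atTop (𝓝 0)) (hd0 : Tendsto d atTop (𝓝 0)) :
    Tendsto (conv c d) atTop (𝓝 0) := by
  rw [Metric.tendsto_atTop] at *
  intro ε hε
  obtain ⟨N, hN⟩ := hc0 (ε / 2) (half_pos hε)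
  obtain ⟨M, hM⟩ := hd0 (ε / 2) (half_pos hε)
  refine ⟨N + M, fun s hs => ?_⟩
  rw [dist_zero_right]
  refine lt_of_le_of_lt (conv_le (half_pos hε).le fun x hx => ?_) (half_lt_self hε)
  rw [Finset.HasAntidiagonal.mem_antidiagonal] at hx
  rcases le_or_gt N x.1 with h | h
  · have h1 := (hN _ h).le
    rw [dist_zero_right] at h1
    calc ‖c x.1‖ * ‖d x.2‖ ≤ ε / 2 * 1 :=
          mul_le_mul h1 (hd _).2 (norm_nonneg _) (half_pos hε).le
      _ = ε / 2 := mul_one _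
  · have h1 := (hM x.2 (by omega)).le
    rw [dist_zero_right] at h1
    calc ‖c x.1‖ * ‖d x.2‖ ≤ 1 * (ε / 2) :=
          mul_le_mul (hc _).2 h1 (norm_nonneg _) zero_le_one
      _ = ε / 2 := one_mul _

/-- The ring `𝒪_{p^r}` of the series `∑_s c_s γ^{s(n+1)/p^r} t^s` with `c_s ∈ 𝔒_q`, `c_s → 0`. -/
def Or (p a n r : ℕ) [Fact p.Prime] (g : PadicAlgCl p) :
    Subring (PowerSeries (PadicAlgCl p)) where
  carrier := {f | ∃ c : ℕ → PadicAlgCl p, (∀ s, c s ∈ Oq p a g) ∧ Tendsto c atTop (𝓝 0) ∧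
    f = tser p a n r g c}
  mul_mem' := by
    rintro _ _ ⟨c, hc, hc0, rfl⟩ ⟨d, hd, hd0, rfl⟩
    exact ⟨conv c d, conv_mem hc hd, conv_tendsto hc hd hc0 hd0, tser_mul _ _ _ _ _ _ _⟩
  one_mem' := by
    refine ⟨fun s => if s = 0 then 1 else 0, fun s => ?_, ?_, ?_⟩
    · dsimp only
      split_ifs
      · exact one_mem _
      · exact zero_mem _
    · refine tendsto_const_nhds.congr' ?_
      filter_upwards [eventually_gt_atTop 0] with s hs
      rw [if_neg hs.ne']
    · ext s
      rw [PowerSeries.coeff_one, tser, PowerSeries.coeff_mk]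
      split_ifs with h
      · simp [h, gpow]
      · simp
  add_mem' := by
    rintro _ _ ⟨c, hc, hc0, rfl⟩ ⟨d, hd, hd0, rfl⟩
    refine ⟨fun s => c s + d s, fun s => add_mem (hc s) (hd s), by simpa using hc0.add hd0, ?_⟩
    ext s
    simp [tser, add_mul]
  zero_mem' := by
    refine ⟨fun _ => 0, fun _ => zero_mem _, tendsto_const_nhds, ?_⟩
    ext s
    simp [tser]
  neg_mem' := by
    rintro _ ⟨c, hc, hc0, rfl⟩
    refine ⟨fun s => -c s, fun s => neg_mem (hc s), by simpa using hc0.neg, ?_⟩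
    ext s
    simp [tser]

lemma C_mem_Or (p a n r : ℕ) [Fact p.Prime] (g : PadicAlgCl p) (x : Oq p a g) :
    PowerSeries.C (x : PadicAlgCl p) ∈ Or p a n r g := by
  refine ⟨fun s => if s = 0 then (x : PadicAlgCl p) else 0, fun s => ?_, ?_, ?_⟩
  · dsimp only
    split_ifs
    · exact x.2
    · exact zero_mem _
  · refine tendsto_const_nhds.congr' ?_
    filter_upwards [eventually_gt_atTop 0] with s hs
    rw [if_neg hs.ne']
  · ext s
    rw [PowerSeries.coeff_C, tser, PowerSeries.coeff_mk]
    split_ifs with h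
    · simp [h, gpow]
    · simp

/-- The inclusion of the constants `𝔒_q → 𝒪_{p^r}`. -/
def constHom (p a n r : ℕ) [Fact p.Prime] (g : PadicAlgCl p) : Oq p a g →+* Or p a n r g :=
  ((PowerSeries.C (R := PadicAlgCl p)).comp (Oq p a g).subtype).codRestrict (Or p a n r g)
    (C_mem_Or p a n r g)

/-! ### Formal series in `x` with coefficients in `K⟦t⟧` -/

/-- Formal series `∑_{u ∈ ℤ^n} f(u) x^u` with coefficients `f(u)` power series in `t`. -/
abbrev Ser (p n : ℕ) [Fact p.Prime] : Type := (Fin n → ℤ) → PowerSeries (PadicAlgCl p)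

/-- The product of two formal series. In all the uses below each coefficient is a finite sum. -/
def smulS {p n : ℕ} [Fact p.Prime] (f h : Ser p n) : Ser p n := fun u =>
  PowerSeries.mk fun s => ∑ᶠ v : Fin n → ℤ, PowerSeries.coeff s (f v * h (u - v))

/-- `x_l ∂/∂x_l`. -/
def xD {p n : ℕ} [Fact p.Prime] (l : Fin n) (f : Ser p n) : Ser p n := fun u => (u l) • f u

/-- `t ∂/∂t`. -/
def tD {p n : ℕ} [Fact p.Prime] (f : Ser p n) : Ser p n := fun u =>
  PowerSeries.mk fun s => (s : PadicAlgCl p) * PowerSeries.coeff s (f u)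

/-- `K(t^N, x^M) = x_1^M + ⋯ + x_n^M + t^N / (x_1 ⋯ x_n)^M`. -/
def Kser (p n N M : ℕ) [Fact p.Prime] : Ser p n :=
  ∑ l : Fin n, Pi.single (Pi.single l (M : ℤ)) 1 +
    Pi.single (fun _ => -(M : ℤ)) (PowerSeries.X ^ N)

/-- `γ_i = ∑_{j ≤ i} γ^{p^j}/p^j`. -/
def gamSeq (p a : ℕ) [Fact p.Prime] (g : PadicAlgCl p) (i : ℕ) : PadicAlgCl p :=
  ∑ j ∈ Finset.range (i + 1), gam p a g ^ p ^ j / (p : PadicAlgCl p) ^ j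

/-- `H(t^{p^r}, x)`, where `H(t, x) = ∑_i γ_i K(t^{p^i}, x^{p^i})`. -/
def Hser (p a n r : ℕ) [Fact p.Prime] (g : PadicAlgCl p) : Ser p n := fun u =>
  PowerSeries.mk fun s =>
    ∑ᶠ i : ℕ, gamSeq p a g i * PowerSeries.coeff s (Kser p n (p ^ (r + i)) (p ^ i) u)

/-- `D_{t^{p^r}, l} = x_l ∂/∂x_l + x_l ∂H(t^{p^r}, x)/∂x_l`. -/
def Dop (p a n r : ℕ) [Fact p.Prime] (g : PadicAlgCl p) (l : Fin n) (f : Ser p n) : Ser p n :=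
  xD l f + smulS (xD l (Hser p a n r g)) f

/-- `∂_{t^{p^r}} = t ∂/∂t + t ∂H(t^{p^r}, x)/∂t`. -/
def dop (p a n r : ℕ) [Fact p.Prime] (g : PadicAlgCl p) (f : Ser p n) : Ser p n :=
  tD f + smulS (tD (Hser p a n r g)) f

/-- The Artin–Hasse series `E(T) = exp(∑_j T^{p^j}/p^j)`. -/
def artinHasse (p : ℕ) : PowerSeries ℚ :=
  (PowerSeries.exp ℚ).subst
    (PowerSeries.mk fun m => open Classical in if ∃ j : ℕ, m = p ^ j then (1 / m : ℚ) else 0)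

/-- The coefficients of Dwork's splitting function `θ(T) = E(γT) = ∑ θ_j T^j`. -/
def theta (p a : ℕ) [Fact p.Prime] (g : PadicAlgCl p) (j : ℕ) : PadicAlgCl p :=
  ((PowerSeries.coeff j (artinHasse p) : ℚ) : PadicAlgCl p) * gam p a g ^ j

/-- `F(t, x) = θ(x_1) ⋯ θ(x_n) θ(t/(x_1 ⋯ x_n))`: the coefficient of `x^u` is
`∑ θ_{m_1} ⋯ θ_{m_n} θ_l t^l`, over the `l ≥ m(u)` and `m_i = u_i + l`. -/
def Fser (p a n : ℕ) [Fact p.Prime] (g : PadicAlgCl p) : Ser p n := fun u =>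
  PowerSeries.mk fun l =>
    if mfun u ≤ l then (∏ i, theta p a g (u i + l).toNat) * theta p a g l else 0

/-- `α_1 = ψ_x ∘ F(t, x)`, where `ψ_x (∑ a(u) x^u) = ∑ a(pu) x^u`. -/
def alphaOp (p a n : ℕ) [Fact p.Prime] (g : PadicAlgCl p) (f : Ser p n) : Ser p n := fun u =>
  smulS (Fser p a n g) f ((p : ℤ) • u)

/-! ### The spaces `𝒞_{p^r}` and relative cohomology -/

/-- `∑_u ξ(u) γ^{w(u)} t^{p^r m(u)} x^u` where `ξ(u) = ∑_s c(u,s) γ^{s(n+1)/p^r} t^s`. -/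
def xser (p a n r : ℕ) [Fact p.Prime] (g : PadicAlgCl p)
    (c : (Fin n → ℤ) → ℕ → PadicAlgCl p) : Ser p n := fun u =>
  tser p a n r g (c u) *
    (PowerSeries.C (gam p a g ^ wfun u) * PowerSeries.X ^ (p ^ r * mfun u))

/-- The `𝒪_{p^r}`-module `𝒞_{p^r}` of the series `∑_u ξ(u) γ^{w(u)} t^{p^r m(u)} x^u` with
`ξ(u) ∈ 𝒪_{p^r}` and `ξ(u) → 0` in the sup-norm as `w(u) → ∞`. -/
def Cr (p a n r : ℕ) [Fact p.Prime] (g : PadicAlgCl p) : Submodule (Or p a n r g) (Ser p n) where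
  carrier := {f | ∃ c : (Fin n → ℤ) → ℕ → PadicAlgCl p,
    (∀ u s, c u s ∈ Oq p a g) ∧ (∀ u, Tendsto (c u) atTop (𝓝 0)) ∧
    (∀ ε : ℝ, 0 < ε → ∃ N : ℤ, ∀ u, N ≤ wfun u → ∀ s, ‖c u s‖ ≤ ε) ∧
    f = xser p a n r g c}
  add_mem' := by
    rintro _ _ ⟨c, hc, hc0, hcu, rfl⟩ ⟨d, hd, hd0, hdu, rfl⟩
    refine ⟨fun u s => c u s + d u s, fun u s => add_mem (hc u s) (hd u s),
      fun u => by simpa using (hc0 u).add (hd0 u), fun ε hε => ?_, ?_⟩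
    · obtain ⟨N, hN⟩ := hcu ε hε
      obtain ⟨M, hM⟩ := hdu ε hε
      exact ⟨max N M, fun u hu s => (IsUltrametricDist.norm_add_le_max _ _).trans
        (max_le (hN u ((le_max_left _ _).trans hu) s) (hM u ((le_max_right _ _).trans hu) s))⟩
    · funext u
      rw [Pi.add_apply, xser, xser, xser, ← add_mul]
      congr 1
      ext s
      simp [tser, add_mul]
  zero_mem' := by
    refine ⟨fun _ _ => 0, fun _ _ => zero_mem _, fun _ => tendsto_const_nhds,
      fun ε hε => ⟨0, fun _ _ _ => by simpa using hε.le⟩, ?_⟩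
    funext u
    have : tser p a n r g (fun _ => 0) = 0 := by ext s; simp [tser]
    rw [xser, this, zero_mul]
    rfl
  smul_mem' := by
    rintro ⟨_, d, hd, hd0, rfl⟩ _ ⟨c, hc, hc0, hcu, rfl⟩
    refine ⟨fun u => conv d (c u), fun u => conv_mem hd (hc u),
      fun u => conv_tendsto hd (hc u) hd0 (hc0 u), fun ε hε => ?_, ?_⟩
    · obtain ⟨N, hN⟩ := hcu ε hε
      refine ⟨N, fun u hu s => conv_le hε.le fun x _ => ?_⟩
      calc ‖d x.1‖ * ‖c u x.2‖ ≤ 1 * ε :=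
            mul_le_mul (hd _).2 (hN u hu _) (norm_nonneg _) zero_le_one
        _ = ε := one_mul _
    · funext u
      change tser p a n r g d * xser p a n r g c u = _
      rw [xser, xser, ← mul_assoc, tser_mul]

/-- The image of the last boundary map of the Koszul complex of `𝒞_{p^r}` on `D_{t^{p^r}, 1}, …,
D_{t^{p^r}, n}`, that is `∑_l D_{t^{p^r}, l} 𝒞_{p^r}`. -/
def bdry (p a n r : ℕ) [Fact p.Prime] (g : PadicAlgCl p) :
    Submodule (Or p a n r g) (Cr p a n r g) :=
  Submodule.span _ {η | ∃ (l : Fin n) (f : Cr p a n r g), (η : Ser p n) = Dop p a n r g l f}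

/-- The relative cohomology `H^n(𝒞_{p^r}, D_{t^{p^r}})`, the top cohomology of the Koszul complex. -/
def Hn (p a n r : ℕ) [Fact p.Prime] (g : PadicAlgCl p) : Type :=
  Cr p a n r g ⧸ bdry p a n r g

instance (p a n r : ℕ) [Fact p.Prime] (g : PadicAlgCl p) : AddCommGroup (Hn p a n r g) :=
  inferInstanceAs (AddCommGroup (Cr p a n r g ⧸ bdry p a n r g))

instance (p a n r : ℕ) [Fact p.Prime] (g : PadicAlgCl p) :
    Module (Or p a n r g) (Hn p a n r g) :=
  inferInstanceAs (Module (Or p a n r g) (Cr p a n r g ⧸ bdry p a n r g))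

instance (p a n r : ℕ) [Fact p.Prime] (g : PadicAlgCl p) : Module (Oq p a g) (Hn p a n r g) :=
  Module.compHom _ (constHom p a n r g)

/-- The class in `H^n(𝒞_{p^r}, D_{t^{p^r}})` of an element of `𝒞_{p^r}`. -/
def cls (p a n r : ℕ) [Fact p.Prime] (g : PadicAlgCl p) :
    Cr p a n r g →ₗ[Or p a n r g] Hn p a n r g :=
  (bdry p a n r g).mkQ

/-- The exponent `(1, …, 1, 0, …, 0)` of `x_1 ⋯ x_i`. -/
def expo (n i : ℕ) : Fin n → ℤ := fun l => if (l : ℕ) < i then 1 else 0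

/-- `e_i = γ^i x_1 ⋯ x_i`, as a formal series. -/
def eSer (p a n : ℕ) [Fact p.Prime] (g : PadicAlgCl p) (i : ℕ) : Ser p n :=
  Pi.single (expo n i) (PowerSeries.C (gam p a g ^ i))

lemma mfun_expo (n i : ℕ) : mfun (expo n i) = 0 := by
  unfold mfun expo
  refine (Finset.sup_eq_bot_iff _ _).2 fun l _ => ?_
  split_ifs <;> simp

lemma wfun_expo (n i : ℕ) (h : i ≤ n) : wfun (expo n i) = i := by
  unfold wfun
  rw [mfun_expo]
  simp only [expo, Finset.sum_boole, Nat.cast_zero, mul_zero, add_zero]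
  have : (Finset.univ.filter fun l : Fin n => (l : ℕ) < i).card = i := by
    rw [Fin.card_filter_val_lt]
    exact min_eq_right h
  exact_mod_cast this

lemma eSer_mem (p a n r : ℕ) [Fact p.Prime] (g : PadicAlgCl p) (i : Fin (n + 1)) :
    eSer p a n g i ∈ Cr p a n r g := by
  refine ⟨fun u s => if u = expo n i ∧ s = 0 then 1 else 0, fun u s => ?_, fun u => ?_,
    fun ε hε => ⟨wfun (expo n i) + 1, fun u hu s => ?_⟩, ?_⟩
  · dsimp only
    split_ifs
    · exact one_mem _
    · exact zero_mem _
  · refine tendsto_const_nhds.congr' ?_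
    filter_upwards [eventually_gt_atTop 0] with s hs
    rw [if_neg fun h => hs.ne' h.2]
  · dsimp only
    rw [if_neg, norm_zero]
    · exact hε.le
    · rintro ⟨rfl, -⟩
      omega
  · funext u
    rw [eSer, xser]
    by_cases h : u = expo n i
    · subst h
      have h1 : tser p a n r g (fun s => if expo n i = expo n i ∧ s = 0 then 1 else 0) = 1 := by
        ext s
        rw [PowerSeries.coeff_one, tser, PowerSeries.coeff_mk]
        by_cases hs : s = 0 <;> simp [hs, gpow]
      rw [Pi.single_eq_same, h1, one_mul, mfun_expo, wfun_expo n i (Nat.lt_succ_iff.1 i.2)]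
      simp
    · have h1 : tser p a n r g (fun s => if u = expo n i ∧ s = 0 then 1 else 0) = 0 := by
        ext s
        simp [tser, h]
      rw [Pi.single_eq_of_ne h, h1, zero_mul]

/-- The class of `e_i = γ^i x_1 ⋯ x_i` in `H^n(𝒞_{p^r}, D_{t^{p^r}})`. -/
def eCls (p a n r : ℕ) [Fact p.Prime] (g : PadicAlgCl p) (i : Fin (n + 1)) : Hn p a n r g :=
  cls p a n r g ⟨eSer p a n g i, eSer_mem p a n r g i⟩

/-- The connection `∂_t` on `H^n(𝒞, D_t)` is the map induced by `∂_t` on `𝒞`. -/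
def IsConn (p a n : ℕ) [Fact p.Prime] (g : PadicAlgCl p)
    (φ : Hn p a n 0 g →ₗ[Oq p a g] Hn p a n 0 g) : Prop :=
  ∀ f : Cr p a n 0 g, ∃ h : Cr p a n 0 g, (h : Ser p n) = dop p a n 0 g f ∧
    φ (cls p a n 0 g f) = cls p a n 0 g h

/-- The connection `∂_t` on `H^n(𝒞, D_t)`. -/
def conn (p a n : ℕ) [Fact p.Prime] (g : PadicAlgCl p) :
    Hn p a n 0 g →ₗ[Oq p a g] Hn p a n 0 g :=
  Classical.epsilon (IsConn p a n g)

/-- The relative Frobenius `ᾱ_1 : H^n(𝒞, D_t) → H^n(𝒞_p, D_{t^p})` is the map induced by `α_1`. -/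
def IsFrob (p a n : ℕ) [Fact p.Prime] (g : PadicAlgCl p)
    (φ : Hn p a n 0 g →ₗ[Oq p a g] Hn p a n 1 g) : Prop :=
  ∀ f : Cr p a n 0 g, ∃ h : Cr p a n 1 g, (h : Ser p n) = alphaOp p a n g f ∧
    φ (cls p a n 0 g f) = cls p a n 1 g h

/-- The relative Frobenius `ᾱ_1 : H^n(𝒞, D_t) → H^n(𝒞_p, D_{t^p})`. -/
def frob (p a n : ℕ) [Fact p.Prime] (g : PadicAlgCl p) :
    Hn p a n 0 g →ₗ[Oq p a g] Hn p a n 1 g :=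
  Classical.epsilon (IsFrob p a n g)

/-! ### Symmetric powers -/

/-- The degree `k` part of the symmetric algebra of `H^n(𝒞_{p^r}, D_{t^{p^r}})` over `𝒪_{p^r}`. -/
def symSub (p a n k r : ℕ) [Fact p.Prime] (g : PadicAlgCl p) :
    Submodule (Or p a n r g) (SymmetricAlgebra (Or p a n r g) (Hn p a n r g)) :=
  Submodule.span _ (Set.range fun v : Fin k → Hn p a n r g =>
    ∏ i, SymmetricAlgebra.ι (Or p a n r g) (Hn p a n r g) (v i))

/-- `S_{k, t^{p^r}} = Sym^k_{𝒪_{p^r}} H^n(𝒞_{p^r}, D_{t^{p^r}})`. -/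
def Sk (p a n k r : ℕ) [Fact p.Prime] (g : PadicAlgCl p) : Type := symSub p a n k r g

instance (p a n k r : ℕ) [Fact p.Prime] (g : PadicAlgCl p) : AddCommGroup (Sk p a n k r g) :=
  inferInstanceAs (AddCommGroup (symSub p a n k r g))

instance (p a n k r : ℕ) [Fact p.Prime] (g : PadicAlgCl p) :
    Module (Or p a n r g) (Sk p a n k r g) :=
  inferInstanceAs (Module (Or p a n r g) (symSub p a n k r g))

instance (p a n k r : ℕ) [Fact p.Prime] (g : PadicAlgCl p) :
    Module (Oq p a g) (Sk p a n k r g) :=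
  Module.compHom _ (constHom p a n r g)

/-- The monomial `v_1 ⋯ v_k` in `S_{k, t^{p^r}}`. -/
def symProd (p a n k r : ℕ) [Fact p.Prime] (g : PadicAlgCl p) (v : Fin k → Hn p a n r g) :
    Sk p a n k r g :=
  ⟨∏ i, SymmetricAlgebra.ι (Or p a n r g) (Hn p a n r g) (v i), Submodule.subset_span ⟨v, rfl⟩⟩

lemma exists_prod_eq {A : Type*} [CommMonoid A] {k : ℕ} {N : ℕ} (i : Fin N → ℕ)
    (h : ∑ j, i j = k) : ∃ σ : Fin k → Fin N, ∀ x : Fin N → A,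
      ∏ l, x (σ l) = ∏ j, x j ^ i j := by
  subst h
  refine ⟨fun l => (finSigmaFinEquiv.symm l).1, fun x => ?_⟩
  rw [finSigmaFinEquiv.symm.prod_comp (fun y => x y.1), Fintype.prod_sigma]
  simp

/-- The monomial `e^i = e_0^{i_0} ⋯ e_n^{i_n}` in `S_{k, t^{p^r}}`. -/
def eMono (p a n k r : ℕ) [Fact p.Prime] (g : PadicAlgCl p) (i : Idx n k) : Sk p a n k r g :=
  ⟨∏ j, SymmetricAlgebra.ι (Or p a n r g) (Hn p a n r g) (eCls p a n r g j) ^ i.1 j, by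
    obtain ⟨σ, hσ⟩ := exists_prod_eq
      (A := SymmetricAlgebra (Or p a n r g) (Hn p a n r g)) i.1 i.2
    rw [← hσ fun j => SymmetricAlgebra.ι (Or p a n r g) (Hn p a n r g) (eCls p a n r g j)]
    exact Submodule.subset_span ⟨fun l => eCls p a n r g (σ l), rfl⟩⟩

/-- The extension of `∂_t` to `S_{k,t}`:
`∂_t(v_1 ⋯ v_k) = ∑_i v_1 ⋯ v̂_i ⋯ v_k ∂_t(v_i)`. -/
def IsSymConn (p a n k : ℕ) [Fact p.Prime] (g : PadicAlgCl p)
    (φ : Sk p a n k 0 g →ₗ[Oq p a g] Sk p a n k 0 g) : Prop :=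
  ∀ v : Fin k → Hn p a n 0 g, φ (symProd p a n k 0 g v) =
    ∑ i, symProd p a n k 0 g (Function.update v i (conn p a n g (v i)))

/-- The connection `∂_t` on `S_{k,t}`. -/
def symConn (p a n k : ℕ) [Fact p.Prime] (g : PadicAlgCl p) :
    Sk p a n k 0 g →ₗ[Oq p a g] Sk p a n k 0 g :=
  Classical.epsilon (IsSymConn p a n k g)

/-- `Sym^k(ᾱ_1) : S_{k,t} → S_{k,t^p}` maps `v_1 ⋯ v_k` to `ᾱ_1(v_1) ⋯ ᾱ_1(v_k)`. -/
def IsSymFrob (p a n k : ℕ) [Fact p.Prime] (g : PadicAlgCl p)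
    (φ : Sk p a n k 0 g →ₗ[Oq p a g] Sk p a n k 1 g) : Prop :=
  ∀ v : Fin k → Hn p a n 0 g, φ (symProd p a n k 0 g v) =
    symProd p a n k 1 g fun i => frob p a n g (v i)

/-- `Sym^k(ᾱ_1) : S_{k,t} → S_{k,t^p}`. -/
def symFrob (p a n k : ℕ) [Fact p.Prime] (g : PadicAlgCl p) :
    Sk p a n k 0 g →ₗ[Oq p a g] Sk p a n k 1 g :=
  Classical.epsilon (IsSymFrob p a n k g)

/-- `ψ_t : S_{k,t^p} → S_{k,t}` maps `ζ e^i` to `ψ_t(ζ) e^i` for `ζ ∈ 𝒪_p`, where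
`ψ_t(∑ a(s) t^s) = ∑ a(ps) t^s`. -/
def IsPsi (p a n k : ℕ) [Fact p.Prime] (g : PadicAlgCl p)
    (φ : Sk p a n k 1 g →ₗ[Oq p a g] Sk p a n k 0 g) : Prop :=
  ∀ (ζ : Or p a n 1 g) (i : Idx n k), ∃ η : Or p a n 0 g,
    (∀ s, PowerSeries.coeff s (η : PowerSeries (PadicAlgCl p)) =
      PowerSeries.coeff (p * s) (ζ : PowerSeries (PadicAlgCl p))) ∧
    φ (ζ • eMono p a n k 1 g i) = η • eMono p a n k 0 g i

/-- `ψ_t : S_{k,t^p} → S_{k,t}`. -/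
def psi (p a n k : ℕ) [Fact p.Prime] (g : PadicAlgCl p) :
    Sk p a n k 1 g →ₗ[Oq p a g] Sk p a n k 0 g :=
  Classical.epsilon (IsPsi p a n k g)

/-- `β_{k,1} = ψ_t ∘ Sym^k(ᾱ_1) : S_{k,t} → S_{k,t}`. -/
def beta (p a n k : ℕ) [Fact p.Prime] (g : PadicAlgCl p) :
    Sk p a n k 0 g →ₗ[Oq p a g] Sk p a n k 0 g :=
  psi p a n k g ∘ₗ symFrob p a n k g

/-- `H^1(S_{k,t}, ∂_t) = S_{k,t} / ∂_t S_{k,t}`. -/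
abbrev H1 (p a n k : ℕ) [Fact p.Prime] (g : PadicAlgCl p) : Type :=
  Sk p a n k 0 g ⧸ LinearMap.range (symConn p a n k g)

/-- The class in `H^1(S_{k,t}, ∂_t)` of an element of `S_{k,t}`. -/
def cls1 (p a n k : ℕ) [Fact p.Prime] (g : PadicAlgCl p) :
    Sk p a n k 0 g →ₗ[Oq p a g] H1 p a n k g :=
  (LinearMap.range (symConn p a n k g)).mkQ

/-- The Frobenius `β̄_{k,1}` on `H^1(S_{k,t}, ∂_t)` is the map induced by `β_{k,1}`. -/
def IsBetaBar (p a n k : ℕ) [Fact p.Prime] (g : PadicAlgCl p)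
    (φ : H1 p a n k g →ₗ[Oq p a g] H1 p a n k g) : Prop :=
  ∀ s : Sk p a n k 0 g, φ (cls1 p a n k g s) = cls1 p a n k g (beta p a n k g s)

/-- The Frobenius `β̄_{k,1}` on `H^1(S_{k,t}, ∂_t)`. -/
def betaBar (p a n k : ℕ) [Fact p.Prime] (g : PadicAlgCl p) :
    H1 p a n k g →ₗ[Oq p a g] H1 p a n k g :=
  Classical.epsilon (IsBetaBar p a n k g)

/-- The operators above exist: each of them satisfies the equations that determine it. -/
def OperatorsExist (p a n k : ℕ) [Fact p.Prime] (g : PadicAlgCl p) : Prop :=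
  IsConn p a n g (conn p a n g) ∧ IsFrob p a n g (frob p a n g) ∧
    IsSymConn p a n k g (symConn p a n k g) ∧ IsSymFrob p a n k g (symFrob p a n k g) ∧
    IsPsi p a n k g (psi p a n k g) ∧ IsBetaBar p a n k g (betaBar p a n k g)

end

end HyperKloosterman

/-!
All estimates are made with one family of weights: for a real `P` with `1 ≤ P < p` (or `P ≤ p`),
a coefficient in degree `d` has size at most a constant times `P ^ (-d)`.

**The splitting function.** The Artin-Hasse series has `p`-integral coefficients
(`norm_coeff_artinHasse_le`), so the `j`-th coefficient of `θ` has size at most `‖γ‖ ^ j`. In the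
normalised coordinates `Y_0 = γ t / (x_1 ⋯ x_n)`, `Y_l = γ x_l` everything below is integral, and
the weight `w` becomes the degree in `Y`.

**Relative cohomology.** In these coordinates `D_{t^{p^r}, l}` is `E_l - E_0`, where `E_l` is the
Euler operator `Y_l ∂/∂Y_l` plus multiplication by `Y_l ∂H/∂Y_l` (`cf_Dop`). The multiplication part
is `Y_l` up to terms that are smaller by a factor `P / p` on series of growth `P < p`, and the Euler
part has lower degree. The quotient of the polynomial ring by the `Y_l - Y_0` has rank one in each
degree, so a perturbation argument (`solve_of_perturbation`) reduces every series to a combination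
of `e_0, …, e_n` (`exists_hnMap_eq`), uniquely (`hnMap_unique`), and with coefficients of the same
growth. This gives the basis `hnBasis` of `H^n` and the estimate `norm_repr_le`. By the same
reasoning the connection matrix is that of the reduced connection `G` up to an error of
size `P / p` (`norm_conn_repr_sub_le`).

**Frobenius.** The map `α_1` commutes with `D_l` up to a factor `p` and is compatible with `∂_t`
(`alphaOp_Dop`, `alphaOp_dop`). Since `ψ_x` divides exponents by `p`, it turns growth `1` into growth
`P` for every `P < p` (`ball_alphaOp`); with `norm_repr_le` this bounds the matrix of `α_1`
(`norm_frob_repr_le`), and then, through the monomial basis `skBasis` of the symmetric power and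
after `ψ_t` has divided the exponents of `t` by `p`, that of `β_{k,1}` (`norm_beta_repr_le`). The
relation `ψ_t ∂_{t^p} = p ∂_t ψ_t` makes `β_{k,1}` descend to `H^1` (`isBetaBar_betaBar`).

**The symmetric power.** After adjoining `τ` with `τ ^ (n + 1) = t`, a Vandermonde base change
diagonalises the reduced connection; its eigenvalues on the symmetric power are `τ * ∑ i_j ζ ^ j`,
which are nonzero exactly because `d_k(n, p) = 0`. So the reduced connection is injective
(`redNabla_injective`), and a constant basis complements its image. In each degree this says that a
certain square integer matrix is bijective modulo `p` (`mulVec_bijective`), so it has an integral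
inverse up to a denominator prime to `p` (`exists_int_inverse`). On the `p`-adic side `∂_t` differs
from this matrix by `t d/dt`, which has lower degree, and by a perturbation of size `P / p`; the same
perturbation argument then solves every element of the symmetric power in terms of the constant
basis and the image of `∂_t`, again with the weights `P ^ d` (`exists_cokMap_eq`,
`eq_zero_of_cokMap_eq_zero`).

**Conclusion.** Frobenius improves growth from `1` to `P`, and the reduction to the constant basis
preserves growth `P`. Therefore `‖B(j, i)‖ * P ^ w(j) ≤ 1` for every `P < p`, and the theorem follows
on letting `P` tend to `p` (`norm_repr_betaBar_le`).
-/

namespace HyperKloosterman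

noncomputable section

/-! ### The Artin–Hasse series is `p`-integral -/

lemma norm_sub_le_max' {V : Type*} [SeminormedAddCommGroup V] [IsUltrametricDist V] (x y : V) :
    ‖x - y‖ ≤ max ‖x‖ ‖y‖ := by
  rw [sub_eq_add_neg, ← norm_neg y]
  exact IsUltrametricDist.norm_add_le_max _ _

open PowerSeries in
/-- A solution of `X F' = V F` with `V(0) = 0` is determined by its constant term. -/
lemma powerSeries_ode_unique {V F G : PowerSeries ℚ} (hV : coeff 0 V = 0)
    (hF : X * derivative ℚ F = V * F) (hG : X * derivative ℚ G = V * G)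
    (h0 : coeff 0 F = coeff 0 G) : F = G := by
  have key : ∀ H : PowerSeries ℚ, X * derivative ℚ H = V * H → ∀ n : ℕ,
      (n : ℚ) * coeff n H = ∑ x ∈ Finset.HasAntidiagonal.antidiagonal n, coeff x.1 V * coeff x.2 H := by
    intro H hH n
    rw [← coeff_mul, ← hH]
    cases n with
    | zero => simp
    | succ n => rw [coeff_succ_X_mul, coeff_derivative]; push_cast; ring
  ext n
  induction n using Nat.strong_induction_on with
  | _ n ih =>
    rcases Nat.eq_zero_or_pos n with rfl | hn
    · exact h0
    · have hn' : (n : ℚ) ≠ 0 := by exact_mod_cast hn.ne'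
      refine mul_left_cancel₀ hn' ?_
      rw [key F hF, key G hG]
      refine Finset.sum_congr rfl fun x hx => ?_
      rw [Finset.HasAntidiagonal.mem_antidiagonal] at hx
      rcases Nat.eq_zero_or_pos x.1 with h | h
      · rw [h, hV, zero_mul, zero_mul]
      · rw [ih x.2 (by omega)]

/-- The series `∑_j T^{p^j}`. -/
def frobSum (R : Type*) [Semiring R] (p : ℕ) : PowerSeries R :=
  PowerSeries.mk fun m => open Classical in if ∃ j : ℕ, m = p ^ j then 1 else 0

open PowerSeries in
/-- The logarithmic derivative of the Artin–Hasse series is `∑_j X^{p^j}`. -/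
lemma X_mul_derivative_artinHasse (p : ℕ) [hp : Fact p.Prime] :
    X * derivative ℚ (artinHasse p) = frobSum ℚ p * artinHasse p := by
  classical
  set S : PowerSeries ℚ :=
    mk fun m => open Classical in if ∃ j : ℕ, m = p ^ j then (1 / m : ℚ) else 0 with hS
  have h0 : constantCoeff S = 0 := by
    rw [← coeff_zero_eq_constantCoeff_apply, hS, coeff_mk]
    split_ifs <;> simp
  have hsub : HasSubst S := HasSubst.of_constantCoeff_zero' h0
  have hXS : X * derivative ℚ S = frobSum ℚ p := by
    ext n
    cases n with
    | zero =>
      have : ¬ ∃ j : ℕ, 0 = p ^ j := fun ⟨j, hj⟩ => (pow_pos hp.1.pos j).ne hj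
      simp [frobSum, this]
    | succ n =>
      rw [coeff_succ_X_mul, coeff_derivative, hS, coeff_mk, frobSum, coeff_mk]
      split_ifs
      · push_cast; field_simp
      · simp
  have : derivative ℚ (artinHasse p) = artinHasse p * derivative ℚ S := by
    rw [artinHasse, derivative_subst hsub, derivative_exp]
  rw [this, ← hXS]
  ring

open PowerSeries in
lemma coeff_zero_artinHasse (p : ℕ) [Fact p.Prime] : coeff 0 (artinHasse p) = 1 := by
  have h0 : constantCoeff (mk fun m => open Classical in
      if ∃ j : ℕ, m = p ^ j then (1 / m : ℚ) else 0 : PowerSeries ℚ) = 0 := by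
    rw [← coeff_zero_eq_constantCoeff_apply, coeff_mk]
    split_ifs <;> simp
  rw [artinHasse, coeff_subst' (HasSubst.of_constantCoeff_zero' h0), finsum_eq_single _ 0]
  · simp
  · intro n hn
    rw [coeff_zero_eq_constantCoeff_apply, map_pow, h0, zero_pow hn, smul_zero]

open PowerSeries in
/-- The functional equation `E(T)^p = E(T^p) exp(pT)` behind Dwork's lemma. -/
lemma artinHasse_pow (p : ℕ) [hp : Fact p.Prime] :
    artinHasse p ^ p = expand p hp.1.ne_zero (artinHasse p) * rescale (p : ℚ) (exp ℚ) := by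
  classical
  have hp0 := hp.1.ne_zero
  have hW := X_mul_derivative_artinHasse p
  -- With `W = ∑_j X^{p^j}`, both sides solve `X Z' = p W Z`. On the right this uses
  -- `W(X^p) = W(X) - X`: the factor `exp(pX)` accounts for the missing term.
  have hWp : expand p hp0 (frobSum ℚ p) = frobSum ℚ p - X := by
    ext n
    rw [coeff_expand, map_sub, coeff_X, frobSum, coeff_mk, coeff_mk]
    by_cases hn : p ∣ n
    · obtain ⟨m, rfl⟩ := hn
      have h1 : p * m ≠ 1 := fun h => hp.1.one_lt.ne' (Nat.eq_one_of_mul_eq_one_right h)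
      rw [if_pos (dvd_mul_right _ _), if_neg h1, Nat.mul_div_cancel_left _ hp.1.pos, sub_zero]
      refine if_congr ⟨fun ⟨j, hj⟩ => ⟨j + 1, by rw [hj, pow_succ']⟩, fun ⟨j, hj⟩ => ?_⟩ rfl rfl
      cases j with
      | zero => exact absurd hj h1
      | succ j => exact ⟨j, Nat.eq_of_mul_eq_mul_left hp.1.pos (by rw [hj, pow_succ'])⟩
    · rw [if_neg hn]
      by_cases h1 : n = 1
      · rw [if_pos h1, if_pos ⟨0, by rw [h1, pow_zero]⟩, sub_self]
      · rw [if_neg h1, if_neg, sub_zero]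
        rintro ⟨j, rfl⟩
        cases j with
        | zero => exact h1 (pow_zero p)
        | succ j => exact hn ⟨p ^ j, pow_succ' p j⟩
  refine powerSeries_ode_unique (V := (p : PowerSeries ℚ) * frobSum ℚ p) ?_ ?_ ?_ ?_
  · have : ¬ ∃ j : ℕ, 0 = p ^ j := fun ⟨j, hj⟩ => (pow_pos hp.1.pos j).ne hj
    rw [← map_natCast (C (R := ℚ)), coeff_C_mul, frobSum, coeff_mk, if_neg this, mul_zero]
  · rw [derivative_pow]
    have : artinHasse p ^ p = artinHasse p ^ (p - 1) * artinHasse p := by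
      rw [← pow_succ, Nat.sub_add_cancel hp.1.one_le]
    rw [this]
    linear_combination (p : PowerSeries ℚ) * artinHasse p ^ (p - 1) * hW
  · have hE : X * derivative ℚ (expand p hp0 (artinHasse p)) =
        (p : PowerSeries ℚ) * (frobSum ℚ p - X) * expand p hp0 (artinHasse p) := by
      rw [expand_apply, derivative_subst (HasSubst.X_pow hp0), derivative_pow, derivative_X,
        mul_one, ← expand_apply p hp0, ← expand_apply p hp0]
      have hX : (X : PowerSeries ℚ) ^ p = X * X ^ (p - 1) := by
        rw [← pow_succ', Nat.sub_add_cancel hp.1.one_le]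
      have := congrArg (expand p hp0) hW
      rw [map_mul, map_mul, expand_X, hWp, hX] at this
      linear_combination (p : PowerSeries ℚ) * this
    have hX : X * derivative ℚ (rescale (p : ℚ) (exp ℚ)) =
        (p : PowerSeries ℚ) * X * rescale (p : ℚ) (exp ℚ) := by
      rw [← exp_pow_eq_rescale_exp, derivative_pow, derivative_exp]
      have : exp ℚ ^ p = exp ℚ ^ (p - 1) * exp ℚ := by
        rw [← pow_succ, Nat.sub_add_cancel hp.1.one_le]
      rw [this]
      ring
    rw [Derivation.leibniz, smul_eq_mul, smul_eq_mul]
    linear_combination rescale (p : ℚ) (exp ℚ) * hE + expand p hp0 (artinHasse p) * hX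
  · have h0 := coeff_zero_artinHasse p
    rw [coeff_zero_eq_constantCoeff_apply] at h0
    rw [coeff_zero_eq_constantCoeff_apply, coeff_zero_eq_constantCoeff_apply, map_pow, map_mul, h0, constantCoeff_expand, h0, ← coeff_zero_eq_constantCoeff_apply,
      coeff_rescale]
    simp

open PowerSeries in
/-- `f(X)^p ≡ f(X^p)` modulo `p`. -/
lemma coeff_pow_sub_expand_dvd (p : ℕ) [hp : Fact p.Prime] (f : PowerSeries ℤ_[p]) (n : ℕ) :
    (p : ℤ_[p]) ∣ coeff n (f ^ p - expand p hp.1.ne_zero f) := by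
  have h : map (PadicInt.toZMod (p := p)) (f ^ p - expand p hp.1.ne_zero f) = 0 := by
    rw [map_sub, map_pow, map_expand]
    have := MvPowerSeries.map_frobenius_expand (σ := Unit) (R := ZMod p) p hp.1.ne_zero
      (f := map (PadicInt.toZMod (p := p)) f)
    rw [ZMod.frobenius_zmod] at this
    have h2 : ∀ g : PowerSeries (ZMod p), MvPowerSeries.map (RingHom.id (ZMod p)) g = g := by
      intro g; exact congrFun (congrArg DFunLike.coe MvPowerSeries.map_id) g
    rw [h2] at this
    rw [← this]
    exact sub_self _
  have h1 := congrArg (coeff n) h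
  rw [coeff_map, map_zero, ← RingHom.mem_ker, PadicInt.ker_toZMod, PadicInt.maximalIdeal_eq_span_p,
    Ideal.mem_span_singleton] at h1
  exact h1

lemma norm_pow_div_factorial_le (p : ℕ) [hp : Fact p.Prime] {m : ℕ} (hm : m ≠ 0) :
    ‖(p : ℚ_[p]) ^ m / (m.factorial : ℚ_[p])‖ ≤ (p : ℝ)⁻¹ := by
  have hf : (m.factorial : ℚ_[p]) ≠ 0 := by exact_mod_cast m.factorial_ne_zero
  have hp1 : (1 : ℝ) < p := by exact_mod_cast hp.1.one_lt
  have h1 := sub_one_mul_padicValNat_factorial_lt_of_ne_zero p hm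
  have h2 : padicValNat p m.factorial + 1 ≤ m := by
    have : 1 ≤ p - 1 := by have := hp.1.two_le; omega
    nlinarith
  rw [norm_div, norm_pow, Padic.norm_p, Padic.norm_eq_zpow_neg_valuation hf, Padic.valuation_natCast,
    zpow_neg, zpow_natCast, inv_pow, div_inv_eq_mul, inv_mul_le_iff₀ (by positivity),
    ← div_eq_mul_inv, le_div_iff₀ (by positivity), ← pow_succ]
  exact pow_le_pow_right₀ hp1.le h2

open PowerSeries in
/-- **Dwork's lemma** for the Artin–Hasse series: its coefficients are `p`-adic integers. -/
theorem norm_coeff_artinHasse_le (p : ℕ) [hp : Fact p.Prime] (n : ℕ) :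
    ‖((coeff n (artinHasse p) : ℚ) : ℚ_[p])‖ ≤ 1 := by
  have hp0 := hp.1.ne_zero
  have hppos : (0 : ℝ) < (p : ℝ)⁻¹ := by have := hp.1.pos; positivity
  induction n using Nat.strong_induction_on with
  | _ n ih =>
  rcases Nat.eq_zero_or_pos n with rfl | hn
  · rw [coeff_zero_artinHasse]; simp
  -- `F` is the truncation of `E` below degree `n`; it is integral by induction. The coefficient `e`
  -- of `X^n` in `E` enters linearly in the coefficient of `X^n` in `E^p` (as `p e`) and not at all
  -- in the one of `E(X^p)`, so that it suffices to bound the other terms by `|p|`.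
  set E : PowerSeries ℚ_[p] := map (algebraMap ℚ ℚ_[p]) (artinHasse p) with hE
  have hz : ∀ m, ∃ z : ℤ_[p],
      (z : ℚ_[p]) = if m < n then ((coeff m (artinHasse p) : ℚ) : ℚ_[p]) else 0 := fun m => by
    split_ifs with h
    · exact ⟨⟨_, ih m h⟩, rfl⟩
    · exact ⟨0, rfl⟩
  choose z hz using hz
  let f : PowerSeries ℤ_[p] := mk z
  set F : PowerSeries ℚ_[p] := map (algebraMap ℤ_[p] ℚ_[p]) f with hF
  have hcE : ∀ m, coeff m E = ((coeff m (artinHasse p) : ℚ) : ℚ_[p]) := fun m => by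
    rw [hE, coeff_map]; rfl
  have hcF : ∀ m, coeff m F = if m < n then coeff m E else 0 := fun m => by
    rw [hF, coeff_map, coeff_mk, hcE]
    exact hz m
  obtain ⟨r, hr⟩ : X ^ n ∣ E - F := by
    rw [X_pow_dvd_iff]
    intro m hm
    rw [map_sub, hcF, if_pos hm, sub_self]
  have hr0 : constantCoeff r = coeff n E := by
    have := congrArg (coeff n) hr
    rw [map_sub, hcF, if_neg (lt_irrefl n), sub_zero, coeff_X_pow_mul', if_pos le_rfl,
      Nat.sub_self, coeff_zero_eq_constantCoeff_apply] at this
    exact this.symm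
  have hE0 : constantCoeff E = 1 := by
    rw [← coeff_zero_eq_constantCoeff_apply, hcE, coeff_zero_artinHasse, Rat.cast_one]
  have hF0 : constantCoeff F = 1 := by
    rw [← coeff_zero_eq_constantCoeff_apply, hcF, if_pos hn, coeff_zero_eq_constantCoeff_apply, hE0]
  have e1 : coeff n (E ^ p) = coeff n (F ^ p) + p * coeff n E := by
    have := (Commute.all E F).mul_geom_sum₂ p
    rw [← sub_eq_iff_eq_add', ← map_sub, ← this, hr, mul_assoc, coeff_X_pow_mul', if_pos le_rfl,
      Nat.sub_self, coeff_zero_eq_constantCoeff_apply, map_mul, hr0, map_sum]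
    simp [hE0, hF0, mul_comm]
  have e2 : E ^ p = expand p hp0 E * map (algebraMap ℚ ℚ_[p]) (rescale (p : ℚ) (exp ℚ)) := by
    rw [hE, ← map_pow, artinHasse_pow, map_mul, map_expand]
  set G := map (algebraMap ℚ ℚ_[p]) (rescale (p : ℚ) (exp ℚ)) with hG
  have hcG : ∀ m, coeff m G = (p : ℚ_[p]) ^ m / (m.factorial : ℚ_[p]) := fun m => by
    rw [hG, coeff_map, coeff_rescale, coeff_exp]
    simp [div_eq_mul_inv]
  have e3 : ∀ m ≤ n, coeff m (expand p hp0 E) = coeff m (expand p hp0 F) := by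
    intro m hm
    rw [coeff_expand, coeff_expand]
    split_ifs with h
    · obtain ⟨l, rfl⟩ := h
      have hl : l < n := by
        rcases Nat.eq_zero_or_pos l with h | h
        · omega
        · have := hp.1.two_le; nlinarith
      rw [Nat.mul_div_cancel_left _ hp.1.pos, hcF, if_pos hl]
    · rfl
  have hFint : ∀ m, ‖coeff m (expand p hp0 F)‖ ≤ 1 := fun m => by
    rw [hF, ← map_expand, coeff_map]; exact PadicInt.norm_le_one _
  have e4 : coeff n (E ^ p) = coeff n (expand p hp0 F) +
      ∑ x ∈ (Finset.HasAntidiagonal.antidiagonal n).erase (n, 0), coeff x.1 (expand p hp0 F) * coeff x.2 G := by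
    rw [e2, coeff_mul, ← Finset.add_sum_erase _ _
      (show (n, 0) ∈ Finset.HasAntidiagonal.antidiagonal n by simp), e3 n le_rfl, hcG]
    congr 1
    · simp
    · refine Finset.sum_congr rfl fun x hx => ?_
      rw [Finset.mem_erase, Finset.HasAntidiagonal.mem_antidiagonal] at hx
      rw [e3 x.1 (by omega)]
  have e5 : ‖coeff n (F ^ p) - coeff n (expand p hp0 F)‖ ≤ (p : ℝ)⁻¹ := by
    obtain ⟨z, hz⟩ := coeff_pow_sub_expand_dvd p f n
    rw [hF, ← map_pow, ← map_expand, ← map_sub, ← map_sub, coeff_map, hz, map_mul, norm_mul]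
    have h1 : ‖algebraMap ℤ_[p] ℚ_[p] z‖ ≤ 1 := PadicInt.norm_le_one z
    have h2 : ‖algebraMap ℤ_[p] ℚ_[p] (p : ℤ_[p])‖ = (p : ℝ)⁻¹ := by
      rw [map_natCast, Padic.norm_p]
    rw [h2]
    nlinarith
  have e6 : ‖∑ x ∈ (Finset.HasAntidiagonal.antidiagonal n).erase (n, 0),
      coeff x.1 (expand p hp0 F) * coeff x.2 G‖ ≤ (p : ℝ)⁻¹ := by
    refine IsUltrametricDist.norm_sum_le_of_forall_le_of_nonneg hppos.le fun x hx => ?_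
    have hx2 : x.2 ≠ 0 := by
      intro h
      rw [Finset.mem_erase, Finset.HasAntidiagonal.mem_antidiagonal] at hx
      exact hx.1 (Prod.ext (by simp; omega) h)
    rw [norm_mul, hcG]
    have := norm_pow_div_factorial_le p hx2
    have := hFint x.1
    nlinarith [norm_nonneg (coeff x.1 (expand p hp0 F)),
      norm_nonneg ((p : ℚ_[p]) ^ x.2 / (x.2.factorial : ℚ_[p]))]
  have e7 : (p : ℚ_[p]) * coeff n E =
      (∑ x ∈ (Finset.HasAntidiagonal.antidiagonal n).erase (n, 0), coeff x.1 (expand p hp0 F) * coeff x.2 G) -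
      (coeff n (F ^ p) - coeff n (expand p hp0 F)) := by
    linear_combination e4 - e1
  have e8 : ‖(p : ℚ_[p]) * coeff n E‖ ≤ (p : ℝ)⁻¹ := by
    rw [e7]
    exact (norm_sub_le_max' _ _).trans (max_le e6 e5)
  rw [norm_mul, Padic.norm_p] at e8
  rw [← hcE]
  exact le_of_mul_le_mul_left (by simpa using e8) hppos

/-! ### The Dwork root and the coefficient field -/

lemma norm_prime (p : ℕ) [Fact p.Prime] : ‖(p : PadicAlgCl p)‖ = (p : ℝ)⁻¹ := by
  have := PadicAlgCl.norm_extends p (p : ℚ_[p])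
  rw [map_natCast, Padic.norm_p] at this
  exact this

lemma norm_ratCast (p : ℕ) [Fact p.Prime] (x : ℚ) : ‖(x : PadicAlgCl p)‖ = ‖(x : ℚ_[p])‖ := by
  have := PadicAlgCl.norm_extends p (x : ℚ_[p])
  rw [map_ratCast] at this
  exact this

lemma norm_intCast_le_one (p : ℕ) [Fact p.Prime] (x : ℤ) : ‖(x : PadicAlgCl p)‖ ≤ 1 := by
  have := norm_ratCast p (x : ℚ)
  rw [Rat.cast_intCast, Rat.cast_intCast] at this
  rw [this]
  exact Padic.norm_int_le_one x

lemma norm_natCast_le_one (p : ℕ) [Fact p.Prime] (x : ℕ) : ‖(x : PadicAlgCl p)‖ ≤ 1 := by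
  exact_mod_cast norm_intCast_le_one p (x : ℤ)

variable {p a : ℕ} [hp : Fact p.Prime] {g : PadicAlgCl p}

lemma one_lt_prime : (1 : ℝ) < p := by exact_mod_cast hp.1.one_lt

lemma gam_ne_zero (hD : IsDworkRoot p (gam p a g)) : gam p a g ≠ 0 := by
  intro h
  have h2 := hD.2
  rw [h, norm_zero, zero_pow (by have := hp.1.two_le; omega)] at h2
  have : (0 : ℝ) < (p : ℝ)⁻¹ := by have := hp.1.pos; positivity
  exact this.ne h2

lemma g_ne_zero (hD : IsDworkRoot p (gam p a g)) : g ≠ 0 := by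
  rintro rfl
  exact gam_ne_zero hD (zero_pow (pow_pos hp.1.pos a).ne')

lemma norm_gam_lt_one (hD : IsDworkRoot p (gam p a g)) : ‖gam p a g‖ < 1 := by
  by_contra! h
  have h2 := hD.2
  have : (1 : ℝ) ≤ ‖gam p a g‖ ^ (p - 1) := one_le_pow₀ h
  rw [h2] at this
  exact absurd this (not_le.2 (inv_lt_one_of_one_lt₀ one_lt_prime))

lemma norm_g_lt_one (hD : IsDworkRoot p (gam p a g)) : ‖g‖ < 1 := by
  by_contra! h
  have : (1 : ℝ) ≤ ‖gam p a g‖ := by rw [gam, norm_pow]; exact one_le_pow₀ h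
  exact absurd this (not_le.2 (norm_gam_lt_one hD))

/-- `γ_i` is as small as the first omitted term `γ^{p^{i+1}}/p^{i+1}`. -/
lemma norm_gamSeq_le (hD : IsDworkRoot p (gam p a g)) (i : ℕ) :
    ‖gamSeq p a g i‖ ≤ ‖gam p a g‖ ^ p ^ (i + 1) * (p : ℝ) ^ (i + 1) := by
  set γ := gam p a g
  have hp0 : (0 : ℝ) < p := by exact_mod_cast hp.1.pos
  have ht : ∀ j, ‖γ ^ p ^ j / (p : PadicAlgCl p) ^ j‖ = ‖γ‖ ^ p ^ j * (p : ℝ) ^ j := fun j => by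
    rw [norm_div, norm_pow, norm_pow, norm_prime, inv_pow, div_inv_eq_mul]
  have hanti : Antitone fun j => ‖γ‖ ^ p ^ j * (p : ℝ) ^ j := by
    refine antitone_nat_of_succ_le fun j => ?_
    have h1 : ‖γ‖ ^ p ^ (j + 1) = ‖γ‖ ^ p ^ j * ((p : ℝ)⁻¹) ^ p ^ j := by
      rw [← hD.2, ← pow_mul, ← pow_add]
      congr 1
      have := hp.1.one_le
      rw [pow_succ, mul_comm, Nat.sub_mul, one_mul]
      have : p ^ j ≤ p * p ^ j := Nat.le_mul_of_pos_left _ hp.1.pos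
      omega
    have h2 : ((p : ℝ)⁻¹) ^ p ^ j ≤ (p : ℝ)⁻¹ := by
      simpa using pow_le_pow_of_le_one (by positivity) (inv_le_one_of_one_le₀ one_lt_prime.le)
        (Nat.one_le_pow j p hp.1.pos)
    calc ‖γ‖ ^ p ^ (j + 1) * (p : ℝ) ^ (j + 1)
        = ‖γ‖ ^ p ^ j * (p : ℝ) ^ j * (((p : ℝ)⁻¹) ^ p ^ j * p) := by rw [h1]; ring
      _ ≤ ‖γ‖ ^ p ^ j * (p : ℝ) ^ j * ((p : ℝ)⁻¹ * p) := by gcongr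
      _ = ‖γ‖ ^ p ^ j * (p : ℝ) ^ j := by rw [inv_mul_cancel₀ hp0.ne', mul_one]
  -- Since `γ` is a root of the full series, `γ_i` is minus the tail of the series after `i`; its
  -- first term dominates.
  have hlim := hD.1.tendsto_sum_nat
  have hlim2 : Tendsto (fun N => ‖gamSeq p a g i -
      ∑ j ∈ Finset.range N, γ ^ p ^ j / (p : PadicAlgCl p) ^ j‖) atTop
      (𝓝 ‖gamSeq p a g i - 0‖) := (tendsto_const_nhds.sub hlim).norm
  rw [sub_zero] at hlim2
  refine le_of_tendsto hlim2 ?_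
  filter_upwards [eventually_ge_atTop (i + 1)] with N hN
  rw [gamSeq, ← Finset.sum_range_add_sum_Ico _ hN, sub_add_cancel_left, norm_neg]
  refine IsUltrametricDist.norm_sum_le_of_forall_le_of_nonneg (by positivity) fun j hj => ?_
  rw [ht]
  exact hanti (Finset.mem_Ico.1 hj).1

/-- The coefficients `c_i = p^i γ_i / γ^{p^i}` of `Y_l ∂H/∂Y_l = ∑_i c_i Y_l^{p^i}`, for the
normalised variables `Y_0 = γ t/(x_1 ⋯ x_n)` and `Y_l = γ x_l`. -/
def cc (p a : ℕ) [Fact p.Prime] (g : PadicAlgCl p) (i : ℕ) : PadicAlgCl p :=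
  (p : PadicAlgCl p) ^ i * gamSeq p a g i / gam p a g ^ p ^ i

lemma cc_zero (hD : IsDworkRoot p (gam p a g)) : cc p a g 0 = 1 := by
  simp [cc, gamSeq, gam_ne_zero hD]

lemma norm_cc_le (hD : IsDworkRoot p (gam p a g)) (i : ℕ) :
    ‖cc p a g i‖ ≤ ((p : ℝ)⁻¹) ^ (p ^ i - 1) := by
  have hp0 : (0 : ℝ) < p := by exact_mod_cast hp.1.pos
  have hg0 : 0 < ‖gam p a g‖ := norm_pos_iff.2 (gam_ne_zero hD)
  rw [cc, norm_div, norm_mul, norm_pow, norm_pow, norm_prime, div_le_iff₀ (by positivity)]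
  have h1 : ‖gam p a g‖ ^ p ^ (i + 1) = ‖gam p a g‖ ^ p ^ i * ((p : ℝ)⁻¹) ^ p ^ i := by
    rw [← hD.2, ← pow_mul, ← pow_add]
    congr 1
    rw [pow_succ, mul_comm, Nat.sub_mul, one_mul]
    have : p ^ i ≤ p * p ^ i := Nat.le_mul_of_pos_left _ hp.1.pos
    omega
  have h2 : ((p : ℝ)⁻¹) ^ p ^ i = ((p : ℝ)⁻¹) ^ (p ^ i - 1) * (p : ℝ)⁻¹ := by
    rw [← pow_succ, Nat.sub_add_cancel (Nat.one_le_pow i p hp.1.pos)]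
  calc (p : ℝ)⁻¹ ^ i * ‖gamSeq p a g i‖
      ≤ (p : ℝ)⁻¹ ^ i * (‖gam p a g‖ ^ p ^ (i + 1) * (p : ℝ) ^ (i + 1)) := by
        gcongr; exact norm_gamSeq_le hD i
    _ = ((p : ℝ)⁻¹) ^ (p ^ i - 1) * ‖gam p a g‖ ^ p ^ i * (((p : ℝ)⁻¹) ^ (i + 1) * p ^ (i + 1)) := by
        rw [h1, h2]; ring
    _ = _ := by rw [← mul_pow, inv_mul_cancel₀ hp0.ne', one_pow, mul_one]

lemma g_mem_Lq : g ∈ Lq p a g := IntermediateField.subset_adjoin _ _ (Set.mem_insert _ _)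

lemma gam_mem_Lq : gam p a g ∈ Lq p a g := pow_mem g_mem_Lq _

lemma gamSeq_mem_Lq (i : ℕ) : gamSeq p a g i ∈ Lq p a g :=
  sum_mem fun _ _ => div_mem (pow_mem gam_mem_Lq _) (pow_mem (natCast_mem _ _) _)

lemma cc_mem_Lq (i : ℕ) : cc p a g i ∈ Lq p a g :=
  div_mem (mul_mem (pow_mem (natCast_mem _ _) _) (gamSeq_mem_Lq i)) (pow_mem gam_mem_Lq _)

/-- The field `ℚ_q(γ^{1/q})` is finite over `ℚ_p`, hence complete. -/
lemma isComplete_Lq (ha : 1 ≤ a) : IsComplete (Lq p a g : Set (PadicAlgCl p)) := by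
  classical
  have hfin : (insert g {z : PadicAlgCl p | z ^ (p ^ a - 1) = 1}).Finite := by
    refine Set.Finite.insert _ ?_
    have hN : 0 < p ^ a - 1 := by
      have := Nat.one_lt_pow (by omega : a ≠ 0) hp.1.one_lt
      omega
    refine (Polynomial.nthRoots (p ^ a - 1) (1 : PadicAlgCl p)).toFinset.finite_toSet.subset ?_
    intro z hz
    simpa [Polynomial.mem_nthRoots hN] using hz
  have : Finite ↑(insert g {z : PadicAlgCl p | z ^ (p ^ a - 1) = 1}) := hfin
  have : FiniteDimensional ℚ_[p] (Lq p a g) :=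
    IntermediateField.finiteDimensional_adjoin fun x _ =>
      (Algebra.IsAlgebraic.isAlgebraic (R := ℚ_[p]) x).isIntegral
  have : FiniteDimensional ℚ_[p] (Lq p a g).toSubmodule := this
  exact Submodule.complete_of_finiteDimensional (Lq p a g).toSubmodule

lemma norm_theta_le (j : ℕ) : ‖theta p a g j‖ ≤ ‖gam p a g‖ ^ j := by
  rw [theta, norm_mul, norm_pow, norm_ratCast]
  exact mul_le_of_le_one_left (by positivity) (norm_coeff_artinHasse_le p j)

lemma theta_mem_Lq (j : ℕ) : theta p a g j ∈ Lq p a g :=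
  mul_mem (by
    have := (Lq p a g).algebraMap_mem ((PowerSeries.coeff j (artinHasse p) : ℚ) : ℚ_[p])
    rwa [map_ratCast] at this) (pow_mem gam_mem_Lq _)

/-- Dwork's splitting function `θ(T) = E(γT)`. -/
def thetaSer (p a : ℕ) [Fact p.Prime] (g : PadicAlgCl p) : PowerSeries (PadicAlgCl p) :=
  PowerSeries.mk (theta p a g)

/-- The series `∑_i p^i γ_i T^{p^i} = T d/dT ∑_i γ_i T^{p^i}`. -/
def hSer (p a : ℕ) [Fact p.Prime] (g : PadicAlgCl p) : PowerSeries (PadicAlgCl p) :=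
  PowerSeries.mk fun m => if m = p ^ Nat.log p m then
    (p : PadicAlgCl p) ^ Nat.log p m * gamSeq p a g (Nat.log p m) else 0

lemma coeff_hSer_pow (i : ℕ) : PowerSeries.coeff (p ^ i) (hSer p a g) =
    (p : PadicAlgCl p) ^ i * gamSeq p a g i := by
  rw [hSer, PowerSeries.coeff_mk, Nat.log_pow hp.1.one_lt, if_pos rfl]

lemma coeff_hSer_of_ne {m : ℕ} (h : ∀ i, m ≠ p ^ i) : PowerSeries.coeff m (hSer p a g) = 0 := by
  rw [hSer, PowerSeries.coeff_mk, if_neg (h _)]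

lemma gamSeq_succ (i : ℕ) : gamSeq p a g (i + 1) =
    gamSeq p a g i + gam p a g ^ p ^ (i + 1) / (p : PadicAlgCl p) ^ (i + 1) := by
  rw [gamSeq, Finset.sum_range_succ, ← gamSeq]

open PowerSeries in
/-- The logarithmic derivative of `θ` is `h(T) - p h(T^p)` for `h = ∑_i p^i γ_i T^{p^i}`. -/
lemma X_mul_derivative_thetaSer :
    X * derivative (PadicAlgCl p) (thetaSer p a g) =
      thetaSer p a g * (hSer p a g -
        (p : PowerSeries (PadicAlgCl p)) * expand p hp.1.ne_zero (hSer p a g)) := by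
  have hp0 : (p : PadicAlgCl p) ≠ 0 := by exact_mod_cast hp.1.ne_zero
  have e1 : thetaSer p a g = rescale (gam p a g) (map (algebraMap ℚ (PadicAlgCl p)) (artinHasse p)) := by
    ext j
    rw [thetaSer, coeff_mk, coeff_rescale, coeff_map, theta, mul_comm]
    rfl
  have e2 : hSer p a g - (p : PowerSeries (PadicAlgCl p)) * expand p hp.1.ne_zero (hSer p a g) =
      rescale (gam p a g) (map (algebraMap ℚ (PadicAlgCl p)) (frobSum ℚ p)) := by
    ext j
    rw [map_sub, ← map_natCast (C (R := PadicAlgCl p)), coeff_C_mul, coeff_expand, coeff_rescale,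
      coeff_map, frobSum, coeff_mk]
    by_cases hj : ∃ i, j = p ^ i
    · rw [if_pos hj, map_one, mul_one]
      obtain ⟨i, rfl⟩ := hj
      rw [coeff_hSer_pow]
      cases i with
      | zero =>
        rw [if_neg (by rw [pow_zero]; exact hp.1.one_lt.ne' ∘ Nat.dvd_one.1)]
        simp [gamSeq]
      | succ i =>
        rw [if_pos (dvd_pow_self p (Nat.succ_ne_zero i)), pow_succ' p i,
          Nat.mul_div_cancel_left _ hp.1.pos, coeff_hSer_pow, gamSeq_succ, ← pow_succ' p i]
        field_simp
        ring
    · rw [if_neg hj, map_zero, mul_zero, coeff_hSer_of_ne fun i h => hj ⟨i, h⟩]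
      split_ifs with hd
      · rw [coeff_hSer_of_ne, mul_zero, sub_zero]
        rintro i hi
        refine hj ⟨i + 1, ?_⟩
        rw [pow_succ', ← hi, Nat.mul_div_cancel' hd]
      · rw [mul_zero, sub_zero]
  have key : ∀ F : PowerSeries ℚ, X * derivative (PadicAlgCl p)
      (rescale (gam p a g) (map (algebraMap ℚ (PadicAlgCl p)) F)) =
      rescale (gam p a g) (map (algebraMap ℚ (PadicAlgCl p)) (X * derivative ℚ F)) := by
    intro F
    ext j
    rw [coeff_rescale, coeff_map]
    cases j with
    | zero => simp
    | succ j =>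
      rw [coeff_succ_X_mul, coeff_derivative, coeff_succ_X_mul, coeff_derivative, coeff_rescale,
        coeff_map]
      simp
      ring
  rw [e2, e1, key, X_mul_derivative_artinHasse, map_mul, map_mul, mul_comm]

/-! ### Weighted null sequences and approximate solutions of linear equations -/

section Abstract

variable {p : ℕ} [hp : Fact p.Prime] {I J : Type*}

/-- The families `x` with coordinates in `L`, supported in `S`, with `‖x i‖ ω i ≤ C` for all `i`
and `‖x i‖ ω i → 0` along the cofinite filter. -/
def Ball (L : IntermediateField ℚ_[p] (PadicAlgCl p)) (S : Set I) (ω : I → ℝ) (C : ℝ)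
    (x : I → PadicAlgCl p) : Prop :=
  (∀ i, x i ∈ L) ∧ (∀ i ∉ S, x i = 0) ∧ (∀ i, ‖x i‖ * ω i ≤ C) ∧
    ∀ ε : ℝ, 0 < ε → {i | ε < ‖x i‖ * ω i}.Finite

variable {L : IntermediateField ℚ_[p] (PadicAlgCl p)} {S : Set I} {ω : I → ℝ} {C C' : ℝ}
  {x y : I → PadicAlgCl p}

lemma Ball.mono (hx : Ball L S ω C x) (h : C ≤ C') : Ball L S ω C' x :=
  ⟨hx.1, hx.2.1, fun i => (hx.2.2.1 i).trans h, hx.2.2.2⟩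

lemma Ball.mono_set {S' : Set I} (hx : Ball L S ω C x) (h : S ⊆ S') : Ball L S' ω C x :=
  ⟨hx.1, fun i hi => hx.2.1 i fun h' => hi (h h'), hx.2.2.1, hx.2.2.2⟩

lemma Ball.zero (hC : 0 ≤ C) : Ball L S ω C (0 : I → PadicAlgCl p) :=
  ⟨fun _ => zero_mem _, fun _ _ => rfl, fun i => by simpa using hC, fun ε hε => by
    convert Set.finite_empty
    simp [not_lt.2 hε.le]⟩

lemma Ball.add (hω : ∀ i, 0 ≤ ω i) (hx : Ball L S ω C x) (hy : Ball L S ω C y) :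
    Ball L S ω C (x + y) := by
  have key : ∀ i, ‖(x + y) i‖ * ω i ≤ max (‖x i‖ * ω i) (‖y i‖ * ω i) := fun i => by
    rw [← max_mul_of_nonneg _ _ (hω i)]
    exact mul_le_mul_of_nonneg_right (IsUltrametricDist.norm_add_le_max _ _) (hω i)
  refine ⟨fun i => add_mem (hx.1 i) (hy.1 i), fun i hi => ?_, fun i => ?_, fun ε hε => ?_⟩
  · rw [Pi.add_apply, hx.2.1 i hi, hy.2.1 i hi, add_zero]
  · exact (key i).trans (max_le (hx.2.2.1 i) (hy.2.2.1 i))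
  · refine ((hx.2.2.2 ε hε).union (hy.2.2.2 ε hε)).subset fun i hi => ?_
    exact (lt_max_iff.1 (lt_of_lt_of_le hi (key i)))

lemma Ball.smul {c : PadicAlgCl p} (hc : c ∈ L) (hx : Ball L S ω C x) :
    Ball L S ω (‖c‖ * C) (c • x) := by
  refine ⟨fun i => mul_mem hc (hx.1 i), fun i hi => ?_, fun i => ?_, fun ε hε => ?_⟩
  · rw [Pi.smul_apply, hx.2.1 i hi, smul_zero]
  · rw [Pi.smul_apply, smul_eq_mul, norm_mul, mul_assoc]
    exact mul_le_mul_of_nonneg_left (hx.2.2.1 i) (norm_nonneg _)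
  · rcases eq_or_ne c 0 with rfl | h
    · convert Set.finite_empty
      simp [not_lt.2 hε.le]
    · have hc0 : 0 < ‖c‖ := norm_pos_iff.2 h
      refine (hx.2.2.2 (ε / ‖c‖) (by positivity)).subset fun i hi => ?_
      rw [Set.mem_ofPred_eq, Pi.smul_apply, smul_eq_mul, norm_mul, mul_assoc] at hi
      rw [Set.mem_ofPred_eq, div_lt_iff₀ hc0]
      linarith

lemma Ball.smul_le {c : PadicAlgCl p} (hc : c ∈ L) (hc1 : ‖c‖ ≤ 1) (hC : 0 ≤ C)
    (hx : Ball L S ω C x) : Ball L S ω C (c • x) :=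
  (Ball.smul hc hx).mono (mul_le_of_le_one_left hC hc1)

lemma Ball.neg (hx : Ball L S ω C x) : Ball L S ω C (-x) :=
  ⟨fun i => neg_mem (hx.1 i), fun i hi => by rw [Pi.neg_apply, hx.2.1 i hi, neg_zero],
    fun i => by rw [Pi.neg_apply, norm_neg]; exact hx.2.2.1 i,
    fun ε hε => by simpa only [Pi.neg_apply, norm_neg] using hx.2.2.2 ε hε⟩

lemma Ball.sub (hω : ∀ i, 0 ≤ ω i) (hx : Ball L S ω C x) (hy : Ball L S ω C y) :
    Ball L S ω C (x - y) := by
  rw [sub_eq_add_neg]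
  exact Ball.add hω hx hy.neg

lemma Ball.sum {κ : Type*} (hω : ∀ i, 0 ≤ ω i) (hC : 0 ≤ C) (F : Finset κ)
    {f : κ → I → PadicAlgCl p} (hf : ∀ k ∈ F, Ball L S ω C (f k)) :
    Ball L S ω C (∑ k ∈ F, f k) := by
  classical
  induction F using Finset.induction_on with
  | empty => exact Ball.zero hC
  | insert k F hk ih =>
    rw [Finset.sum_insert hk]
    exact Ball.add hω (hf k (Finset.mem_insert_self k F))
      (ih fun l hl => hf l (Finset.mem_insert_of_mem hl))

/-- A finitely supported family lies in the ball as soon as it satisfies the bound. -/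
lemma Ball.of_finite (hL : ∀ i, x i ∈ L) (hS : ∀ i ∉ S, x i = 0) (hC : ∀ i, ‖x i‖ * ω i ≤ C)
    (hfin : (Function.support x).Finite) : Ball L S ω C x := by
  refine ⟨hL, hS, hC, fun ε hε => hfin.subset fun i hi => ?_⟩
  rw [Function.mem_support]
  intro h
  rw [Set.mem_ofPred_eq, h, norm_zero, zero_mul] at hi
  exact absurd hi (not_lt.2 hε.le)

lemma Ball.single [DecidableEq I] {i : I} (hi : i ∈ S) (hω : 0 ≤ C) (h : ω i ≤ C) :
    Ball L S ω C (Pi.single i 1 : I → PadicAlgCl p) := by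
  refine Ball.of_finite (fun j => ?_) (fun j hj => ?_) (fun j => ?_)
    ((Set.finite_singleton i).subset (Pi.support_single_subset))
  · rcases eq_or_ne j i with rfl | h
    · simp
    · simp [h]
  · exact Pi.single_eq_of_ne (fun h => hj (by rw [h]; exact hi)) _
  · rcases eq_or_ne j i with rfl | h'
    · simpa using h
    · simpa [h'] using hω

/-- The change of weights to smaller ones. -/
lemma Ball.weight {ω' : I → ℝ} (hω : ∀ i, ω' i ≤ ω i) (hx : Ball L S ω C x) :
    Ball L S ω' C x := by
  have key : ∀ i, ‖x i‖ * ω' i ≤ ‖x i‖ * ω i := fun i =>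
    mul_le_mul_of_nonneg_left (hω i) (norm_nonneg _)
  exact ⟨hx.1, hx.2.1, fun i => (key i).trans (hx.2.2.1 i),
    fun ε hε => (hx.2.2.2 ε hε).subset fun i hi => lt_of_lt_of_le hi (key i)⟩

/-- Splitting off the finitely many coordinates larger than `ε`. -/
lemma Ball.truncate (hx : Ball L S ω C x) {ε : ℝ} (hε : 0 < ε) :
    ∃ F : Finset I, (∀ i, i ∈ F ↔ ε < ‖x i‖ * ω i) ∧ (F : Set I) ⊆ S ∧
      Ball L S ω ε fun i => open Classical in if i ∈ F then 0 else x i := by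
  classical
  refine ⟨(hx.2.2.2 ε hε).toFinset, fun i => by simp, fun i hi => ?_, fun i => ?_, fun i hi => ?_,
    fun i => ?_, fun η hη => (hx.2.2.2 η hη).subset fun i hi => ?_⟩
  · by_contra h
    have h1 : ε < ‖x i‖ * ω i := by simpa using hi
    rw [hx.2.1 i h, norm_zero, zero_mul] at h1
    exact absurd h1 (not_lt.2 hε.le)
  · dsimp only; split_ifs
    · exact zero_mem _
    · exact hx.1 i
  · dsimp only; split_ifs
    · rfl
    · exact hx.2.1 i hi
  · dsimp only; split_ifs with h
    · rw [norm_zero, zero_mul]; exact hε.le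
    · simpa using h
  · rw [Set.mem_ofPred_eq] at hi ⊢
    dsimp only at hi
    split_ifs at hi with h
    · rw [norm_zero, zero_mul] at hi; exact absurd hi (not_lt.2 hη.le)
    · exact hi

/-- If the equation `φ y = x` can be solved up to an error smaller by the factor `δ < 1`, with no
loss in the size of `y`, then it can be solved exactly. Continuity of `φ` is for the product
topology: each coordinate of `φ y` depends on finitely many coordinates of `y`. -/
theorem solve_of_approx (hL : IsComplete (L : Set (PadicAlgCl p))) {T : Set J} {ω' : J → ℝ}
    (hω : ∀ i, 0 < ω i) (hω' : ∀ j, 0 < ω' j)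
    (φ : (I → PadicAlgCl p) →ₗ[PadicAlgCl p] (J → PadicAlgCl p)) (hφ : Continuous φ)
    {δ : ℝ} (hδ0 : 0 < δ) (hδ : δ < 1)
    (hstep : ∀ C : ℝ, 0 < C → ∀ x, Ball L T ω' C x → ∃ y, Ball L S ω C y ∧
      Ball L T ω' (δ * C) (x - φ y))
    (hC : 0 < C) {x : J → PadicAlgCl p} (hx : Ball L T ω' C x) :
    ∃ y, Ball L S ω C y ∧ φ y = x := by
  choose! Y hY1 hY2 using hstep
  -- The successive errors `xs m` and corrections `ys m` are of size `δ^m C`; the solution is the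
  -- sum of the corrections.
  let xs : ℕ → J → PadicAlgCl p := fun m =>
    Nat.rec x (fun m z => z - φ (Y (δ ^ m * C) z)) m
  let ys : ℕ → I → PadicAlgCl p := fun m => Y (δ ^ m * C) (xs m)
  have hxs : ∀ m, xs (m + 1) = xs m - φ (ys m) := fun m => rfl
  have hpos : ∀ m, 0 < δ ^ m * C := fun m => by positivity
  have hxm : ∀ m, Ball L T ω' (δ ^ m * C) (xs m) := by
    intro m
    induction m with
    | zero => rw [pow_zero, one_mul]; exact hx
    | succ m ih =>
      rw [hxs, pow_succ', mul_assoc]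
      exact hY2 _ (hpos m) _ ih
  have hym : ∀ m, Ball L S ω (δ ^ m * C) (ys m) := fun m => hY1 _ (hpos m) _ (hxm m)
  let Sm : ℕ → I → PadicAlgCl p := fun N => ∑ m ∈ Finset.range N, ys m
  have hSmφ : ∀ N, φ (Sm N) = x - xs N := by
    intro N
    induction N with
    | zero => simp [Sm, xs]
    | succ N ih =>
      rw [show Sm (N + 1) = Sm N + ys N from Finset.sum_range_succ _ _, map_add, ih, hxs]
      abel
  have hle : ∀ m i, ‖ys m i‖ ≤ C / ω i * δ ^ m := fun m i => by
    rw [div_mul_eq_mul_div, le_div_iff₀ (hω i), mul_comm C]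
    exact (hym m).2.2.1 i
  have hSL : ∀ N i, Sm N i ∈ (L : Set (PadicAlgCl p)) := fun N i => by
    rw [show Sm N i = ∑ m ∈ Finset.range N, ys m i from Finset.sum_apply _ _ _]
    exact sum_mem fun m _ => (hym m).1 i
  have hlim : ∀ i, ∃ z ∈ (L : Set (PadicAlgCl p)), Tendsto (fun N => Sm N i) atTop (𝓝 z) := by
    intro i
    refine cauchySeq_tendsto_of_isComplete hL (fun N => hSL N i) ?_
    refine cauchySeq_of_le_geometric δ (C / ω i) hδ fun N => ?_
    rw [dist_eq_norm, show Sm (N + 1) = Sm N + ys N from Finset.sum_range_succ _ _, Pi.add_apply,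
      sub_add_cancel_left, norm_neg]
    exact hle N i
  choose y hyL hy using hlim
  have hSm_mem : ∀ N M, N ≤ M → Ball L S ω (δ ^ N * C) (Sm M - Sm N) := by
    intro N M h
    rw [show Sm M - Sm N = ∑ m ∈ Finset.Ico N M, ys m from
      (Finset.sum_Ico_eq_sub _ h).symm]
    refine Ball.sum (fun i => (hω i).le) (hpos N).le _ fun m hm => (hym m).mono ?_
    exact mul_le_mul_of_nonneg_right
      (pow_le_pow_of_le_one hδ0.le hδ.le (Finset.mem_Ico.1 hm).1) hC.le
  have htail : ∀ N i, ‖y i - Sm N i‖ * ω i ≤ δ ^ N * C := by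
    intro N i
    have h1 : Tendsto (fun M => ‖Sm M i - Sm N i‖ * ω i) atTop (𝓝 (‖y i - Sm N i‖ * ω i)) :=
      (((hy i).sub_const _).norm).mul_const _
    refine le_of_tendsto h1 ?_
    filter_upwards [eventually_ge_atTop N] with M hM
    exact (hSm_mem N M hM).2.2.1 i
  refine ⟨y, ⟨hyL, fun i hi => ?_, fun i => ?_, fun ε hε => ?_⟩, ?_⟩
  · refine tendsto_nhds_unique (hy i) ?_
    convert (tendsto_const_nhds : Tendsto (fun _ : ℕ => (0 : PadicAlgCl p)) atTop _) with N
    rw [show Sm N i = ∑ m ∈ Finset.range N, ys m i from Finset.sum_apply _ _ _]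
    exact Finset.sum_eq_zero fun m _ => (hym m).2.1 i hi
  · simpa [Sm] using htail 0 i
  · obtain ⟨N, hN⟩ := exists_pow_lt_of_lt_one (show 0 < ε / C by positivity) hδ
    rw [lt_div_iff₀ hC] at hN
    have hS := hSm_mem 0 N (Nat.zero_le N)
    rw [show Sm 0 = 0 from rfl, sub_zero] at hS
    refine (hS.2.2.2 ε hε).subset fun i hi => ?_
    rw [Set.mem_ofPred_eq] at hi ⊢
    by_contra! h
    have h3 : ‖y i‖ ≤ max ‖y i - Sm N i‖ ‖Sm N i‖ := by
      simpa using IsUltrametricDist.norm_add_le_max (y i - Sm N i) (Sm N i)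
    have h4 := mul_le_mul_of_nonneg_right h3 (hω i).le
    rw [max_mul_of_nonneg _ _ (hω i).le] at h4
    have h5 := h4.trans (max_le ((htail N i).trans hN.le) h)
    linarith
  · have h1 : Tendsto (fun N => φ (Sm N)) atTop (𝓝 (φ y)) :=
      (hφ.tendsto y).comp (tendsto_pi_nhds.2 hy)
    refine tendsto_nhds_unique h1 (tendsto_pi_nhds.2 fun j => ?_)
    have h2 : Tendsto (fun N => xs N j) atTop (𝓝 0) := by
      rw [tendsto_zero_iff_norm_tendsto_zero]
      have h3 : Tendsto (fun N => δ ^ N * (C / ω' j)) atTop (𝓝 (0 * (C / ω' j))) :=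
        (tendsto_pow_atTop_nhds_zero_of_lt_one hδ0.le hδ).mul_const _
      rw [zero_mul] at h3
      refine squeeze_zero (fun _ => norm_nonneg _) (fun N => ?_) h3
      rw [← mul_div_assoc, le_div_iff₀ (hω' j)]
      exact (hxm N).2.2.1 j
    have h4 : Tendsto (fun N => x j - xs N j) atTop (𝓝 (x j - 0)) := tendsto_const_nhds.sub h2
    rw [sub_zero] at h4
    exact h4.congr fun N => by rw [hSmφ N]; rfl

/-- A small perturbation `φ` of an operator `φ₁` that can be inverted on the unit vectors, within
the weights, is surjective between balls of the same radius. -/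
theorem solve_of_perturbation [DecidableEq J] (hL : IsComplete (L : Set (PadicAlgCl p)))
    {T : Set J} {ω' : J → ℝ} (hω : ∀ i, 0 < ω i) (hω' : ∀ j, 0 < ω' j)
    (φ φ₁ : (I → PadicAlgCl p) →ₗ[PadicAlgCl p] (J → PadicAlgCl p)) (hφ : Continuous φ)
    {δ : ℝ} (hδ0 : 0 < δ) (hδ : δ < 1)
    (R : J → I → PadicAlgCl p) (hR : ∀ j ∈ T, Ball L S ω (ω' j) (R j))
    (hR1 : ∀ j ∈ T, φ₁ (R j) = Pi.single j 1)
    (hX : ∀ C : ℝ, 0 < C → ∀ y, Ball L S ω C y → Ball L T ω' (δ * C) (φ y - φ₁ y))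
    (hC : 0 < C) {x : J → PadicAlgCl p} (hx : Ball L T ω' C x) :
    ∃ y, Ball L S ω C y ∧ φ y = x := by
  classical
  refine solve_of_approx hL hω hω' φ hφ hδ0 hδ (fun C hC x hx => ?_) hC hx
  -- The finitely many large coordinates of `x` are reached by the combination of the `R j`; the
  -- small ones are part of the error.
  obtain ⟨F, hF, hFT, hsm⟩ := hx.truncate (show 0 < δ * C by positivity)
  have hy : Ball L S ω C (∑ j ∈ F, x j • R j) := by
    refine Ball.sum (fun i => (hω i).le) hC.le _ fun j hj => ?_
    exact (Ball.smul (hx.1 j) (hR j (hFT hj))).mono (hx.2.2.1 j)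
  refine ⟨_, hy, ?_⟩
  have e1 : x - φ₁ (∑ j ∈ F, x j • R j) = fun j => if j ∈ F then 0 else x j := by
    rw [map_sum]
    simp_rw [map_smul]
    rw [Finset.sum_congr rfl fun j hj => by rw [hR1 j (hFT hj)]]
    funext j
    rw [Pi.sub_apply, Finset.sum_apply]
    simp only [Pi.smul_apply, Pi.single_apply, smul_eq_mul, mul_ite, mul_one, mul_zero,
      Finset.sum_ite_eq]
    split_ifs <;> simp
  have e2 : x - φ (∑ j ∈ F, x j • R j) = (fun j => if j ∈ F then 0 else x j) -
      (φ (∑ j ∈ F, x j • R j) - φ₁ (∑ j ∈ F, x j • R j)) := by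
    rw [← e1]; abel
  rw [e2]
  refine Ball.sub (fun j => (hω' j).le) ?_ (hX C hC _ hy)
  convert hsm using 3

end Abstract

/-! ### The differential operators on series in `Y_0, …, Y_n` -/

section Model

variable {p : ℕ} [hp : Fact p.Prime] {n : ℕ}

/-- Exponents of the monomials in `Y_0, …, Y_n`. -/
abbrev Mon (n : ℕ) : Type := Fin (n + 1) → ℕ

/-- Total degree. -/
def mdeg (a : Mon n) : ℕ := ∑ l, a l

/-- Multiplication by the monomial `Y_l`, on exponents. -/
def up (l : Fin (n + 1)) (b : Mon n) : Mon n := Function.update b l (b l + 1)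

lemma mdeg_update (l : Fin (n + 1)) (b : Mon n) (m : ℕ) :
    mdeg (Function.update b l m) + b l = mdeg b + m := by
  unfold mdeg
  rw [Finset.sum_update_of_mem (Finset.mem_univ l),
    ← Finset.add_sum_erase Finset.univ b (Finset.mem_univ l), Finset.sdiff_singleton_eq_erase]
  ring

lemma mdeg_up (l : Fin (n + 1)) (b : Mon n) : mdeg (up l b) = mdeg b + 1 := by
  have := mdeg_update l b (b l + 1)
  unfold up
  omega

lemma mdeg_update_sub {l : Fin (n + 1)} {a : Mon n} {m : ℕ} (h : m ≤ a l) :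
    mdeg (Function.update a l (a l - m)) + m = mdeg a := by
  have := mdeg_update l a (a l - m)
  omega

lemma up_self (l : Fin (n + 1)) (b : Mon n) : up l b l = b l + 1 := Function.update_self _ _ _

lemma up_of_ne {l j : Fin (n + 1)} (h : j ≠ l) (b : Mon n) : up l b j = b j :=
  Function.update_of_ne h _ _

lemma eq_up_of_ne_zero {l : Fin (n + 1)} {a : Mon n} (h : a l ≠ 0) :
    up l (Function.update a l (a l - 1)) = a := by
  unfold up
  rw [Function.update_self, Function.update_idem, Nat.sub_add_cancel (Nat.one_le_iff_ne_zero.2 h),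
    Function.update_eq_self]

/-- Multiplication by the series `∑ h_m Y_l^m`. -/
def mulVar (l : Fin (n + 1)) (h : ℕ → PadicAlgCl p) :
    (Mon n → PadicAlgCl p) →ₗ[PadicAlgCl p] (Mon n → PadicAlgCl p) where
  toFun x a := ∑ m ∈ Finset.range (a l + 1), h m * x (Function.update a l (a l - m))
  map_add' x y := by
    funext a
    simp [mul_add, Finset.sum_add_distrib]
  map_smul' c x := by
    funext a
    simp only [Pi.smul_apply, smul_eq_mul, RingHom.id_apply, Finset.mul_sum]
    exact Finset.sum_congr rfl fun m _ => by ring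

lemma mulVar_apply (l : Fin (n + 1)) (h : ℕ → PadicAlgCl p) (x : Mon n → PadicAlgCl p)
    (a : Mon n) : mulVar l h x a =
      ∑ m ∈ Finset.range (a l + 1), h m * x (Function.update a l (a l - m)) := rfl

lemma continuous_mulVar (l : Fin (n + 1)) (h : ℕ → PadicAlgCl p) :
    Continuous (mulVar l h : (Mon n → PadicAlgCl p) →ₗ[PadicAlgCl p] _) :=
  continuous_pi fun a => show Continuous fun x : Mon n → PadicAlgCl p =>
      ∑ m ∈ Finset.range (a l + 1), h m * x (Function.update a l (a l - m)) by fun_prop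

/-- The Euler operator `Y_l ∂/∂Y_l`. -/
def euler (l : Fin (n + 1)) :
    (Mon n → PadicAlgCl p) →ₗ[PadicAlgCl p] (Mon n → PadicAlgCl p) where
  toFun x a := (a l : PadicAlgCl p) * x a
  map_add' x y := by funext a; simp [mul_add]
  map_smul' c x := by
    funext a
    simp only [Pi.smul_apply, smul_eq_mul, RingHom.id_apply]
    ring

lemma euler_apply (l : Fin (n + 1)) (x : Mon n → PadicAlgCl p) (a : Mon n) :
    euler l x a = (a l : PadicAlgCl p) * x a := rfl

lemma continuous_euler (l : Fin (n + 1)) :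
    Continuous (euler l : (Mon n → PadicAlgCl p) →ₗ[PadicAlgCl p] _) :=
  continuous_pi fun a => show Continuous fun x : Mon n → PadicAlgCl p =>
      (a l : PadicAlgCl p) * x a by fun_prop

/-- `E_l = Y_l ∂/∂Y_l + ∑ h_m Y_l^m`. -/
def Eop (h : ℕ → PadicAlgCl p) (l : Fin (n + 1)) :
    (Mon n → PadicAlgCl p) →ₗ[PadicAlgCl p] (Mon n → PadicAlgCl p) := euler l + mulVar l h

/-- `D_l = E_l - E_0`. -/
def Dmod (h : ℕ → PadicAlgCl p) (l : Fin n) :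
    (Mon n → PadicAlgCl p) →ₗ[PadicAlgCl p] (Mon n → PadicAlgCl p) := Eop h l.succ - Eop h 0

lemma Dmod_apply (h : ℕ → PadicAlgCl p) (l : Fin n) (x : Mon n → PadicAlgCl p) (a : Mon n) :
    Dmod h l x a = ((a l.succ : PadicAlgCl p) - a 0) * x a + mulVar l.succ h x a - mulVar 0 h x a := by
  simp only [Dmod, Eop, LinearMap.sub_apply, LinearMap.add_apply, Pi.sub_apply, Pi.add_apply,
    euler_apply]
  ring

lemma continuous_Dmod (h : ℕ → PadicAlgCl p) (l : Fin n) : Continuous (Dmod h l) := by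
  unfold Dmod Eop
  exact (((continuous_euler _).add (continuous_mulVar _ _)).sub
    ((continuous_euler _).add (continuous_mulVar _ _)))

lemma mulVar_comm {l j : Fin (n + 1)} (hlj : l ≠ j) (h : ℕ → PadicAlgCl p)
    (x : Mon n → PadicAlgCl p) : mulVar l h (mulVar j h x) = mulVar j h (mulVar l h x) := by
  funext a
  simp only [mulVar_apply, Finset.mul_sum]
  rw [Finset.sum_comm' (s := Finset.range (a l + 1)) (t' := Finset.range (a j + 1))
    (s' := fun _ => Finset.range (a l + 1))]
  · refine Finset.sum_congr rfl fun m _ => ?_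
    rw [Function.update_of_ne hlj]
    refine Finset.sum_congr rfl fun k _ => ?_
    rw [Function.update_of_ne hlj.symm, Function.update_comm hlj]
    ring
  · intro m k
    rw [Function.update_of_ne hlj.symm]

lemma euler_mulVar_comm {l j : Fin (n + 1)} (hlj : l ≠ j) (h : ℕ → PadicAlgCl p)
    (x : Mon n → PadicAlgCl p) : euler l (mulVar j h x) = mulVar j h (euler l x) := by
  funext a
  simp only [mulVar_apply, Finset.mul_sum, euler_apply]
  refine Finset.sum_congr rfl fun m _ => ?_
  rw [Function.update_of_ne hlj]
  ring

lemma Eop_comm (h : ℕ → PadicAlgCl p) (l j : Fin (n + 1)) (x : Mon n → PadicAlgCl p) :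
    Eop h l (Eop h j x) = Eop h j (Eop h l x) := by
  rcases eq_or_ne l j with rfl | hlj
  · rfl
  have h1 : euler l (euler j x) = euler j (euler l x) := by
    funext a
    simp only [euler_apply]
    ring
  simp only [Eop, LinearMap.add_apply, map_add]
  rw [mulVar_comm hlj, euler_mulVar_comm hlj, ← euler_mulVar_comm hlj.symm, h1]
  abel

lemma Dmod_comm (h : ℕ → PadicAlgCl p) (l j : Fin n) (x : Mon n → PadicAlgCl p) :
    Dmod h l (Dmod h j x) = Dmod h j (Dmod h l x) := by
  simp only [Dmod, LinearMap.sub_apply, map_sub]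
  rw [Eop_comm h l.succ j.succ, Eop_comm h l.succ 0, Eop_comm h 0 j.succ]
  abel

/-- The properties of the sequence `h` with `Y_l ∂H/∂Y_l = ∑ h_m Y_l^m` that make the operator
`E_l` a small perturbation of `Y_l ∂/∂Y_l + Y_l`. -/
structure DworkSeq (L : IntermediateField ℚ_[p] (PadicAlgCl p)) (h : ℕ → PadicAlgCl p) : Prop where
  zero : h 0 = 0
  one : h 1 = 1
  mem : ∀ m, h m ∈ L
  le : ∀ m, 1 ≤ m → ‖h m‖ ≤ ((p : ℝ)⁻¹) ^ (m - 1)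

variable {L : IntermediateField ℚ_[p] (PadicAlgCl p)} {h : ℕ → PadicAlgCl p}

/-- The part of degree at least two of the series `h`. -/
def tailSeq (h : ℕ → PadicAlgCl p) (m : ℕ) : PadicAlgCl p := if m ≤ 1 then 0 else h m

/-- The sequence `0, 1, 0, 0, …`, for which `E_l = Y_l ∂/∂Y_l + Y_l`. -/
def oneSeq (p : ℕ) [Fact p.Prime] : ℕ → PadicAlgCl p := Pi.single 1 1

lemma mulVar_eq_add (hh : DworkSeq L h) (l : Fin (n + 1)) (x : Mon n → PadicAlgCl p) :
    mulVar l h x = mulVar l (oneSeq p) x + mulVar l (tailSeq h) x := by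
  funext a
  rw [Pi.add_apply, mulVar_apply, mulVar_apply, mulVar_apply, ← Finset.sum_add_distrib]
  refine Finset.sum_congr rfl fun m _ => ?_
  rw [← add_mul]
  congr 1
  rcases Nat.lt_or_ge 1 m with h1 | h1
  · simp [tailSeq, oneSeq, not_le.2 h1, h1.ne']
  · interval_cases m <;> simp [tailSeq, oneSeq, hh.zero, hh.one]

lemma mulVar_oneSeq (l : Fin (n + 1)) (x : Mon n → PadicAlgCl p) (a : Mon n) :
    mulVar l (oneSeq p) x a = if a l = 0 then 0 else x (Function.update a l (a l - 1)) := by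
  rw [mulVar_apply]
  split_ifs with h0
  · rw [h0]; simp [oneSeq]
  · rw [Finset.sum_eq_single 1]
    · simp [oneSeq]
    · intro m _ hm; simp [oneSeq, hm]
    · intro hm; exact absurd (Finset.mem_range.2 (by omega)) hm

lemma mulVar_oneSeq_up (l : Fin (n + 1)) (x : Mon n → PadicAlgCl p) (b : Mon n) :
    mulVar l (oneSeq p) x (up l b) = x b := by
  rw [mulVar_oneSeq, up_self, if_neg (Nat.succ_ne_zero _), Nat.add_sub_cancel, up,
    Function.update_idem, Function.update_eq_self]

lemma mulVar_oneSeq_single (l : Fin (n + 1)) (b : Mon n) :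
    mulVar l (oneSeq p) (Pi.single b 1) = Pi.single (up l b) 1 := by
  funext a
  rw [mulVar_oneSeq]
  by_cases h0 : a l = 0
  · rw [if_pos h0, Pi.single_eq_of_ne]
    rintro rfl
    rw [up_self] at h0
    exact Nat.succ_ne_zero _ h0
  · rw [if_neg h0]
    by_cases h1 : a = up l b
    · subst h1
      rw [up_self, Nat.add_sub_cancel, Pi.single_eq_same, up, Function.update_idem,
        Function.update_eq_self, Pi.single_eq_same]
    · rw [Pi.single_eq_of_ne h1, Pi.single_eq_of_ne]
      rintro rfl
      exact h1 (eq_up_of_ne_zero h0).symm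

lemma euler_single (l : Fin (n + 1)) (b : Mon n) :
    euler l (Pi.single b 1 : Mon n → PadicAlgCl p) = (b l : ℤ) • Pi.single b 1 := by
  funext a
  rw [euler_apply, Pi.smul_apply]
  rcases eq_or_ne a b with rfl | h
  · simp
  · simp [h]

lemma Dmod_oneSeq_single (l : Fin n) (b : Mon n) :
    Dmod (oneSeq p) l (Pi.single b 1) = ((b l.succ : ℤ) - b 0) • Pi.single b 1 +
      (Pi.single (up l.succ b) 1 - Pi.single (up 0 b) 1) := by
  simp only [Dmod, Eop, LinearMap.sub_apply, LinearMap.add_apply, euler_single,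
    mulVar_oneSeq_single, sub_smul]
  abel

/-! ### Bounds for the operators -/

lemma Ball.scale {I : Type*} {S : Set I} {ω : I → ℝ} {C : ℝ} {x : I → PadicAlgCl p} {c : ℝ}
    (hc : 0 < c) (hx : Ball L S ω C x) : Ball L S (fun i => c * ω i) (c * C) x := by
  refine ⟨hx.1, hx.2.1, fun i => ?_, fun ε hε => (hx.2.2.2 (ε / c) (by positivity)).subset
    fun i hi => ?_⟩
  · have := mul_le_mul_of_nonneg_left (hx.2.2.1 i) hc.le
    linarith
  · rw [Set.mem_ofPred_eq] at hi ⊢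
    rw [div_lt_iff₀ hc]
    linarith

lemma Ball.comp_injective {I J : Type*} {S : Set I} {ω : I → ℝ} {C : ℝ} {x : I → PadicAlgCl p}
    (hx : Ball L S ω C x) {f : J → I} (hf : Function.Injective f) :
    Ball L (f ⁻¹' S) (fun j => ω (f j)) C (fun j => x (f j)) :=
  ⟨fun _ => hx.1 _, fun _ hj => hx.2.1 _ hj, fun _ => hx.2.2.1 _,
    fun ε hε => Set.Finite.preimage (f := f) hf.injOn (hx.2.2.2 ε hε)⟩

/-- Multiplication by a series in `Y_l` multiplies the radii. -/
lemma ball_mulVar {P κ C : ℝ} (hP : 0 < P) (hκ : 0 < κ) (hC : 0 < C) {S S' : Set (Mon n)}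
    {l : Fin (n + 1)} (hS : ∀ a ∉ S', ∀ m ≤ a l, Function.update a l (a l - m) ∉ S)
    (hh : Ball L Set.univ (fun m => P ^ m) κ h) {x : Mon n → PadicAlgCl p}
    (hx : Ball L S (fun b => P ^ mdeg b) C x) :
    Ball L S' (fun b => P ^ mdeg b) (κ * C) (mulVar l h x) := by
  -- The weights are multiplicative along the variable `Y_l`.
  have key : ∀ (a : Mon n) (m : ℕ), m ≤ a l →
      ‖h m * x (Function.update a l (a l - m))‖ * P ^ mdeg a =
      (‖h m‖ * P ^ m) * (‖x (Function.update a l (a l - m))‖ *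
        P ^ mdeg (Function.update a l (a l - m))) := by
    intro a m hm
    rw [← mdeg_update_sub hm, norm_mul, pow_add]
    ring
  refine ⟨fun a => ?_, fun a ha => ?_, fun a => ?_, fun ε hε => ?_⟩
  · rw [mulVar_apply]
    exact sum_mem fun m _ => mul_mem (hh.1 m) (hx.1 _)
  · rw [mulVar_apply]
    refine Finset.sum_eq_zero fun m hm => ?_
    rw [hx.2.1 _ (hS a ha m (by simpa [Nat.lt_succ_iff] using hm)), mul_zero]
  · have hPa : 0 < P ^ mdeg a := by positivity
    rw [← le_div_iff₀ hPa, mulVar_apply]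
    refine IsUltrametricDist.norm_sum_le_of_forall_le_of_nonneg (by positivity) fun m hm => ?_
    rw [Finset.mem_range, Nat.lt_succ_iff] at hm
    rw [le_div_iff₀ hPa, key a m hm]
    exact mul_le_mul (hh.2.2.1 m) (hx.2.2.1 _) (by positivity) hκ.le
  · refine (Set.Finite.image2 (fun b m => Function.update b l (b l + m))
      (hx.2.2.2 (ε / κ) (by positivity)) (hh.2.2.2 (ε / C) (by positivity))).subset fun a ha => ?_
    have hPa : 0 < P ^ mdeg a := by positivity
    rw [Set.mem_ofPred_eq, ← div_lt_iff₀ hPa, mulVar_apply] at ha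
    obtain ⟨m, hm, hlt⟩ : ∃ m ≤ a l, ε / P ^ mdeg a <
        ‖h m * x (Function.update a l (a l - m))‖ := by
      by_contra! hcon
      refine absurd ha (not_lt.2 ?_)
      refine IsUltrametricDist.norm_sum_le_of_forall_le_of_nonneg (by positivity) fun m hm => ?_
      exact hcon m (by simpa [Nat.lt_succ_iff] using hm)
    rw [div_lt_iff₀ hPa, key a m hm] at hlt
    refine ⟨Function.update a l (a l - m), ?_, m, ?_, ?_⟩
    · rw [Set.mem_ofPred_eq, div_lt_iff₀ hκ, mul_comm]
      exact hlt.trans_le (mul_le_mul_of_nonneg_right (hh.2.2.1 m) (by positivity))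
    · rw [Set.mem_ofPred_eq, div_lt_iff₀ hC]
      exact hlt.trans_le (mul_le_mul_of_nonneg_left (hx.2.2.1 _) (by positivity))
    · simp only [Function.update_self, Function.update_idem, Nat.sub_add_cancel hm,
        Function.update_eq_self]

lemma ball_euler {ω : Mon n → ℝ} {C : ℝ} (hω : ∀ b, 0 ≤ ω b) {S : Set (Mon n)} {l : Fin (n + 1)}
    {x : Mon n → PadicAlgCl p} (hx : Ball L S ω C x) : Ball L S ω C (euler l x) := by
  have key : ∀ b, ‖euler l x b‖ * ω b ≤ ‖x b‖ * ω b := fun b => by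
    rw [euler_apply, norm_mul]
    exact mul_le_mul_of_nonneg_right
      (mul_le_of_le_one_left (norm_nonneg _) (norm_natCast_le_one p _)) (hω b)
  exact ⟨fun b => mul_mem (natCast_mem _ _) (hx.1 b),
    fun b hb => by rw [euler_apply, hx.2.1 b hb, mul_zero], fun b => (key b).trans (hx.2.2.1 b),
    fun ε hε => (hx.2.2.2 ε hε).subset fun b hb => lt_of_lt_of_le hb (key b)⟩

/-- The terms of degree at least two are smaller than `Y_l` by the factor `P/p`. -/
lemma tailSeq_ball (hh : DworkSeq L h) {P : ℝ} (hP : 1 ≤ P) (hPp : P < p) :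
    Ball L Set.univ (fun m => P ^ m) (P * (P / p)) (tailSeq h) := by
  have hp0 : (0 : ℝ) < p := by exact_mod_cast hp.1.pos
  have hP0 : 0 < P := by linarith
  have hq1 : P / p < 1 := (div_lt_one hp0).2 hPp
  have hq0 : 0 < P / p := by positivity
  have key : ∀ m, 2 ≤ m → ‖tailSeq h m‖ * P ^ m ≤ P * (P / p) ^ (m - 1) := by
    intro m hm
    rw [tailSeq, if_neg (by omega)]
    calc ‖h m‖ * P ^ m ≤ ((p : ℝ)⁻¹) ^ (m - 1) * P ^ m := by
          gcongr; exact hh.le m (by omega)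
      _ = P * (P / p) ^ (m - 1) := by
          obtain ⟨k, rfl⟩ : ∃ k, m = k + 1 := ⟨m - 1, by omega⟩
          rw [Nat.add_sub_cancel, div_eq_mul_inv, mul_pow, pow_succ]
          ring
  refine ⟨fun m => ?_, fun m hm => absurd (Set.mem_univ m) hm, fun m => ?_, fun ε hε => ?_⟩
  · unfold tailSeq; split_ifs
    · exact zero_mem _
    · exact hh.mem m
  · rcases Nat.lt_or_ge m 2 with h2 | h2
    · rw [tailSeq, if_pos (by omega), norm_zero, zero_mul]; positivity
    · refine (key m h2).trans (mul_le_mul_of_nonneg_left ?_ hP0.le)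
      simpa using pow_le_pow_of_le_one hq0.le hq1.le (show 1 ≤ m - 1 by omega)
  · obtain ⟨N, hN⟩ := exists_pow_lt_of_lt_one (show 0 < ε / P by positivity) hq1
    refine (Set.finite_lt_nat (N + 2)).subset fun m hm => ?_
    rw [Set.mem_ofPred_eq] at hm ⊢
    by_contra! hcon
    have h1 := hm.trans_le (key m (by omega))
    have h2 : (P / p) ^ (m - 1) ≤ (P / p) ^ N := pow_le_pow_of_le_one hq0.le hq1.le (by omega)
    rw [lt_div_iff₀ hP0] at hN
    nlinarith

lemma oneSeq_ball {P : ℝ} (hP : 0 < P) : Ball L Set.univ (fun m => P ^ m) P (oneSeq p) :=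
  Ball.single (Set.mem_univ 1) hP.le (by simp)

lemma DworkSeq.ball (hh : DworkSeq L h) {P : ℝ} (hP : 1 ≤ P) (hPp : P < p) :
    Ball L Set.univ (fun m => P ^ m) P h := by
  have hp0 : (0 : ℝ) < p := by exact_mod_cast hp.1.pos
  have h1 : h = oneSeq p + tailSeq h := by
    funext m
    rcases Nat.lt_or_ge 1 m with h1 | h1
    · simp [tailSeq, oneSeq, not_le.2 h1, h1.ne']
    · interval_cases m <;> simp [tailSeq, oneSeq, hh.zero, hh.one]
  rw [h1]
  refine Ball.add (fun m => by positivity) (oneSeq_ball (by linarith))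
    ((tailSeq_ball hh hP hPp).mono ?_)
  exact mul_le_of_le_one_right (by linarith) ((div_le_one hp0).2 hPp.le)

/-- The perturbation `D_l - (Y_l ∂_l - Y_0 ∂_0 + Y_l - Y_0)` is small. -/
lemma ball_Dmod_sub (hh : DworkSeq L h) {P C : ℝ} (hP : 1 ≤ P) (hPp : P < p) (hC : 0 < C)
    {S : Set (Mon n)} {l : Fin n}
    (hS : ∀ a ∉ S, ∀ m ≤ a l.succ, Function.update a l.succ (a l.succ - m) ∉ S)
    (hS0 : ∀ a ∉ S, ∀ m ≤ a 0, Function.update a 0 (a 0 - m) ∉ S)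
    {x : Mon n → PadicAlgCl p} (hx : Ball L S (fun b => P ^ (mdeg b + 1)) C x) :
    Ball L S (fun b => P ^ mdeg b) (P / p * C) (Dmod h l x - Dmod (oneSeq p) l x) := by
  have hp0 : (0 : ℝ) < p := by exact_mod_cast hp.1.pos
  have hP0 : 0 < P := by linarith
  have hx' : Ball L S (fun b => P ^ mdeg b) (P⁻¹ * C) x := by
    have := hx.scale (inv_pos.2 hP0)
    simp only [pow_succ'] at this
    convert this using 2 with b
    rw [inv_mul_cancel_left₀ hP0.ne']
  have e : Dmod h l x - Dmod (oneSeq p) l x =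
      mulVar l.succ (tailSeq h) x - mulVar 0 (tailSeq h) x := by
    simp only [Dmod, Eop, LinearMap.sub_apply, LinearMap.add_apply, mulVar_eq_add hh]
    abel
  have hc : P * (P / p) * (P⁻¹ * C) = P / p * C := by field_simp
  rw [e, ← hc]
  exact Ball.sub (fun b => by positivity)
    (ball_mulVar hP0 (by positivity) (by positivity) hS (tailSeq_ball hh hP hPp) hx')
    (ball_mulVar hP0 (by positivity) (by positivity) hS0 (tailSeq_ball hh hP hPp) hx')

lemma ball_Eop (hh : DworkSeq L h) {C : ℝ} (hC : 0 < C) {S : Set (Mon n)} {l : Fin (n + 1)}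
    (hS : ∀ a ∉ S, ∀ m ≤ a l, Function.update a l (a l - m) ∉ S)
    {x : Mon n → PadicAlgCl p} (hx : Ball L S (fun b => (1 : ℝ) ^ mdeg b) C x) :
    Ball L S (fun b => (1 : ℝ) ^ mdeg b) C (Eop h l x) := by
  have h1 := ball_mulVar zero_lt_one zero_lt_one hC hS (hh.ball le_rfl one_lt_prime) hx
  rw [one_mul] at h1
  exact Ball.add (fun b => by positivity) (ball_euler (fun b => by positivity) hx) h1

lemma ball_Dmod (hh : DworkSeq L h) {C : ℝ} (hC : 0 < C) {S : Set (Mon n)} {l : Fin n}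
    (hS : ∀ a ∉ S, ∀ m ≤ a l.succ, Function.update a l.succ (a l.succ - m) ∉ S)
    (hS0 : ∀ a ∉ S, ∀ m ≤ a 0, Function.update a 0 (a 0 - m) ∉ S)
    {x : Mon n → PadicAlgCl p} (hx : Ball L S (fun b => (1 : ℝ) ^ mdeg b) C x) :
    Ball L S (fun b => (1 : ℝ) ^ mdeg b) C (Dmod h l x) :=
  Ball.sub (fun b => by positivity) (ball_Eop hh hC hS hx) (ball_Eop hh hC hS0 hx)

end Model

/-! ### The cokernel of `D_1, …, D_n` -/

section Cokernel

variable {p : ℕ} [hp : Fact p.Prime] {n : ℕ}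

/-- The integral combinations of the unit vectors indexed by `S`. -/
def intSpan (p : ℕ) [Fact p.Prime] {I : Type*} [DecidableEq I] (S : Set I) :
    AddSubgroup (I → PadicAlgCl p) :=
  AddSubgroup.closure ((fun i => Pi.single i 1) '' S)

section IntSpan

variable {I : Type*} [DecidableEq I] {S S' : Set I}

lemma single_mem_intSpan {i : I} (hi : i ∈ S) :
    (Pi.single i 1 : I → PadicAlgCl p) ∈ intSpan p S :=
  AddSubgroup.subset_closure ⟨i, hi, rfl⟩

lemma intSpan_mono (h : S ⊆ S') : intSpan p S ≤ intSpan p S' :=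
  AddSubgroup.closure_mono (Set.image_mono h)

lemma apply_eq_zero_of_mem_intSpan {z : I → PadicAlgCl p} (hz : z ∈ intSpan p S) {i : I}
    (hi : i ∉ S) : z i = 0 := by
  induction hz using AddSubgroup.closure_induction with
  | mem x hx =>
    obtain ⟨j, hj, rfl⟩ := hx
    exact Pi.single_eq_of_ne (fun h => hi (by rw [h]; exact hj)) _
  | zero => rfl
  | add x y _ _ hx hy => rw [Pi.add_apply, hx, hy, add_zero]
  | neg x _ hx => rw [Pi.neg_apply, hx, neg_zero]

lemma ball_of_mem_intSpan {L : IntermediateField ℚ_[p] (PadicAlgCl p)} {ω : I → ℝ} {C : ℝ}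
    (hC : 0 ≤ C) (hω : ∀ i, 0 ≤ ω i) (h : ∀ i ∈ S, ω i ≤ C) {z : I → PadicAlgCl p}
    (hz : z ∈ intSpan p S) : Ball L S ω C z := by
  induction hz using AddSubgroup.closure_induction with
  | mem x hx =>
    obtain ⟨j, hj, rfl⟩ := hx
    exact Ball.single hj hC (h j hj)
  | zero => exact Ball.zero hC
  | add x y _ _ hx hy => exact Ball.add hω hx hy
  | neg x _ hx => exact hx.neg

end IntSpan

/-- The series `∑ v_d Y^{ε d}`, where `ε d` is an exponent of degree `d`. -/
def embSeq (p : ℕ) [Fact p.Prime] (ε : ℕ → Mon n) :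
    (ℕ → PadicAlgCl p) →ₗ[PadicAlgCl p] (Mon n → PadicAlgCl p) where
  toFun v a := if a = ε (mdeg a) then v (mdeg a) else 0
  map_add' x y := by funext a; dsimp only [Pi.add_apply]; split_ifs <;> simp
  map_smul' c x := by funext a; dsimp only [Pi.smul_apply, RingHom.id_apply]; split_ifs <;> simp

lemma embSeq_apply (ε : ℕ → Mon n) (v : ℕ → PadicAlgCl p) (a : Mon n) :
    embSeq p ε v a = if a = ε (mdeg a) then v (mdeg a) else 0 := rfl

lemma embSeq_single {ε : ℕ → Mon n} (hε : ∀ d, mdeg (ε d) = d) (d : ℕ) :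
    embSeq p ε (Pi.single d 1) = Pi.single (ε d) 1 := by
  funext a
  rw [embSeq_apply]
  by_cases h : a = ε d
  · subst h
    rw [hε, if_pos rfl, Pi.single_eq_same, Pi.single_eq_same]
  · rw [Pi.single_eq_of_ne h]
    split_ifs with h1
    · rw [Pi.single_eq_of_ne]
      rintro h2
      exact h (h1.trans (by rw [h2]))
    · rfl

lemma continuous_embSeq (ε : ℕ → Mon n) : Continuous (embSeq p ε) :=
  continuous_pi fun a => by
    change Continuous fun v : ℕ → PadicAlgCl p => if a = ε (mdeg a) then v (mdeg a) else 0
    split_ifs <;> fun_prop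

lemma ball_embSeq {L : IntermediateField ℚ_[p] (PadicAlgCl p)} {ε : ℕ → Mon n}
    {P C : ℝ} (hC : 0 ≤ C) {v : ℕ → PadicAlgCl p}
    (hv : Ball L Set.univ (fun d => P ^ d) C v) :
    Ball L Set.univ (fun a => P ^ mdeg a) C (embSeq p ε v) := by
  refine ⟨fun a => ?_, fun a ha => absurd (Set.mem_univ a) ha, fun a => ?_, fun η hη => ?_⟩
  · rw [embSeq_apply]; split_ifs
    · exact hv.1 _
    · exact zero_mem _
  · rw [embSeq_apply]; split_ifs
    · exact hv.2.2.1 _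
    · rw [norm_zero, zero_mul]; exact hC
  · refine ((hv.2.2.2 η hη).image ε).subset fun a ha => ?_
    rw [Set.mem_ofPred_eq, embSeq_apply] at ha
    split_ifs at ha with h
    · exact ⟨mdeg a, ha, h.symm⟩
    · rw [norm_zero, zero_mul] at ha; exact absurd ha (not_lt.2 hη.le)

/-- The map `(q, v) ↦ ∑_l D_l q_l + ∑_d v_d Y^{ε d}`. -/
def hnMap (h : ℕ → PadicAlgCl p) (ε : ℕ → Mon n) :
    ((Fin n × Mon n) ⊕ ℕ → PadicAlgCl p) →ₗ[PadicAlgCl p] (Mon n → PadicAlgCl p) :=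
  ∑ l : Fin n, Dmod h l ∘ₗ LinearMap.funLeft _ _ (fun b => Sum.inl (l, b)) +
    embSeq p ε ∘ₗ LinearMap.funLeft _ _ Sum.inr

lemma hnMap_apply (h : ℕ → PadicAlgCl p) (ε : ℕ → Mon n)
    (z : (Fin n × Mon n) ⊕ ℕ → PadicAlgCl p) :
    hnMap h ε z = ∑ l : Fin n, Dmod h l (fun b => z (Sum.inl (l, b))) +
      embSeq p ε (fun d => z (Sum.inr d)) := by
  simp only [hnMap, LinearMap.add_apply, LinearMap.sum_apply, LinearMap.comp_apply]
  rfl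

lemma continuous_hnMap (h : ℕ → PadicAlgCl p) (ε : ℕ → Mon n) : Continuous (hnMap h ε) := by
  have : ⇑(hnMap h ε) = fun z => ∑ l : Fin n, Dmod h l (fun b => z (Sum.inl (l, b))) +
      embSeq p ε (fun d => z (Sum.inr d)) := funext (hnMap_apply h ε)
  rw [this]
  refine Continuous.add (continuous_finsetSum _ fun l _ => ?_) ?_
  · exact (continuous_Dmod h l).comp (by fun_prop)
  · exact (continuous_embSeq ε).comp (by fun_prop)

lemma hnMap_single_inl (h : ℕ → PadicAlgCl p) (ε : ℕ → Mon n) (l : Fin n) (b : Mon n) :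
    hnMap h ε (Pi.single (Sum.inl (l, b)) 1) = Dmod h l (Pi.single b 1) := by
  rw [hnMap_apply, Finset.sum_eq_single l]
  · have h1 : (fun d : ℕ => (Pi.single (Sum.inl (l, b)) 1 :
        (Fin n × Mon n) ⊕ ℕ → PadicAlgCl p) (Sum.inr d)) = 0 := by
      funext d; exact Pi.single_eq_of_ne (by simp) _
    have h2 : (fun c : Mon n => (Pi.single (Sum.inl (l, b)) 1 :
        (Fin n × Mon n) ⊕ ℕ → PadicAlgCl p) (Sum.inl (l, c))) = Pi.single b 1 := by
      funext c
      simp [Pi.single_apply]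
    rw [h1, h2, map_zero, add_zero]
  · intro j _ hj
    have : (fun c : Mon n => (Pi.single (Sum.inl (l, b)) 1 :
        (Fin n × Mon n) ⊕ ℕ → PadicAlgCl p) (Sum.inl (j, c))) = 0 := by
      funext c; exact Pi.single_eq_of_ne (by simp [hj]) _
    rw [this, map_zero]
  · intro h; exact absurd (Finset.mem_univ l) h

lemma hnMap_single_inr (h : ℕ → PadicAlgCl p) {ε : ℕ → Mon n} (hε : ∀ d, mdeg (ε d) = d) (d : ℕ) :
    hnMap h ε (Pi.single (Sum.inr d) 1) = Pi.single (ε d) 1 := by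
  have h1 : ∀ l : Fin n, (fun b : Mon n => (Pi.single (Sum.inr d) 1 :
      (Fin n × Mon n) ⊕ ℕ → PadicAlgCl p) (Sum.inl (l, b))) = 0 := fun l => by
    funext c; exact Pi.single_eq_of_ne (by simp) _
  have h2 : (fun c : ℕ => (Pi.single (Sum.inr d) 1 :
      (Fin n × Mon n) ⊕ ℕ → PadicAlgCl p) (Sum.inr c)) = Pi.single d 1 := by
    funext c
    simp [Pi.single_apply]
  rw [hnMap_apply, h2, embSeq_single hε, Finset.sum_eq_zero, zero_add]
  intro l _
  rw [h1, map_zero]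

/-- The degrees of the unknowns in `hnMap`. -/
def hnDeg : (Fin n × Mon n) ⊕ ℕ → ℕ := Sum.elim (fun x => mdeg x.2 + 1) id

/-- The exponent of `Y_0^d`. -/
def hub (n d : ℕ) : Mon n := Pi.single 0 d

lemma mdeg_hub (d : ℕ) : mdeg (hub n d) = d := by
  simp [mdeg, hub]

/-- The unit vectors are in the image of the leading part of `hnMap`: this is the elementary fact
that `ℤ[Y_0, …, Y_n]/(Y_1 - Y_0, …, Y_n - Y_0)` is free of rank one in each degree. -/
lemma exists_hnMap_oneSeq {ε : ℕ → Mon n} (hε : ∀ d, mdeg (ε d) = d) (d : ℕ) :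
    ∀ a : Mon n, mdeg a = d → ∃ z ∈ intSpan p {i : (Fin n × Mon n) ⊕ ℕ | hnDeg i ≤ d},
      z (Sum.inr d) = 1 ∧ hnMap (oneSeq p) ε z = Pi.single a 1 := by
  induction d using Nat.strong_induction_on with
  | _ d ihd =>
  -- In the relation `D_l Y^b = Y_l Y^b - Y_0 Y^b + (b_l - b_0) Y^b` the last term has lower degree.
  -- Hence `Y^a` may be compared with `Y_0^d` by replacing one factor `Y_l` by `Y_0` at a time.
  have hB : ∀ N : ℕ, ∀ a : Mon n, mdeg a = d → a 0 + N = d →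
      ∃ z ∈ intSpan p {i : (Fin n × Mon n) ⊕ ℕ | hnDeg i ≤ d},
        z (Sum.inr d) = 0 ∧ hnMap (oneSeq p) ε z = Pi.single a 1 - Pi.single (hub n d) 1 := by
    intro N
    induction N with
    | zero =>
      intro a ha ha0
      have : a = hub n d := by
        have h1 : ∀ l : Fin n, a l.succ = 0 := by
          intro l
          have h2 : mdeg a = a 0 + ∑ l : Fin n, a l.succ := Fin.sum_univ_succ a
          have h3 := Finset.single_le_sum (f := fun l : Fin n => a l.succ)
            (fun i _ => Nat.zero_le _) (Finset.mem_univ l)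
          omega
        funext l
        refine Fin.cases ?_ (fun l => ?_) l
        · simp [hub]; omega
        · rw [h1, hub, Pi.single_eq_of_ne (Fin.succ_ne_zero l)]
      refine ⟨0, zero_mem _, rfl, ?_⟩
      rw [map_zero, this, sub_self]
    | succ N ih =>
      intro a ha ha0
      obtain ⟨l, hl⟩ : ∃ l : Fin n, a l.succ ≠ 0 := by
        by_contra! hcon
        have h2 : mdeg a = a 0 + ∑ l : Fin n, a l.succ := Fin.sum_univ_succ a
        simp [hcon] at h2
        omega
      set b := Function.update a l.succ (a l.succ - 1) with hb
      have hup : up l.succ b = a := eq_up_of_ne_zero hl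
      have hbd : mdeg b + 1 = d := by rw [← ha, ← hup, mdeg_up]
      obtain ⟨zb, hzb, -, hzb2⟩ := ihd (mdeg b) (by omega) b rfl
      obtain ⟨z, hz, hz0, hz2⟩ := ih (up 0 b) (by rw [mdeg_up, hbd]) (by
        rw [up_self, hb, Function.update_of_ne (Fin.succ_ne_zero l).symm]; omega)
      have hsub : {i : (Fin n × Mon n) ⊕ ℕ | hnDeg i ≤ mdeg b} ⊆ {i | hnDeg i ≤ d} :=
        fun i (hi : hnDeg i ≤ mdeg b) => show hnDeg i ≤ d by omega
      refine ⟨Pi.single (Sum.inl (l, b)) 1 - ((b l.succ : ℤ) - b 0) • zb + z, ?_, ?_, ?_⟩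
      · refine add_mem (sub_mem (single_mem_intSpan ?_) (zsmul_mem ?_ _)) hz
        · simp [hnDeg, hbd]
        · exact intSpan_mono hsub hzb
      · rw [Pi.add_apply, Pi.sub_apply, Pi.smul_apply, hz0,
          apply_eq_zero_of_mem_intSpan hzb (i := Sum.inr d) (by simp [hnDeg]; omega)]
        simp
      · rw [map_add, map_sub, map_zsmul, hnMap_single_inl, Dmod_oneSeq_single, hup, hzb2, hz2]
        abel
  intro a ha
  have hle : ∀ a : Mon n, mdeg a = d → a 0 ≤ d := fun a ha => by
    rw [← ha]
    exact Finset.single_le_sum (f := a) (fun i _ => Nat.zero_le _) (Finset.mem_univ 0)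
  obtain ⟨z, hz, hz0, hz2⟩ := hB (d - a 0) a ha (by have := hle a ha; omega)
  obtain ⟨y, hy, hy0, hy2⟩ := hB (d - ε d 0) (ε d) (hε d) (by have := hle (ε d) (hε d); omega)
  refine ⟨z - y + Pi.single (Sum.inr d) 1,
    add_mem (sub_mem hz hy) (single_mem_intSpan (by simp [hnDeg])), ?_, ?_⟩
  · simp [hz0, hy0]
  · rw [map_add, map_sub, hz2, hy2, hnMap_single_inr _ hε]
    abel

variable {L : IntermediateField ℚ_[p] (PadicAlgCl p)} {h : ℕ → PadicAlgCl p}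

lemma ball_inl {P C : ℝ} {z : (Fin n × Mon n) ⊕ ℕ → PadicAlgCl p}
    (hz : Ball L Set.univ (fun i => P ^ hnDeg i) C z) (l : Fin n) :
    Ball L Set.univ (fun b : Mon n => P ^ (mdeg b + 1)) C (fun b => z (Sum.inl (l, b))) :=
  hz.comp_injective (f := fun b : Mon n => Sum.inl (l, b)) fun b c hbc => by simpa using hbc

lemma ball_inr {P C : ℝ} {z : (Fin n × Mon n) ⊕ ℕ → PadicAlgCl p}
    (hz : Ball L Set.univ (fun i => P ^ hnDeg i) C z) :
    Ball L Set.univ (fun d : ℕ => P ^ d) C (fun d => z (Sum.inr d)) :=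
  hz.comp_injective (f := Sum.inr) Sum.inr_injective

lemma ball_hnMap_sub (hh : DworkSeq L h) {P C : ℝ} (hP : 1 ≤ P) (hPp : P < p) (hC : 0 < C)
    (ε : ℕ → Mon n) {z : (Fin n × Mon n) ⊕ ℕ → PadicAlgCl p}
    (hz : Ball L Set.univ (fun i => P ^ hnDeg i) C z) :
    Ball L Set.univ (fun a => P ^ mdeg a) (P / p * C) (hnMap h ε z - hnMap (oneSeq p) ε z) := by
  have hp0 : (0 : ℝ) < p := by exact_mod_cast hp.1.pos
  rw [hnMap_apply, hnMap_apply, add_sub_add_right_eq_sub, ← Finset.sum_sub_distrib]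
  refine Ball.sum (fun a => by positivity) (by positivity) _ fun l _ => ?_
  exact ball_Dmod_sub hh hP hPp hC (fun a ha => absurd (Set.mem_univ a) ha)
    (fun a ha => absurd (Set.mem_univ a) ha) (ball_inl hz l)

/-- Every series is a combination of the monomials `Y^{ε d}` modulo the images of the `D_l`, with
control of its growth. -/
theorem exists_hnMap_eq (hL : IsComplete (L : Set (PadicAlgCl p))) (hh : DworkSeq L h)
    {ε : ℕ → Mon n} (hε : ∀ d, mdeg (ε d) = d) {P C : ℝ} (hP : 1 ≤ P) (hPp : P < p) (hC : 0 < C)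
    {x : Mon n → PadicAlgCl p} (hx : Ball L Set.univ (fun a => P ^ mdeg a) C x) :
    ∃ z, Ball L Set.univ (fun i => P ^ hnDeg i) C z ∧ hnMap h ε z = x := by
  have hp0 : (0 : ℝ) < p := by exact_mod_cast hp.1.pos
  have hP0 : 0 < P := by linarith
  have hR := fun a : Mon n => exists_hnMap_oneSeq (p := p) hε (mdeg a) a rfl
  choose R hR _ hR2 using hR
  refine solve_of_perturbation hL (fun i => by positivity) (fun a => by positivity) _
    (hnMap (oneSeq p) ε) (continuous_hnMap h ε) (δ := P / p) (by positivity)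
    ((div_lt_one hp0).2 hPp) R (fun a _ => ?_) (fun a _ => hR2 a)
    (fun C hC y hy => ball_hnMap_sub hh hP hPp hC ε hy) hC hx
  exact (ball_of_mem_intSpan (by positivity) (fun i => by positivity)
    (fun i hi => pow_le_pow_right₀ hP hi) (hR a)).mono_set (Set.subset_univ _)

/-! ### Uniqueness: elimination of one variable at a time -/

/-- If `D_m q` does not involve `Y_m` up to a small error, then `q` is small. -/
lemma div_unique_step (hh : DworkSeq L h) {m : Fin n} {C : ℝ} (hC : 0 < C)
    {q f : Mon n → PadicAlgCl p} (hq : Ball L Set.univ (fun b => (1 : ℝ) ^ mdeg b) C q)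
    (hf : ∀ a : Mon n, a m.succ ≠ 0 → f a = 0) (hqf : Dmod h m q + f = 0) (b : Mon n) :
    ‖q b‖ ≤ (p : ℝ)⁻¹ * C := by
  have hp0 : (0 : ℝ) < p := by exact_mod_cast hp.1.pos
  have hδ : 0 < (p : ℝ)⁻¹ * C := by positivity
  have hsm := ball_Dmod_sub (l := m) (S := Set.univ) hh le_rfl one_lt_prime hC
    (fun a ha => absurd (Set.mem_univ a) ha) (fun a ha => absurd (Set.mem_univ a) ha)
    (x := q) (by simpa using hq)
  have hsm' : ∀ a, ‖(Dmod h m q - Dmod (oneSeq p) m q) a‖ ≤ (p : ℝ)⁻¹ * C := fun a => by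
    simpa using hsm.2.2.1 a
  obtain ⟨F, hF, -, -⟩ := hq.truncate hδ
  have hF' : ∀ b, b ∈ F ↔ (p : ℝ)⁻¹ * C < ‖q b‖ := fun b => by simpa using hF b
  by_contra! hcon
  obtain ⟨b₀, hb₀, hmax⟩ := Finset.exists_max_image F mdeg ⟨b, (hF' b).2 hcon⟩
  have hbig : ∀ b, mdeg b₀ < mdeg b → ‖q b‖ ≤ (p : ℝ)⁻¹ * C := fun b hb => by
    by_contra! hc
    exact absurd (hmax b ((hF' b).2 hc)) (not_le.2 hb)
  -- The coefficient of `Y_m Y^b` in the leading part of `D_m q` is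
  -- `q_b - q_c + (integer) q_{Y_m Y^b}`, with `Y_0 Y^c = Y_m Y^b`. The last term is of higher degree,
  -- and `c` involves `Y_0` to a lower power than `b`.
  have claim : ∀ N : ℕ, ∀ b : Mon n, b 0 = N → mdeg b = mdeg b₀ → ‖q b‖ ≤ (p : ℝ)⁻¹ * C := by
    intro N
    induction N with
    | zero =>
      intro b hb0 hbd
      have e := congrFun hqf (up m.succ b)
      rw [Pi.add_apply, hf _ (by rw [up_self]; exact Nat.succ_ne_zero _), add_zero, Pi.zero_apply] at e
      have e2 : (Dmod h m q - Dmod (oneSeq p) m q) (up m.succ b) =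
          -(((b m.succ + 1 - 0 : ℤ) : PadicAlgCl p) * q (up m.succ b)) - q b := by
        rw [Pi.sub_apply, e, Dmod_apply, mulVar_oneSeq_up, mulVar_oneSeq, up_self,
          up_of_ne (Fin.succ_ne_zero m).symm, hb0, if_pos rfl]
        push_cast
        simp
        ring
      have e3 : q b = -(((b m.succ + 1 - 0 : ℤ) : PadicAlgCl p) * q (up m.succ b)) -
          (Dmod h m q - Dmod (oneSeq p) m q) (up m.succ b) := by rw [e2]; ring
      rw [e3]
      refine (norm_sub_le_max' _ _).trans (max_le ?_ (hsm' _))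
      rw [norm_neg, norm_mul]
      exact (mul_le_of_le_one_left (norm_nonneg _) (norm_intCast_le_one p _)).trans
        (hbig _ (by rw [mdeg_up]; omega))
    | succ N ih =>
      intro b hb0 hbd
      have e := congrFun hqf (up m.succ b)
      rw [Pi.add_apply, hf _ (by rw [up_self]; exact Nat.succ_ne_zero _), add_zero, Pi.zero_apply] at e
      have hu0 : up m.succ b 0 = N + 1 := by rw [up_of_ne (Fin.succ_ne_zero m).symm, hb0]
      set c := Function.update (up m.succ b) 0 (up m.succ b 0 - 1) with hc
      have e2 : (Dmod h m q - Dmod (oneSeq p) m q) (up m.succ b) =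
          -(((b m.succ - N : ℤ) : PadicAlgCl p) * q (up m.succ b)) - q b + q c := by
        rw [Pi.sub_apply, e, Dmod_apply, mulVar_oneSeq_up, mulVar_oneSeq, up_self,
          hu0, if_neg (Nat.succ_ne_zero N), hc, hu0]
        push_cast
        ring
      have e3 : q b = -(((b m.succ - N : ℤ) : PadicAlgCl p) * q (up m.succ b)) + q c -
          (Dmod h m q - Dmod (oneSeq p) m q) (up m.succ b) := by rw [e2]; ring
      have hcd : mdeg c = mdeg b₀ := by
        have := mdeg_update_sub (l := 0) (a := up m.succ b) (m := 1) (by omega)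
        rw [mdeg_up] at this
        rw [hc, ← hbd]
        omega
      rw [e3]
      refine (norm_sub_le_max' _ _).trans (max_le ?_ (hsm' _))
      refine (IsUltrametricDist.norm_add_le_max _ _).trans (max_le ?_ ?_)
      · rw [norm_neg, norm_mul]
        exact (mul_le_of_le_one_left (norm_nonneg _) (norm_intCast_le_one p _)).trans
          (hbig _ (by rw [mdeg_up]; omega))
      · refine ih c ?_ hcd
        rw [hc, Function.update_self, hu0, Nat.add_sub_cancel]
  exact absurd (claim _ b₀ rfl rfl) (not_le.2 ((hF' b₀).1 hb₀))

/-- A family bounded by `δ^N C` for all `N` vanishes. -/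
lemma eq_zero_of_contract {I : Type*} {S : Set I} {ω : I → ℝ} (hω : ∀ i, 0 < ω i)
    {x : I → PadicAlgCl p} {C δ : ℝ} (hC : 0 < C) (hδ0 : 0 < δ) (hδ : δ < 1)
    (hx : Ball L S ω C x)
    (hstep : ∀ C : ℝ, 0 < C → Ball L S ω C x → ∀ i, ‖x i‖ * ω i ≤ δ * C) : x = 0 := by
  have key : ∀ N : ℕ, Ball L S ω (δ ^ N * C) x := by
    intro N
    induction N with
    | zero => simpa using hx
    | succ N ih =>
      refine ⟨hx.1, hx.2.1, fun i => ?_, hx.2.2.2⟩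
      rw [pow_succ', mul_assoc]
      exact hstep _ (by positivity) ih i
  funext i
  have h3 : Tendsto (fun N => δ ^ N * C) atTop (𝓝 (0 * C)) :=
    (tendsto_pow_atTop_nhds_zero_of_lt_one hδ0.le hδ).mul_const _
  rw [zero_mul] at h3
  have h4 := ge_of_tendsto h3 (Eventually.of_forall fun N => (key N).2.2.1 i)
  have h5 : ‖x i‖ ≤ 0 := by
    by_contra! hc
    exact absurd h4 (not_le.2 (mul_pos hc (hω i)))
  exact norm_le_zero_iff.1 h5

/-- A remainder of the division by `D_m` that lies in the image of `D_m` vanishes. -/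
lemma div_unique (hh : DworkSeq L h) {m : Fin n} {C : ℝ} (hC : 0 < C)
    {q f : Mon n → PadicAlgCl p} (hq : Ball L Set.univ (fun b => (1 : ℝ) ^ mdeg b) C q)
    (hf : ∀ a : Mon n, a m.succ ≠ 0 → f a = 0) (hqf : Dmod h m q + f = 0) : f = 0 := by
  have hq0 : q = 0 := by
    refine eq_zero_of_contract (fun i => by positivity) hC
      (inv_pos.2 (by exact_mod_cast hp.1.pos : (0 : ℝ) < p)) (inv_lt_one_of_one_lt₀ one_lt_prime)
      hq fun C hC hq b => ?_
    rw [one_pow, mul_one]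
    exact div_unique_step hh hC hq hf hqf b
  rwa [hq0, map_zero, zero_add] at hqf

/-- The exponents that involve only `Y_0` and the variables `Y_l` with `l ∈ T`. -/
def varSet (T : Finset (Fin n)) : Set (Mon n) := {a | ∀ l ∉ T, a l.succ = 0}

lemma varSet_update {T : Finset (Fin n)} {j : Fin (n + 1)}
    (hj : ∀ l ∉ T, l.succ ≠ j) {a : Mon n} {m : ℕ} :
    Function.update a j m ∈ varSet T ↔ a ∈ varSet T :=
  forall₂_congr fun l hl => by rw [Function.update_of_ne (hj l hl)]

/-- The map `(q, f) ↦ D_m q + f`. -/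
def divMap (h : ℕ → PadicAlgCl p) (m : Fin n) :
    (Mon n ⊕ Mon n → PadicAlgCl p) →ₗ[PadicAlgCl p] (Mon n → PadicAlgCl p) :=
  Dmod h m ∘ₗ LinearMap.funLeft _ _ Sum.inl + LinearMap.funLeft _ _ Sum.inr

lemma divMap_apply (h : ℕ → PadicAlgCl p) (m : Fin n) (z : Mon n ⊕ Mon n → PadicAlgCl p) :
    divMap h m z = Dmod h m (fun b => z (Sum.inl b)) + fun b => z (Sum.inr b) := rfl

/-- The unknowns of the division by `D_m`, for series in the variables `T ∋ m`: the quotient is a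
series in the variables `T`, the remainder a series in the variables `T \ {m}`. -/
def divSet (T : Finset (Fin n)) (m : Fin n) : Set (Mon n ⊕ Mon n) :=
  {i | Sum.elim (· ∈ varSet T) (fun a => a ∈ varSet T ∧ a m.succ = 0) i}

/-- Division of a monomial by the leading part of `D_m`, with integral coefficients. -/
lemma exists_divMap_oneSeq {T : Finset (Fin n)} {m : Fin n} (hm : m ∈ T) (d : ℕ) :
    ∀ N : ℕ, ∀ a ∈ varSet T, mdeg a = d → a m.succ = N →
      ∃ z ∈ intSpan p (divSet T m), divMap (oneSeq p) m z = Pi.single a 1 := by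
  have hsucc : ∀ l ∉ T, l.succ ≠ m.succ := fun l hl h =>
    hl (by rw [Fin.succ_injective n h]; exact hm)
  have hzero : ∀ l ∉ T, l.succ ≠ (0 : Fin (n + 1)) := fun l _ => Fin.succ_ne_zero l
  induction d using Nat.strong_induction_on with
  | _ d ihd =>
  intro N
  induction N with
  | zero =>
    intro a ha _ ham
    refine ⟨Pi.single (Sum.inr a) 1, single_mem_intSpan ⟨ha, ham⟩, ?_⟩
    rw [divMap_apply]
    have h1 : (fun b : Mon n => (Pi.single (Sum.inr a) 1 : Mon n ⊕ Mon n → PadicAlgCl p)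
        (Sum.inl b)) = 0 := by funext c; exact Pi.single_eq_of_ne (by simp) _
    have h2 : (fun b : Mon n => (Pi.single (Sum.inr a) 1 : Mon n ⊕ Mon n → PadicAlgCl p)
        (Sum.inr b)) = Pi.single a 1 := by funext c; simp [Pi.single_apply]
    rw [h1, h2, map_zero, zero_add]
  | succ N ih =>
    intro a ha had ham
    set b := Function.update a m.succ (a m.succ - 1) with hb
    have hup : up m.succ b = a := eq_up_of_ne_zero (by omega)
    have hbd : mdeg b + 1 = d := by rw [← had, ← hup, mdeg_up]
    have hbT : b ∈ varSet T := (varSet_update hsucc).2 ha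
    obtain ⟨zb, hzb, hzb2⟩ := ihd (mdeg b) (by omega) _ b hbT rfl rfl
    obtain ⟨z, hz, hz2⟩ := ih (up 0 b) ((varSet_update hzero).2 hbT) (by rw [mdeg_up, hbd]) (by
      rw [up_of_ne (Fin.succ_ne_zero m), hb, Function.update_self]; omega)
    refine ⟨Pi.single (Sum.inl b) 1 - ((b m.succ : ℤ) - b 0) • zb + z,
      add_mem (sub_mem (single_mem_intSpan hbT) (zsmul_mem hzb _)) hz, ?_⟩
    have h1 : divMap (oneSeq p) m (Pi.single (Sum.inl b) 1) = Dmod (oneSeq p) m (Pi.single b 1) := by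
      have h1 : (fun c : Mon n => (Pi.single (Sum.inl b) 1 : Mon n ⊕ Mon n → PadicAlgCl p)
          (Sum.inl c)) = Pi.single b 1 := by funext c; simp [Pi.single_apply]
      have h2 : (fun c : Mon n => (Pi.single (Sum.inl b) 1 : Mon n ⊕ Mon n → PadicAlgCl p)
          (Sum.inr c)) = 0 := by funext c; exact Pi.single_eq_of_ne (by simp) _
      rw [divMap_apply, h1, h2, add_zero]
    rw [map_add, map_sub, map_zsmul, h1, Dmod_oneSeq_single, hup, hzb2, hz2]
    abel

/-- Division with remainder by `D_m`. -/
lemma exists_div (hL : IsComplete (L : Set (PadicAlgCl p))) (hh : DworkSeq L h)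
    {T : Finset (Fin n)} {m : Fin n} (hm : m ∈ T) {C : ℝ} (hC : 0 < C)
    {x : Mon n → PadicAlgCl p} (hx : Ball L (varSet T) (fun a => (1 : ℝ) ^ mdeg a) C x) :
    ∃ q f : Mon n → PadicAlgCl p, Ball L (varSet T) (fun a => (1 : ℝ) ^ mdeg a) C q ∧
      Ball L (varSet (T.erase m)) (fun a => (1 : ℝ) ^ mdeg a) C f ∧ Dmod h m q + f = x := by
  have hp0 : (0 : ℝ) < p := by exact_mod_cast hp.1.pos
  have hsucc : ∀ l ∉ T, l.succ ≠ m.succ := fun l hl h =>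
    hl (by rw [Fin.succ_injective n h]; exact hm)
  have hzero : ∀ l ∉ T, l.succ ≠ (0 : Fin (n + 1)) := fun l _ => Fin.succ_ne_zero l
  -- The leading part of the division is exact over `ℤ`; the rest is a small perturbation.
  have hR : ∀ a : Mon n, ∃ z, a ∈ varSet T → z ∈ intSpan p (divSet T m) ∧
      divMap (oneSeq p) m z = Pi.single a 1 := by
    intro a
    by_cases ha : a ∈ varSet T
    · obtain ⟨z, hz⟩ := exists_divMap_oneSeq (p := p) hm (mdeg a) _ a ha rfl rfl
      exact ⟨z, fun _ => hz⟩
    · exact ⟨0, fun h => absurd h ha⟩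
  choose R hR using hR
  have hcont : Continuous (divMap h m) :=
    ((continuous_Dmod h m).comp
      (show Continuous fun z : Mon n ⊕ Mon n → PadicAlgCl p => fun b => z (Sum.inl b) by fun_prop)).add
      (show Continuous fun z : Mon n ⊕ Mon n → PadicAlgCl p => fun b => z (Sum.inr b) by fun_prop)
  have hRb : ∀ a ∈ varSet T, Ball L (divSet T m) (fun _ => (1 : ℝ)) ((1 : ℝ) ^ mdeg a) (R a) :=
    fun a ha => ball_of_mem_intSpan (by positivity) (fun i => zero_le_one) (fun i _ => by simp)
      (hR a ha).1
  have hX : ∀ C : ℝ, 0 < C → ∀ y, Ball L (divSet T m) (fun _ => (1 : ℝ)) C y →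
      Ball L (varSet T) (fun a => (1 : ℝ) ^ mdeg a) (1 / p * C)
        (divMap h m y - divMap (oneSeq p) m y) := by
    intro C hC y hy
    rw [divMap_apply, divMap_apply, add_sub_add_right_eq_sub]
    have hy' : Ball L (varSet T) (fun b : Mon n => (1 : ℝ) ^ (mdeg b + 1)) C
        (fun b => y (Sum.inl b)) := by
      have := hy.comp_injective (f := Sum.inl) Sum.inl_injective
      simpa [divSet] using this
    exact ball_Dmod_sub hh le_rfl one_lt_prime hC
      (fun a ha k _ h' => ha ((varSet_update hsucc).1 h'))
      (fun a ha k _ h' => ha ((varSet_update hzero).1 h')) hy'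
  obtain ⟨z, hz, hzx⟩ := solve_of_perturbation hL (fun i => one_pos) (fun a => by positivity) _
    (divMap (oneSeq p) m) hcont (by positivity) ((div_lt_one hp0).2 one_lt_prime) R hRb
    (fun a ha => (hR a ha).2) hX hC hx
  refine ⟨fun b => z (Sum.inl b), fun b => z (Sum.inr b), ?_, ?_, hzx⟩
  · have := hz.comp_injective (f := Sum.inl) Sum.inl_injective
    simpa [divSet] using this
  · have := hz.comp_injective (f := Sum.inr) Sum.inr_injective
    simp only [one_pow]
    refine this.mono_set fun a ha l hl => ?_
    by_cases hlm : l = m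
    · rw [hlm]; exact ha.2
    · exact ha.1 l fun h => hl (Finset.mem_erase.2 ⟨hlm, h⟩)

lemma Dmod_eq_zero_of_support {m l : Fin n} (hlm : l ≠ m) {x : Mon n → PadicAlgCl p}
    (hx : ∀ a : Mon n, a m.succ ≠ 0 → x a = 0) {a : Mon n} (ha : a m.succ ≠ 0) :
    Dmod h l x a = 0 := by
  have hne : m.succ ≠ l.succ := fun h => hlm (Fin.succ_injective n h).symm
  rw [Dmod_apply, hx a ha, mul_zero, mulVar_apply, mulVar_apply, Finset.sum_eq_zero,
    Finset.sum_eq_zero]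
  · simp
  · intro k _
    rw [hx _ (by rwa [Function.update_of_ne (Fin.succ_ne_zero m)]), mul_zero]
  · intro k _
    rw [hx _ (by rwa [Function.update_of_ne hne]), mul_zero]

/-- A series in `Y_0` alone is not in the sum of the images of the `D_l`, unless it is zero. -/
theorem hub_unique (hL : IsComplete (L : Set (PadicAlgCl p))) (hh : DworkSeq L h)
    {C : ℝ} (hC : 0 < C) {f : Mon n → PadicAlgCl p} (hf : ∀ a ∉ varSet (∅ : Finset (Fin n)), f a = 0)
    (T : Finset (Fin n)) : ∀ q : Fin n → Mon n → PadicAlgCl p,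
      (∀ l ∈ T, Ball L (varSet T) (fun a => (1 : ℝ) ^ mdeg a) C (q l)) →
      ∑ l ∈ T, Dmod h l (q l) + f = 0 → f = 0 := by
  induction T using Finset.induction_on with
  | empty => intro q _ h; simpa using h
  | insert m T hm ih =>
    intro q hq hsum
    have hmT : m ∈ insert m T := Finset.mem_insert_self m T
    have hzero : ∀ l ∉ insert m T, l.succ ≠ (0 : Fin (n + 1)) := fun l _ => Fin.succ_ne_zero l
    have hsucc : ∀ j ∈ insert m T, ∀ l ∉ insert m T, l.succ ≠ j.succ := fun j hj l hl h =>
      hl (by rw [Fin.succ_injective n h]; exact hj)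
    -- Divide the `q l` by `D_m`, `q_l = D_m u_l + r_l`. As the operators commute, the relation becomes
    -- `D_m U + ∑_{l ∈ T} D_l r_l + f = 0`, where only the first term may involve `Y_m`, so that it
    -- vanishes.
    have hdiv : ∀ l, ∃ u r : Mon n → PadicAlgCl p, l ∈ T →
        Ball L (varSet (insert m T)) (fun a => (1 : ℝ) ^ mdeg a) C u ∧
        Ball L (varSet T) (fun a => (1 : ℝ) ^ mdeg a) C r ∧ Dmod h m u + r = q l := by
      intro l
      by_cases hl : l ∈ T
      · obtain ⟨u, r, hu, hr, he⟩ := exists_div hL hh hmT hC (hq l (Finset.mem_insert_of_mem hl))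
        rw [Finset.erase_insert hm] at hr
        exact ⟨u, r, fun _ => ⟨hu, hr, he⟩⟩
      · exact ⟨0, 0, fun h => absurd h hl⟩
    choose u r hur using hdiv
    refine ih r (fun l hl => (hur l hl).2.1) ?_
    have hU : Ball L (varSet (insert m T)) (fun a => (1 : ℝ) ^ mdeg a) C
        (q m + ∑ l ∈ T, Dmod h l (u l)) := by
      refine Ball.add (fun a => by positivity) (hq m hmT)
        (Ball.sum (fun a => by positivity) hC.le _ fun l hl => ?_)
      exact ball_Dmod hh hC
        (fun a ha k _ h' => ha ((varSet_update (hsucc l (Finset.mem_insert_of_mem hl))).1 h'))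
        (fun a ha k _ h' => ha ((varSet_update hzero).1 h')) (hur l hl).1
    refine div_unique (m := m) hh hC (hU.mono_set (Set.subset_univ _)) (fun a ha => ?_) ?_
    · rw [Pi.add_apply, Finset.sum_apply, hf a, add_zero]
      · refine Finset.sum_eq_zero fun l hl => ?_
        refine Dmod_eq_zero_of_support (m := m) (fun h => hm (h ▸ hl)) (fun a ha => ?_) ha
        exact (hur l hl).2.1.2.1 a fun h => ha (h m hm)
      · intro h
        exact ha (h m (Finset.notMem_empty m))
    · rw [← hsum, Finset.sum_insert hm, map_add, map_sum]
      rw [Finset.sum_congr rfl fun l hl => (by rw [← (hur l hl).2.2, map_add, Dmod_comm] :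
        Dmod h l (q l) = Dmod h m (Dmod h l (u l)) + Dmod h l (r l)), Finset.sum_add_distrib]
      abel

/-- The monomials `Y^{ε d}`, `d ≥ 0`, are independent modulo the images of the `D_l`. -/
theorem hnMap_unique (hL : IsComplete (L : Set (PadicAlgCl p))) (hh : DworkSeq L h)
    {ε : ℕ → Mon n} (hε : ∀ d, mdeg (ε d) = d) {C : ℝ} (hC : 0 < C)
    {q : Fin n → Mon n → PadicAlgCl p}
    (hq : ∀ l, Ball L Set.univ (fun a => (1 : ℝ) ^ mdeg a) C (q l)) {v : ℕ → PadicAlgCl p}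
    (hv : Ball L Set.univ (fun d => (1 : ℝ) ^ d) C v)
    (hqv : ∑ l, Dmod h l (q l) + embSeq p ε v = 0) : v = 0 := by
  have hp0 : (0 : ℝ) < p := by exact_mod_cast hp.1.pos
  have hδ1 : (p : ℝ)⁻¹ < 1 := inv_lt_one_of_one_lt₀ one_lt_prime
  set C₀ := C
  have hC₀ : 0 < C₀ := hC
  refine eq_zero_of_contract (δ := (p : ℝ)⁻¹) (fun i => by positivity) hC (inv_pos.2 hp0) hδ1 hv
    fun C hC hv => ?_
  have hδ : 0 < (p : ℝ)⁻¹ * C := by positivity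
  obtain ⟨F, hF, -, hsm⟩ := hv.truncate hδ
  by_contra! hcon
  obtain ⟨d₀, hd₀⟩ := hcon
  have hFne : F.Nonempty := ⟨d₀, (hF d₀).2 hd₀⟩
  set d := F.max' hFne with hd
  have hdF : d ∈ F := Finset.max'_mem F hFne
  -- Compare the monomials `Y^{ε e}` with the powers of `Y_0`.
  have hz : ∀ e, ∃ z, Ball L Set.univ (fun i => (1 : ℝ) ^ hnDeg i) 1 z ∧
      hnMap h (hub n) z = Pi.single (ε e) 1 ∧ (∀ c, e < c → ‖z (Sum.inr c)‖ ≤ (p : ℝ)⁻¹) ∧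
      ‖z (Sum.inr e) - 1‖ ≤ (p : ℝ)⁻¹ := by
    intro e
    obtain ⟨z₁, hz₁, h1, h2⟩ := exists_hnMap_oneSeq (p := p) (ε := hub n) mdeg_hub e (ε e) (hε e)
    have hb₁ : Ball L Set.univ (fun i => (1 : ℝ) ^ hnDeg i) 1 z₁ :=
      (ball_of_mem_intSpan zero_le_one (fun i => by positivity) (fun i _ => by simp) hz₁).mono_set
        (Set.subset_univ _)
    have hb := (ball_hnMap_sub hh le_rfl one_lt_prime one_pos (hub n) hb₁).neg
    rw [one_div, mul_one] at hb
    obtain ⟨z₂, hz₂, h3⟩ := exists_hnMap_eq hL hh (ε := hub n) mdeg_hub le_rfl one_lt_prime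
      (inv_pos.2 hp0) hb
    have hs : ∀ i, ‖z₂ i‖ ≤ (p : ℝ)⁻¹ := fun i => by simpa using hz₂.2.2.1 i
    refine ⟨z₁ + z₂, Ball.add (fun i => by positivity) hb₁ (hz₂.mono hδ1.le), ?_, fun c hc => ?_, ?_⟩
    · rw [map_add, h3, h2]; abel
    · rw [Pi.add_apply, apply_eq_zero_of_mem_intSpan hz₁ (by simp [hnDeg, hc]), zero_add]
      exact hs _
    · rw [Pi.add_apply, h1, add_sub_cancel_left]
      exact hs _
  choose z hzb hz1 hz2 hz3 using hz
  obtain ⟨y, hy, hy1⟩ := exists_hnMap_eq hL hh (ε := hub n) mdeg_hub le_rfl one_lt_prime hδ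
    (ball_embSeq (ε := ε) hδ.le hsm)
  have hZ : hnMap h (hub n) (∑ e ∈ F, v e • z e + y) = embSeq p ε v := by
    have hve : v = ∑ e ∈ F, v e • Pi.single e 1 + fun i => if i ∈ F then 0 else v i := by
      funext i
      rw [Pi.add_apply, Finset.sum_apply]
      simp only [Pi.smul_apply, Pi.single_apply, smul_eq_mul, mul_ite, mul_one, mul_zero,
        Finset.sum_ite_eq]
      split_ifs <;> simp
    conv_rhs => rw [hve, map_add, map_sum]
    rw [map_add, map_sum]
    congr 1
    · refine Finset.sum_congr rfl fun e _ => ?_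
      rw [map_smul, map_smul, hz1, embSeq_single hε]
    · rw [hy1]; congr 1; funext i; congr
  set Z := ∑ e ∈ F, v e • z e + y with hZdef
  have hZb : Ball L Set.univ (fun i => (1 : ℝ) ^ hnDeg i) C Z := by
    refine Ball.add (fun i => by positivity) (Ball.sum (fun i => by positivity) hC.le _ fun e _ => ?_)
      (hy.mono (mul_le_of_le_one_left hC.le hδ1.le))
    refine ((hzb e).smul (hv.1 e)).mono ?_
    simpa using hv.2.2.1 e
  have hrel : ∑ l, Dmod h l (q l + fun b => Z (Sum.inl (l, b))) +
      embSeq p (hub n) (fun d => Z (Sum.inr d)) = 0 := by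
    rw [← hqv, ← hZ, hnMap_apply]
    simp only [map_add, Finset.sum_add_distrib]
    abel
  have hvan : embSeq p (hub n) (fun d => Z (Sum.inr d)) = 0 := by
    refine hub_unique hL hh (C := max C₀ C) (lt_max_of_lt_left hC₀) (fun a ha => ?_) Finset.univ _
      (fun l _ => ?_) hrel
    · rw [embSeq_apply, if_neg]
      intro h'
      refine ha fun l _ => ?_
      rw [h', hub, Pi.single_eq_of_ne (Fin.succ_ne_zero l)]
    · have huniv : varSet (Finset.univ : Finset (Fin n)) = Set.univ :=
        Set.eq_univ_of_forall fun a l hl => absurd (Finset.mem_univ l) hl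
      rw [huniv]
      refine Ball.add (fun i => by positivity) ((hq l).mono (le_max_left _ _))
        (Ball.mono ?_ (le_max_right _ _))
      simpa using ball_inl hZb l
  have hZd : Z (Sum.inr d) = 0 := by
    have := congrFun hvan (hub n d)
    rwa [embSeq_apply, mdeg_hub, if_pos rfl] at this
  have hvd : v d = -(∑ e ∈ F.erase d, v e * z e (Sum.inr d)) - v d * (z d (Sum.inr d) - 1) -
      y (Sum.inr d) := by
    rw [hZdef, Pi.add_apply, Finset.sum_apply, ← Finset.add_sum_erase F _ hdF] at hZd
    simp only [Pi.smul_apply, smul_eq_mul] at hZd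
    linear_combination hZd
  have hvC : ∀ e, ‖v e‖ ≤ C := fun e => by simpa using hv.2.2.1 e
  have hmul : ∀ x w : PadicAlgCl p, ‖x‖ ≤ C → ‖w‖ ≤ (p : ℝ)⁻¹ → ‖x * w‖ ≤ (p : ℝ)⁻¹ * C := by
    intro x w hx hw
    rw [norm_mul, mul_comm]
    exact mul_le_mul hw hx (norm_nonneg _) (inv_pos.2 hp0).le
  have hle : ‖v d‖ ≤ (p : ℝ)⁻¹ * C := by
    rw [hvd]
    refine (norm_sub_le_max' _ _).trans (max_le ((norm_sub_le_max' _ _).trans (max_le ?_ ?_)) ?_)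
    · rw [norm_neg]
      refine IsUltrametricDist.norm_sum_le_of_forall_le_of_nonneg hδ.le fun e he => ?_
      have he' := Finset.mem_erase.1 he
      exact hmul _ _ (hvC e) (hz2 e d (lt_of_le_of_ne (Finset.le_max' F e he'.2) he'.1))
    · exact hmul _ _ (hvC d) (hz3 d)
    · simpa using hy.2.2.1 (Sum.inr d)
  have := (hF d).1 hdF
  rw [one_pow, mul_one] at this
  exact absurd hle (not_le.2 this)

end Cokernel

/-! ### Coordinates on the spaces `𝒞_{p^r}` -/

section Coordinates

variable {p a n : ℕ} [hp : Fact p.Prime] {g : PadicAlgCl p}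

lemma mfun_le_iff {u : Fin n → ℤ} {k : ℕ} : mfun u ≤ k ↔ ∀ l, -(k : ℤ) ≤ u l := by
  unfold mfun
  rw [Finset.sup_le_iff]
  exact ⟨fun h l => by have := h l (Finset.mem_univ l); omega, fun h l _ => by have := h l; omega⟩

lemma le_mfun (u : Fin n → ℤ) (l : Fin n) : -(mfun u : ℤ) ≤ u l := mfun_le_iff.1 le_rfl l

lemma mfun_add_le (u v : Fin n → ℤ) : mfun (u + v) ≤ mfun u + mfun v := by
  rw [mfun_le_iff]
  intro l
  have := le_mfun u l
  have := le_mfun v l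
  rw [Pi.add_apply]
  push_cast
  omega

/-- The exponent of `x` in the monomial `Y^b`, where `Y_0 = γ t/(x_1 ⋯ x_n)`, `Y_l = γ x_l`. -/
def mpos (b : Mon n) : Fin n → ℤ := fun l => (b l.succ : ℤ) - b 0

/-- The exponent `b` for which `t^N x^u` is a scalar multiple of `t^i Y(t^{p^r})^b`, where
`i = N % p^r`. -/
def midx (p r : ℕ) (u : Fin n → ℤ) (N : ℕ) : Mon n :=
  Fin.cons (N / p ^ r) fun l => (u l + (N / p ^ r : ℕ)).toNat

lemma midx_zero (r : ℕ) (u : Fin n → ℤ) (N : ℕ) : midx p r u N 0 = N / p ^ r := rfl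

lemma midx_succ (r : ℕ) (u : Fin n → ℤ) (N : ℕ) (l : Fin n) :
    midx p r u N l.succ = (u l + (N / p ^ r : ℕ)).toNat := rfl

lemma mul_mfun_le_iff {r N : ℕ} {u : Fin n → ℤ} : p ^ r * mfun u ≤ N ↔ mfun u ≤ N / p ^ r := by
  rw [Nat.le_div_iff_mul_le (pow_pos hp.1.pos r), mul_comm]

lemma mpos_midx {r N : ℕ} {u : Fin n → ℤ} (h : p ^ r * mfun u ≤ N) : mpos (midx p r u N) = u := by
  rw [mul_mfun_le_iff, mfun_le_iff] at h
  funext l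
  have := h l
  rw [mpos, midx_zero, midx_succ]
  omega

lemma midx_mpos {r i : ℕ} (hi : i < p ^ r) (b : Mon n) :
    midx p r (mpos b) (p ^ r * b 0 + i) = b := by
  have h : (p ^ r * b 0 + i) / p ^ r = b 0 := by
    rw [Nat.mul_add_div (pow_pos hp.1.pos r), Nat.div_eq_of_lt hi, add_zero]
  funext l
  refine Fin.cases ?_ (fun l => ?_) l
  · rw [midx_zero, h]
  · rw [midx_succ, h, mpos]
    omega

lemma mfun_mpos_le {r i : ℕ} (b : Mon n) : p ^ r * mfun (mpos b) ≤ p ^ r * b 0 + i := by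
  refine le_trans (Nat.mul_le_mul_left _ ?_) (Nat.le_add_right _ _)
  rw [mfun_le_iff]
  intro l
  rw [mpos]
  omega

/-- The factor `γ^{|b|} γ^{i(n+1)/p^r}` that normalises the monomial `t^i Y(t^{p^r})^b`. -/
def wfac (p a n r : ℕ) [Fact p.Prime] (g : PadicAlgCl p) (i : ℕ) (b : Mon n) : PadicAlgCl p :=
  g ^ (p ^ a * mdeg b + p ^ (a - r) * ((n + 1) * i))

lemma wfac_ne_zero (hg : g ≠ 0) (r i : ℕ) (b : Mon n) : wfac p a n r g i b ≠ 0 := pow_ne_zero _ hg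

lemma wfac_mem (r i : ℕ) (b : Mon n) : wfac p a n r g i b ∈ Lq p a g := pow_mem g_mem_Lq _

/-- The scaling in the definition of `𝒞_{p^r}` is that of the normalised monomials. -/
lemma wfac_eq {r : ℕ} (hr : r ≤ a) (hg : g ≠ 0) {N : ℕ} {u : Fin n → ℤ}
    (h : p ^ r * mfun u ≤ N) :
    gpow p a n r g (N - p ^ r * mfun u) * gam p a g ^ wfun u =
      wfac p a n r g (N % p ^ r) (midx p r u N) := by
  have h' := mul_mfun_le_iff.1 h
  obtain ⟨k, hk⟩ := Nat.exists_eq_add_of_le h'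
  have hN : N - p ^ r * mfun u = p ^ r * k + N % p ^ r := by
    have := Nat.div_add_mod N (p ^ r)
    rw [hk, mul_add] at this
    omega
  have hdeg : (mdeg (midx p r u N) : ℤ) = wfun u + (n + 1) * k := by
    unfold mdeg wfun
    rw [Fin.sum_univ_succ, midx_zero]
    push_cast
    have : ∀ l : Fin n, ((midx p r u N l.succ : ℕ) : ℤ) = u l + (mfun u + k) := fun l => by
      rw [midx_succ]
      have := (mfun_le_iff.1 h') l
      omega
    simp only [this, Finset.sum_add_distrib, Finset.sum_const, Finset.card_univ, Fintype.card_fin]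
    have hk' : ((N : ℤ) / (p : ℤ) ^ r) = mfun u + k := by exact_mod_cast hk
    rw [hk']
    simp only [nsmul_eq_mul]
    ring
  have hγ : gam p a g ≠ 0 := pow_ne_zero _ hg
  have hpa : p ^ a = p ^ (a - r) * p ^ r := by rw [← pow_add, Nat.sub_add_cancel hr]
  have e1 : gam p a g ^ wfun u * gam p a g ^ ((n + 1) * k) = gam p a g ^ mdeg (midx p r u N) := by
    rw [← zpow_natCast, ← zpow_natCast, hdeg, ← zpow_add₀ hγ]
    push_cast
    rfl
  rw [hN, gpow, wfac, mul_add, mul_add, pow_add, pow_add, pow_mul g (p ^ a), ← gam, ← e1]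
  have e2 : g ^ (p ^ (a - r) * ((n + 1) * (p ^ r * k))) = gam p a g ^ ((n + 1) * k) := by
    rw [gam, ← pow_mul, hpa]
    ring_nf
  rw [e2]
  ring

/-- The coefficient of the normalised monomial `t^i Y(t^{p^r})^b`. -/
def cf (p a n r : ℕ) [Fact p.Prime] (g : PadicAlgCl p) (f : Ser p n) (i : ℕ) (b : Mon n) :
    PadicAlgCl p :=
  PowerSeries.coeff (p ^ r * b 0 + i) (f (mpos b)) / wfac p a n r g i b

/-- The series supported in the monomials `t^N x^u` with `N ≥ p^r m(u)`. -/
def Supp (r : ℕ) (f : Ser p n) : Prop :=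
  ∀ u N, N < p ^ r * mfun u → PowerSeries.coeff N (f u) = 0

lemma Supp.zero_of {r : ℕ} {f : Ser p n} (hf : Supp r f) : Supp 0 f := fun u N hN => by
  refine hf u N (lt_of_lt_of_le hN ?_)
  rw [pow_zero, one_mul]
  exact Nat.le_mul_of_pos_left _ (pow_pos hp.1.pos r)

lemma coeff_eq_cf (hg : g ≠ 0) (r : ℕ) (f : Ser p n) {u : Fin n → ℤ} {N : ℕ}
    (h : p ^ r * mfun u ≤ N) : PowerSeries.coeff N (f u) =
      cf p a n r g f (N % p ^ r) (midx p r u N) * wfac p a n r g (N % p ^ r) (midx p r u N) := by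
  rw [cf, div_mul_cancel₀ _ (wfac_ne_zero hg _ _ _), mpos_midx h, midx_zero, Nat.div_add_mod]

lemma eq_of_cf_eq (hg : g ≠ 0) {r : ℕ} {f f' : Ser p n} (hf : Supp r f) (hf' : Supp r f')
    (h : ∀ i < p ^ r, cf p a n r g f i = cf p a n r g f' i) : f = f' := by
  funext u
  ext N
  rcases Nat.lt_or_ge N (p ^ r * mfun u) with hN | hN
  · rw [hf u N hN, hf' u N hN]
  · rw [coeff_eq_cf (a := a) hg r f hN, coeff_eq_cf (a := a) hg r f' hN,
      h _ (Nat.mod_lt _ (pow_pos hp.1.pos r))]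

lemma cf_add (r : ℕ) (f f' : Ser p n) (i : ℕ) :
    cf p a n r g (f + f') i = cf p a n r g f i + cf p a n r g f' i := by
  funext b
  simp [cf, add_div]

lemma cf_sum {κ : Type*} (r : ℕ) (F : Finset κ) (f : κ → Ser p n) (i : ℕ) :
    cf p a n r g (∑ k ∈ F, f k) i = ∑ k ∈ F, cf p a n r g (f k) i := by
  classical
  induction F using Finset.induction_on with
  | empty =>
    funext b
    simp [cf]
  | insert k F hk ih => rw [Finset.sum_insert hk, Finset.sum_insert hk, cf_add, ih]

lemma Supp.add {r : ℕ} {f f' : Ser p n} (hf : Supp r f) (hf' : Supp r f') : Supp r (f + f') :=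
  fun u N hN => by rw [Pi.add_apply, map_add, hf u N hN, hf' u N hN, add_zero]

lemma Supp.sum {κ : Type*} {r : ℕ} (F : Finset κ) {f : κ → Ser p n} (hf : ∀ k ∈ F, Supp r (f k)) :
    Supp r (∑ k ∈ F, f k) := fun u N hN => by
  rw [Finset.sum_apply, map_sum]
  exact Finset.sum_eq_zero fun k hk => hf k hk u N hN

lemma coeff_xser (r : ℕ) (c : (Fin n → ℤ) → ℕ → PadicAlgCl p) (u : Fin n → ℤ) (N : ℕ) :
    PowerSeries.coeff N (xser p a n r g c u) = if p ^ r * mfun u ≤ N then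
      c u (N - p ^ r * mfun u) * (gpow p a n r g (N - p ^ r * mfun u) * gam p a g ^ wfun u)
      else 0 := by
  rw [xser, ← mul_assoc, PowerSeries.coeff_mul_X_pow']
  split_ifs
  · rw [PowerSeries.coeff_mul_C, tser, PowerSeries.coeff_mk, mul_assoc]
  · rfl

lemma finite_wfun_lt (N : ℤ) : {u : Fin n → ℤ | wfun u < N}.Finite := by
  refine (Set.Finite.pi fun _ : Fin n => Set.finite_Icc (-|N|) |N|).subset fun u hu => ?_
  rw [Set.mem_ofPred_eq] at hu
  have hw : wfun u = ∑ l, (u l + mfun u) + mfun u := by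
    unfold wfun
    rw [Finset.sum_add_distrib]
    simp
    ring
  have h1 : ∀ l, 0 ≤ u l + mfun u := fun l => by have := le_mfun u l; omega
  have hsum : 0 ≤ ∑ l, (u l + mfun u) := Finset.sum_nonneg fun l _ => h1 l
  intro l _
  have h2 : u l + mfun u ≤ ∑ l, (u l + mfun u) :=
    Finset.single_le_sum (f := fun l => u l + (mfun u : ℤ)) (fun l _ => h1 l) (Finset.mem_univ l)
  have h3 := h1 l
  have h4 := le_abs_self N
  have h5 : (mfun u : ℤ) < N := by omega
  have h6 := le_mfun u l
  exact Set.mem_Icc.2 ⟨by linarith, by linarith⟩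

/-- Membership in `𝒞_{p^r}`, in terms of the coefficients of the normalised monomials. -/
lemma mem_Cr_iff (hg : g ≠ 0) {r : ℕ} (hr : r ≤ a) (f : Ser p n) : f ∈ Cr p a n r g ↔
    Supp r f ∧ Ball (Lq p a g) Set.univ (fun _ => 1) 1
      (fun x : Fin (p ^ r) × Mon n => cf p a n r g f x.1 x.2) := by
  have hpr := pow_pos hp.1.pos r
  constructor
  · rintro ⟨c, hc, hc0, hcu, rfl⟩
    -- The coordinates are a reindexing of the coefficients `c u s` by the bijection
    -- `(i, b) ↔ (u, s)`, `u = mpos b`, `s = p^r b_0 + i - p^r m(u)`.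
    have key : ∀ x : Fin (p ^ r) × Mon n, cf p a n r g (xser p a n r g c) x.1 x.2 =
        c (mpos x.2) (p ^ r * x.2 0 + x.1 - p ^ r * mfun (mpos x.2)) := by
      rintro ⟨i, b⟩
      have hle := mfun_mpos_le (p := p) (r := r) (i := i) b
      have hmod : (p ^ r * b 0 + i) % p ^ r = i := by
        rw [Nat.mul_add_mod, Nat.mod_eq_of_lt i.2]
      rw [cf, coeff_xser, if_pos hle, wfac_eq hr hg hle, midx_mpos i.2, hmod,
        mul_div_cancel_right₀ _ (wfac_ne_zero hg _ _ _)]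
    refine ⟨fun u N hN => by rw [coeff_xser, if_neg (not_le.2 hN)], fun x => ?_,
      fun x hx => absurd (Set.mem_univ x) hx, fun x => ?_, fun ε hε => ?_⟩
    · dsimp only
      rw [key]; exact (hc _ _).1
    · dsimp only
      rw [key, mul_one]; exact (hc _ _).2
    · obtain ⟨N, hN⟩ := hcu ε hε
      have hfin : {y : (Fin n → ℤ) × ℕ | ε < ‖c y.1 y.2‖}.Finite := by
        have h1 : ∀ u, {s : ℕ | ε < ‖c u s‖}.Finite := fun u => by
          have := (hc0 u)
          rw [← Nat.cofinite_eq_atTop, Metric.tendsto_nhds] at this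
          refine (this ε hε).subset fun s hs => ?_
          rw [Set.mem_ofPred_eq] at hs
          simp only [dist_zero_right, Set.mem_compl_iff, Set.mem_ofPred_eq, not_lt]
          exact hs.le
        refine ((finite_wfun_lt (n := n) N).biUnion fun u _ =>
          (h1 u).image (Prod.mk u)).subset fun y hy => ?_
        rw [Set.mem_ofPred_eq] at hy
        refine Set.mem_biUnion (x := y.1) ?_ ⟨y.2, hy, rfl⟩
        rw [Set.mem_ofPred_eq]
        by_contra! hcon
        exact absurd hy (not_lt.2 (hN _ hcon _))
      refine (hfin.preimage (f := fun x : Fin (p ^ r) × Mon n =>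
        (mpos x.2, p ^ r * x.2 0 + x.1 - p ^ r * mfun (mpos x.2))) ?_).subset fun x hx => ?_
      · rintro ⟨i, b⟩ - ⟨i', b'⟩ - h
        rw [Prod.mk.injEq] at h
        obtain ⟨h1, h2⟩ := h
        dsimp only at h1 h2
        have l1 := mfun_mpos_le (p := p) (r := r) (i := i) b
        have l2 := mfun_mpos_le (p := p) (r := r) (i := i') b'
        rw [h1] at h2 l1
        have h3 : p ^ r * b 0 + i = p ^ r * b' 0 + i' := by omega
        have h4 := midx_mpos (p := p) i.2 b
        rw [h1, h3, midx_mpos i'.2] at h4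
        subst h4
        have : (i : ℕ) = i' := by omega
        rw [Fin.ext this]
      · rw [Set.mem_ofPred_eq] at hx
        dsimp only at hx
        rw [key, mul_one] at hx
        exact hx
  · rintro ⟨hs, hb⟩
    let c : (Fin n → ℤ) → ℕ → PadicAlgCl p := fun u s =>
      cf p a n r g f ((s + p ^ r * mfun u) % p ^ r) (midx p r u (s + p ^ r * mfun u))
    have hB : ∀ u s, ∃ x : Fin (p ^ r) × Mon n, x =
        (⟨(s + p ^ r * mfun u) % p ^ r, Nat.mod_lt _ hpr⟩, midx p r u (s + p ^ r * mfun u)) :=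
      fun u s => ⟨_, rfl⟩
    have hfin : ∀ ε : ℝ, 0 < ε → {y : (Fin n → ℤ) × ℕ | ε < ‖c y.1 y.2‖}.Finite := by
      intro ε hε
      refine Set.Finite.subset ((hb.2.2.2 ε hε).preimage (f := fun y : (Fin n → ℤ) × ℕ =>
        ((⟨(y.2 + p ^ r * mfun y.1) % p ^ r, Nat.mod_lt _ hpr⟩,
          midx p r y.1 (y.2 + p ^ r * mfun y.1)) : Fin (p ^ r) × Mon n)) ?_) fun y hy => ?_
      · rintro ⟨u, s⟩ - ⟨u', s'⟩ - h
        rw [Prod.mk.injEq, Fin.mk.injEq] at h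
        obtain ⟨h1, h2⟩ := h
        dsimp only at h1 h2
        have h3 := mpos_midx (p := p) (r := r) (u := u) (N := s + p ^ r * mfun u) (by omega)
        rw [h2, mpos_midx (by omega)] at h3
        subst h3
        have h4 := congrFun h2 0
        rw [midx_zero, midx_zero] at h4
        have h5 := Nat.div_add_mod (s + p ^ r * mfun u') (p ^ r)
        have h6 := Nat.div_add_mod (s' + p ^ r * mfun u') (p ^ r)
        rw [h1, h4, h6] at h5
        have : s = s' := by omega
        rw [this]
      · rw [Set.mem_preimage, Set.mem_ofPred_eq, mul_one]
        exact hy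
    refine ⟨c, fun u s => ?_, fun u => ?_, fun ε hε => ?_, ?_⟩
    · obtain ⟨x, hx⟩ := hB u s
      have h1 := hb.1 x
      have h2 := hb.2.2.1 x
      rw [hx] at h1 h2
      exact ⟨h1, by rw [mul_one] at h2; exact h2⟩
    · rw [← Nat.cofinite_eq_atTop, Metric.tendsto_nhds]
      intro ε hε
      have h1 := (hfin (ε / 2) (half_pos hε)).preimage (f := fun s : ℕ => (u, s))
        (fun s _ s' _ h => by simpa using h)
      refine h1.subset fun s hs => ?_
      simp only [dist_zero_right, Set.mem_compl_iff, Set.mem_ofPred_eq, not_lt] at hs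
      rw [Set.mem_preimage, Set.mem_ofPred_eq]
      linarith
    · obtain ⟨N, hN⟩ := ((hfin ε hε).image fun y => wfun y.1).bddAbove
      refine ⟨N + 1, fun u hu s => ?_⟩
      by_contra! hcon
      have := hN ⟨(u, s), hcon, rfl⟩
      dsimp only at this
      omega
    · funext u
      ext N
      rw [coeff_xser]
      split_ifs with hN
      · rw [wfac_eq hr hg hN, coeff_eq_cf (a := a) hg r f hN]
        simp only [c, Nat.sub_add_cancel hN]
      · exact hs u N (not_le.1 hN)

/-- The series with given coefficients of the normalised monomials. -/
def ofModel (p a n r : ℕ) [Fact p.Prime] (g : PadicAlgCl p) (y : ℕ → Mon n → PadicAlgCl p) :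
    Ser p n := fun u => PowerSeries.mk fun N => if p ^ r * mfun u ≤ N then
      y (N % p ^ r) (midx p r u N) * wfac p a n r g (N % p ^ r) (midx p r u N) else 0

lemma supp_ofModel (r : ℕ) (y : ℕ → Mon n → PadicAlgCl p) : Supp r (ofModel p a n r g y) :=
  fun u N hN => by rw [ofModel, PowerSeries.coeff_mk, if_neg (not_le.2 hN)]

lemma cf_ofModel (hg : g ≠ 0) {r i : ℕ} (hi : i < p ^ r) (y : ℕ → Mon n → PadicAlgCl p) :
    cf p a n r g (ofModel p a n r g y) i = y i := by
  funext b
  have hmod : (p ^ r * b 0 + i) % p ^ r = i := by rw [Nat.mul_add_mod, Nat.mod_eq_of_lt hi]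
  rw [cf, ofModel, PowerSeries.coeff_mk, if_pos (mfun_mpos_le b), midx_mpos hi, hmod,
    mul_div_cancel_right₀ _ (wfac_ne_zero hg _ _ _)]

/-- A family of balls indexed by a finite type is a ball. -/
lemma ball_prod {L : IntermediateField ℚ_[p] (PadicAlgCl p)} {κ I : Type*} [Finite κ] {ω : I → ℝ}
    {C : ℝ} {x : κ → I → PadicAlgCl p} (hx : ∀ k, Ball L Set.univ ω C (x k)) :
    Ball L Set.univ (fun y : κ × I => ω y.2) C (fun y => x y.1 y.2) := by
  refine ⟨fun y => (hx y.1).1 y.2, fun y hy => absurd (Set.mem_univ y) hy,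
    fun y => (hx y.1).2.2.1 y.2, fun ε hε => ?_⟩
  refine (Set.finite_iUnion fun k => ((hx k).2.2.2 ε hε).image (Prod.mk k)).subset fun y hy => ?_
  exact Set.mem_iUnion.2 ⟨y.1, y.2, hy, rfl⟩

lemma ofModel_mem (hg : g ≠ 0) {r : ℕ} (hr : r ≤ a) {y : ℕ → Mon n → PadicAlgCl p}
    (hy : ∀ i < p ^ r, Ball (Lq p a g) Set.univ (fun _ => 1) 1 (y i)) :
    ofModel p a n r g y ∈ Cr p a n r g := by
  rw [mem_Cr_iff hg hr]
  refine ⟨supp_ofModel r y, ?_⟩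
  have := ball_prod (κ := Fin (p ^ r)) fun i => hy i i.2
  convert this using 2 with x
  rw [cf_ofModel hg x.1.2]

lemma ball_cf (hg : g ≠ 0) {r : ℕ} (hr : r ≤ a) {f : Ser p n} (hf : f ∈ Cr p a n r g) {i : ℕ}
    (hi : i < p ^ r) : Ball (Lq p a g) Set.univ (fun _ => 1) 1 (cf p a n r g f i) :=
  (((mem_Cr_iff hg hr f).1 hf).2.comp_injective (f := fun b : Mon n => ((⟨i, hi⟩ : Fin (p ^ r)), b))
    fun b c h => by simpa using h)

end Coordinates

/-! ### Multiplication of formal series -/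

section Product

variable {p a n : ℕ} [hp : Fact p.Prime] {g : PadicAlgCl p}

/-- The coefficients of the monomials `y^A`, where `y_0 = t/(x_1 ⋯ x_n)` and `y_l = x_l`. -/
def toMon (f : Ser p n) (A : Mon n) : PadicAlgCl p := PowerSeries.coeff (A 0) (f (mpos A))

/-- The product of two power series in `n + 1` variables, on coefficients. -/
def mconv (F G : Mon n → PadicAlgCl p) (A : Mon n) : PadicAlgCl p :=
  ∑ B ∈ Finset.Iic A, F B * G (A - B)

lemma supp_smulS {r : ℕ} {G f : Ser p n} (hG : Supp r G) (hf : Supp r f) : Supp r (smulS G f) := by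
  intro u N hN
  rw [smulS, PowerSeries.coeff_mk]
  refine finsum_eq_zero_of_forall_eq_zero fun v => ?_
  rw [PowerSeries.coeff_mul]
  refine Finset.sum_eq_zero fun x hx => ?_
  rw [Finset.HasAntidiagonal.mem_antidiagonal] at hx
  rcases Nat.lt_or_ge x.1 (p ^ r * mfun v) with h | h
  · rw [hG _ _ h, zero_mul]
  · rcases Nat.lt_or_ge x.2 (p ^ r * mfun (u - v)) with h' | h'
    · rw [hf _ _ h', mul_zero]
    · exfalso
      have h1 := mfun_add_le v (u - v)
      rw [add_sub_cancel] at h1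
      have h2 := Nat.mul_le_mul_left (p ^ r) h1
      rw [mul_add] at h2
      omega

lemma mpos_sub {A B : Mon n} (h : B ≤ A) : mpos (A - B) = mpos A - mpos B := by
  funext l
  have h0 : B 0 ≤ A 0 := h 0
  have h1 : B l.succ ≤ A l.succ := h l.succ
  simp only [mpos, Pi.sub_apply]
  omega

lemma mpos_inj {A B : Mon n} (h : mpos A = mpos B) (h0 : A 0 = B 0) : A = B := by
  funext l
  refine Fin.cases h0 (fun l => ?_) l
  have := congrFun h l
  simp only [mpos] at this
  omega

lemma coeff_eq_zero_of_lt {f : Ser p n} (hf : Supp 0 f) {u : Fin n → ℤ} {N : ℕ}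
    (h : N < mfun u) : PowerSeries.coeff N (f u) = 0 := hf u N (by simpa using h)

lemma exists_mon {u : Fin n → ℤ} {N : ℕ} (h : mfun u ≤ N) :
    ∃ A : Mon n, mpos A = u ∧ A 0 = N := by
  refine ⟨Fin.cons N fun l => (u l + N).toNat, funext fun l => ?_, rfl⟩
  have := mfun_le_iff.1 h l
  simp only [mpos, Fin.cons_succ, Fin.cons_zero]
  omega

lemma mfun_mpos (A : Mon n) : mfun (mpos A) ≤ A 0 :=
  mfun_le_iff.2 fun l => by rw [mpos]; omega

lemma toMon_smulS {G f : Ser p n} (hG : Supp 0 G) (hf : Supp 0 f) :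
    toMon (smulS G f) = mconv (toMon G) (toMon f) := by
  classical
  funext A
  -- The nonzero terms of the product come from the pairs of monomials `y^B`, `y^{A-B}`.
  set V := (Finset.Iic A).image mpos with hV
  have hmem : ∀ v, ∀ x ∈ Finset.HasAntidiagonal.antidiagonal (A 0),
      PowerSeries.coeff x.1 (G v) * PowerSeries.coeff x.2 (f (mpos A - v)) ≠ 0 →
      ∃ B ≤ A, mpos B = v ∧ B 0 = x.1 := by
    intro v x hx hne
    rw [Finset.HasAntidiagonal.mem_antidiagonal] at hx
    have h1 : mfun v ≤ x.1 := by
      by_contra! h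
      exact hne (by rw [coeff_eq_zero_of_lt hG h, zero_mul])
    have h2 : mfun (mpos A - v) ≤ x.2 := by
      by_contra! h
      exact hne (by rw [coeff_eq_zero_of_lt hf h, mul_zero])
    obtain ⟨B, hB, hB0⟩ := exists_mon h1
    refine ⟨B, fun l => ?_, hB, hB0⟩
    refine Fin.cases (show B 0 ≤ A 0 by omega) (fun l => ?_) l
    change B l.succ ≤ A l.succ
    have h3 := mfun_le_iff.1 h2 l
    rw [← hB, Pi.sub_apply, mpos, mpos] at h3
    omega
  rw [toMon, smulS, PowerSeries.coeff_mk]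
  simp only [PowerSeries.coeff_mul]
  rw [finsum_eq_sum_of_support_subset (s := V), Finset.sum_sigma', mconv]
  · symm
    refine Finset.sum_of_injOn (fun B => ⟨mpos B, (B 0, A 0 - B 0)⟩) ?_ ?_ ?_ ?_
    · intro B _ C _ h
      simp only [Sigma.mk.injEq, heq_eq_eq, Prod.mk.injEq] at h
      exact mpos_inj h.1 h.2.1
    · intro B hB
      rw [Finset.mem_coe, Finset.mem_Iic] at hB
      have h0 : B 0 ≤ A 0 := hB 0
      simp only [Finset.coe_sigma, Set.mem_sigma_iff, Finset.mem_coe, hV, Finset.mem_image,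
        Finset.mem_Iic, Finset.HasAntidiagonal.mem_antidiagonal]
      exact ⟨⟨B, hB, rfl⟩, by omega⟩
    · rintro ⟨v, x⟩ hx hnot
      rw [Finset.mem_sigma] at hx
      by_contra hne
      obtain ⟨B, hB, hBv, hB0⟩ := hmem v x hx.2 hne
      refine hnot ⟨B, by simpa using hB, ?_⟩
      have := Finset.HasAntidiagonal.mem_antidiagonal.1 hx.2
      simp only [hBv, hB0, Sigma.mk.injEq, heq_eq_eq, true_and]
      dsimp only at this
      exact Prod.ext rfl (by dsimp only; omega)
    · intro B hB
      rw [Finset.mem_Iic] at hB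
      dsimp only
      rw [toMon, toMon, mpos_sub hB, Pi.sub_apply]
  · intro v hv
    rw [Function.mem_support] at hv
    obtain ⟨x, hx, hne⟩ := Finset.exists_ne_zero_of_sum_ne_zero hv
    obtain ⟨B, hB, hBv, _⟩ := hmem v x hx hne
    rw [hV, Finset.coe_image]
    exact ⟨B, by simpa using hB, hBv⟩

/-! ### Multiplication by a power series in one monomial -/

open Classical in
/-- Multiplication by `∑ h_m y^{mz}`. -/
def mulMon (z : Mon n) (h : ℕ → PadicAlgCl p) (f : Mon n → PadicAlgCl p) (A : Mon n) :
    PadicAlgCl p :=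
  ∑ m ∈ Finset.range (mdeg A + 1), if m • z ≤ A then h m * f (A - m • z) else 0

/-- The power series `∑ h_m y^{mz}`. -/
def lineMon (z : Mon n) (h : ℕ → PadicAlgCl p) (A : Mon n) : PadicAlgCl p :=
  ∑ m ∈ Finset.range (mdeg A + 1), if A = m • z then h m else 0

lemma mdeg_mono {A B : Mon n} (h : A ≤ B) : mdeg A ≤ mdeg B :=
  Finset.sum_le_sum fun l _ => h l

lemma le_mdeg_nsmul {z : Mon n} (hz : z ≠ 0) (m : ℕ) : m ≤ mdeg (m • z) := by
  obtain ⟨l, hl⟩ := Function.ne_iff.1 hz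
  have h1 : (m • z) l ≤ mdeg (m • z) :=
    Finset.single_le_sum (f := m • z) (fun _ _ => Nat.zero_le _) (Finset.mem_univ l)
  rw [Pi.smul_apply, smul_eq_mul] at h1
  exact (Nat.le_mul_of_pos_right m (Nat.pos_of_ne_zero hl)).trans h1

lemma mem_range_of_nsmul_le {z : Mon n} (hz : z ≠ 0) {m : ℕ} {A B : Mon n} (h : m • z ≤ B)
    (hB : B ≤ A) : m ∈ Finset.range (mdeg A + 1) :=
  Finset.mem_range.2 (Nat.lt_succ_of_le ((le_mdeg_nsmul hz m).trans (mdeg_mono (h.trans hB))))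

open Classical in
/-- The sum that defines `mulMon` may be taken over any large enough set of indices. -/
lemma mulMon_eq_sum {z : Mon n} (hz : z ≠ 0) (h : ℕ → PadicAlgCl p) (f : Mon n → PadicAlgCl p)
    (A : Mon n) {S : Finset ℕ} (hS : ∀ m, m • z ≤ A → m ∈ S) :
    mulMon z h f A = ∑ m ∈ S, if m • z ≤ A then h m * f (A - m • z) else 0 := by
  classical
  rw [mulMon, ← Finset.sum_filter, ← Finset.sum_filter]
  congr 1
  ext m
  rw [Finset.mem_filter, Finset.mem_filter]
  exact ⟨fun hm => ⟨hS m hm.2, hm.2⟩, fun hm => ⟨mem_range_of_nsmul_le hz hm.2 le_rfl, hm.2⟩⟩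

lemma mconv_lineMon {z : Mon n} (hz : z ≠ 0) (h : ℕ → PadicAlgCl p) (f : Mon n → PadicAlgCl p) :
    mconv (lineMon z h) f = mulMon z h f := by
  classical
  funext A
  have h1 : ∀ B ∈ Finset.Iic A, lineMon z h B * f (A - B) =
      ∑ m ∈ Finset.range (mdeg A + 1), if B = m • z then h m * f (A - B) else 0 := by
    intro B hB
    rw [Finset.mem_Iic] at hB
    rw [lineMon, Finset.sum_mul]
    simp only [ite_mul, zero_mul]
    refine Finset.sum_subset (Finset.range_mono (Nat.succ_le_succ (mdeg_mono hB))) fun m _ hm => ?_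
    rw [if_neg]
    rintro rfl
    exact hm (mem_range_of_nsmul_le hz le_rfl le_rfl)
  rw [mconv, Finset.sum_congr rfl h1, Finset.sum_comm, mulMon]
  refine Finset.sum_congr rfl fun m _ => ?_
  rw [Finset.sum_ite_eq' (Finset.Iic A) (m • z) fun B => h m * f (A - B)]
  simp only [Finset.mem_Iic]

lemma mconv_comm (F G : Mon n → PadicAlgCl p) : mconv F G = mconv G F := by
  funext A
  refine Finset.sum_nbij' (fun B => A - B) (fun B => A - B) ?_ ?_ ?_ ?_ ?_
  · intro B _
    rw [Finset.mem_Iic]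
    exact tsub_le_self
  · intro B _
    rw [Finset.mem_Iic]
    exact tsub_le_self
  · intro B hB
    exact tsub_tsub_cancel_of_le (Finset.mem_Iic.1 hB)
  · intro B hB
    exact tsub_tsub_cancel_of_le (Finset.mem_Iic.1 hB)
  · intro B hB
    rw [tsub_tsub_cancel_of_le (Finset.mem_Iic.1 hB), mul_comm]

lemma mconv_mulMon {z : Mon n} (hz : z ≠ 0) (h : ℕ → PadicAlgCl p) (F G : Mon n → PadicAlgCl p) :
    mconv F (mulMon z h G) = mulMon z h (mconv F G) := by
  classical
  funext A
  have h1 : ∀ B ∈ Finset.Iic A, F B * mulMon z h G (A - B) =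
      ∑ m ∈ (Finset.range (mdeg A + 1)).filter fun m => m • z ≤ A - B,
        F B * (h m * G (A - B - m • z)) := by
    intro B _
    rw [mulMon_eq_sum hz h G (A - B) (S := Finset.range (mdeg A + 1))
      (fun m hm => mem_range_of_nsmul_le hz hm tsub_le_self), Finset.mul_sum, Finset.sum_filter]
    exact Finset.sum_congr rfl fun m _ => by rw [mul_ite, mul_zero]
  rw [mconv, Finset.sum_congr rfl h1, mulMon, ← Finset.sum_filter, Finset.sum_comm'
    (t' := (Finset.range (mdeg A + 1)).filter fun m => m • z ≤ A)
    (s' := fun m => Finset.Iic (A - m • z))]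
  · refine Finset.sum_congr rfl fun m _ => ?_
    rw [mconv, Finset.mul_sum]
    refine Finset.sum_congr rfl fun B _ => ?_
    rw [tsub_right_comm]
    ring
  · intro B m
    simp only [Finset.mem_filter, Finset.mem_Iic]
    constructor
    · rintro ⟨hB, hm, hle⟩
      have hmA := hle.trans (tsub_le_self (a := A))
      exact ⟨(le_tsub_iff_le_tsub hmA hB).1 hle, hm, hmA⟩
    · rintro ⟨hB, hm, hle⟩
      have hBA := hB.trans tsub_le_self
      exact ⟨hBA, hm, (le_tsub_iff_le_tsub hle hBA).2 hB⟩

lemma mulMon_mconv {z : Mon n} (hz : z ≠ 0) (h : ℕ → PadicAlgCl p) (F G : Mon n → PadicAlgCl p) :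
    mconv (mulMon z h F) G = mulMon z h (mconv F G) := by
  rw [mconv_comm, mconv_mulMon hz, mconv_comm]

lemma mconv_add (F G G' : Mon n → PadicAlgCl p) :
    mconv F (G + G') = mconv F G + mconv F G' := by
  funext A
  simp [mconv, mul_add, Finset.sum_add_distrib]

lemma mconv_sub (F G G' : Mon n → PadicAlgCl p) :
    mconv F (G - G') = mconv F G - mconv F G' := by
  funext A
  simp [mconv, mul_sub, Finset.sum_sub_distrib]

lemma mconv_smul (F G : Mon n → PadicAlgCl p) (c : PadicAlgCl p) :
    mconv F (c • G) = c • mconv F G := by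
  funext A
  simp only [mconv, Pi.smul_apply, smul_eq_mul, Finset.mul_sum]
  exact Finset.sum_congr rfl fun _ _ => by ring

/-- The Leibniz rule for `y_l ∂/∂y_l`. -/
lemma euler_mconv (l : Fin (n + 1)) (F G : Mon n → PadicAlgCl p) :
    euler l (mconv F G) = mconv (euler l F) G + mconv F (euler l G) := by
  funext A
  rw [euler_apply, Pi.add_apply, mconv, mconv, mconv, Finset.mul_sum, ← Finset.sum_add_distrib]
  refine Finset.sum_congr rfl fun B hB => ?_
  have h : B l ≤ A l := Finset.mem_Iic.1 hB l
  rw [euler_apply, euler_apply, Pi.sub_apply, Nat.cast_sub h]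
  ring

end Product

/-! ### The differential operators in coordinates -/

section Operators

variable {p a n : ℕ} [hp : Fact p.Prime] {g : PadicAlgCl p}

/-- The exponent of a variable `y_l`. -/
abbrev evar (l : Fin (n + 1)) : Mon n := Pi.single l 1

/-- The exponent of `t^{p^r}/(x_1 ⋯ x_n)`. -/
def zvar (p n r : ℕ) : Mon n := Fin.cons (p ^ r) fun _ => p ^ r - 1

lemma evar_ne_zero (l : Fin (n + 1)) : evar l ≠ 0 := fun h => by
  have := congrFun h l
  simp at this

lemma zvar_ne_zero (r : ℕ) : zvar p n r ≠ 0 := fun h =>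
  (pow_pos hp.1.pos r).ne' (congrFun h 0)

lemma zvar_zero : zvar p n 0 = evar 0 := by
  funext l
  refine Fin.cases ?_ (fun l => ?_) l <;> simp [zvar]

lemma mpos_nsmul_evar (m : ℕ) (l : Fin n) :
    mpos (m • evar l.succ : Mon n) = Pi.single l (m : ℤ) := by
  funext j
  rcases eq_or_ne j l with rfl | h
  · simp [mpos]
  · simp [mpos, h]

lemma mpos_nsmul_zvar (m r : ℕ) : mpos (m • zvar p n r) = fun _ => -(m : ℤ) := by
  funext j
  have := pow_pos hp.1.pos r
  simp only [mpos, zvar, Pi.smul_apply, Fin.cons_succ, Fin.cons_zero, smul_eq_mul]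
  push_cast [Nat.cast_sub this]
  ring

/-- The coefficients of `h = ∑_i p^i γ_i T^{p^i}`. -/
def hs (p a : ℕ) [Fact p.Prime] (g : PadicAlgCl p) (m : ℕ) : PadicAlgCl p :=
  PowerSeries.coeff m (hSer p a g)

lemma nsmul_injective {z : Mon n} (hz : z ≠ 0) : Function.Injective fun m : ℕ => m • z := by
  obtain ⟨l, hl⟩ := Function.ne_iff.1 hz
  intro m m' h
  have := congrFun h l
  simp only [Pi.smul_apply, smul_eq_mul] at this
  exact Nat.eq_of_mul_eq_mul_right (Nat.pos_of_ne_zero hl) this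

lemma pow_injective_of_prime : Function.Injective fun i : ℕ => p ^ i :=
  Nat.pow_right_injective hp.1.two_le

lemma lineMon_hs {z : Mon n} (hz : z ≠ 0) (A : Mon n) : lineMon z (hs p a g) A =
    ∑ i ∈ Finset.range (mdeg A + 1), if A = p ^ i • z then
      (p : PadicAlgCl p) ^ i * gamSeq p a g i else 0 := by
  rw [lineMon]
  by_cases h : ∃ i, A = p ^ i • z
  · obtain ⟨i, rfl⟩ := h
    have hle := le_mdeg_nsmul hz (p ^ i)
    have hi := (Nat.lt_pow_self hp.1.one_lt (n := i)).le
    rw [Finset.sum_eq_single (p ^ i), Finset.sum_eq_single i, if_pos rfl, if_pos rfl, hs,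
      coeff_hSer_pow]
    · intro j _ hj
      rw [if_neg fun h => hj (pow_injective_of_prime (nsmul_injective hz h)).symm]
    · exact fun h => absurd (Finset.mem_range.2 (by omega)) h
    · intro j _ hj
      rw [if_neg fun h => hj (nsmul_injective hz h).symm]
    · exact fun h => absurd (Finset.mem_range.2 (by omega)) h
  · rw [Finset.sum_eq_zero, Finset.sum_eq_zero]
    · intro i _
      rw [if_neg fun h' => h ⟨i, h'⟩]
    · intro m _
      split_ifs with hm
      · exact coeff_hSer_of_ne fun i hi => h ⟨i, by rw [hm, hi]⟩
      · rfl

lemma coeff_Kser (N M s : ℕ) (u : Fin n → ℤ) : PowerSeries.coeff s (Kser p n N M u) =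
    (∑ j : Fin n, if u = Pi.single j (M : ℤ) ∧ s = 0 then (1 : PadicAlgCl p) else 0) +
      if u = (fun _ => -(M : ℤ)) ∧ s = N then 1 else 0 := by
  rw [Kser, Pi.add_apply, map_add, Finset.sum_apply, map_sum]
  congr 1
  · refine Finset.sum_congr rfl fun j _ => ?_
    rw [Pi.single_apply]
    by_cases h : u = Pi.single j (M : ℤ)
    · simp [h, PowerSeries.coeff_one]
    · simp [h]
  · rw [Pi.single_apply]
    by_cases h : u = fun _ => -(M : ℤ)
    · simp [h, PowerSeries.coeff_X_pow]
    · simp [h]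

lemma toMon_Hser (r : ℕ) (A : Mon n) : toMon (Hser p a n r g) A =
    ∑ i ∈ Finset.range (mdeg A + 1), gamSeq p a g i *
      ((∑ j : Fin n, if A = p ^ i • evar j.succ then 1 else 0) +
        if A = p ^ i • zvar p n r then 1 else 0) := by
  -- The monomials of `K(t^{p^{r+i}}, x^{p^i})` are the `p^i`-th powers of `x_1, …, x_n` and of
  -- `t^{p^r}/(x_1 ⋯ x_n)`.
  have key : ∀ i, PowerSeries.coeff (A 0) (Kser p n (p ^ (r + i)) (p ^ i) (mpos A)) =
      ((∑ j : Fin n, if A = p ^ i • evar j.succ then 1 else 0) +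
        if A = p ^ i • zvar p n r then 1 else 0 : PadicAlgCl p) := by
    intro i
    rw [coeff_Kser]
    congr 1
    · refine Finset.sum_congr rfl fun j _ => if_congr ?_ rfl rfl
      rw [← mpos_nsmul_evar]
      constructor
      · rintro ⟨h1, h2⟩
        exact mpos_inj h1 (by rw [h2]; simp)
      · intro h
        exact ⟨by rw [h], by rw [h]; simp⟩
    · refine if_congr ?_ rfl rfl
      rw [← mpos_nsmul_zvar (p := p) (p ^ i) r]
      have h0 : (p ^ i • zvar p n r) 0 = p ^ (r + i) := by
        simp only [zvar, Pi.smul_apply, Fin.cons_zero, smul_eq_mul]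
        ring
      constructor
      · rintro ⟨h1, h2⟩
        exact mpos_inj h1 (by rw [h2, h0])
      · intro h
        refine ⟨by rw [h], by rw [h, h0]⟩
  rw [toMon, Hser, PowerSeries.coeff_mk]
  simp only [key]
  refine finsum_eq_sum_of_support_subset _ fun i hi => ?_
  rw [Function.mem_support] at hi
  have hlt := Nat.lt_pow_self hp.1.one_lt (n := i)
  have hcase : ∃ z : Mon n, z ≠ 0 ∧ A = p ^ i • z := by
    by_contra! hcon
    refine hi ?_
    rw [Finset.sum_eq_zero fun j _ => if_neg (hcon _ (evar_ne_zero _)),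
      if_neg (hcon _ (zvar_ne_zero _)), add_zero, mul_zero]
  obtain ⟨z, hz, hA⟩ := hcase
  have := le_mdeg_nsmul hz (p ^ i)
  rw [← hA] at this
  simp only [Finset.coe_range, Set.mem_Iio]
  omega

lemma toMon_xD (l : Fin n) (f : Ser p n) (A : Mon n) :
    toMon (xD l f) A = ((A l.succ : PadicAlgCl p) - A 0) * toMon f A := by
  rw [toMon, xD, map_zsmul, zsmul_eq_mul, mpos, toMon]
  push_cast
  rfl

lemma toMon_tD (f : Ser p n) (A : Mon n) : toMon (tD f) A = (A 0 : PadicAlgCl p) * toMon f A := by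
  simp [toMon, tD]

lemma toMon_add (f f' : Ser p n) : toMon (f + f') = toMon f + toMon f' := by
  funext A
  simp [toMon]

lemma toMon_xD_Hser (r : ℕ) (l : Fin n) : toMon (xD l (Hser p a n r g)) =
    lineMon (evar l.succ) (hs p a g) - lineMon (zvar p n r) (hs p a g) := by
  funext A
  rw [toMon_xD, toMon_Hser, Pi.sub_apply, lineMon_hs (evar_ne_zero _), lineMon_hs (zvar_ne_zero r),
    Finset.mul_sum, ← Finset.sum_sub_distrib]
  refine Finset.sum_congr rfl fun i _ => ?_
  have h1 : ((A l.succ : PadicAlgCl p) - A 0) *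
      (∑ j : Fin n, if A = p ^ i • evar j.succ then 1 else 0) =
      if A = p ^ i • evar l.succ then (p : PadicAlgCl p) ^ i else 0 := by
    rw [Finset.mul_sum, Finset.sum_eq_single l]
    · split_ifs with h
      · rw [h]; simp
      · rw [mul_zero]
    · intro j _ hj
      split_ifs with h
      · rw [h, mul_one]
        simp [Pi.single_eq_of_ne (fun h' => hj (Fin.succ_injective n h').symm)]
      · rw [mul_zero]
    · exact fun h => absurd (Finset.mem_univ _) h
  have h2 : ((A l.succ : PadicAlgCl p) - A 0) * (if A = p ^ i • zvar p n r then 1 else 0) =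
      -if A = p ^ i • zvar p n r then (p : PadicAlgCl p) ^ i else 0 := by
    split_ifs with h
    · have h3 := congrFun (mpos_nsmul_zvar (p := p) (n := n) (p ^ i) r) l
      rw [← h, mpos] at h3
      have h4 : ((A l.succ : PadicAlgCl p) - A 0) = -(p : PadicAlgCl p) ^ i := by exact_mod_cast h3
      rw [h4, mul_one]
    · simp
  rw [mul_left_comm, mul_add, h1, h2]
  split_ifs <;> ring

lemma toMon_tD_Hser (r : ℕ) : toMon (tD (Hser p a n r g)) =
    ((p : PadicAlgCl p) ^ r) • lineMon (zvar p n r) (hs p a g) := by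
  funext A
  rw [toMon_tD, toMon_Hser, Pi.smul_apply, lineMon_hs (zvar_ne_zero r), smul_eq_mul,
    Finset.mul_sum, Finset.mul_sum]
  refine Finset.sum_congr rfl fun i _ => ?_
  have h1 : (A 0 : PadicAlgCl p) *
      (∑ j : Fin n, if A = p ^ i • evar j.succ then 1 else 0) = 0 := by
    rw [Finset.mul_sum]
    refine Finset.sum_eq_zero fun j _ => ?_
    split_ifs with h
    · rw [h]; simp
    · rw [mul_zero]
  have h2 : (A 0 : PadicAlgCl p) * (if A = p ^ i • zvar p n r then 1 else 0) =
      if A = p ^ i • zvar p n r then (p : PadicAlgCl p) ^ i * p ^ r else 0 := by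
    split_ifs with h
    · rw [h]; simp [zvar]
    · simp
  rw [mul_left_comm, mul_add, h1, h2]
  split_ifs <;> ring

lemma Supp.xD {r : ℕ} {f : Ser p n} (hf : Supp r f) (l : Fin n) : Supp r (xD l f) :=
  fun u N hN => by rw [HyperKloosterman.xD, map_zsmul, hf u N hN, smul_zero]

lemma Supp.tD {r : ℕ} {f : Ser p n} (hf : Supp r f) : Supp r (tD f) :=
  fun u N hN => by rw [HyperKloosterman.tD, PowerSeries.coeff_mk, hf u N hN, mul_zero]

lemma supp_Hser (r : ℕ) : Supp r (Hser p a n r g) := by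
  intro u N hN
  rw [Hser, PowerSeries.coeff_mk]
  refine finsum_eq_zero_of_forall_eq_zero fun i => ?_
  rw [coeff_Kser, Finset.sum_eq_zero, if_neg, add_zero, mul_zero]
  · rintro ⟨rfl, rfl⟩
    refine absurd hN (not_lt.2 ?_)
    rw [pow_add]
    refine Nat.mul_le_mul_left _ (mfun_le_iff.2 fun l => by push_cast; exact le_rfl)
  · intro j _
    rw [if_neg]
    rintro ⟨rfl, rfl⟩
    have h0 : mfun (Pi.single j ((p ^ i : ℕ) : ℤ) : Fin n → ℤ) ≤ 0 := mfun_le_iff.2 fun l => by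
      rcases eq_or_ne l j with rfl | h
      · rw [Pi.single_eq_same]; positivity
      · rw [Pi.single_eq_of_ne h]; simp
    rw [Nat.le_zero.1 h0, mul_zero] at hN
    exact absurd hN (lt_irrefl 0)

lemma Supp.dop {r : ℕ} {f : Ser p n} (hf : Supp r f) : Supp r (dop p a n r g f) :=
  hf.tD.add (supp_smulS (supp_Hser r).tD hf)

lemma Supp.dopX {r : ℕ} {f : Ser p n} (hf : Supp r f) (l : Fin n) :
    Supp r (Dop p a n r g l f) :=
  (hf.xD l).add (supp_smulS ((supp_Hser r).xD l) hf)

/-- Evaluation of `mulMon` if the shifts by more than `k` contribute nothing. -/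
lemma mulMon_eq_range {z : Mon n} (hz : z ≠ 0) (h : ℕ → PadicAlgCl p) (f : Mon n → PadicAlgCl p)
    (A : Mon n) {k : ℕ} (h1 : ∀ m ≤ k, m • z ≤ A) (h2 : ∀ m, k < m → m • z ≤ A → f (A - m • z) = 0) :
    mulMon z h f A = ∑ m ∈ Finset.range (k + 1), h m * f (A - m • z) := by
  classical
  have hsub : Finset.range (k + 1) ⊆ Finset.range (mdeg A + 1) := fun m hm =>
    mem_range_of_nsmul_le hz (h1 m (Nat.lt_succ_iff.1 (Finset.mem_range.1 hm))) le_rfl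
  rw [mulMon, ← Finset.sum_subset hsub]
  · refine Finset.sum_congr rfl fun m hm => ?_
    rw [if_pos (h1 m (Nat.lt_succ_iff.1 (Finset.mem_range.1 hm)))]
  · intro m _ hm
    split_ifs with hle
    · rw [h2 m (by simpa using hm) hle, mul_zero]
    · rfl

/-- The exponent `A` for which `y^A` is a multiple of `t^i Y(t^{p^r})^b`. -/
def ridx (p r i : ℕ) (b : Mon n) : Mon n :=
  Fin.cons (p ^ r * b 0 + i) fun l => p ^ r * b 0 + i + b l.succ - b 0

lemma le_pow_mul (r b : ℕ) : b ≤ p ^ r * b := Nat.le_mul_of_pos_left _ (pow_pos hp.1.pos r)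

lemma mpos_ridx (r i : ℕ) (b : Mon n) : mpos (ridx p r i b) = mpos b := by
  funext l
  have := le_pow_mul (p := p) r (b 0)
  simp only [mpos, ridx, Fin.cons_zero, Fin.cons_succ]
  omega

lemma toMon_ridx (hg : g ≠ 0) (r i : ℕ) (f : Ser p n) (b : Mon n) :
    toMon f (ridx p r i b) = cf p a n r g f i b * wfac p a n r g i b := by
  rw [toMon, mpos_ridx, cf, div_mul_cancel₀ _ (wfac_ne_zero hg _ _ _)]
  rfl

/-- The normalised coefficients of `h`. -/
def hnorm (p a : ℕ) [Fact p.Prime] (g : PadicAlgCl p) (m : ℕ) : PadicAlgCl p :=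
  hs p a g m / gam p a g ^ m

lemma dworkSeq_hnorm (hD : IsDworkRoot p (gam p a g)) : DworkSeq (Lq p a g) (hnorm p a g) := by
  have hpow : ∀ i, hnorm p a g (p ^ i) = cc p a g i := fun i => by
    rw [hnorm, hs, coeff_hSer_pow, cc]
  refine ⟨?_, ?_, fun m => ?_, fun m hm => ?_⟩
  · rw [hnorm, hs, coeff_hSer_of_ne fun i => (pow_pos hp.1.pos i).ne, zero_div]
  · have := hpow 0
    rwa [pow_zero, cc_zero hD] at this
  · by_cases h : ∃ i, m = p ^ i
    · obtain ⟨i, rfl⟩ := h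
      rw [hpow]
      exact cc_mem_Lq i
    · rw [hnorm, hs, coeff_hSer_of_ne fun i hi => h ⟨i, hi⟩, zero_div]
      exact zero_mem _
  · by_cases h : ∃ i, m = p ^ i
    · obtain ⟨i, rfl⟩ := h
      rw [hpow]
      exact norm_cc_le hD i
    · rw [hnorm, hs, coeff_hSer_of_ne fun i hi => h ⟨i, hi⟩, zero_div, norm_zero]
      positivity

lemma wfac_update (r i : ℕ) {b : Mon n} {l : Fin (n + 1)} {m : ℕ} (hm : m ≤ b l) :
    wfac p a n r g i b =
      wfac p a n r g i (Function.update b l (b l - m)) * gam p a g ^ m := by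
  rw [wfac, wfac, gam, ← pow_mul, ← pow_add, ← mdeg_update_sub hm]
  congr 1
  ring

/-- Multiplication by `h(x_l)` is multiplication by `∑ h_m γ^{-m} Y_l^m` in normalised
coordinates. -/
lemma mulMon_evar_ridx (hg : g ≠ 0) {r i : ℕ} (hi : i < p ^ r) {f : Ser p n} (hf : Supp r f)
    (l : Fin n) (b : Mon n) : mulMon (evar l.succ) (hs p a g) (toMon f) (ridx p r i b) =
      wfac p a n r g i b * mulVar l.succ (hnorm p a g) (cf p a n r g f i) b := by
  have hle := le_pow_mul (p := p) r (b 0)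
  have hval : ridx p r i b l.succ = p ^ r * b 0 + i + b l.succ - b 0 := rfl
  have hcoord : ∀ m, m ≤ ridx p r i b l.succ → m • evar l.succ ≤ ridx p r i b := fun m hm j => by
    rcases eq_or_ne j l.succ with rfl | h
    · simpa using hm
    · simp [h]
  rw [mulMon_eq_range (evar_ne_zero _) _ _ _ (k := b l.succ), mulVar_apply, Finset.mul_sum]
  · refine Finset.sum_congr rfl fun m hm => ?_
    rw [Finset.mem_range, Nat.lt_succ_iff] at hm
    have e : ridx p r i b - m • evar l.succ =
        ridx p r i (Function.update b l.succ (b l.succ - m)) := by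
      have hb0 : Function.update b l.succ (b l.succ - m) 0 = b 0 :=
        Function.update_of_ne (Fin.succ_ne_zero l).symm _ _
      funext j
      refine Fin.cases ?_ (fun j => ?_) j
      · simp [ridx, hb0]
      · rcases eq_or_ne j l with rfl | h
        · simp [ridx, hb0]
          omega
        · have h' : j.succ ≠ l.succ := fun h' => h (Fin.succ_injective n h')
          simp [ridx, h', hb0]
    rw [e, toMon_ridx (a := a) hg, wfac_update r i hm, hnorm]
    have := pow_ne_zero m (pow_ne_zero (p ^ a) hg)
    rw [gam]
    field_simp
  · exact fun m hm => hcoord m (by omega)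
  · intro m hm hml
    refine hf _ _ ?_
    -- A shift by `m > b_l` leads to a pair `(u, N)` with `N < p^r m(u)`, outside the support of `f`.
    have h1 := hml l.succ
    rw [Pi.smul_apply, evar, Pi.single_eq_same, hval, smul_eq_mul, mul_one] at h1
    have h2 : (b 0 : ℤ) + 1 ≤ mfun (mpos (ridx p r i b - m • evar l.succ)) := by
      have h3 := le_mfun (mpos (ridx p r i b - m • evar l.succ)) l
      rw [mpos_sub hml, mpos_ridx, mpos_nsmul_evar, Pi.sub_apply, Pi.single_eq_same, mpos] at h3
      rw [mpos_sub hml, mpos_ridx, mpos_nsmul_evar]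
      omega
    have h4 : b 0 + 1 ≤ mfun (mpos (ridx p r i b - m • evar l.succ)) := by exact_mod_cast h2
    have h5 := Nat.mul_le_mul_left (p ^ r) h4
    have h6 : (ridx p r i b - m • evar l.succ) 0 = p ^ r * b 0 + i := by simp [ridx]
    rw [h6]
    rw [mul_add] at h5
    omega

/-- Multiplication by `h(t^{p^r}/(x_1 ⋯ x_n))` is multiplication by `∑ h_m γ^{-m} Y_0^m` in
normalised coordinates. -/
lemma mulMon_zvar_ridx (hg : g ≠ 0) {r i : ℕ} (hi : i < p ^ r) (f : Ser p n)
    (b : Mon n) : mulMon (zvar p n r) (hs p a g) (toMon f) (ridx p r i b) =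
      wfac p a n r g i b * mulVar 0 (hnorm p a g) (cf p a n r g f i) b := by
  have hle := le_pow_mul (p := p) r (b 0)
  have hpos := pow_pos hp.1.pos r
  rw [mulMon_eq_range (zvar_ne_zero r) _ _ _ (k := b 0), mulVar_apply, Finset.mul_sum]
  · refine Finset.sum_congr rfl fun m hm => ?_
    rw [Finset.mem_range, Nat.lt_succ_iff] at hm
    have e : ridx p r i b - m • zvar p n r = ridx p r i (Function.update b 0 (b 0 - m)) := by
      obtain ⟨k, hk⟩ := Nat.exists_eq_add_of_le hm
      obtain ⟨P, hP⟩ := Nat.exists_eq_succ_of_ne_zero hpos.ne'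
      funext j
      refine Fin.cases ?_ (fun j => ?_) j
      · simp [ridx, zvar, hk, mul_add]
        rw [hP, mul_comm m]
        omega
      · have e1 : m * P = P * m := mul_comm _ _
        simp [ridx, zvar, hk, hP, mul_add, add_mul, Nat.succ_eq_add_one, e1]
        omega
    rw [e, toMon_ridx (a := a) hg, wfac_update r i hm, hnorm]
    have := pow_ne_zero m (pow_ne_zero (p ^ a) hg)
    rw [gam]
    field_simp
  · intro m hm j
    have h1 : m * p ^ r ≤ p ^ r * b 0 := by rw [mul_comm]; exact Nat.mul_le_mul_left _ hm
    obtain ⟨k, hk⟩ := Nat.exists_eq_add_of_le hm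
    refine Fin.cases ?_ (fun j => ?_) j
    · simp only [ridx, zvar, Pi.smul_apply, Fin.cons_zero, smul_eq_mul]
      omega
    · simp only [ridx, zvar, Pi.smul_apply, Fin.cons_succ, smul_eq_mul]
      have h2 : m * (p ^ r - 1) ≤ b 0 * (p ^ r - 1) := Nat.mul_le_mul_right _ hm
      have h3 : b 0 * (p ^ r - 1) = p ^ r * b 0 - b 0 := by rw [Nat.mul_sub_one, mul_comm]
      omega
  · intro m hm hml
    exfalso
    have h1 := hml 0
    simp only [ridx, zvar, Pi.smul_apply, Fin.cons_zero, smul_eq_mul] at h1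
    have h2 : p ^ r * (b 0 + 1) ≤ m * p ^ r := by rw [mul_comm m]; exact Nat.mul_le_mul_left _ hm
    rw [mul_add] at h2
    omega

lemma cf_eq_toMon (r i : ℕ) (f : Ser p n) (b : Mon n) :
    cf p a n r g f i b = toMon f (ridx p r i b) / wfac p a n r g i b := by
  rw [toMon, mpos_ridx, cf]
  rfl

/-- In coordinates, `D_{t^{p^r}, l}` is the operator `D_l` of the model, on each residue class
modulo `p^r` of exponents of `t`. -/
lemma cf_Dop (hg : g ≠ 0) {r i : ℕ} (hi : i < p ^ r) {f : Ser p n} (hf : Supp r f) (l : Fin n) :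
    cf p a n r g (Dop p a n r g l f) i = Dmod (hnorm p a g) l (cf p a n r g f i) := by
  funext b
  have hle := le_pow_mul (p := p) r (b 0)
  have hsub : (mconv (lineMon (evar l.succ) (hs p a g) - lineMon (zvar p n r) (hs p a g)) (toMon f))
      = mulMon (evar l.succ) (hs p a g) (toMon f) - mulMon (zvar p n r) (hs p a g) (toMon f) := by
    rw [mconv_comm, mconv_sub, mconv_comm, mconv_lineMon (evar_ne_zero _), mconv_comm,
      mconv_lineMon (zvar_ne_zero r)]
  rw [cf_eq_toMon, Dop, toMon_add, Pi.add_apply, toMon_xD, toMon_smulS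
    ((supp_Hser r).xD l).zero_of hf.zero_of, toMon_xD_Hser, hsub, Pi.sub_apply,
    mulMon_evar_ridx (a := a) hg hi hf, mulMon_zvar_ridx (a := a) hg hi, toMon_ridx (a := a) hg, Dmod_apply]
  have e : ((ridx p r i b l.succ : PadicAlgCl p) - ridx p r i b 0) = (b l.succ : PadicAlgCl p) - b 0 := by
    have := congrFun (mpos_ridx (p := p) r i b) l
    simp only [mpos] at this
    exact_mod_cast this
  rw [e]
  have := wfac_ne_zero (p := p) (a := a) (n := n) hg r i b
  field_simp
  ring

/-- In coordinates, `∂_{t^{p^r}}` is `i + p^r E_0`, on the residue class of `i` modulo `p^r` of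
exponents of `t`. -/
lemma cf_dop (hg : g ≠ 0) {r i : ℕ} (hi : i < p ^ r) {f : Ser p n} (hf : Supp r f) :
    cf p a n r g (dop p a n r g f) i = (i : PadicAlgCl p) • cf p a n r g f i +
      (p : PadicAlgCl p) ^ r • Eop (hnorm p a g) 0 (cf p a n r g f i) := by
  funext b
  rw [cf_eq_toMon, dop, toMon_add, Pi.add_apply, toMon_tD, toMon_smulS
    (supp_Hser r).tD.zero_of hf.zero_of, toMon_tD_Hser, mconv_comm, mconv_smul, mconv_comm,
    mconv_lineMon (zvar_ne_zero r), Pi.smul_apply, mulMon_zvar_ridx (a := a) hg hi,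
    toMon_ridx (a := a) hg, Eop]
  have e : (ridx p r i b 0 : PadicAlgCl p) = (p : PadicAlgCl p) ^ r * b 0 + i := by
    simp [ridx]
  simp only [e, Pi.add_apply, Pi.smul_apply, smul_eq_mul, LinearMap.add_apply, euler_apply]
  have := wfac_ne_zero (p := p) (a := a) (n := n) hg r i b
  field_simp
  ring

end Operators

/-! ### The Koszul operators as linear maps -/

section Linear

variable {p a n : ℕ} [hp : Fact p.Prime] {g : PadicAlgCl p}

lemma ball_one_iff {L : IntermediateField ℚ_[p] (PadicAlgCl p)} {S : Set (Mon n)} {C : ℝ}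
    {x : Mon n → PadicAlgCl p} :
    Ball L S (fun b => (1 : ℝ) ^ mdeg b) C x ↔ Ball L S (fun _ => 1) C x := by
  simp only [one_pow]

lemma eq_of_toMon_eq {f f' : Ser p n} (hf : Supp 0 f) (hf' : Supp 0 f') (h : toMon f = toMon f') :
    f = f' := by
  funext u
  ext N
  rcases Nat.lt_or_ge N (mfun u) with hN | hN
  · rw [coeff_eq_zero_of_lt hf hN, coeff_eq_zero_of_lt hf' hN]
  · obtain ⟨A, rfl, rfl⟩ := exists_mon hN
    exact congrFun h A

lemma Supp.smul {r : ℕ} {f : Ser p n} (hf : Supp r f) (ζ : PowerSeries (PadicAlgCl p)) :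
    Supp r (ζ • f) := by
  intro u N hN
  rw [Pi.smul_apply, smul_eq_mul, PowerSeries.coeff_mul]
  refine Finset.sum_eq_zero fun x hx => ?_
  have := Finset.HasAntidiagonal.mem_antidiagonal.1 hx
  rw [hf u x.2 (by omega), mul_zero]

/-- Multiplication by a power series in `t = y_0 y_1 ⋯ y_n`. -/
lemma toMon_smul {f : Ser p n} (hf : Supp 0 f) (ζ : PowerSeries (PadicAlgCl p)) :
    toMon (ζ • f) = mulMon 1 (fun m => PowerSeries.coeff m ζ) (toMon f) := by
  classical
  funext A
  have hA : A 0 ≤ mdeg A :=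
    Finset.single_le_sum (f := A) (fun _ _ => Nat.zero_le _) (Finset.mem_univ 0)
  rw [toMon, Pi.smul_apply, smul_eq_mul, PowerSeries.coeff_mul,
    Finset.Nat.sum_antidiagonal_eq_sum_range_succ_mk, mulMon,
    ← Finset.sum_subset (Finset.range_mono (Nat.succ_le_succ hA))]
  · refine Finset.sum_congr rfl fun m hm => ?_
    rw [Finset.mem_range, Nat.lt_succ_iff] at hm
    split_ifs with hle
    · rw [toMon, mpos_sub hle]
      congr 2
      · simp
      · congr 1
        funext l
        simp [mpos]
    · obtain ⟨l, hl⟩ : ∃ l, A l < m := by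
        by_contra! hcon
        exact hle fun l => by simpa using hcon l
      dsimp only
      rw [coeff_eq_zero_of_lt hf, mul_zero]
      refine Fin.cases (fun hl => by omega) (fun l hl => ?_) l hl
      have := le_mfun (mpos A) l
      rw [mpos] at this
      omega
  · intro m _ hm
    rw [if_neg]
    intro hle
    have := hle 0
    simp at this hm
    omega

lemma one_ne_zero_mon : (1 : Mon n) ≠ 0 := fun h => by simpa using congrFun h 0

lemma smulS_smul {G f : Ser p n} (hG : Supp 0 G) (hf : Supp 0 f) (ζ : PowerSeries (PadicAlgCl p)) :
    smulS G (ζ • f) = ζ • smulS G f := by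
  have h0 : Supp 0 (smulS G f) := supp_smulS hG hf
  refine eq_of_toMon_eq (supp_smulS hG (hf.smul ζ)) (h0.smul ζ) ?_
  rw [toMon_smulS hG (hf.smul ζ), toMon_smul hf, toMon_smul h0, mconv_mulMon one_ne_zero_mon,
    toMon_smulS hG hf]

lemma smulS_add {G f f' : Ser p n} (hG : Supp 0 G) (hf : Supp 0 f) (hf' : Supp 0 f') :
    smulS G (f + f') = smulS G f + smulS G f' := by
  refine eq_of_toMon_eq (supp_smulS hG (hf.add hf'))
    ((supp_smulS hG hf).add (supp_smulS hG hf')) ?_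
  rw [toMon_smulS hG (hf.add hf'), toMon_add, toMon_add, mconv_add, toMon_smulS hG hf,
    toMon_smulS hG hf']

lemma Dop_add {r : ℕ} (l : Fin n) {f f' : Ser p n} (hf : Supp 0 f) (hf' : Supp 0 f') :
    Dop p a n r g l (f + f') = Dop p a n r g l f + Dop p a n r g l f' := by
  have : xD l (f + f') = xD l f + xD l f' := by
    funext u; simp [xD]
  rw [Dop, smulS_add ((supp_Hser r).xD l).zero_of hf hf', this, Dop, Dop]
  abel

lemma Dop_smul {r : ℕ} (l : Fin n) {f : Ser p n} (hf : Supp 0 f) (ζ : PowerSeries (PadicAlgCl p)) :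
    Dop p a n r g l (ζ • f) = ζ • Dop p a n r g l f := by
  have : xD l (ζ • f) = ζ • xD l f := by
    funext u; simp [xD, mul_left_comm]
  rw [Dop, smulS_smul ((supp_Hser r).xD l).zero_of hf, this, Dop, smul_add]

/-- `t d/dt` on power series. -/
def tdS (ζ : PowerSeries (PadicAlgCl p)) : PowerSeries (PadicAlgCl p) :=
  PowerSeries.mk fun s => (s : PadicAlgCl p) * PowerSeries.coeff s ζ

lemma tdS_mul (ζ η : PowerSeries (PadicAlgCl p)) : tdS (ζ * η) = tdS ζ * η + ζ * tdS η := by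
  ext s
  rw [tdS, PowerSeries.coeff_mk, map_add, PowerSeries.coeff_mul, PowerSeries.coeff_mul,
    PowerSeries.coeff_mul, Finset.mul_sum, ← Finset.sum_add_distrib]
  refine Finset.sum_congr rfl fun x hx => ?_
  rw [← Finset.HasAntidiagonal.mem_antidiagonal.1 hx, tdS, tdS, PowerSeries.coeff_mk,
    PowerSeries.coeff_mk]
  push_cast
  ring

lemma tdS_add (ζ η : PowerSeries (PadicAlgCl p)) : tdS (ζ + η) = tdS ζ + tdS η := by
  ext s
  simp [tdS, mul_add]

lemma dop_add {r : ℕ} {f f' : Ser p n} (hf : Supp 0 f) (hf' : Supp 0 f') :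
    dop p a n r g (f + f') = dop p a n r g f + dop p a n r g f' := by
  have : tD (f + f') = tD f + tD f' := by
    funext u; exact tdS_add (f u) (f' u)
  rw [dop, smulS_add (supp_Hser r).tD.zero_of hf hf', this, dop, dop]
  abel

lemma dop_smul {r : ℕ} {f : Ser p n} (hf : Supp 0 f) (ζ : PowerSeries (PadicAlgCl p)) :
    dop p a n r g (ζ • f) = tdS ζ • f + ζ • dop p a n r g f := by
  have : tD (ζ • f) = tdS ζ • f + ζ • tD f := by
    funext u; exact tdS_mul ζ (f u)
  rw [dop, smulS_smul (supp_Hser r).tD.zero_of hf, this, dop, smul_add]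
  abel

lemma supp_of_mem_Cr {r : ℕ} (hg : g ≠ 0) (hr : r ≤ a) {f : Ser p n} (hf : f ∈ Cr p a n r g) :
    Supp r f := ((mem_Cr_iff hg hr f).1 hf).1

lemma mem_Cr_of_cf (hg : g ≠ 0) {r : ℕ} (hr : r ≤ a) {f : Ser p n} (hf : Supp r f)
    (h : ∀ i < p ^ r, Ball (Lq p a g) Set.univ (fun _ => 1) 1 (cf p a n r g f i)) :
    f ∈ Cr p a n r g :=
  (mem_Cr_iff hg hr f).2 ⟨hf, ball_prod (κ := Fin (p ^ r)) fun i => h i i.2⟩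

lemma Dop_mem (hD : IsDworkRoot p (gam p a g)) {r : ℕ} (hr : r ≤ a) (l : Fin n) {f : Ser p n}
    (hf : f ∈ Cr p a n r g) : Dop p a n r g l f ∈ Cr p a n r g := by
  have hg := g_ne_zero hD
  have hs := supp_of_mem_Cr hg hr hf
  refine mem_Cr_of_cf hg hr (hs.dopX l) fun i hi => ?_
  rw [cf_Dop hg hi hs, ← ball_one_iff]
  exact ball_Dmod (dworkSeq_hnorm hD) zero_lt_one (fun a ha => absurd (Set.mem_univ a) ha)
    (fun a ha => absurd (Set.mem_univ a) ha) (ball_one_iff.2 (ball_cf hg hr hf hi))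

lemma dop_mem (hD : IsDworkRoot p (gam p a g)) {r : ℕ} (hr : r ≤ a) {f : Ser p n}
    (hf : f ∈ Cr p a n r g) : dop p a n r g f ∈ Cr p a n r g := by
  have hg := g_ne_zero hD
  have hs := supp_of_mem_Cr hg hr hf
  refine mem_Cr_of_cf hg hr hs.dop fun i hi => ?_
  have hb := ball_cf hg hr hf hi
  rw [cf_dop hg hi hs]
  refine Ball.add (fun _ => zero_le_one) (Ball.smul_le (natCast_mem _ _) (norm_natCast_le_one p _)
    zero_le_one hb) (Ball.smul_le (pow_mem (natCast_mem _ _) _) ?_ zero_le_one ?_)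
  · rw [norm_pow]
    exact pow_le_one₀ (norm_nonneg _) (norm_natCast_le_one p _)
  · exact ball_one_iff.1 (ball_Eop (dworkSeq_hnorm hD) zero_lt_one
      (fun a ha => absurd (Set.mem_univ a) ha) (ball_one_iff.2 hb))

lemma cf_smul_const (r : ℕ) (x : PadicAlgCl p) (f : Ser p n) (i : ℕ) :
    cf p a n r g ((PowerSeries.C x) • f) i = x • cf p a n r g f i := by
  funext b
  simp [cf, mul_div_assoc]

lemma dop_Dop (hD : IsDworkRoot p (gam p a g)) {r : ℕ} (l : Fin n) {f : Ser p n}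
    (hf : Supp r f) : dop p a n r g (Dop p a n r g l f) = Dop p a n r g l (dop p a n r g f) := by
  have hg := g_ne_zero hD
  refine eq_of_cf_eq (a := a) hg (hf.dopX l).dop (hf.dop.dopX l) fun i hi => ?_
  rw [cf_dop hg hi (hf.dopX l), cf_Dop hg hi hf, cf_Dop hg hi hf.dop, cf_dop hg hi hf, map_add,
    map_smul, map_smul]
  congr 2
  simp only [Dmod, LinearMap.sub_apply, map_sub]
  rw [Eop_comm _ l.succ 0]

/-- The operator `D_{t^{p^r}, l}` on `𝒞_{p^r}`. -/
def DopL (hD : IsDworkRoot p (gam p a g)) {r : ℕ} (hr : r ≤ a) (l : Fin n) :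
    Cr p a n r g →ₗ[Or p a n r g] Cr p a n r g where
  toFun f := ⟨Dop p a n r g l f, Dop_mem hD hr l f.2⟩
  map_add' f f' := Subtype.ext (Dop_add l (supp_of_mem_Cr (g_ne_zero hD) hr f.2).zero_of
    (supp_of_mem_Cr (g_ne_zero hD) hr f'.2).zero_of)
  map_smul' _ f := Subtype.ext (Dop_smul l (supp_of_mem_Cr (g_ne_zero hD) hr f.2).zero_of _)

/-- The operator `∂_{t^{p^r}}` on `𝒞_{p^r}`. -/
def dopL (hD : IsDworkRoot p (gam p a g)) {r : ℕ} (hr : r ≤ a) :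
    Cr p a n r g →+ Cr p a n r g :=
  AddMonoidHom.mk' (fun f => ⟨dop p a n r g f, dop_mem hD hr f.2⟩) fun f f' =>
    Subtype.ext (dop_add (supp_of_mem_Cr (g_ne_zero hD) hr f.2).zero_of
      (supp_of_mem_Cr (g_ne_zero hD) hr f'.2).zero_of)

lemma mem_bdry_iff (hD : IsDworkRoot p (gam p a g)) {r : ℕ} (hr : r ≤ a) (η : Cr p a n r g) :
    η ∈ bdry p a n r g ↔ ∃ q : Fin n → Cr p a n r g, η = ∑ l, DopL hD hr l (q l) := by
  constructor
  · intro h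
    induction h using Submodule.span_induction with
    | mem x hx =>
      obtain ⟨l, f, hf⟩ := hx
      refine ⟨Pi.single l f, Subtype.ext ?_⟩
      rw [Finset.sum_eq_single l]
      · rw [Pi.single_eq_same]; exact hf
      · intro j _ hj
        rw [Pi.single_eq_of_ne hj, map_zero]
      · exact fun h => absurd (Finset.mem_univ l) h
    | zero => exact ⟨0, by simp⟩
    | add x y _ _ hx hy =>
      obtain ⟨q, rfl⟩ := hx
      obtain ⟨q', rfl⟩ := hy
      exact ⟨q + q', by simp [Finset.sum_add_distrib]⟩
    | smul ζ x _ hx =>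
      obtain ⟨q, rfl⟩ := hx
      exact ⟨ζ • q, by simp [Finset.smul_sum]⟩
  · rintro ⟨q, rfl⟩
    exact sum_mem fun l _ => Submodule.subset_span ⟨l, q l, rfl⟩

lemma cls_eq_zero_iff {r : ℕ} (η : Cr p a n r g) :
    cls p a n r g η = 0 ↔ η ∈ bdry p a n r g := Submodule.Quotient.mk_eq_zero _

lemma cls_surjective (r : ℕ) : Function.Surjective (cls p a n r g) := Submodule.mkQ_surjective _

/-- The Euler derivation `t d/dt` of `𝒪_{p^r}`. -/
def tdO (r : ℕ) : Derivation ℤ (Or p a n r g) (Or p a n r g) :=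
  Derivation.mk' (AddMonoidHom.toIntLinearMap (AddMonoidHom.mk' (fun ζ => (⟨tdS ζ, by
      obtain ⟨c, hc, hc0, hζ⟩ := ζ.2
      refine ⟨fun s => s * c s, fun s => mul_mem (natCast_mem _ _) (hc s), ?_, ?_⟩
      · refine squeeze_zero_norm (fun s => ?_) (tendsto_zero_iff_norm_tendsto_zero.1 hc0)
        rw [norm_mul]
        exact mul_le_of_le_one_left (norm_nonneg _) (norm_natCast_le_one p s)
      · rw [hζ]
        ext s
        simp only [tdS, tser, PowerSeries.coeff_mk]
        ring⟩ : Or p a n r g)) fun _ _ => Subtype.ext (tdS_add _ _)))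
    fun ζ η => Subtype.ext (by
      have := tdS_mul (ζ : PowerSeries (PadicAlgCl p)) η
      simp only [AddMonoidHom.coe_toIntLinearMap, AddMonoidHom.mk'_apply, smul_eq_mul,
        Subring.coe_mul, Subring.coe_add]
      rw [this]
      ring)

lemma coe_tdO {r : ℕ} (ζ : Or p a n r g) :
    ((tdO r ζ : Or p a n r g) : PowerSeries (PadicAlgCl p)) = tdS ζ := rfl

lemma tdO_constHom (r : ℕ) (x : Oq p a g) : tdO r (constHom p a n r g x) = 0 := by
  refine Subtype.ext ?_
  rw [coe_tdO]
  ext s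
  change PowerSeries.coeff s (tdS (PowerSeries.C (x : PadicAlgCl p))) = _
  rw [tdS, PowerSeries.coeff_mk, PowerSeries.coeff_C]
  split_ifs with h <;> simp [h]

lemma dopL_smul (hD : IsDworkRoot p (gam p a g)) {r : ℕ} (hr : r ≤ a) (ζ : Or p a n r g)
    (f : Cr p a n r g) : dopL hD hr (ζ • f) = tdO r ζ • f + ζ • dopL hD hr f :=
  Subtype.ext (dop_smul (supp_of_mem_Cr (g_ne_zero hD) hr f.2).zero_of _)

/-- `∂_{t^{p^r}}` commutes with the Koszul operators and descends to `H^n(𝒞_{p^r})`. -/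
lemma exists_connHom (hD : IsDworkRoot p (gam p a g)) {r : ℕ} (hr : r ≤ a) :
    ∃ S : Hn p a n r g →+ Hn p a n r g, ∀ f, S (cls p a n r g f) = cls p a n r g (dopL hD hr f) := by
  let π := (cls p a n r g).toAddMonoidHom
  have hker : π.ker ≤ (π.comp (dopL hD hr)).ker := by
    intro f hf
    rw [AddMonoidHom.mem_ker] at hf ⊢
    have hf' := (cls_eq_zero_iff f).1 hf
    obtain ⟨q, rfl⟩ := (mem_bdry_iff hD hr f).1 hf'
    refine (cls_eq_zero_iff _).2 ((mem_bdry_iff hD hr _).2 ⟨fun l => dopL hD hr (q l), ?_⟩)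
    rw [map_sum]
    exact Finset.sum_congr rfl fun l _ =>
      Subtype.ext (dop_Dop hD l (supp_of_mem_Cr (g_ne_zero hD) hr (q l).2))
  refine ⟨π.liftOfSurjective (cls_surjective r) ⟨_, hker⟩, fun f => ?_⟩
  exact AddMonoidHom.liftOfRightInverse_comp_apply _ _ _ ⟨_, hker⟩ f

/-- The connection on `H^n(𝒞_{p^r})`. -/
def connHom (hD : IsDworkRoot p (gam p a g)) {r : ℕ} (hr : r ≤ a) :
    Hn p a n r g →+ Hn p a n r g := (exists_connHom hD hr).choose

lemma connHom_cls (hD : IsDworkRoot p (gam p a g)) {r : ℕ} (hr : r ≤ a) (f : Cr p a n r g) :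
    connHom hD hr (cls p a n r g f) = cls p a n r g (dopL hD hr f) :=
  (exists_connHom hD hr).choose_spec f

lemma connHom_smul (hD : IsDworkRoot p (gam p a g)) {r : ℕ} (hr : r ≤ a) (ζ : Or p a n r g)
    (x : Hn p a n r g) : connHom hD hr (ζ • x) = tdO r ζ • x + ζ • connHom hD hr x := by
  obtain ⟨f, rfl⟩ := cls_surjective r x
  rw [← map_smul, connHom_cls, dopL_smul, map_add, map_smul, map_smul, connHom_cls]

/-- The defining property of `conn` is satisfiable, and so `conn` has it. -/
theorem isConn_conn (hD : IsDworkRoot p (gam p a g)) : IsConn p a n g (conn p a n g) := by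
  refine Classical.epsilon_spec (p := IsConn p a n g)
    ⟨{ toFun := connHom hD (Nat.zero_le a), map_add' := map_add _, map_smul' := fun c x => ?_ },
    fun f => ⟨dopL hD (Nat.zero_le a) f, rfl, connHom_cls hD (Nat.zero_le a) f⟩⟩
  change connHom hD (Nat.zero_le a) (constHom p a n 0 g c • x) = constHom p a n 0 g c • _
  rw [connHom_smul, tdO_constHom, zero_smul, zero_add]

lemma conn_eq_connHom (hD : IsDworkRoot p (gam p a g)) (x : Hn p a n 0 g) :
    conn p a n g x = connHom hD (Nat.zero_le a) x := by
  obtain ⟨f, rfl⟩ := cls_surjective 0 x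
  obtain ⟨h, hh, hc⟩ := isConn_conn hD f
  rw [hc, connHom_cls]
  congr 1
  exact Subtype.ext hh

end Linear

/-! ### The basis `e_0, …, e_n` of relative cohomology -/

section Basis

variable {p a n : ℕ} [hp : Fact p.Prime] {g : PadicAlgCl p}

lemma gpow_ne_zero (hg : g ≠ 0) (r s : ℕ) : gpow p a n r g s ≠ 0 := pow_ne_zero _ hg

/-- The normalised coefficients `c_s` of `∑_s c_s γ^{s(n+1)/p^r} t^s`. -/
def nco (p a n r : ℕ) [Fact p.Prime] (g : PadicAlgCl p) (ζ : PowerSeries (PadicAlgCl p)) (s : ℕ) :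
    PadicAlgCl p := PowerSeries.coeff s ζ / gpow p a n r g s

lemma nco_tser (hg : g ≠ 0) (r : ℕ) (c : ℕ → PadicAlgCl p) :
    nco p a n r g (tser p a n r g c) = c := by
  funext s
  rw [nco, tser, PowerSeries.coeff_mk, mul_div_cancel_right₀ _ (gpow_ne_zero hg r s)]

lemma tser_nco (hg : g ≠ 0) (r : ℕ) (ζ : PowerSeries (PadicAlgCl p)) :
    tser p a n r g (nco p a n r g ζ) = ζ := by
  ext s
  rw [tser, PowerSeries.coeff_mk, nco, div_mul_cancel₀ _ (gpow_ne_zero hg r s)]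

lemma nco_mem (hg : g ≠ 0) {r : ℕ} (ζ : Or p a n r g) (s : ℕ) :
    nco p a n r g ζ s ∈ Oq p a g := by
  obtain ⟨c, hc, _, hζ⟩ := ζ.2
  rw [hζ, nco_tser hg]
  exact hc s

lemma nco_tendsto (hg : g ≠ 0) {r : ℕ} (ζ : Or p a n r g) :
    Tendsto (nco p a n r g ζ) atTop (𝓝 0) := by
  obtain ⟨c, _, hc, hζ⟩ := ζ.2
  rw [hζ, nco_tser hg]
  exact hc

/-- The element of `𝒪_{p^r}` with given normalised coefficients. -/
def mkOr (r : ℕ) (c : ℕ → PadicAlgCl p) (hc : ∀ s, c s ∈ Oq p a g) (hc0 : Tendsto c atTop (𝓝 0)) :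
    Or p a n r g := ⟨tser p a n r g c, c, hc, hc0, rfl⟩

/-- The exponent of `T^s Y_1 ⋯ Y_j`, where `T = Y_0 ⋯ Y_n`, `d = (n+1)s + j`, `0 ≤ j ≤ n`. -/
def eps (n d : ℕ) : Mon n :=
  Fin.cons (d / (n + 1)) fun l => d / (n + 1) + if (l : ℕ) < d % (n + 1) then 1 else 0

lemma mdeg_eps (d : ℕ) : mdeg (eps n d) = d := by
  unfold mdeg eps
  rw [Fin.sum_univ_succ]
  simp only [Fin.cons_zero, Fin.cons_succ, Finset.sum_add_distrib, Finset.sum_const,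
    Finset.card_univ, Fintype.card_fin, Finset.sum_boole, smul_eq_mul]
  have h1 : (Finset.univ.filter fun l : Fin n => (l : ℕ) < d % (n + 1)).card = d % (n + 1) := by
    rw [Fin.card_filter_val_lt]
    exact min_eq_right (Nat.lt_succ_iff.1 (Nat.mod_lt _ n.succ_pos))
  rw [h1]
  have := Nat.div_add_mod d (n + 1)
  simp only [Nat.cast_id]
  nlinarith

lemma mpos_eps (d : ℕ) : mpos (eps n d) = expo n (d % (n + 1)) := by
  funext l
  simp only [mpos, eps, expo, Fin.cons_zero, Fin.cons_succ]
  push_cast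
  ring

lemma eps_add_mul (s : ℕ) (j : Fin (n + 1)) :
    ((n + 1) * s + j) / (n + 1) = s ∧ ((n + 1) * s + j) % (n + 1) = j := by
  refine ⟨?_, ?_⟩
  · rw [Nat.mul_add_div n.succ_pos, Nat.div_eq_of_lt j.2, add_zero]
  · rw [Nat.mul_add_mod, Nat.mod_eq_of_lt j.2]

lemma eq_eps_of_mpos {b : Mon n} {j : Fin (n + 1)} (h : mpos b = expo n j) :
    b = eps n ((n + 1) * b 0 + j) := by
  obtain ⟨h1, h2⟩ := eps_add_mul (b 0) j
  refine mpos_inj (by rw [h, mpos_eps, h2]) ?_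
  rw [eps, Fin.cons_zero, h1]

/-- The sequences indexed by degree that describe `∑_j (∑_s c_j(s) γ^{s(n+1)/p^r} t^s) e_j`. -/
def vseq (p n r : ℕ) [Fact p.Prime] (c : Fin (n + 1) → ℕ → PadicAlgCl p) (i d : ℕ) :
    PadicAlgCl p :=
  c ⟨d % (n + 1), Nat.mod_lt _ n.succ_pos⟩ (p ^ r * (d / (n + 1)) + i)

lemma vseq_add_mul (r : ℕ) (c : Fin (n + 1) → ℕ → PadicAlgCl p) (i s : ℕ) (j : Fin (n + 1)) :
    vseq p n r c i ((n + 1) * s + j) = c j (p ^ r * s + i) := by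
  obtain ⟨h1, h2⟩ := eps_add_mul s j
  have h3 : (⟨((n + 1) * s + j) % (n + 1), Nat.mod_lt _ n.succ_pos⟩ : Fin (n + 1)) = j := Fin.ext h2
  rw [vseq, h1, h3]

lemma expo_injective {j j' : ℕ} (hj : j ≤ n) (hj' : j' ≤ n) (h : expo n j = expo n j') :
    j = j' := by
  have h1 := wfun_expo n j hj
  rw [h, wfun_expo n j' hj'] at h1
  exact_mod_cast h1.symm

lemma supp_eSer (r j : ℕ) : Supp r (eSer p a n g j) := by
  intro u N hN
  by_cases h : u = expo n j
  · subst h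
    rw [mfun_expo, mul_zero] at hN
    exact absurd hN (Nat.not_lt_zero _)
  · rw [eSer, Pi.single_eq_of_ne h, map_zero]

lemma wfac_eps {r : ℕ} (hr : r ≤ a) (i s : ℕ) (j : Fin (n + 1)) :
    wfac p a n r g i (eps n ((n + 1) * s + j)) =
      gpow p a n r g (p ^ r * s + i) * gam p a g ^ (j : ℕ) := by
  have hpa : p ^ a = p ^ (a - r) * p ^ r := by rw [← pow_add, Nat.sub_add_cancel hr]
  rw [wfac, mdeg_eps, gpow, gam, ← pow_mul, ← pow_add, hpa]
  congr 1
  ring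

/-- In coordinates, combinations of the `e_j` are combinations of one monomial in each degree. -/
lemma cf_sum_eSer (hg : g ≠ 0) {r : ℕ} (hr : r ≤ a) (c : Fin (n + 1) → ℕ → PadicAlgCl p) (i : ℕ) :
    cf p a n r g (∑ j : Fin (n + 1), tser p a n r g (c j) • eSer p a n g j) i =
      embSeq p (eps n) (vseq p n r c i) := by
  funext b
  rw [cf_sum, Finset.sum_apply, embSeq_apply]
  by_cases h : ∃ j : Fin (n + 1), mpos b = expo n j
  · obtain ⟨j, hj⟩ := h
    have hb := eq_eps_of_mpos hj
    have hd : mdeg b = (n + 1) * b 0 + j := by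
      conv_lhs => rw [hb]
      exact mdeg_eps _
    rw [hd, if_pos hb, vseq_add_mul, Finset.sum_eq_single j]
    · have hw := wfac_eps (p := p) (a := a) (g := g) hr i (b 0) j
      rw [← hb] at hw
      rw [cf, Pi.smul_apply, hj, eSer, Pi.single_eq_same, smul_eq_mul, PowerSeries.coeff_mul_C,
        tser, PowerSeries.coeff_mk, hw, mul_assoc, mul_div_cancel_right₀]
      rw [← hw]
      exact wfac_ne_zero hg _ _ _
    · intro j' _ hj'
      rw [cf, Pi.smul_apply, hj, eSer, Pi.single_eq_of_ne, smul_zero, map_zero, zero_div]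
      intro h
      exact hj' (Fin.ext (expo_injective (Nat.lt_succ_iff.1 j.2) (Nat.lt_succ_iff.1 j'.2) h).symm)
    · exact fun h => absurd (Finset.mem_univ j) h
  · rw [if_neg, Finset.sum_eq_zero]
    · intro j _
      rw [cf, Pi.smul_apply, eSer, Pi.single_eq_of_ne (fun h' => h ⟨j, h'⟩), smul_zero, map_zero,
        zero_div]
    · intro hb
      refine h ⟨⟨mdeg b % (n + 1), Nat.mod_lt _ n.succ_pos⟩, ?_⟩
      rw [hb, mpos_eps, mdeg_eps]

lemma ball_vseq {r : ℕ} {c : Fin (n + 1) → ℕ → PadicAlgCl p} (hc : ∀ j s, c j s ∈ Oq p a g)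
    (hc0 : ∀ j, Tendsto (c j) atTop (𝓝 0)) (i : ℕ) :
    Ball (Lq p a g) Set.univ (fun d => (1 : ℝ) ^ d) 1 (vseq p n r c i) := by
  refine ⟨fun d => (hc _ _).1, fun d hd => absurd (Set.mem_univ d) hd, fun d => ?_, fun ε hε => ?_⟩
  · dsimp only
    rw [one_pow, mul_one]; exact (hc _ _).2
  · have hfin : ∀ j, {s : ℕ | ε < ‖c j s‖}.Finite := fun j => by
      have := hc0 j
      rw [← Nat.cofinite_eq_atTop, Metric.tendsto_nhds] at this
      refine (this ε hε).subset fun s hs => ?_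
      rw [Set.mem_ofPred_eq] at hs
      simp only [dist_zero_right, Set.mem_compl_iff, Set.mem_ofPred_eq, not_lt]
      exact hs.le
    refine (Set.finite_iUnion fun j : Fin (n + 1) =>
      (hfin j).preimage (f := fun s => p ^ r * s + i) ?_ |>.image
        fun s => (n + 1) * s + j).subset fun d hd => ?_
    · intro s _ s' _ h
      dsimp only at h
      exact Nat.eq_of_mul_eq_mul_left (pow_pos hp.1.pos r) (by omega)
    · rw [Set.mem_ofPred_eq] at hd
      dsimp only at hd
      rw [one_pow, mul_one] at hd
      exact Set.mem_iUnion.2 ⟨⟨d % (n + 1), Nat.mod_lt _ n.succ_pos⟩, d / (n + 1), hd,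
        Nat.div_add_mod d (n + 1)⟩

/-- Every element of `𝒞_{p^r}` is a combination of the `e_j` up to the image of the Koszul
differential. -/
lemma exists_decomp (ha : 1 ≤ a) (hD : IsDworkRoot p (gam p a g)) {r : ℕ} (hr : r ≤ a)
    (f : Cr p a n r g) : ∃ (ζ : Fin (n + 1) → Or p a n r g) (q : Fin n → Cr p a n r g),
      f = ∑ j, ζ j • (⟨eSer p a n g j, eSer_mem p a n r g j⟩ : Cr p a n r g) +
        ∑ l, DopL hD hr l (q l) := by
  have hg := g_ne_zero hD
  have hpr := pow_pos hp.1.pos r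
  -- Solve separately on each residue class `i` modulo `p^r` of exponents of `t`: there the operators
  -- are those of the model.
  have hz : ∀ i, ∃ z, i < p ^ r → Ball (Lq p a g) Set.univ (fun x => (1 : ℝ) ^ hnDeg x) 1 z ∧
      hnMap (hnorm p a g) (eps n) z = cf p a n r g f i := by
    intro i
    by_cases hi : i < p ^ r
    · obtain ⟨z, hz⟩ := exists_hnMap_eq (isComplete_Lq ha) (dworkSeq_hnorm hD) (mdeg_eps (n := n))
        le_rfl one_lt_prime zero_lt_one (ball_one_iff.2 (ball_cf hg hr f.2 hi))
      exact ⟨z, fun _ => hz⟩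
    · exact ⟨0, fun h => absurd h hi⟩
  choose z hz using hz
  let c : Fin (n + 1) → ℕ → PadicAlgCl p := fun j s =>
    z (s % p ^ r) (Sum.inr ((n + 1) * (s / p ^ r) + j))
  have hmod : ∀ s, s % p ^ r < p ^ r := fun s => Nat.mod_lt _ hpr
  have hc : ∀ j s, c j s ∈ Oq p a g := fun j s => by
    have hb := (hz _ (hmod s)).1
    refine ⟨hb.1 _, ?_⟩
    have := hb.2.2.1 (Sum.inr ((n + 1) * (s / p ^ r) + j))
    dsimp only at this
    rwa [one_pow, mul_one] at this
  have hc0 : ∀ j, Tendsto (c j) atTop (𝓝 0) := fun j => by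
    rw [← Nat.cofinite_eq_atTop, Metric.tendsto_nhds]
    intro ε hε
    refine Set.Finite.subset (Set.finite_iUnion fun i : Fin (p ^ r) =>
      (((ball_inr (hz i i.2).1).2.2.2 (ε / 2) (half_pos hε)).image
        fun d => p ^ r * (d / (n + 1)) + i)) fun s hs => ?_
    simp only [dist_zero_right, Set.mem_compl_iff, Set.mem_ofPred_eq, not_lt] at hs
    refine Set.mem_iUnion.2 ⟨⟨s % p ^ r, hmod s⟩, (n + 1) * (s / p ^ r) + j, ?_, ?_⟩
    · rw [Set.mem_ofPred_eq]
      dsimp only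
      rw [one_pow, mul_one]
      exact lt_of_lt_of_le (half_lt_self hε) hs
    · dsimp only
      rw [(eps_add_mul (s / p ^ r) j).1, Nat.div_add_mod]
  let y : Fin n → ℕ → Mon n → PadicAlgCl p := fun l i b => z i (Sum.inl (l, b))
  have hy : ∀ l, ∀ i < p ^ r, Ball (Lq p a g) Set.univ (fun _ => 1) 1 (y l i) := fun l i hi => by
    have := ball_inl (hz i hi).1 l
    simpa only [one_pow] using this
  refine ⟨fun j => mkOr r (c j) (hc j) (hc0 j), fun l => ⟨_, ofModel_mem hg hr (hy l)⟩,
    Subtype.ext ?_⟩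
  have h1 : ((∑ j, (mkOr r (c j) (hc j) (hc0 j) : Or p a n r g) • (⟨eSer p a n g j, eSer_mem p a n r g j⟩ :
      Cr p a n r g) : Cr p a n r g) : Ser p n) =
      ∑ j : Fin (n + 1), tser p a n r g (c j) • eSer p a n g j := by
    rw [Submodule.coe_sum]
    rfl
  have h2 : ((∑ l, DopL hD hr l ⟨_, ofModel_mem hg hr (hy l)⟩ : Cr p a n r g) : Ser p n) =
      ∑ l, Dop p a n r g l (ofModel p a n r g (y l)) := by
    rw [Submodule.coe_sum]
    rfl
  rw [Submodule.coe_add, h1, h2]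
  have h3 : Supp r (∑ j : Fin (n + 1), tser p a n r g (c j) • eSer p a n g j) :=
    Supp.sum _ fun j _ => (supp_eSer r (j : ℕ)).smul _
  refine eq_of_cf_eq (a := a) hg (supp_of_mem_Cr hg hr f.2)
    (h3.add (Supp.sum _ fun l _ => (supp_ofModel r (y l)).dopX l)) fun i hi => ?_
  rw [cf_add, cf_sum_eSer hg hr, cf_sum, ← (hz i hi).2, hnMap_apply, add_comm]
  congr 1
  · congr 1
    funext d
    rw [vseq]
    simp only [c]
    rw [Nat.mul_add_mod, Nat.mod_eq_of_lt hi, Nat.mul_add_div hpr, Nat.div_eq_of_lt hi, add_zero,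
      Nat.div_add_mod]
  · refine Finset.sum_congr rfl fun l _ => ?_
    rw [cf_Dop hg hi (supp_ofModel r (y l)), cf_ofModel hg hi]

lemma cf_decomp (hD : IsDworkRoot p (gam p a g)) {r : ℕ} (hr : r ≤ a) {f : Cr p a n r g}
    {ζ : Fin (n + 1) → Or p a n r g} {q : Fin n → Cr p a n r g}
    (h : f = ∑ j, ζ j • (⟨eSer p a n g j, eSer_mem p a n r g j⟩ : Cr p a n r g) +
        ∑ l, DopL hD hr l (q l)) {i : ℕ} (hi : i < p ^ r) :
    cf p a n r g f i = embSeq p (eps n) (vseq p n r (fun j => nco p a n r g (ζ j)) i) +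
      ∑ l, Dmod (hnorm p a g) l (cf p a n r g (q l) i) := by
  have hg := g_ne_zero hD
  rw [h, Submodule.coe_add, cf_add, Submodule.coe_sum, Submodule.coe_sum, cf_sum _ _ (fun l =>
    ((DopL hD hr l (q l) : Cr p a n r g) : Ser p n)), ← cf_sum_eSer hg hr]
  congr 1
  · congr 1
    refine Finset.sum_congr rfl fun j _ => ?_
    rw [tser_nco hg]
    rfl
  · refine Finset.sum_congr rfl fun l _ => ?_
    exact cf_Dop hg hi (supp_of_mem_Cr hg hr (q l).2) l

/-- The coordinates with respect to the `e_j` satisfy every bound that the coefficients satisfy. -/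
lemma decomp_bound (ha : 1 ≤ a) (hD : IsDworkRoot p (gam p a g)) {r : ℕ} (hr : r ≤ a)
    {f : Cr p a n r g} {ζ : Fin (n + 1) → Or p a n r g} {q : Fin n → Cr p a n r g}
    (h : f = ∑ j, ζ j • (⟨eSer p a n g j, eSer_mem p a n r g j⟩ : Cr p a n r g) +
        ∑ l, DopL hD hr l (q l)) {i : ℕ} (hi : i < p ^ r) {P C : ℝ} (hP : 1 ≤ P) (hPp : P < p)
    (hC : 0 < C) (hf : Ball (Lq p a g) Set.univ (fun b => P ^ mdeg b) C (cf p a n r g f i))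
    (j : Fin (n + 1)) (s : ℕ) :
    ‖nco p a n r g (ζ j) (p ^ r * s + i)‖ * P ^ ((n + 1) * s + j) ≤ C := by
  have hg := g_ne_zero hD
  -- There is a solution that satisfies the bound, and by uniqueness its coordinates are the `ζ j`.
  obtain ⟨z, hz, hzf⟩ := exists_hnMap_eq (isComplete_Lq ha) (dworkSeq_hnorm hD)
    (mdeg_eps (n := n)) hP hPp hC hf
  have hdec := cf_decomp hD hr h hi
  rw [← hzf, hnMap_apply] at hdec
  have hz1 : Ball (Lq p a g) Set.univ (fun x : (Fin n × Mon n) ⊕ ℕ => (1 : ℝ) ^ hnDeg x) C z :=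
    hz.weight fun x => by rw [one_pow]; exact one_le_pow₀ hP
  set v := vseq p n r (fun j => nco p a n r g (ζ j)) i with hv
  set C' := max C 1
  have hC' : 0 < C' := lt_max_of_lt_left hC
  have hunique := hnMap_unique (isComplete_Lq ha) (dworkSeq_hnorm hD) (mdeg_eps (n := n)) hC'
    (q := fun l => (fun b => z (Sum.inl (l, b))) - cf p a n r g (q l) i)
    (v := (fun d => z (Sum.inr d)) - v) (fun l => ?_) ?_ ?_
  · have h1 := congrFun hunique ((n + 1) * s + j)
    rw [Pi.sub_apply, hv, vseq_add_mul, Pi.zero_apply, sub_eq_zero] at h1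
    rw [← h1]
    exact (ball_inr hz).2.2.1 _
  · refine Ball.sub (fun b => by positivity) ?_ ((ball_one_iff.2 (ball_cf hg hr (q l).2 hi)).mono
      (le_max_right _ _))
    have := ball_inl hz1 l
    simp only [one_pow] at this ⊢
    exact this.mono (le_max_left _ _)
  · exact Ball.sub (fun b => by positivity) ((ball_inr hz1).mono (le_max_left _ _))
      ((ball_vseq (fun j s => nco_mem hg (ζ j) s) (fun j => nco_tendsto hg (ζ j)) i).mono
        (le_max_right _ _))
  · simp only [map_sub, Finset.sum_sub_distrib]
    rw [sub_add_sub_comm, hdec, add_comm (∑ l, Dmod _ l (cf p a n r g (q l) i)), sub_self]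

lemma decomp_unique (ha : 1 ≤ a) (hD : IsDworkRoot p (gam p a g)) {r : ℕ} (hr : r ≤ a)
    {ζ : Fin (n + 1) → Or p a n r g} {q : Fin n → Cr p a n r g}
    (h : 0 = ∑ j, ζ j • (⟨eSer p a n g j, eSer_mem p a n r g j⟩ : Cr p a n r g) +
        ∑ l, DopL hD hr l (q l)) : ζ = 0 := by
  have hg := g_ne_zero hD
  have hpr := pow_pos hp.1.pos r
  funext j
  refine Subtype.ext ?_
  rw [← tser_nco (p := p) (a := a) (n := n) hg r ((ζ j : Or p a n r g) : PowerSeries _)]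
  have h0 : nco p a n r g (ζ j) = 0 := by
    funext s
    -- The element `0` satisfies every bound `C > 0`.
    have key := fun C hC => decomp_bound ha hD hr h (Nat.mod_lt s hpr) le_rfl one_lt_prime
      (C := C) hC (by
        convert Ball.zero (L := Lq p a g) (S := Set.univ) (ω := fun b : Mon n => (1 : ℝ) ^ mdeg b) hC.le
        funext b
        simp [cf]) j (s / p ^ r)
    rw [Nat.div_add_mod, one_pow, mul_one] at key
    rw [Pi.zero_apply, ← norm_le_zero_iff]
    exact le_of_forall_pos_le_add fun ε hε => by rw [zero_add]; exact key ε hε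
  rw [h0]
  ext s
  simp [tser]

lemma sum_smul_eCls {r : ℕ} (ζ : Fin (n + 1) → Or p a n r g) :
    ∑ j, ζ j • eCls p a n r g j =
      cls p a n r g (∑ j, ζ j • (⟨eSer p a n g j, eSer_mem p a n r g j⟩ : Cr p a n r g)) := by
  rw [map_sum]
  exact Finset.sum_congr rfl fun j _ => (map_smul _ _ _).symm

/-- The classes `e_0, …, e_n` form a basis of `H^n(𝒞_{p^r})`. -/
def hnBasis (ha : 1 ≤ a) (hD : IsDworkRoot p (gam p a g)) {r : ℕ} (hr : r ≤ a) :
    Module.Basis (Fin (n + 1)) (Or p a n r g) (Hn p a n r g) :=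
  Module.Basis.mk (v := eCls p a n r g)
    (by
      rw [Fintype.linearIndependent_iff]
      intro ζ hζ
      rw [sum_smul_eCls, cls_eq_zero_iff, mem_bdry_iff hD hr] at hζ
      obtain ⟨q, hq⟩ := hζ
      refine congrFun (decomp_unique ha hD hr (ζ := ζ) (q := fun l => -q l) ?_)
      rw [hq]
      simp)
    (by
      rintro x -
      obtain ⟨f, rfl⟩ := cls_surjective r x
      obtain ⟨ζ, q, rfl⟩ := exists_decomp ha hD hr f
      rw [map_add, ← sum_smul_eCls, (cls_eq_zero_iff _).2 ((mem_bdry_iff hD hr _).2 ⟨q, rfl⟩),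
        add_zero]
      exact sum_mem fun j _ => Submodule.smul_mem _ _ (Submodule.subset_span ⟨j, rfl⟩))

lemma hnBasis_apply (ha : 1 ≤ a) (hD : IsDworkRoot p (gam p a g)) {r : ℕ} (hr : r ≤ a)
    (j : Fin (n + 1)) : hnBasis (n := n) ha hD hr j = eCls p a n r g j := by
  rw [hnBasis, Module.Basis.mk_apply]

lemma hnBasis_repr_of_decomp (ha : 1 ≤ a) (hD : IsDworkRoot p (gam p a g)) {r : ℕ} (hr : r ≤ a)
    {f : Cr p a n r g} {ζ : Fin (n + 1) → Or p a n r g} {q : Fin n → Cr p a n r g}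
    (h : f = ∑ j, ζ j • (⟨eSer p a n g j, eSer_mem p a n r g j⟩ : Cr p a n r g) +
        ∑ l, DopL hD hr l (q l)) (j : Fin (n + 1)) :
    (hnBasis ha hD hr).repr (cls p a n r g f) j = ζ j := by
  have : cls p a n r g f = ∑ j, ζ j • hnBasis ha hD hr j := by
    simp only [hnBasis_apply]
    rw [h, map_add, ← sum_smul_eCls, (cls_eq_zero_iff _).2 ((mem_bdry_iff hD hr _).2 ⟨q, rfl⟩),
      add_zero]
  rw [this, Module.Basis.repr_sum_self]

/-- The coordinates of a cohomology class satisfy every bound that a representative satisfies. -/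
lemma norm_repr_le (ha : 1 ≤ a) (hD : IsDworkRoot p (gam p a g)) {r : ℕ} (hr : r ≤ a)
    (f : Cr p a n r g) {i : ℕ} (hi : i < p ^ r) {P C : ℝ} (hP : 1 ≤ P) (hPp : P < p)
    (hC : 0 < C) (hf : Ball (Lq p a g) Set.univ (fun b => P ^ mdeg b) C (cf p a n r g f i))
    (j : Fin (n + 1)) (s : ℕ) :
    ‖nco p a n r g ((hnBasis ha hD hr).repr (cls p a n r g f) j) (p ^ r * s + i)‖ *
      P ^ ((n + 1) * s + j) ≤ C := by
  obtain ⟨ζ, q, h⟩ := exists_decomp ha hD hr f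
  rw [hnBasis_repr_of_decomp ha hD hr h]
  exact decomp_bound ha hD hr h hi hP hPp hC hf j s

end Basis

/-! ### The matrix of the connection -/

section ConnMatrix

variable {p a n : ℕ} [hp : Fact p.Prime] {g : PadicAlgCl p}

lemma eps_succ (d : ℕ) (l : Fin n) :
    eps n d l.succ = d / (n + 1) + if (l : ℕ) < d % (n + 1) then 1 else 0 := rfl

lemma eps_zero_of_le {j : ℕ} (hj : j ≤ n) : eps n j 0 = 0 := by
  rw [eps, Fin.cons_zero, Nat.div_eq_of_lt (Nat.lt_succ_of_le hj)]

lemma cf_eSer {r : ℕ} (hg : g ≠ 0) (hr : r ≤ a) {i : ℕ} (j : Fin (n + 1)) :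
    cf p a n r g (eSer p a n g j) i = if i = 0 then Pi.single (eps n j) 1 else 0 := by
  classical
  set c : Fin (n + 1) → ℕ → PadicAlgCl p := fun m s => if m = j ∧ s = 0 then 1 else 0 with hc
  have h1 : ∑ m : Fin (n + 1), tser p a n r g (c m) • eSer p a n g m = eSer p a n g j := by
    rw [Finset.sum_eq_single j]
    · have : tser p a n r g (c j) = 1 := by
        ext s
        rw [PowerSeries.coeff_one, tser, PowerSeries.coeff_mk]
        by_cases hs : s = 0 <;> simp [hc, hs, gpow]
      rw [this, one_smul]
    · intro m _ hm
      have : tser p a n r g (c m) = 0 := by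
        ext s
        simp [tser, hc, hm]
      rw [this, zero_smul]
    · exact fun h => absurd (Finset.mem_univ j) h
  rw [← h1, cf_sum_eSer hg hr]
  split_ifs with hi
  · subst hi
    rw [← embSeq_single mdeg_eps]
    congr 1
    funext d
    rw [vseq, hc]
    dsimp only
    rw [Pi.single_apply]
    refine if_congr ?_ rfl rfl
    have hd := Nat.div_add_mod d (n + 1)
    have hj := j.2
    have hpr := (pow_pos hp.1.pos r).ne'
    constructor
    · rintro ⟨h1, h2⟩
      rw [← h1]
      dsimp only
      have h3 : d / (n + 1) = 0 := by
        rcases Nat.mul_eq_zero.1 (by omega : p ^ r * (d / (n + 1)) = 0) with h | h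
        · exact absurd h hpr
        · exact h
      rw [h3] at hd
      omega
    · rintro rfl
      refine ⟨Fin.ext (Nat.mod_eq_of_lt hj), ?_⟩
      rw [Nat.div_eq_of_lt hj, mul_zero]
  · have : vseq p n r c i = 0 := by
      funext d
      rw [vseq, hc]
      dsimp only
      rw [if_neg]
      · rfl
      · rintro ⟨_, h⟩
        omega
    rw [this, map_zero]

/-- `e_j`, as an element of `𝒞_{p^r}`. -/
abbrev eEl (p a n r : ℕ) [Fact p.Prime] (g : PadicAlgCl p) (j : Fin (n + 1)) : Cr p a n r g :=
  ⟨eSer p a n g j, eSer_mem p a n r g j⟩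

lemma tendsto_ite_zero {c : ℕ → Prop} [DecidablePred c] (h : ∃ N, ∀ s, c s → s ≤ N) :
    Tendsto (fun s => if c s then (1 : PadicAlgCl p) else 0) atTop (𝓝 0) := by
  obtain ⟨N, hN⟩ := h
  refine tendsto_const_nhds.congr' ?_
  filter_upwards [eventually_gt_atTop N] with s hs
  rw [if_neg fun h => absurd (hN s h) (not_le.2 hs)]

/-- The coefficient of `e_m` in `γ^{(n+1)s} t^s e_m` for `d = (n+1)s + m`, and zero otherwise. -/
def unitO (p a n : ℕ) [Fact p.Prime] (g : PadicAlgCl p) (d : ℕ) (m : Fin (n + 1)) : Or p a n 0 g :=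
  mkOr 0 (fun s => if (n + 1) * s + m = d then 1 else 0)
    (fun s => by
      split_ifs
      · exact one_mem _
      · exact zero_mem _)
    (tendsto_ite_zero ⟨d, fun s hs => by nlinarith⟩)

lemma nco_unitO (hg : g ≠ 0) (d : ℕ) (m : Fin (n + 1)) (s : ℕ) :
    nco p a n 0 g (unitO p a n g d m) s = if (n + 1) * s + (m : ℕ) = d then 1 else 0 := by
  exact congrFun (nco_tser (p := p) (a := a) (n := n) hg 0
    fun s => if (n + 1) * s + (m : ℕ) = d then 1 else 0) s

lemma cf_sum_unitO (hg : g ≠ 0) (d : ℕ) :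
    cf p a n 0 g ((∑ m, unitO p a n g d m • eEl p a n 0 g m : Cr p a n 0 g) : Ser p n) 0 =
      Pi.single (eps n d) 1 := by
  have h1 : ((∑ m, unitO p a n g d m • eEl p a n 0 g m : Cr p a n 0 g) : Ser p n) =
      ∑ m : Fin (n + 1), tser p a n 0 g (fun s => if (n + 1) * s + (m : ℕ) = d then 1 else 0) •
        eSer p a n g m := by
    rw [Submodule.coe_sum]
    rfl
  rw [h1, cf_sum_eSer hg (Nat.zero_le a), ← embSeq_single mdeg_eps]
  congr 1
  funext d'
  rw [vseq, Pi.single_apply]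
  dsimp only
  refine if_congr ?_ rfl rfl
  rw [pow_zero, one_mul, add_zero, Nat.div_add_mod]

lemma nco_sub (r : ℕ) (ζ η : PowerSeries (PadicAlgCl p)) (s : ℕ) :
    nco p a n r g (ζ - η) s = nco p a n r g ζ s - nco p a n r g η s := by
  simp [nco, sub_div]

lemma repr_sum_smul_eEl (ha : 1 ≤ a) (hD : IsDworkRoot p (gam p a g)) {r : ℕ} (hr : r ≤ a)
    (ζ : Fin (n + 1) → Or p a n r g) (m : Fin (n + 1)) :
    (hnBasis ha hD hr).repr (cls p a n r g (∑ m, ζ m • eEl p a n r g m)) m = ζ m :=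
  hnBasis_repr_of_decomp ha hD hr (q := 0) (by simp) m

/-- Up to the image of the Koszul differential, `∂_t e_j - Ḡ e_j` is small. -/
lemma norm_conn_repr_sub_le (ha : 1 ≤ a) (hD : IsDworkRoot p (gam p a g)) {P : ℝ} (hP : 1 ≤ P)
    (hPp : P < p) (j m : Fin (n + 1)) (s : ℕ) :
    ‖nco p a n 0 g ((hnBasis ha hD (Nat.zero_le a)).repr (connHom hD (Nat.zero_le a)
      (eCls p a n 0 g j)) m) s - if (n + 1) * s + (m : ℕ) = j + 1 then 1 else 0‖ *
        P ^ ((n + 1) * s + m) ≤ P / p * P ^ ((j : ℕ) + 1) := by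
  have hg := g_ne_zero hD
  have h0 := Nat.zero_le a
  have hp0 : (0 : ℝ) < p := by exact_mod_cast hp.1.pos
  have hP0 : 0 < P := by linarith
  have hdw := dworkSeq_hnorm hD
  -- Modulo small terms `∂_t e_j` is `Y_0 e_j`. For `j < n` the variable `Y_{j+1}` takes the place of
  -- `Y_0` after adding `D_{j+1} e_j`, whose Euler terms vanish because `e_j` involves neither `Y_0`
  -- nor `Y_{j+1}`. For `j = n` already `Y_0 Y_1 ⋯ Y_n = t γ^{n+1} e_0`.
  set D : Cr p a n 0 g := if hj : (j : ℕ) < n then DopL hD h0 ⟨j, hj⟩ (eEl p a n 0 g j) else 0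
    with hDdef
  set f : Cr p a n 0 g := dopL hD h0 (eEl p a n 0 g j) -
    ∑ m, unitO p a n g (j + 1) m • eEl p a n 0 g m + D with hf
  have hcls : cls p a n 0 g f = connHom hD h0 (eCls p a n 0 g j) -
      cls p a n 0 g (∑ m, unitO p a n g (j + 1) m • eEl p a n 0 g m) := by
    have hD0 : cls p a n 0 g D = 0 := by
      rw [hDdef]
      split_ifs with hj
      · rw [cls_eq_zero_iff]
        exact Submodule.subset_span ⟨⟨j, hj⟩, eEl p a n 0 g j, rfl⟩
      · exact map_zero _
    rw [hf, map_add, map_sub, hD0, add_zero, eCls, connHom_cls]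
  have hpos : (0 : ℕ) < p ^ 0 := Nat.one_pos
  have hcf : ∃ l, cf p a n 0 g f 0 =
      mulVar l (tailSeq (hnorm p a g)) (Pi.single (eps n j) 1) := by
    have hej : cf p a n 0 g (eEl p a n 0 g j : Ser p n) 0 = Pi.single (eps n j) 1 := by
      rw [cf_eSer hg h0, if_pos rfl]
    have hjn := Nat.lt_succ_iff.1 j.2
    have e1 : cf p a n 0 g (dopL hD h0 (eEl p a n 0 g j) : Ser p n) 0 =
        Pi.single (up 0 (eps n j)) 1 +
          mulVar 0 (tailSeq (hnorm p a g)) (Pi.single (eps n j) 1) := by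
      have := cf_dop (a := a) hg hpos (supp_eSer (p := p) (a := a) (n := n) (g := g) 0 (j : ℕ))
      rw [cf_eSer hg h0, if_pos rfl, Nat.cast_zero, zero_smul, zero_add, pow_zero, one_smul,
        Eop, LinearMap.add_apply, euler_single, eps_zero_of_le hjn, mulVar_eq_add hdw,
        mulVar_oneSeq_single] at this
      rw [Nat.cast_zero, zero_smul, zero_add] at this
      exact this
    have e2 : cf p a n 0 g (f : Ser p n) 0 = cf p a n 0 g (dopL hD h0 (eEl p a n 0 g j) : Ser p n) 0 -
        Pi.single (eps n (j + 1)) 1 + cf p a n 0 g (D : Ser p n) 0 := by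
      rw [← cf_sum_unitO (p := p) (a := a) hg, hf]
      funext b
      simp [cf, sub_div, add_div]
    rw [e2, e1]
    by_cases hj : (j : ℕ) < n
    · refine ⟨(⟨j, hj⟩ : Fin n).succ, ?_⟩
      have e3 : cf p a n 0 g (D : Ser p n) 0 =
          Dmod (hnorm p a g) ⟨j, hj⟩ (Pi.single (eps n j) 1) := by
        rw [hDdef, dif_pos hj, ← hej]
        exact cf_Dop hg hpos (supp_eSer 0 (j : ℕ)) _
      have hb0 : eps n j (⟨j, hj⟩ : Fin n).succ = 0 := by
        rw [eps_succ, Nat.div_eq_of_lt j.2, Nat.mod_eq_of_lt j.2, if_neg (lt_irrefl _)]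
      have hup : up (⟨j, hj⟩ : Fin n).succ (eps n j) = eps n (j + 1) := by
        have h1 : (j : ℕ) + 1 < n + 1 := by omega
        funext l
        refine Fin.cases ?_ (fun l => ?_) l
        · rw [up_of_ne (Fin.succ_ne_zero _).symm, eps_zero_of_le hjn, eps_zero_of_le (by omega)]
        · by_cases hl : l = ⟨j, hj⟩
          · subst hl
            rw [up_self, hb0]
            rw [eps_succ, Nat.div_eq_of_lt h1, Nat.mod_eq_of_lt h1, if_pos (Nat.lt_succ_self _)]
          · rw [up_of_ne fun h => hl (Fin.succ_injective n h)]
            have hl' : (l : ℕ) ≠ j := fun h => hl (Fin.ext h)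
            simp only [eps_succ, Nat.div_eq_of_lt h1, Nat.mod_eq_of_lt h1,
              Nat.div_eq_of_lt j.2, Nat.mod_eq_of_lt j.2]
            congr 1
            exact if_congr (by omega) rfl rfl
      have e4 : Dmod (hnorm p a g) ⟨j, hj⟩ (Pi.single (eps n j) 1) =
          Dmod (oneSeq p) ⟨j, hj⟩ (Pi.single (eps n j) 1) +
          (mulVar (⟨j, hj⟩ : Fin n).succ (tailSeq (hnorm p a g)) (Pi.single (eps n j) 1) -
            mulVar 0 (tailSeq (hnorm p a g)) (Pi.single (eps n j) 1)) := by
        simp only [Dmod, Eop, LinearMap.sub_apply, LinearMap.add_apply, mulVar_eq_add hdw]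
        abel
      rw [e3, e4, Dmod_oneSeq_single, hb0, eps_zero_of_le hjn, hup]
      simp only [Nat.cast_zero, sub_self, zero_smul]
      abel
    · refine ⟨0, ?_⟩
      have hjn' : (j : ℕ) = n := by omega
      have hup : up 0 (eps n j) = eps n (j + 1) := by
        have h1 : ((j : ℕ) + 1) / (n + 1) = 1 := by rw [hjn', Nat.div_self n.succ_pos]
        have h2 : ((j : ℕ) + 1) % (n + 1) = 0 := by rw [hjn', Nat.mod_self]
        funext l
        refine Fin.cases ?_ (fun l => ?_) l
        · rw [up_self, eps_zero_of_le hjn, eps, Fin.cons_zero, h1]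
        · rw [up_of_ne (Fin.succ_ne_zero _)]
          simp only [eps_succ, h1, h2, Nat.div_eq_of_lt j.2, Nat.mod_eq_of_lt j.2]
          rw [if_pos (by omega), if_neg (by omega)]
      have e3 : cf p a n 0 g (D : Ser p n) 0 = 0 := by
        rw [hDdef, dif_neg hj]
        funext b
        simp [cf]
      rw [e3, hup]
      abel
  obtain ⟨l, hl⟩ := hcf
  have hball : Ball (Lq p a g) Set.univ (fun b => P ^ mdeg b) (P / p * P ^ ((j : ℕ) + 1))
      (cf p a n 0 g f 0) := by
    have h1 := ball_mulVar (L := Lq p a g) (S := Set.univ) (S' := Set.univ) (l := l) hP0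
      (by positivity : 0 < P * (P / p)) (by positivity : 0 < P ^ (j : ℕ))
      (fun a ha => absurd (Set.mem_univ a) ha) (tailSeq_ball hdw hP hPp)
      (Ball.single (i := eps n j) (Set.mem_univ _) (by positivity) (by rw [mdeg_eps]))
    rw [hl]
    refine h1.mono (le_of_eq ?_)
    ring
  have := norm_repr_le ha hD h0 f hpos hP hPp (by positivity) hball m s
  rw [pow_zero, one_mul, add_zero, hcls, map_sub, Finsupp.sub_apply, repr_sum_smul_eEl ha hD h0,
    AddSubgroupClass.coe_sub, nco_sub, nco_unitO hg] at this
  exact this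

/-- The connection on `H^n(𝒞_p)` in terms of the one on `H^n(𝒞)`: by functoriality for `t ↦ t^p`,
its matrix is `p` times the matrix of `∂_t` at `t^p`. -/
lemma conn_repr_frob (ha : 1 ≤ a) (hD : IsDworkRoot p (gam p a g)) (j m : Fin (n + 1)) (s : ℕ) :
    nco p a n 1 g ((hnBasis ha hD ha).repr (connHom hD ha (eCls p a n 1 g j)) m) s =
      if p ∣ s then p * nco p a n 0 g ((hnBasis ha hD (Nat.zero_le a)).repr
        (connHom hD (Nat.zero_le a) (eCls p a n 0 g j)) m) (s / p) else 0 := by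
  have hg := g_ne_zero hD
  have h0 := Nat.zero_le a
  have hp1 : p ^ 1 = p := pow_one p
  obtain ⟨ζ, q, h⟩ := exists_decomp ha hD h0 (dopL hD h0 (eEl p a n 0 g j))
  have hrepr : ∀ m, (hnBasis ha hD h0).repr (connHom hD h0 (eCls p a n 0 g j)) m = ζ m :=
    fun m => by rw [eCls, connHom_cls, hnBasis_repr_of_decomp ha hD h0 h]
  -- Transport the decomposition of `∂_t e_j` along `t ↦ t^p`, which multiplies `∂_t` by `p`; only
  -- the residue class `0` modulo `p` of exponents of `t` occurs.
  let c : Fin (n + 1) → ℕ → PadicAlgCl p := fun m s =>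
    if p ∣ s then p * nco p a n 0 g (ζ m) (s / p) else 0
  have hc : ∀ m s, c m s ∈ Oq p a g := fun m s => by
    dsimp only [c]
    split_ifs
    · exact mul_mem (natCast_mem _ _) (nco_mem hg (ζ m) _)
    · exact zero_mem _
  have hc0 : ∀ m, Tendsto (c m) atTop (𝓝 0) := fun m => by
    have h1 := nco_tendsto hg (ζ m)
    rw [Metric.tendsto_atTop] at h1 ⊢
    intro ε hε
    obtain ⟨N, hN⟩ := h1 ε hε
    refine ⟨p * N, fun s hs => ?_⟩
    dsimp only [c]
    split_ifs with hd
    · have h2 := hN (s / p) ((Nat.le_div_iff_mul_le hp.1.pos).2 (by rw [mul_comm]; exact hs))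
      rw [dist_zero_right] at h2 ⊢
      rw [norm_mul]
      exact lt_of_le_of_lt (mul_le_of_le_one_left (norm_nonneg _) (norm_natCast_le_one p p)) h2
    · simpa using hε
  let y : Fin n → ℕ → Mon n → PadicAlgCl p := fun l i =>
    if i = 0 then (p : PadicAlgCl p) • cf p a n 0 g (q l) 0 else 0
  have hy : ∀ l, ∀ i < p ^ 1, Ball (Lq p a g) Set.univ (fun _ => 1) 1 (y l i) := fun l i _ => by
    dsimp only [y]
    split_ifs
    · exact Ball.smul_le (natCast_mem _ _) (norm_natCast_le_one p p) zero_le_one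
        (ball_cf hg h0 (q l).2 Nat.one_pos)
    · exact Ball.zero zero_le_one
  have hdec : dopL hD ha (eEl p a n 1 g j) =
      ∑ m, (mkOr 1 (c m) (hc m) (hc0 m) : Or p a n 1 g) • eEl p a n 1 g m +
        ∑ l, DopL hD ha l ⟨_, ofModel_mem hg ha (hy l)⟩ := by
    refine Subtype.ext ?_
    have h1 : ((∑ m, (mkOr 1 (c m) (hc m) (hc0 m) : Or p a n 1 g) • eEl p a n 1 g m :
        Cr p a n 1 g) : Ser p n) = ∑ m : Fin (n + 1), tser p a n 1 g (c m) • eSer p a n g m := by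
      rw [Submodule.coe_sum]
      rfl
    have h2 : ((∑ l, DopL hD ha l ⟨_, ofModel_mem hg ha (hy l)⟩ : Cr p a n 1 g) : Ser p n) =
        ∑ l, Dop p a n 1 g l (ofModel p a n 1 g (y l)) := by
      rw [Submodule.coe_sum]
      rfl
    have h3 : Supp 1 (∑ m : Fin (n + 1), tser p a n 1 g (c m) • eSer p a n g m) :=
      Supp.sum _ fun m _ => (supp_eSer 1 (m : ℕ)).smul _
    rw [Submodule.coe_add, h1, h2]
    refine eq_of_cf_eq (a := a) hg (supp_eSer 1 (j : ℕ)).dop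
      (h3.add (Supp.sum _ fun l _ => (supp_ofModel 1 (y l)).dopX l)) fun i hi => ?_
    change cf p a n 1 g (dop p a n 1 g (eSer p a n g j)) i = _
    rw [cf_add, cf_sum_eSer hg ha, cf_sum, cf_dop hg hi (supp_eSer 1 (j : ℕ)), cf_eSer hg ha]
    have h4 : ∑ l, cf p a n 1 g (Dop p a n 1 g l (ofModel p a n 1 g (y l))) i =
        ∑ l, Dmod (hnorm p a g) l (y l i) := Finset.sum_congr rfl fun l _ => by
      rw [cf_Dop hg hi (supp_ofModel 1 (y l)), cf_ofModel hg hi]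
    rw [h4]
    by_cases hi0 : i = 0
    · subst hi0
      have h5 := cf_decomp hD h0 h Nat.one_pos
      have h6 := cf_dop (a := a) hg (r := 0) Nat.one_pos
        (supp_eSer (p := p) (a := a) (n := n) (g := g) 0 (j : ℕ))
      rw [cf_eSer hg h0, if_pos rfl, Nat.cast_zero, zero_smul, zero_add, pow_zero, one_smul] at h6
      change cf p a n 0 g (dop p a n 0 g (eSer p a n g j)) 0 = _ at h5
      rw [if_pos rfl, Nat.cast_zero, zero_smul, zero_add, pow_one, ← h6, h5, smul_add,
        Finset.smul_sum, ← map_smul]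
      congr 1
      · congr 1
        funext d
        rw [Pi.smul_apply, vseq, vseq]
        dsimp only [c]
        rw [pow_one, add_zero, add_zero, if_pos (dvd_mul_right _ _),
          Nat.mul_div_cancel_left _ hp.1.pos, pow_zero, one_mul, smul_eq_mul]
      · refine Finset.sum_congr rfl fun l _ => ?_
        dsimp only [y]
        rw [if_pos rfl, map_smul]
    · rw [if_neg hi0]
      have h5 : vseq p n 1 c i = 0 := by
        funext d
        rw [vseq]
        dsimp only [c]
        rw [if_neg]
        · rfl
        · rw [pow_one, Nat.dvd_add_right (dvd_mul_right _ _)]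
          intro hdvd
          rw [pow_one] at hi
          exact hi0 (Nat.eq_zero_of_dvd_of_lt hdvd hi)
      rw [h5, Finset.sum_eq_zero fun l _ => by dsimp only [y]; rw [if_neg hi0, map_zero]]
      simp
  have h7 := hnBasis_repr_of_decomp ha hD ha hdec m
  rw [eCls, connHom_cls, h7, hrepr]
  exact congrFun (nco_tser hg 1 _) s

end ConnMatrix

/-! ### The relative Frobenius -/

section Frobenius

variable {p a n : ℕ} [hp : Fact p.Prime] {g : PadicAlgCl p}

lemma supp_Fser : Supp 0 (Fser p a n g) := fun u N hN => by
  rw [pow_zero, one_mul] at hN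
  rw [Fser, PowerSeries.coeff_mk, if_neg (not_le.2 hN)]

lemma toMon_Fser (B : Mon n) : toMon (Fser p a n g) B = ∏ l, theta p a g (B l) := by
  rw [toMon, Fser, PowerSeries.coeff_mk, if_pos (mfun_mpos B), Fin.prod_univ_succ, mul_comm]
  congr 1
  refine Finset.prod_congr rfl fun l _ => ?_
  congr 1
  rw [mpos]
  omega

/-- The coefficients of the logarithmic derivative of `θ`. -/
lemma mul_theta (j : ℕ) : (j : PadicAlgCl p) * theta p a g j =
    ∑ m ∈ Finset.range (j + 1), hs p a g m * theta p a g (j - m) -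
      p * ∑ m ∈ Finset.range (j / p + 1), hs p a g m * theta p a g (j - p * m) := by
  -- Compare the coefficients of `T^j` in `T θ'(T) = θ(T) (h(T) - p h(T^p))`.
  have h := congrArg (PowerSeries.coeff j) (X_mul_derivative_thetaSer (p := p) (a := a) (g := g))
  have h1 : PowerSeries.coeff j (PowerSeries.X * PowerSeries.derivative (PadicAlgCl p)
      (thetaSer p a g)) = (j : PadicAlgCl p) * theta p a g j := by
    cases j with
    | zero => simp
    | succ j =>
      rw [PowerSeries.coeff_succ_X_mul, PowerSeries.coeff_derivative, thetaSer,
        PowerSeries.coeff_mk, mul_comm]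
      push_cast
      rfl
  rw [h1] at h
  rw [h, mul_sub, map_sub, mul_comm (thetaSer p a g), PowerSeries.coeff_mul,
    Finset.Nat.sum_antidiagonal_eq_sum_range_succ_mk]
  congr 1
  · refine Finset.sum_congr rfl fun m _ => ?_
    rw [hs, thetaSer, PowerSeries.coeff_mk]
  · have e : thetaSer p a g * ((p : PowerSeries (PadicAlgCl p)) *
        PowerSeries.expand p hp.1.ne_zero (hSer p a g)) =
        PowerSeries.C (p : PadicAlgCl p) *
          (PowerSeries.expand p hp.1.ne_zero (hSer p a g) * thetaSer p a g) := by
      rw [map_natCast]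
      ring
    rw [e, PowerSeries.coeff_C_mul, PowerSeries.coeff_mul,
      Finset.Nat.sum_antidiagonal_eq_sum_range_succ_mk]
    congr 1
    symm
    refine Finset.sum_of_injOn (fun m => p * m) ?_ ?_ ?_ ?_
    · intro m _ m' _ h
      exact Nat.eq_of_mul_eq_mul_left hp.1.pos h
    · intro m hm
      simp only [Finset.coe_range, Set.mem_Iio] at hm ⊢
      have := Nat.mul_le_mul_left p (Nat.lt_succ_iff.1 hm)
      have := Nat.mul_div_le j p
      omega
    · intro m hm hnot
      dsimp only
      rw [PowerSeries.coeff_expand, if_neg, zero_mul]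
      rintro ⟨k, rfl⟩
      refine hnot ⟨k, ?_, rfl⟩
      rw [Finset.mem_range] at hm
      simp only [Finset.coe_range, Set.mem_Iio]
      refine Nat.lt_succ_of_le ((Nat.le_div_iff_mul_le hp.1.pos).2 ?_)
      rw [mul_comm]
      omega
    · intro m _
      dsimp only
      rw [PowerSeries.coeff_expand, if_pos (dvd_mul_right _ _), Nat.mul_div_cancel_left _ hp.1.pos,
        hs, thetaSer, PowerSeries.coeff_mk]

lemma mulMon_nsmul_evar (k : ℕ) (hk : 0 < k) (l : Fin (n + 1)) (h : ℕ → PadicAlgCl p)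
    (f : Mon n → PadicAlgCl p) (A : Mon n) : mulMon (k • evar l) h f A =
      ∑ m ∈ Finset.range (A l / k + 1), h m * f (Function.update A l (A l - k * m)) := by
  have hiff : ∀ m, m • (k • evar l) ≤ A ↔ m ≤ A l / k := by
    intro m
    rw [Nat.le_div_iff_mul_le hk]
    constructor
    · intro h
      simpa using h l
    · intro h j
      rcases eq_or_ne j l with rfl | hj
      · simpa using h
      · simp [hj]
  have hz : k • evar l ≠ 0 := fun h => by
    have := congrFun h l
    simp at this
    omega
  rw [mulMon_eq_range hz h f A (k := A l / k) (fun m hm => (hiff m).2 hm)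
    fun m hm hle => absurd ((hiff m).1 hle) (not_le.2 hm)]
  refine Finset.sum_congr rfl fun m _ => ?_
  congr 2
  funext j
  rcases eq_or_ne j l with rfl | hj
  · simp [mul_comm]
  · simp [hj]

lemma prod_theta_update (A : Mon n) (l : Fin (n + 1)) (m : ℕ) :
    ∏ j, theta p a g (Function.update A l m j) =
      theta p a g m * ∏ j ∈ Finset.univ.erase l, theta p a g (A j) := by
  rw [← Finset.mul_prod_erase _ _ (Finset.mem_univ l), Function.update_self]
  congr 1
  refine Finset.prod_congr rfl fun j hj => ?_
  rw [Function.update_of_ne (Finset.ne_of_mem_erase hj)]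

/-- `y_l ∂F/∂y_l = F · (h(y_l) - p h(y_l^p))`. -/
lemma euler_Fser (l : Fin (n + 1)) : euler l (toMon (Fser p a n g)) =
    mulMon (evar l) (hs p a g) (toMon (Fser p a n g)) -
      (p : PadicAlgCl p) • mulMon (p • evar l) (hs p a g) (toMon (Fser p a n g)) := by
  funext A
  have h1 := mulMon_nsmul_evar 1 Nat.one_pos l (hs p a g) (toMon (Fser p a n g)) A
  rw [one_smul] at h1
  rw [Pi.sub_apply, Pi.smul_apply, smul_eq_mul, h1, mulMon_nsmul_evar p hp.1.pos, euler_apply]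
  simp only [toMon_Fser, prod_theta_update, Nat.div_one, one_mul]
  rw [← Finset.mul_prod_erase Finset.univ (fun j => theta p a g (A j)) (Finset.mem_univ l),
    ← mul_assoc, mul_theta, sub_mul, Finset.sum_mul, mul_assoc, Finset.sum_mul]
  congr 1
  · exact Finset.sum_congr rfl fun m _ => by ring
  · congr 1
    exact Finset.sum_congr rfl fun m _ => by ring

lemma nsmul_evar_ne_zero {k : ℕ} (hk : 0 < k) (l : Fin (n + 1)) : k • evar l ≠ 0 := fun h => by
  have := congrFun h l
  simp at this
  omega

/-- Conjugation by `F` turns `y_l ∂/∂y_l + h(y_l)` into `y_l ∂/∂y_l + p h(y_l^p)`. -/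
lemma mconv_Fser_euler (l : Fin (n + 1)) (f : Mon n → PadicAlgCl p) :
    mconv (toMon (Fser p a n g)) (euler l f + mulMon (evar l) (hs p a g) f) =
      euler l (mconv (toMon (Fser p a n g)) f) +
        (p : PadicAlgCl p) • mulMon (p • evar l) (hs p a g) (mconv (toMon (Fser p a n g)) f) := by
  have h1 := euler_mconv l (toMon (Fser p a n g)) f
  rw [euler_Fser, mconv_comm (_ - _), mconv_sub, mconv_smul, mconv_comm f, mconv_comm f,
    mulMon_mconv (evar_ne_zero l), mulMon_mconv (nsmul_evar_ne_zero hp.1.pos l)] at h1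
  rw [mconv_add, mconv_mulMon (evar_ne_zero l), h1]
  abel

lemma mdeg_residue (i : ℕ) (b : Mon n) : mdeg (fun l => p * b l + i) = p * mdeg b + (n + 1) * i := by
  unfold mdeg
  rw [Finset.sum_add_distrib, Finset.mul_sum]
  simp

/-- The coefficients of `α_1 f`. -/
lemma cf_alphaOp {f : Ser p n} (hf : Supp 0 f) (i : ℕ) (b : Mon n) :
    cf p a n 1 g (alphaOp p a n g f) i b =
      mconv (toMon (Fser p a n g)) (toMon f) (fun l => p * b l + i) / wfac p a n 1 g i b := by
  rw [← toMon_smulS supp_Fser hf, cf, toMon, alphaOp, pow_one]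
  congr 3
  funext l
  simp only [Pi.smul_apply, mpos, smul_eq_mul]
  push_cast
  ring

lemma mfun_prime_smul (u : Fin n → ℤ) : p * mfun u ≤ mfun ((p : ℤ) • u) := by
  have hp0 : (0 : ℤ) < p := by exact_mod_cast hp.1.pos
  rw [mul_comm, ← Nat.le_div_iff_mul_le hp.1.pos, mfun_le_iff]
  intro l
  have h := le_mfun ((p : ℤ) • u) l
  rw [Pi.smul_apply, smul_eq_mul] at h
  have h2 : (-(u l)) ≤ (mfun ((p : ℤ) • u) : ℤ) / p := by
    rw [Int.le_ediv_iff_mul_le hp0]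
    linarith
  push_cast
  omega

lemma supp_alphaOp {f : Ser p n} (hf : Supp 0 f) : Supp 1 (alphaOp p a n g f) := by
  intro u N hN
  refine supp_smulS supp_Fser hf _ _ ?_
  rw [pow_one] at hN
  rw [pow_zero, one_mul]
  exact hN.trans_le (mfun_prime_smul u)

lemma ridx_zero (C : Mon n) : ridx p 0 0 C = C := by
  funext l
  refine Fin.cases ?_ (fun l => ?_) l
  · simp [ridx]
  · simp only [ridx, Fin.cons_succ, pow_zero, one_mul]
    omega

lemma toMon_eq_cf (hg : g ≠ 0) (f : Ser p n) (C : Mon n) :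
    toMon f C = cf p a n 0 g f 0 C * gam p a g ^ mdeg C := by
  have := toMon_ridx (p := p) (a := a) hg 0 0 f C
  rw [ridx_zero] at this
  rw [this, wfac, gam, ← pow_mul]
  simp

/-- `|γ|^{|A|}` bounds the coefficients of `F` and of the elements of `𝒞`. -/
lemma norm_mconv_le (hD : IsDworkRoot p (gam p a g)) {f : Ser p n} (hf : f ∈ Cr p a n 0 g)
    (A : Mon n) : ‖mconv (toMon (Fser p a n g)) (toMon f) A‖ ≤ ‖gam p a g‖ ^ mdeg A := by
  have hg := g_ne_zero hD
  refine IsUltrametricDist.norm_sum_le_of_forall_le_of_nonneg (by positivity) fun B hB => ?_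
  rw [Finset.mem_Iic] at hB
  have hAB : mdeg A = mdeg B + mdeg (A - B) := by
    unfold mdeg
    rw [← Finset.sum_add_distrib]
    refine Finset.sum_congr rfl fun l _ => ?_
    have : B l ≤ A l := hB l
    rw [Pi.sub_apply]
    omega
  have h1 : ‖toMon (Fser p a n g) B‖ ≤ ‖gam p a g‖ ^ mdeg B := by
    rw [toMon_Fser, norm_prod, mdeg, ← Finset.prod_pow_eq_pow_sum]
    exact Finset.prod_le_prod (fun _ _ => norm_nonneg _) fun l _ => norm_theta_le _
  have h2 : ‖toMon f (A - B)‖ ≤ ‖gam p a g‖ ^ mdeg (A - B) := by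
    rw [toMon_eq_cf (a := a) hg, norm_mul, norm_pow]
    refine mul_le_of_le_one_left (by positivity) ?_
    have := (ball_cf hg (Nat.zero_le a) hf Nat.one_pos).2.2.1 (A - B)
    rwa [mul_one] at this
  rw [norm_mul, hAB, pow_add]
  exact mul_le_mul h1 h2 (norm_nonneg _) (by positivity)

lemma toMon_mem_Lq (hg : g ≠ 0) {f : Ser p n} (hf : f ∈ Cr p a n 0 g) (C : Mon n) :
    toMon f C ∈ Lq p a g := by
  rw [toMon_eq_cf (a := a) hg]
  exact mul_mem ((ball_cf hg (Nat.zero_le a) hf Nat.one_pos).1 C) (pow_mem gam_mem_Lq _)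

/-- `ord_p` of the coefficient of `γ^{|b|} γ^{i(n+1)/p}` in `α_1 f` is at least
`|b| + i (n+1)/p`. -/
lemma norm_cf_alphaOp_le (ha : 1 ≤ a) (hD : IsDworkRoot p (gam p a g)) {f : Ser p n}
    (hf : f ∈ Cr p a n 0 g) (i : ℕ) (b : Mon n) : ‖cf p a n 1 g (alphaOp p a n g f) i b‖ ≤
      ((p : ℝ)⁻¹) ^ mdeg b * (‖g‖ ^ (p ^ (a - 1) * (p - 1))) ^ ((n + 1) * i) := by
  have hg := g_ne_zero hD
  have hg0 : 0 < ‖g‖ := norm_pos_iff.2 hg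
  have hpa : p ^ a = p ^ (a - 1) * p := by rw [← pow_succ, Nat.sub_add_cancel ha]
  obtain ⟨P, hP⟩ := Nat.exists_eq_succ_of_ne_zero hp.1.ne_zero
  have hP' : p - 1 = P := by omega
  rw [cf_alphaOp (supp_of_mem_Cr hg (Nat.zero_le a) hf), norm_div,
    div_le_iff₀ (norm_pos_iff.2 (wfac_ne_zero hg _ _ _))]
  refine (norm_mconv_le hD hf _).trans (le_of_eq ?_)
  rw [mdeg_residue, wfac, norm_pow, ← hD.2, gam, norm_pow, hP', ← pow_mul, ← pow_mul, ← pow_mul,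
    ← pow_mul, ← pow_add, ← pow_add]
  congr 1
  have : p = P + 1 := hP
  rw [hpa]
  generalize p ^ (a - 1) = Q
  rw [this]
  ring

lemma finite_mdeg_lt (N : ℕ) : {b : Mon n | mdeg b < N}.Finite := by
  refine (Set.Finite.pi fun _ : Fin (n + 1) => Set.finite_Iio N).subset fun b hb l _ => ?_
  rw [Set.mem_ofPred_eq] at hb
  exact lt_of_le_of_lt (Finset.single_le_sum (f := b) (fun _ _ => Nat.zero_le _)
    (Finset.mem_univ l)) hb

/-- The operator `α_1` improves convergence: the image of a bounded element satisfies bounds for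
every rate of growth `R^p < p`. -/
lemma ball_alphaOp (ha : 1 ≤ a) (hD : IsDworkRoot p (gam p a g)) {f : Ser p n}
    (hf : f ∈ Cr p a n 0 g) (i : ℕ) {R : ℝ} (hR : 1 ≤ R) (hRp : R ^ p < p) :
    Ball (Lq p a g) Set.univ (fun b => (R ^ p) ^ mdeg b) ((R⁻¹) ^ ((n + 1) * i))
      (cf p a n 1 g (alphaOp p a n g f) i) := by
  have hg := g_ne_zero hD
  have hp0 : (0 : ℝ) < p := by exact_mod_cast hp.1.pos
  have hR0 : 0 < R := by linarith
  set P := R ^ p with hPdef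
  have hP0 : 0 < P := by positivity
  have hq1 : P / p < 1 := (div_lt_one hp0).2 hRp
  -- The `p`-th power of the left hand side is `|γ|^{p-1} = 1/p`.
  have hρ : ‖g‖ ^ (p ^ (a - 1) * (p - 1)) ≤ R⁻¹ := by
    refine le_of_lt (lt_of_pow_lt_pow_left₀ p (by positivity) ?_)
    have h1 : (‖g‖ ^ (p ^ (a - 1) * (p - 1))) ^ p = (p : ℝ)⁻¹ := by
      have hpa : p ^ a = p ^ (a - 1) * p := by rw [← pow_succ, Nat.sub_add_cancel ha]
      rw [← hD.2, gam, norm_pow, ← pow_mul, ← pow_mul, hpa]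
      congr 1
      ring
    rw [h1, inv_pow]
    exact inv_strictAnti₀ hP0 hRp
  have key : ∀ b, ‖cf p a n 1 g (alphaOp p a n g f) i b‖ * P ^ mdeg b ≤
      (P / p) ^ mdeg b * (R⁻¹) ^ ((n + 1) * i) := fun b => by
    calc _ ≤ ((p : ℝ)⁻¹) ^ mdeg b * (R⁻¹) ^ ((n + 1) * i) * P ^ mdeg b := by
          gcongr
          refine (norm_cf_alphaOp_le ha hD hf i b).trans ?_
          gcongr
      _ = _ := by rw [div_eq_mul_inv, mul_pow]; ring
  have hC : 0 < (R⁻¹) ^ ((n + 1) * i) := by positivity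
  refine ⟨fun b => ?_, fun b hb => absurd (Set.mem_univ b) hb, fun b => ?_, fun ε hε => ?_⟩
  · rw [cf_alphaOp (supp_of_mem_Cr hg (Nat.zero_le a) hf)]
    refine div_mem (sum_mem fun B _ => mul_mem ?_ (toMon_mem_Lq hg hf _)) (wfac_mem _ _ _)
    rw [toMon_Fser]
    exact prod_mem fun l _ => theta_mem_Lq _
  · exact (key b).trans (mul_le_of_le_one_left hC.le (pow_le_one₀ (by positivity) hq1.le))
  · obtain ⟨N, hN⟩ := exists_pow_lt_of_lt_one (show 0 < ε / (R⁻¹) ^ ((n + 1) * i) by positivity) hq1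
    refine (finite_mdeg_lt N).subset fun b hb => ?_
    rw [Set.mem_ofPred_eq] at hb ⊢
    by_contra! hcon
    have h1 := hb.trans_le (key b)
    have h2 : (P / p) ^ mdeg b ≤ (P / p) ^ N :=
      pow_le_pow_of_le_one (by positivity) hq1.le hcon
    rw [lt_div_iff₀ hC] at hN
    nlinarith

lemma alphaOp_mem (ha : 1 ≤ a) (hD : IsDworkRoot p (gam p a g)) {f : Ser p n}
    (hf : f ∈ Cr p a n 0 g) : alphaOp p a n g f ∈ Cr p a n 1 g := by
  have hg := g_ne_zero hD
  refine mem_Cr_of_cf hg ha (supp_alphaOp (supp_of_mem_Cr hg (Nat.zero_le a) hf)) fun i _ => ?_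
  have := ball_alphaOp ha hD hf i le_rfl (by rw [one_pow]; exact one_lt_prime)
  simpa only [inv_one, one_pow] using this

lemma alphaOp_add {f f' : Ser p n} (hf : Supp 0 f) (hf' : Supp 0 f') :
    alphaOp p a n g (f + f') = alphaOp p a n g f + alphaOp p a n g f' := by
  funext u
  rw [alphaOp, smulS_add supp_Fser hf hf']
  rfl

lemma alphaOp_smul {f : Ser p n} (hf : Supp 0 f) (ζ : PowerSeries (PadicAlgCl p)) :
    alphaOp p a n g (ζ • f) = ζ • alphaOp p a n g f := by
  funext u
  rw [alphaOp, smulS_smul supp_Fser hf]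
  rfl

lemma mulMon_nsmul_evar_residue (hg : g ≠ 0) {i : ℕ} (hi : i < p) (l : Fin (n + 1))
    {f : Ser p n} (hf : Supp 0 f) (b : Mon n) :
    mulMon (p • evar l) (hs p a g) (mconv (toMon (Fser p a n g)) (toMon f)) (fun l => p * b l + i) =
      wfac p a n 1 g i b * mulVar l (hnorm p a g) (cf p a n 1 g (alphaOp p a n g f) i) b := by
  rw [mulMon_nsmul_evar p hp.1.pos, mulVar_apply, Finset.mul_sum, Nat.mul_add_div hp.1.pos,
    Nat.div_eq_of_lt hi, add_zero]
  refine Finset.sum_congr rfl fun m hm => ?_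
  rw [Finset.mem_range, Nat.lt_succ_iff] at hm
  have e : Function.update (fun l => p * b l + i) l (p * b l + i - p * m) =
      fun j => p * Function.update b l (b l - m) j + i := by
    funext j
    rcases eq_or_ne j l with rfl | hj
    · rw [Function.update_self, Function.update_self, Nat.mul_sub]
      have := Nat.mul_le_mul_left p hm
      omega
    · rw [Function.update_of_ne hj, Function.update_of_ne hj]
  rw [e, cf_alphaOp hf, wfac_update 1 i hm, hnorm]
  have h1 := pow_ne_zero m (pow_ne_zero (p ^ a) hg)
  have h2 := wfac_ne_zero (p := p) (a := a) (n := n) hg 1 i (Function.update b l (b l - m))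
  rw [gam]
  field_simp

lemma toMon_Dop_zero (l : Fin n) {f : Ser p n} (hf : Supp 0 f) :
    toMon (Dop p a n 0 g l f) = (euler l.succ (toMon f) + mulMon (evar l.succ) (hs p a g) (toMon f)) -
      (euler 0 (toMon f) + mulMon (evar 0) (hs p a g) (toMon f)) := by
  funext A
  rw [Dop, toMon_add, Pi.add_apply, toMon_xD, toMon_smulS ((supp_Hser 0).xD l) hf, toMon_xD_Hser,
    mconv_comm, mconv_sub, mconv_comm, mconv_lineMon (evar_ne_zero _), mconv_comm,
    mconv_lineMon (zvar_ne_zero 0), zvar_zero]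
  simp only [Pi.sub_apply, Pi.add_apply, euler_apply]
  ring

lemma toMon_dop_zero {f : Ser p n} (hf : Supp 0 f) :
    toMon (dop p a n 0 g f) = euler 0 (toMon f) + mulMon (evar 0) (hs p a g) (toMon f) := by
  funext A
  rw [dop, toMon_add, Pi.add_apply, toMon_tD, toMon_smulS (supp_Hser 0).tD hf, toMon_tD_Hser,
    mconv_comm, mconv_smul, mconv_comm, mconv_lineMon (zvar_ne_zero 0), zvar_zero, pow_zero,
    one_smul]
  rfl

/-- `α_1 D_{t,l} = p D_{t^p,l} α_1`. -/
lemma alphaOp_Dop (hg : g ≠ 0) (l : Fin n) {f : Ser p n} (hf : Supp 0 f) :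
    alphaOp p a n g (Dop p a n 0 g l f) =
      PowerSeries.C (p : PadicAlgCl p) • Dop p a n 1 g l (alphaOp p a n g f) := by
  have hs1 := supp_alphaOp (a := a) (g := g) hf
  refine eq_of_cf_eq (a := a) hg (supp_alphaOp (hf.dopX l)) ((hs1.dopX l).smul _) fun i hi => ?_
  rw [pow_one] at hi
  funext b
  rw [cf_alphaOp (hf.dopX l), toMon_Dop_zero l hf, mconv_sub, mconv_Fser_euler, mconv_Fser_euler,
    cf_smul_const, cf_Dop hg (by rwa [pow_one]) hs1]
  simp only [Pi.sub_apply, Pi.add_apply, Pi.smul_apply, smul_eq_mul, euler_apply,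
    mulMon_nsmul_evar_residue hg hi _ hf, Dmod_apply, cf_alphaOp hf i b]
  have := wfac_ne_zero (p := p) (a := a) (n := n) hg 1 i b
  push_cast
  field_simp
  ring

/-- `α_1 ∂_t = ∂_{t^p} α_1`. -/
lemma alphaOp_dop (hg : g ≠ 0) {f : Ser p n} (hf : Supp 0 f) :
    alphaOp p a n g (dop p a n 0 g f) = dop p a n 1 g (alphaOp p a n g f) := by
  have hs1 := supp_alphaOp (a := a) (g := g) hf
  refine eq_of_cf_eq (a := a) hg (supp_alphaOp hf.dop) hs1.dop fun i hi => ?_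
  rw [pow_one] at hi
  funext b
  rw [cf_alphaOp hf.dop, toMon_dop_zero hf, mconv_Fser_euler, cf_dop hg (by rwa [pow_one]) hs1]
  simp only [Pi.add_apply, Pi.smul_apply, smul_eq_mul, euler_apply, Eop, LinearMap.add_apply,
    mulMon_nsmul_evar_residue hg hi _ hf, cf_alphaOp hf i b]
  have := wfac_ne_zero (p := p) (a := a) (n := n) hg 1 i b
  push_cast
  field_simp
  ring

/-- The operator `α_1` on `𝒞`. -/
def alphaL (ha : 1 ≤ a) (hD : IsDworkRoot p (gam p a g)) : Cr p a n 0 g →+ Cr p a n 1 g :=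
  AddMonoidHom.mk' (fun f => ⟨alphaOp p a n g f, alphaOp_mem ha hD f.2⟩) fun f f' =>
    Subtype.ext (alphaOp_add (supp_of_mem_Cr (g_ne_zero hD) (Nat.zero_le a) f.2)
      (supp_of_mem_Cr (g_ne_zero hD) (Nat.zero_le a) f'.2))

/-- `𝒪_1` is contained in `𝒪_p` because `γ^{s(n+1)}` is a multiple of `γ^{s(n+1)/p}`. -/
lemma mem_Or_one (ha : 1 ≤ a) (hD : IsDworkRoot p (gam p a g)) (ζ : Or p a n 0 g) :
    (ζ : PowerSeries (PadicAlgCl p)) ∈ Or p a n 1 g := by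
  obtain ⟨c, hc, hc0, hζ⟩ := ζ.2
  have hpa : p ^ a = p ^ (a - 1) + p ^ (a - 1) * (p - 1) := by
    obtain ⟨P, hP⟩ := Nat.exists_eq_succ_of_ne_zero hp.1.ne_zero
    have : p ^ a = p ^ (a - 1) * p := by rw [← pow_succ, Nat.sub_add_cancel ha]
    rw [this]
    generalize p ^ (a - 1) = Q
    rw [hP, Nat.succ_sub_one, Nat.succ_eq_add_one]
    ring
  have hpow : ∀ k, g ^ k ∈ Oq p a g := fun k => ⟨pow_mem g_mem_Lq _, by
    rw [norm_pow]; exact pow_le_one₀ (norm_nonneg _) (norm_g_lt_one hD).le⟩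
  refine ⟨fun s => c s * g ^ (p ^ (a - 1) * (p - 1) * ((n + 1) * s)),
    fun s => mul_mem (hc s) (hpow _), ?_, ?_⟩
  · refine squeeze_zero_norm (fun s => ?_) (tendsto_zero_iff_norm_tendsto_zero.1 hc0)
    rw [norm_mul]
    exact mul_le_of_le_one_right (norm_nonneg _) (hpow _).2
  · rw [hζ]
    ext s
    rw [tser, tser, PowerSeries.coeff_mk, PowerSeries.coeff_mk, gpow, gpow, mul_assoc, ← pow_add,
      Nat.sub_zero, hpa]
    congr 2
    ring

/-- The inclusion `𝒪_1 ⊆ 𝒪_p`. -/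
def inclOr (ha : 1 ≤ a) (hD : IsDworkRoot p (gam p a g)) : Or p a n 0 g →+* Or p a n 1 g :=
  (Or p a n 0 g).subtype.codRestrict (Or p a n 1 g) fun ζ => by
    rw [Subring.subtype_apply]
    exact mem_Or_one ha hD ζ

lemma coe_inclOr (ha : 1 ≤ a) (hD : IsDworkRoot p (gam p a g)) (ζ : Or p a n 0 g) :
    ((inclOr ha hD ζ : Or p a n 1 g) : PowerSeries (PadicAlgCl p)) = ζ := by
  rw [inclOr, RingHom.codRestrict_apply, Subring.subtype_apply]

lemma coe_constHom (r : ℕ) (c : Oq p a g) :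
    ((constHom p a n r g c : Or p a n r g) : PowerSeries (PadicAlgCl p)) = PowerSeries.C (c : PadicAlgCl p) :=
  rfl

lemma inclOr_constHom (ha : 1 ≤ a) (hD : IsDworkRoot p (gam p a g)) (c : Oq p a g) :
    inclOr ha hD (constHom p a n 0 g c) = constHom p a n 1 g c :=
  Subtype.ext (by rw [coe_inclOr, coe_constHom, coe_constHom])

lemma inclOr_tdO (ha : 1 ≤ a) (hD : IsDworkRoot p (gam p a g)) (ζ : Or p a n 0 g) :
    inclOr ha hD (tdO 0 ζ) = tdO 1 (inclOr ha hD ζ) :=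
  Subtype.ext (by rw [coe_inclOr, coe_tdO, coe_tdO, coe_inclOr])

lemma coe_alphaL (ha : 1 ≤ a) (hD : IsDworkRoot p (gam p a g)) (f : Cr p a n 0 g) :
    ((alphaL ha hD f : Cr p a n 1 g) : Ser p n) = alphaOp p a n g f := rfl

lemma coe_smul_Cr {r : ℕ} (ζ : Or p a n r g) (f : Cr p a n r g) :
    ((ζ • f : Cr p a n r g) : Ser p n) = (ζ : PowerSeries (PadicAlgCl p)) • (f : Ser p n) := rfl

lemma alphaL_smul (ha : 1 ≤ a) (hD : IsDworkRoot p (gam p a g)) (ζ : Or p a n 0 g)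
    (f : Cr p a n 0 g) : alphaL ha hD (ζ • f) = inclOr ha hD ζ • alphaL ha hD f := by
  refine Subtype.ext ?_
  rw [coe_alphaL, coe_smul_Cr, coe_smul_Cr, coe_inclOr, coe_alphaL]
  exact alphaOp_smul (supp_of_mem_Cr (g_ne_zero hD) (Nat.zero_le a) f.2) _

lemma natCast_smul_eq {r : ℕ} (f : Cr p a n r g) :
    ((p • f : Cr p a n r g) : Ser p n) = PowerSeries.C (p : PadicAlgCl p) • (f : Ser p n) := by
  rw [map_natCast]
  funext u
  simp

/-- `α_1` maps the image of the Koszul differential into that of `p` times the Koszul differential,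
and so descends to cohomology. -/
lemma exists_frobHom (ha : 1 ≤ a) (hD : IsDworkRoot p (gam p a g)) :
    ∃ S : Hn p a n 0 g →+ Hn p a n 1 g,
      ∀ f, S (cls p a n 0 g f) = cls p a n 1 g (alphaL ha hD f) := by
  let π := (cls p a n 0 g).toAddMonoidHom
  let π' := (cls p a n 1 g).toAddMonoidHom
  have hg := g_ne_zero hD
  have h0 := Nat.zero_le a
  have hker : π.ker ≤ (π'.comp (alphaL ha hD)).ker := by
    intro f hf
    rw [AddMonoidHom.mem_ker] at hf ⊢
    have hf' := (cls_eq_zero_iff f).1 hf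
    obtain ⟨q, rfl⟩ := (mem_bdry_iff hD h0 f).1 hf'
    refine (cls_eq_zero_iff _).2 ((mem_bdry_iff hD ha _).2 ⟨fun l => p • alphaL ha hD (q l), ?_⟩)
    rw [map_sum]
    refine Finset.sum_congr rfl fun l _ => ?_
    rw [map_nsmul]
    refine Subtype.ext ?_
    rw [natCast_smul_eq, coe_alphaL]
    exact alphaOp_Dop hg l (supp_of_mem_Cr hg h0 (q l).2)
  refine ⟨π.liftOfSurjective (cls_surjective 0) ⟨_, hker⟩, fun f => ?_⟩
  exact AddMonoidHom.liftOfRightInverse_comp_apply _ _ _ ⟨_, hker⟩ f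

/-- The relative Frobenius `H^n(𝒞) → H^n(𝒞_p)`. -/
def frobHom (ha : 1 ≤ a) (hD : IsDworkRoot p (gam p a g)) : Hn p a n 0 g →+ Hn p a n 1 g :=
  (exists_frobHom ha hD).choose

lemma frobHom_cls (ha : 1 ≤ a) (hD : IsDworkRoot p (gam p a g)) (f : Cr p a n 0 g) :
    frobHom ha hD (cls p a n 0 g f) = cls p a n 1 g (alphaL ha hD f) :=
  (exists_frobHom ha hD).choose_spec f

lemma frobHom_smul (ha : 1 ≤ a) (hD : IsDworkRoot p (gam p a g)) (ζ : Or p a n 0 g)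
    (x : Hn p a n 0 g) : frobHom ha hD (ζ • x) = inclOr ha hD ζ • frobHom ha hD x := by
  obtain ⟨f, rfl⟩ := cls_surjective 0 x
  rw [← map_smul, frobHom_cls, alphaL_smul, map_smul, frobHom_cls]

/-- The relative Frobenius is horizontal. -/
lemma frobHom_conn (ha : 1 ≤ a) (hD : IsDworkRoot p (gam p a g)) (x : Hn p a n 0 g) :
    frobHom ha hD (connHom hD (Nat.zero_le a) x) = connHom hD ha (frobHom ha hD x) := by
  obtain ⟨f, rfl⟩ := cls_surjective 0 x
  rw [connHom_cls, frobHom_cls, frobHom_cls, connHom_cls]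
  refine congrArg _ (Subtype.ext ?_)
  rw [coe_alphaL]
  exact (alphaOp_dop (g_ne_zero hD) (supp_of_mem_Cr (g_ne_zero hD) (Nat.zero_le a) f.2))

/-- The defining property of `frob` is satisfiable, and so `frob` has it. -/
theorem isFrob_frob (ha : 1 ≤ a) (hD : IsDworkRoot p (gam p a g)) :
    IsFrob p a n g (frob p a n g) := by
  refine Classical.epsilon_spec (p := IsFrob p a n g)
    ⟨{ toFun := frobHom ha hD, map_add' := map_add _, map_smul' := fun c x => ?_ },
    fun f => ⟨alphaL ha hD f, rfl, frobHom_cls ha hD f⟩⟩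
  change frobHom ha hD (constHom p a n 0 g c • x) = constHom p a n 1 g c • _
  rw [frobHom_smul, inclOr_constHom]

lemma frob_eq_frobHom (ha : 1 ≤ a) (hD : IsDworkRoot p (gam p a g)) (x : Hn p a n 0 g) :
    frob p a n g x = frobHom ha hD x := by
  obtain ⟨f, rfl⟩ := cls_surjective 0 x
  obtain ⟨h, hh, hc⟩ := isFrob_frob ha hD f
  rw [hc, frobHom_cls]
  congr 1
  exact Subtype.ext hh

/-- The growth of the entries of the matrix of the relative Frobenius. -/
lemma norm_frob_repr_le (ha : 1 ≤ a) (hD : IsDworkRoot p (gam p a g)) {R : ℝ} (hR : 1 ≤ R)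
    (hRp : R ^ p < p) (j m : Fin (n + 1)) (s : ℕ) :
    ‖nco p a n 1 g ((hnBasis ha hD ha).repr (frobHom ha hD (eCls p a n 0 g j)) m) s‖ *
      R ^ ((n + 1) * s + p * m) ≤ 1 := by
  have hR0 : 0 < R := by linarith
  have hi : s % p < p ^ 1 := by rw [pow_one]; exact Nat.mod_lt _ hp.1.pos
  have h := norm_repr_le ha hD ha (alphaL ha hD (eEl p a n 0 g j)) hi (one_le_pow₀ hR (n := p)) hRp
    (by positivity) (ball_alphaOp ha hD (eSer_mem p a n 0 g j) (s % p) hR hRp) m (s / p)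
  rw [pow_one, Nat.div_add_mod, inv_pow, ← frobHom_cls] at h
  have h1 : R ^ ((n + 1) * s + p * m) =
      (R ^ p) ^ ((n + 1) * (s / p) + m) * R ^ ((n + 1) * (s % p)) := by
    rw [← pow_mul, ← pow_add]
    congr 1
    conv_lhs => rw [← Nat.div_add_mod s p]
    ring
  rw [h1, ← mul_assoc]
  have h2 : 0 < R ^ ((n + 1) * (s % p)) := by positivity
  rwa [← le_div_iff₀ h2, one_div]

end Frobenius

/-! ### Maps between symmetric algebras -/

section SymmetricAlgebra

variable {A : Type*} [CommRing A] {H : Type*} [AddCommGroup H] [Module A H]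

/-- The universal property of the symmetric algebra for semilinear maps. -/
lemma exists_symmetricAlgebra_hom {T : Type*} [CommRing T] (f : A →+* T) (φ : H →+ T)
    (hφ : ∀ (c : A) x, φ (c • x) = f c * φ x) : ∃ Φ : SymmetricAlgebra A H →+* T,
      (∀ c, Φ (algebraMap A _ c) = f c) ∧ ∀ x, Φ (SymmetricAlgebra.ι A H x) = φ x := by
  let _ : Algebra A T := f.toAlgebra
  let l : H →ₗ[A] T := 
    { toFun := φ
      map_add' := map_add φ
      map_smul' := fun c x => by
        rw [Algebra.smul_def]
        exact hφ c x }
  exact ⟨(SymmetricAlgebra.lift l : SymmetricAlgebra A H →ₐ[A] T),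
    fun c => (SymmetricAlgebra.lift l).commutes c, fun x => SymmetricAlgebra.lift_ι_apply l x⟩

/-- A derivation along a homomorphism, as a homomorphism to the dual numbers. -/
def dualHom {S : Type*} [CommRing S] (f : A →+* S) (d : A →+ S) (h1 : d 1 = 0)
    (hd : ∀ x y, d (x * y) = f x * d y + f y * d x) : A →+* TrivSqZeroExt S S where
  toFun x := (f x, d x)
  map_one' := Prod.ext (map_one f) h1
  map_zero' := Prod.ext (map_zero f) (map_zero d)
  map_add' x y := Prod.ext (map_add f x y) (map_add d x y)
  map_mul' x y := Prod.ext (map_mul f x y) ((hd x y).trans (by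
    change _ = f x • d y + MulOpposite.op (f y) • d x
    rw [smul_eq_mul, MulOpposite.smul_eq_mul_unop, MulOpposite.unop_op, mul_comm (d x)]))

/-- A connection on `H` extends to a derivation of the symmetric algebra. -/
lemma exists_symmetricAlgebra_derivation (δ : Derivation ℤ A A) (φ : H →+ H)
    (hφ : ∀ (c : A) x, φ (c • x) = δ c • x + c • φ x) :
    ∃ D : Derivation ℤ (SymmetricAlgebra A H) (SymmetricAlgebra A H),
      (∀ c, D (algebraMap A _ c) = algebraMap A _ (δ c)) ∧
      ∀ x, D (SymmetricAlgebra.ι A H x) = SymmetricAlgebra.ι A H (φ x) := by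
  -- The derivation is the nilpotent part of a homomorphism to the dual numbers.
  have hd : ∀ x y : A, algebraMap A (SymmetricAlgebra A H) (δ (x * y)) =
      algebraMap A _ x * algebraMap A _ (δ y) + algebraMap A _ y * algebraMap A _ (δ x) := by
    intro x y
    rw [δ.leibniz, map_add, smul_eq_mul, smul_eq_mul, map_mul, map_mul]
  let f := dualHom (algebraMap A (SymmetricAlgebra A H))
    ((algebraMap A (SymmetricAlgebra A H)).toAddMonoidHom.comp δ.toAddMonoidHom)
    (by simp) hd
  let ψ : H →+ TrivSqZeroExt (SymmetricAlgebra A H) (SymmetricAlgebra A H) :=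
    AddMonoidHom.mk' (fun x => (SymmetricAlgebra.ι A H x, SymmetricAlgebra.ι A H (φ x)))
      fun x y => Prod.ext (map_add _ x y) (by
        change SymmetricAlgebra.ι A H (φ (x + y)) =
          SymmetricAlgebra.ι A H (φ x) + SymmetricAlgebra.ι A H (φ y)
        rw [map_add, map_add])
  obtain ⟨Φ, h1, h2⟩ := exists_symmetricAlgebra_hom f ψ fun c x => by
    refine Prod.ext ?_ ?_
    · change SymmetricAlgebra.ι A H (c • x) = algebraMap A _ c * SymmetricAlgebra.ι A H x
      rw [map_smul, Algebra.smul_def]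
    · change SymmetricAlgebra.ι A H (φ (c • x)) = algebraMap A _ c • SymmetricAlgebra.ι A H (φ x) +
        MulOpposite.op (SymmetricAlgebra.ι A H x) • algebraMap A (SymmetricAlgebra A H) (δ c)
      rw [hφ, map_add, map_smul, map_smul, smul_eq_mul, MulOpposite.smul_eq_mul_unop,
        MulOpposite.unop_op, Algebra.smul_def, Algebra.smul_def, add_comm]
  have hfst : ∀ x, (Φ x).fst = x := by
    intro x
    induction x using SymmetricAlgebra.induction with
    | algebraMap c => rw [h1]; rfl
    | ι x => rw [h2]; rfl
    | mul x y hx hy => rw [map_mul, TrivSqZeroExt.fst_mul, hx, hy]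
    | add x y hx hy => rw [map_add, TrivSqZeroExt.fst_add, hx, hy]
  refine ⟨Derivation.mk' ((AddMonoidHom.mk' (fun x => (Φ x).snd) fun x y => by
    rw [map_add, TrivSqZeroExt.snd_add]).toIntLinearMap) fun x y => ?_, fun c => ?_, fun x => ?_⟩
  · change (Φ (x * y)).snd = x • (Φ y).snd + y • (Φ x).snd
    rw [map_mul, TrivSqZeroExt.snd_mul, hfst, hfst, MulOpposite.smul_eq_mul_unop,
      MulOpposite.unop_op, smul_eq_mul, smul_eq_mul, mul_comm (Φ x).snd]
  · change (Φ _).snd = _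
    rw [h1]; rfl
  · change (Φ _).snd = _
    rw [h2]; rfl

lemma derivation_prod {R S : Type*} [CommRing R] [CommRing S] [Algebra R S] (D : Derivation R S S) {ι : Type*} [DecidableEq ι]
    (F : Finset ι) (x : ι → S) :
    D (∏ l ∈ F, x l) = ∑ l ∈ F, ∏ m ∈ F, Function.update x l (D (x l)) m := by
  induction F using Finset.induction_on with
  | empty => simp
  | insert l F hl ih =>
    have h1 : ∀ y, ∏ m ∈ F, Function.update x l y m = ∏ m ∈ F, x m := fun y =>
      Finset.prod_congr rfl fun m hm => Function.update_of_ne (fun h => hl (by rw [← h]; exact hm)) _ _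
    rw [Finset.prod_insert hl, D.leibniz, ih, Finset.sum_insert hl, Finset.prod_insert hl,
      Function.update_self, h1, smul_eq_mul, smul_eq_mul, Finset.mul_sum, add_comm,
      mul_comm (∏ m ∈ F, x m)]
    congr 1
    refine Finset.sum_congr rfl fun m hm => ?_
    rw [Finset.prod_insert hl, Function.update_of_ne (fun h => hl (by rw [h]; exact hm))]

/-- The number of times each value is taken, for a sequence of length `k`. -/
def countIdx {n k : ℕ} (σ : Fin k → Fin (n + 1)) : Idx n k :=
  ⟨fun j => (Finset.univ.filter fun l => σ l = j).card, by
    rw [← Finset.card_eq_sum_card_fiberwise fun _ _ => Finset.mem_coe.2 (Finset.mem_univ _)]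
    simp⟩

lemma prod_countIdx {n k : ℕ} {S : Type*} [CommMonoid S] (σ : Fin k → Fin (n + 1))
    (x : Fin (n + 1) → S) : ∏ l, x (σ l) = ∏ j, x j ^ (countIdx σ).1 j := by
  rw [← Finset.prod_fiberwise Finset.univ σ]
  refine Finset.prod_congr rfl fun j _ => ?_
  rw [Finset.prod_congr rfl fun l hl => by rw [(Finset.mem_filter.1 hl).2], Finset.prod_const]
  rfl

lemma wt_countIdx {n k : ℕ} (σ : Fin k → Fin (n + 1)) : wt (countIdx σ) = ∑ l, (σ l : ℕ) := by
  have := prod_countIdx σ fun j => Multiplicative.ofAdd (j : ℕ)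
  rw [← ofAdd_sum] at this
  rw [wt, ← Multiplicative.ofAdd.injective.eq_iff, this, ofAdd_sum]
  refine Finset.prod_congr rfl fun j _ => ?_
  rw [← ofAdd_nsmul, smul_eq_mul, mul_comm]

lemma prod_sum_smul {n k : ℕ} {S : Type*} [CommRing S] [Algebra A S]
    (c : Fin k → Fin (n + 1) → A) (x : Fin (n + 1) → S) :
    ∏ l, ∑ j, c l j • x j = ∑ σ : Fin k → Fin (n + 1),
      (∏ l, c l (σ l)) • ∏ j, x j ^ (countIdx σ).1 j := by
  rw [Finset.prod_univ_sum]
  simp only [Fintype.piFinset_univ]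
  refine Finset.sum_congr rfl fun σ _ => ?_
  rw [Finset.prod_smul, prod_countIdx]

lemma linearIndependent_symMono {n : ℕ} (b : Module.Basis (Fin (n + 1)) A H) (k : ℕ) :
    LinearIndependent A fun i : Idx n k => ∏ j, SymmetricAlgebra.ι A H (b j) ^ i.1 j := by
  refine LinearIndependent.of_comp (SymmetricAlgebra.equivMvPolynomial b).toLinearMap ?_
  have h := (MvPolynomial.basisMonomials (Fin (n + 1)) A).linearIndependent.comp
    (fun i : Idx n k => Finsupp.equivFunOnFinite.symm i.1) fun i j h =>
      Subtype.ext (Finsupp.equivFunOnFinite.symm.injective h)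
  have he : (SymmetricAlgebra.equivMvPolynomial b).toLinearMap ∘
      (fun i : Idx n k => ∏ j, SymmetricAlgebra.ι A H (b j) ^ i.1 j) =
      MvPolynomial.basisMonomials (Fin (n + 1)) A ∘
        fun i : Idx n k => Finsupp.equivFunOnFinite.symm i.1 := by
    funext i
    simp only [Function.comp_apply, AlgEquiv.toLinearMap_apply, map_prod, map_pow,
      SymmetricAlgebra.equivMvPolynomial_ι_apply, MvPolynomial.coe_basisMonomials]
    rw [MvPolynomial.monomial_eq, MvPolynomial.C_1, one_mul, Finsupp.prod_fintype _ _ (by simp)]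
    rfl
  rw [he]
  exact h

end SymmetricAlgebra

/-! ### Symmetric powers of the relative cohomology -/

section SymmetricPowers

variable {p a n k : ℕ} [hp : Fact p.Prime] {g : PadicAlgCl p}

/-- The inclusion of the symmetric power into the symmetric algebra. -/
def skVal (p a n k r : ℕ) [Fact p.Prime] (g : PadicAlgCl p) :
    Sk p a n k r g →ₗ[Or p a n r g] SymmetricAlgebra (Or p a n r g) (Hn p a n r g) :=
  (symSub p a n k r g).subtype

lemma skVal_injective {r : ℕ} : Function.Injective (skVal p a n k r g) := Subtype.val_injective

lemma skVal_symProd {r : ℕ} (v : Fin k → Hn p a n r g) :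
    skVal p a n k r g (symProd p a n k r g v) = ∏ i, SymmetricAlgebra.ι _ _ (v i) := rfl

lemma skVal_eMono {r : ℕ} (i : Idx n k) : skVal p a n k r g (eMono p a n k r g i) =
    ∏ j, SymmetricAlgebra.ι _ _ (eCls p a n r g j) ^ i.1 j := rfl

@[elab_as_elim]
lemma sk_induction {r : ℕ} {P : Sk p a n k r g → Prop} (zero : P 0)
    (add : ∀ x y, P x → P y → P (x + y)) (smul : ∀ (ζ : Or p a n r g) x, P x → P (ζ • x))
    (prod : ∀ v, P (symProd p a n k r g v)) (x : Sk p a n k r g) : P x := by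
  obtain ⟨x, hx⟩ := x
  refine Submodule.span_induction (p := fun x hx => P (⟨x, hx⟩ : symSub p a n k r g))
    ?_ zero ?_ ?_ hx
  · rintro _ ⟨v, rfl⟩
    exact prod v
  · intro x y hx hy h1 h2
    exact add _ _ h1 h2
  · intro ζ x hx h
    exact smul ζ _ h

lemma symProd_eq_sum (ha : 1 ≤ a) (hD : IsDworkRoot p (gam p a g)) {r : ℕ} (hr : r ≤ a)
    (v : Fin k → Hn p a n r g) : symProd p a n k r g v = ∑ σ : Fin k → Fin (n + 1),
      (∏ l, (hnBasis ha hD hr).repr (v l) (σ l)) • eMono p a n k r g (countIdx σ) := by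
  refine skVal_injective ?_
  rw [skVal_symProd, map_sum]
  simp only [map_smul, skVal_eMono]
  rw [← prod_sum_smul]
  refine Finset.prod_congr rfl fun l _ => ?_
  conv_lhs => rw [← (hnBasis ha hD hr).sum_repr (v l), map_sum]
  refine Finset.sum_congr rfl fun j _ => ?_
  rw [map_smul, hnBasis_apply]

instance (n k : ℕ) : Finite (Idx n k) := by
  refine Finite.of_injective (β := Fin (n + 1) → Fin (k + 1)) (fun i j => ⟨i.1 j,
    Nat.lt_succ_of_le ((Finset.single_le_sum (f := i.1) (fun _ _ => Nat.zero_le _)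
      (Finset.mem_univ j)).trans i.2.le)⟩) fun i i' h => Subtype.ext (funext fun j => ?_)
  exact Fin.mk.inj_iff.1 (congrFun h j)

instance (n k : ℕ) : Fintype (Idx n k) := Fintype.ofFinite _

/-- The monomials `e^i` form a basis of the symmetric power. -/
def skBasis (k : ℕ) (ha : 1 ≤ a) (hD : IsDworkRoot p (gam p a g)) {r : ℕ} (hr : r ≤ a) :
    Module.Basis (Idx n k) (Or p a n r g) (Sk p a n k r g) :=
  Module.Basis.mk (v := eMono p a n k r g) (by
    refine LinearIndependent.of_comp (skVal p a n k r g) ?_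
    have h := linearIndependent_symMono (hnBasis (n := n) ha hD hr) k
    simp only [hnBasis_apply] at h
    exact h) (by
    rintro x -
    induction x using sk_induction with
    | zero => exact zero_mem _
    | add x y hx hy => exact add_mem hx hy
    | smul ζ x hx => exact Submodule.smul_mem _ ζ hx
    | prod v =>
      rw [symProd_eq_sum ha hD hr]
      exact sum_mem fun σ _ => Submodule.smul_mem _ _ (Submodule.subset_span ⟨_, rfl⟩))

lemma skBasis_apply (ha : 1 ≤ a) (hD : IsDworkRoot p (gam p a g)) {r : ℕ} (hr : r ≤ a)
    (i : Idx n k) : skBasis k ha hD hr i = eMono p a n k r g i := Module.Basis.mk_apply _ _ _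

lemma sk_eq_sum (ha : 1 ≤ a) (hD : IsDworkRoot p (gam p a g)) {r : ℕ} (hr : r ≤ a)
    (x : Sk p a n k r g) :
    x = ∑ i, (skBasis k ha hD hr).repr x i • eMono p a n k r g i := by
  conv_lhs => rw [← (skBasis k ha hD hr).sum_repr x]
  exact Finset.sum_congr rfl fun i _ => by rw [skBasis_apply]

lemma repr_sum_eMono (ha : 1 ≤ a) (hD : IsDworkRoot p (gam p a g)) {r : ℕ} (hr : r ≤ a)
    (ζ : Idx n k → Or p a n r g) (i : Idx n k) :
    (skBasis k ha hD hr).repr (∑ i, ζ i • eMono p a n k r g i) i = ζ i := by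
  rw [Finset.sum_congr rfl fun i _ => by rw [← skBasis_apply ha hD hr i],
    Module.Basis.repr_sum_self]

lemma exists_symDer (hD : IsDworkRoot p (gam p a g)) {r : ℕ} (hr : r ≤ a) :
    ∃ D : Derivation ℤ (SymmetricAlgebra (Or p a n r g) (Hn p a n r g))
        (SymmetricAlgebra (Or p a n r g) (Hn p a n r g)),
      (∀ c, D (algebraMap (Or p a n r g) _ c) = algebraMap (Or p a n r g) _ (tdO r c)) ∧
      ∀ x, D (SymmetricAlgebra.ι _ _ x) = SymmetricAlgebra.ι _ _ (connHom hD hr x) :=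
  exists_symmetricAlgebra_derivation (tdO r) (connHom hD hr) (connHom_smul hD hr)

/-- The derivation of the symmetric algebra that extends the connection. It is only `ℤ`-linear: on
the coefficients it is `t d/dt`. -/
def symDer (n : ℕ) (hD : IsDworkRoot p (gam p a g)) {r : ℕ} (hr : r ≤ a) :
    Derivation ℤ (SymmetricAlgebra (Or p a n r g) (Hn p a n r g))
        (SymmetricAlgebra (Or p a n r g) (Hn p a n r g)) := (exists_symDer hD hr).choose

lemma symDer_smul (hD : IsDworkRoot p (gam p a g)) {r : ℕ} (hr : r ≤ a) (c : Or p a n r g)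
    (x : SymmetricAlgebra (Or p a n r g) (Hn p a n r g)) :
    symDer n hD hr (c • x) = tdO r c • x + c • symDer n hD hr x := by
  have h := (exists_symDer (n := n) hD hr).choose_spec.1 c
  rw [Algebra.smul_def, Algebra.smul_def, Algebra.smul_def, Derivation.leibniz, smul_eq_mul,
    smul_eq_mul, add_comm, mul_comm x, symDer, h]

lemma symDer_ι (hD : IsDworkRoot p (gam p a g)) {r : ℕ} (hr : r ≤ a) (x : Hn p a n r g) :
    symDer n hD hr (SymmetricAlgebra.ι _ _ x) = SymmetricAlgebra.ι _ _ (connHom hD hr x) :=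
  (exists_symDer hD hr).choose_spec.2 x

lemma symDer_symProd (hD : IsDworkRoot p (gam p a g)) {r : ℕ} (hr : r ≤ a)
    (v : Fin k → Hn p a n r g) : symDer n hD hr (skVal p a n k r g (symProd p a n k r g v)) =
      skVal p a n k r g (∑ i, symProd p a n k r g (Function.update v i (connHom hD hr (v i)))) := by
  rw [skVal_symProd, derivation_prod, map_sum]
  refine Finset.sum_congr rfl fun i _ => ?_
  rw [skVal_symProd]
  refine Finset.prod_congr rfl fun l _ => ?_
  rcases eq_or_ne l i with rfl | h
  · rw [Function.update_self, Function.update_self, symDer_ι]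
  · rw [Function.update_of_ne h, Function.update_of_ne h]

lemma exists_symConnHom (k : ℕ) (hD : IsDworkRoot p (gam p a g)) {r : ℕ} (hr : r ≤ a) :
    ∃ S : Sk p a n k r g →+ Sk p a n k r g,
      ∀ x, skVal p a n k r g (S x) = symDer n hD hr (skVal p a n k r g x) := by
  have h : ∀ x : Sk p a n k r g, ∃ y : Sk p a n k r g,
      skVal p a n k r g y = symDer n hD hr (skVal p a n k r g x) := by
    intro x
    induction x using sk_induction with
    | zero => exact ⟨0, by rw [map_zero, map_zero]⟩
    | add x y hx hy =>
      obtain ⟨x', hx⟩ := hx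
      obtain ⟨y', hy⟩ := hy
      exact ⟨x' + y', by rw [map_add, map_add, map_add, hx, hy]⟩
    | smul ζ x hx =>
      obtain ⟨x', hx⟩ := hx
      exact ⟨tdO r ζ • x + ζ • x', by rw [map_add, map_smul, map_smul, map_smul, hx, symDer_smul]⟩
    | prod v => exact ⟨_, (symDer_symProd hD hr v).symm⟩
  choose S hS using h
  exact ⟨AddMonoidHom.mk' S fun x y => skVal_injective (by rw [map_add, hS, hS, hS, map_add, map_add]),
    hS⟩

/-- The connection on the symmetric power of `H^n(𝒞_{p^r})`. -/
def symConnHom (k : ℕ) (hD : IsDworkRoot p (gam p a g)) {r : ℕ} (hr : r ≤ a) :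
    Sk p a n k r g →+ Sk p a n k r g := (exists_symConnHom k hD hr).choose

lemma skVal_symConnHom (hD : IsDworkRoot p (gam p a g)) {r : ℕ} (hr : r ≤ a)
    (x : Sk p a n k r g) : skVal p a n k r g (symConnHom k hD hr x) =
      symDer n hD hr (skVal p a n k r g x) := (exists_symConnHom k hD hr).choose_spec x

lemma symConnHom_smul (hD : IsDworkRoot p (gam p a g)) {r : ℕ} (hr : r ≤ a) (ζ : Or p a n r g)
    (x : Sk p a n k r g) :
    symConnHom k hD hr (ζ • x) = tdO r ζ • x + ζ • symConnHom k hD hr x :=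
  skVal_injective (by
    rw [skVal_symConnHom, map_smul, symDer_smul, map_add, map_smul, map_smul, skVal_symConnHom])

lemma symConnHom_symProd (hD : IsDworkRoot p (gam p a g)) {r : ℕ} (hr : r ≤ a)
    (v : Fin k → Hn p a n r g) : symConnHom k hD hr (symProd p a n k r g v) =
      ∑ i, symProd p a n k r g (Function.update v i (connHom hD hr (v i))) :=
  skVal_injective (by rw [skVal_symConnHom, symDer_symProd])

lemma symProd_smul_update {r : ℕ} (ζ : Or p a n r g) (v : Fin k → Hn p a n r g) (l : Fin k) :
    symProd p a n k r g (Function.update v l (ζ • v l)) = ζ • symProd p a n k r g v := by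
  refine skVal_injective ?_
  rw [map_smul, skVal_symProd, skVal_symProd, ← Finset.mul_prod_erase _ _ (Finset.mem_univ l),
    ← Finset.mul_prod_erase Finset.univ (fun i => SymmetricAlgebra.ι _ _ (v i)) (Finset.mem_univ l),
    Function.update_self, map_smul, smul_mul_assoc]
  congr 2
  refine Finset.prod_congr rfl fun m hm => ?_
  rw [Function.update_of_ne (Finset.ne_of_mem_erase hm)]

/-- For `k ≥ 1`, additive maps on the symmetric power are determined by the products. -/
lemma sk_hom_ext (hk : 1 ≤ k) {r : ℕ} {M : Type*} [AddCommGroup M] {S S' : Sk p a n k r g →+ M}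
    (h : ∀ v, S (symProd p a n k r g v) = S' (symProd p a n k r g v)) : S = S' := by
  have key : ∀ x : Sk p a n k r g, ∀ ζ : Or p a n r g, S (ζ • x) = S' (ζ • x) := by
    intro x
    induction x using sk_induction with
    | zero => intro ζ; rw [smul_zero, map_zero, map_zero]
    | add x y hx hy => intro ζ; rw [smul_add, map_add, map_add, hx, hy]
    | smul η x hx => intro ζ; rw [smul_smul, hx]
    | prod v => intro ζ; rw [← symProd_smul_update ζ v ⟨0, hk⟩, h]
  ext x
  simpa using key x 1

lemma oq_smul_sk {r : ℕ} (c : Oq p a g) (x : Sk p a n k r g) :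
    c • x = constHom p a n r g c • x := rfl

/-- The defining property of `symConn` is satisfiable, and so `symConn` has it. -/
theorem isSymConn_symConn (hD : IsDworkRoot p (gam p a g)) :
    IsSymConn p a n k g (symConn p a n k g) := by
  refine Classical.epsilon_spec (p := IsSymConn p a n k g)
    ⟨{ toFun := symConnHom k hD (Nat.zero_le a), map_add' := map_add _,
       map_smul' := fun c x => ?_ }, fun v => ?_⟩
  · rw [oq_smul_sk, symConnHom_smul, tdO_constHom, zero_smul, zero_add]
    rfl
  · change symConnHom k hD (Nat.zero_le a) _ = _
    rw [symConnHom_symProd]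
    simp only [conn_eq_connHom hD]

lemma symConn_eq (hk : 1 ≤ k) (hD : IsDworkRoot p (gam p a g)) (x : Sk p a n k 0 g) :
    symConn p a n k g x = symConnHom k hD (Nat.zero_le a) x := by
  have : (symConn p a n k g).toAddMonoidHom = symConnHom k hD (Nat.zero_le a) :=
    sk_hom_ext hk fun v => by
      rw [symConnHom_symProd]
      refine (isSymConn_symConn hD v).trans ?_
      simp only [conn_eq_connHom hD]
  exact DFunLike.congr_fun this x

/-- The ring homomorphism of symmetric algebras that extends the relative Frobenius. -/
lemma exists_symFrobRing (n : ℕ) (ha : 1 ≤ a) (hD : IsDworkRoot p (gam p a g)) :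
    ∃ Φ : SymmetricAlgebra (Or p a n 0 g) (Hn p a n 0 g) →+*
        SymmetricAlgebra (Or p a n 1 g) (Hn p a n 1 g),
      (∀ c, Φ (algebraMap _ _ c) = algebraMap (Or p a n 1 g) _ (inclOr ha hD c)) ∧
      ∀ x, Φ (SymmetricAlgebra.ι _ _ x) = SymmetricAlgebra.ι (Or p a n 1 g) _ (frobHom ha hD x) :=
  exists_symmetricAlgebra_hom ((algebraMap (Or p a n 1 g) _).comp (inclOr ha hD))
    ((SymmetricAlgebra.ι (Or p a n 1 g) (Hn p a n 1 g)).toAddMonoidHom.comp (frobHom ha hD))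
    fun c x => by
      rw [AddMonoidHom.comp_apply, AddMonoidHom.comp_apply, RingHom.comp_apply, frobHom_smul,
        LinearMap.toAddMonoidHom_coe, map_smul, Algebra.smul_def]

lemma exists_symFrobHom (k : ℕ) (ha : 1 ≤ a) (hD : IsDworkRoot p (gam p a g)) :
    ∃ S : Sk p a n k 0 g →+ Sk p a n k 1 g, (∀ (ζ : Or p a n 0 g) x, S (ζ • x) = inclOr ha hD ζ • S x) ∧
      ∀ v, S (symProd p a n k 0 g v) = symProd p a n k 1 g fun i => frobHom ha hD (v i) := by
  obtain ⟨Φ, h1, h2⟩ := exists_symFrobRing n ha hD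
  have hsm : ∀ (ζ : Or p a n 0 g) x, Φ (ζ • x) = inclOr ha hD ζ • Φ x := fun ζ x => by
    rw [Algebra.smul_def, Algebra.smul_def, map_mul, h1]
  have hprod : ∀ v, Φ (skVal p a n k 0 g (symProd p a n k 0 g v)) =
      skVal p a n k 1 g (symProd p a n k 1 g fun i => frobHom ha hD (v i)) := fun v => by
    rw [skVal_symProd, skVal_symProd, map_prod]
    simp only [h2]
  have h : ∀ x : Sk p a n k 0 g, ∃ y : Sk p a n k 1 g,
      skVal p a n k 1 g y = Φ (skVal p a n k 0 g x) := by
    intro x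
    induction x using sk_induction with
    | zero => exact ⟨0, by rw [map_zero, map_zero, map_zero]⟩
    | add x y hx hy =>
      obtain ⟨x', hx⟩ := hx
      obtain ⟨y', hy⟩ := hy
      exact ⟨x' + y', by rw [map_add, map_add, map_add, hx, hy]⟩
    | smul ζ x hx =>
      obtain ⟨x', hx⟩ := hx
      exact ⟨inclOr ha hD ζ • x', by rw [map_smul, map_smul, hx, hsm]⟩
    | prod v => exact ⟨_, (hprod v).symm⟩
  choose S hS using h
  refine ⟨AddMonoidHom.mk' S fun x y => skVal_injective (by
    rw [map_add, hS, hS, hS, map_add, map_add]), fun ζ x => skVal_injective ?_,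
    fun v => skVal_injective ?_⟩
  · change skVal p a n k 1 g (S (ζ • x)) = skVal p a n k 1 g (inclOr ha hD ζ • S x)
    rw [hS, (skVal p a n k 0 g).map_smul, hsm, map_smul, hS]
  · change skVal p a n k 1 g (S _) = _
    rw [hS, hprod]

/-- The symmetric power of the relative Frobenius. -/
def symFrobHom (k : ℕ) (ha : 1 ≤ a) (hD : IsDworkRoot p (gam p a g)) :
    Sk p a n k 0 g →+ Sk p a n k 1 g := (exists_symFrobHom k ha hD).choose

lemma symFrobHom_smul (ha : 1 ≤ a) (hD : IsDworkRoot p (gam p a g)) (ζ : Or p a n 0 g)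
    (x : Sk p a n k 0 g) : symFrobHom k ha hD (ζ • x) = inclOr ha hD ζ • symFrobHom k ha hD x :=
  (exists_symFrobHom k ha hD).choose_spec.1 ζ x

lemma symFrobHom_symProd (ha : 1 ≤ a) (hD : IsDworkRoot p (gam p a g)) (v : Fin k → Hn p a n 0 g) :
    symFrobHom k ha hD (symProd p a n k 0 g v) = symProd p a n k 1 g fun i => frobHom ha hD (v i) :=
  (exists_symFrobHom k ha hD).choose_spec.2 v

/-- The defining property of `symFrob` is satisfiable, and so `symFrob` has it. -/
theorem isSymFrob_symFrob (ha : 1 ≤ a) (hD : IsDworkRoot p (gam p a g)) :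
    IsSymFrob p a n k g (symFrob p a n k g) := by
  refine Classical.epsilon_spec (p := IsSymFrob p a n k g)
    ⟨{ toFun := symFrobHom k ha hD, map_add' := map_add _,
       map_smul' := fun c x => ?_ }, fun v => ?_⟩
  · rw [oq_smul_sk, symFrobHom_smul, inclOr_constHom, ← oq_smul_sk, RingHom.id_apply]
  · change symFrobHom k ha hD _ = _
    rw [symFrobHom_symProd]
    simp only [frob_eq_frobHom ha hD]

lemma symFrob_eq (hk : 1 ≤ k) (ha : 1 ≤ a) (hD : IsDworkRoot p (gam p a g)) (x : Sk p a n k 0 g) :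
    symFrob p a n k g x = symFrobHom k ha hD x := by
  have : (symFrob p a n k g).toAddMonoidHom = symFrobHom k ha hD :=
    sk_hom_ext hk fun v => by
      rw [symFrobHom_symProd]
      refine (isSymFrob_symFrob ha hD v).trans ?_
      simp only [frob_eq_frobHom ha hD]
  exact DFunLike.congr_fun this x

lemma symFrobHom_symConnHom (ha : 1 ≤ a) (hD : IsDworkRoot p (gam p a g)) (x : Sk p a n k 0 g) :
    symFrobHom k ha hD (symConnHom k hD (Nat.zero_le a) x) =
      symConnHom k hD ha (symFrobHom k ha hD x) := by
  induction x using sk_induction with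
  | zero => simp only [map_zero]
  | add x y hx hy => simp only [map_add, hx, hy]
  | smul ζ x hx =>
    rw [symConnHom_smul, map_add, symFrobHom_smul, symFrobHom_smul, symFrobHom_smul,
      symConnHom_smul, hx, inclOr_tdO]
  | prod v =>
    rw [symConnHom_symProd, map_sum, symFrobHom_symProd, symConnHom_symProd]
    refine Finset.sum_congr rfl fun i _ => ?_
    rw [symFrobHom_symProd]
    congr 1
    funext l
    rcases eq_or_ne l i with rfl | h
    · rw [Function.update_self, Function.update_self, frobHom_conn]
    · rw [Function.update_of_ne h, Function.update_of_ne h]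

end SymmetricPowers

/-! ### The Frobenius on the symmetric power -/

section SymmetricFrobenius

variable {p a n k : ℕ} [hp : Fact p.Prime] {g : PadicAlgCl p}

/-- The exponent of `e^i e_m / e_j`, provided that `e_j` divides `e^i`. -/
def move {n k : ℕ} (i : Idx n k) (j m : Fin (n + 1)) : Idx n k :=
  if h : i.1 j = 0 then i else ⟨i.1 - Pi.single j 1 + Pi.single m 1, by
    have h1 : Pi.single j 1 ≤ i.1 := fun l => by
      rcases eq_or_ne l j with rfl | hl
      · rw [Pi.single_eq_same]; exact Nat.one_le_iff_ne_zero.2 h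
      · rw [Pi.single_eq_of_ne hl]; exact Nat.zero_le _
    have h2 := Finset.sum_congr rfl fun l (_ : l ∈ Finset.univ) => congrFun (tsub_add_cancel_of_le h1) l
    simp only [Pi.add_apply, Finset.sum_add_distrib, i.2, Finset.sum_pi_single',
      Finset.mem_univ, if_true] at h2 ⊢
    exact h2⟩

lemma move_val {i : Idx n k} {j : Fin (n + 1)} (h : i.1 j ≠ 0) (m : Fin (n + 1)) :
    (move i j m).1 = i.1 - Pi.single j 1 + Pi.single m 1 := by
  rw [move, dif_neg h]

lemma prod_move {S : Type*} [CommMonoid S] {i : Idx n k} {j : Fin (n + 1)} (h : i.1 j ≠ 0)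
    (m : Fin (n + 1)) (x : Fin (n + 1) → S) : ∏ l, x l ^ (move i j m).1 l =
      x m * (x j ^ (i.1 j - 1) * ∏ l ∈ Finset.univ.erase j, x l ^ i.1 l) := by
  have h1 : ∏ l, x l ^ (Pi.single m 1 : Fin (n + 1) → ℕ) l = x m := by
    rw [Finset.prod_eq_single m]
    · rw [Pi.single_eq_same, pow_one]
    · intro l _ hl
      rw [Pi.single_eq_of_ne hl, pow_zero]
    · intro h; exact absurd (Finset.mem_univ m) h
  have h2 : ∏ l, x l ^ (i.1 - Pi.single j 1 : Fin (n + 1) → ℕ) l =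
      x j ^ (i.1 j - 1) * ∏ l ∈ Finset.univ.erase j, x l ^ i.1 l := by
    rw [← Finset.mul_prod_erase _ _ (Finset.mem_univ j), Pi.sub_apply, Pi.single_eq_same]
    congr 1
    refine Finset.prod_congr rfl fun l hl => ?_
    rw [Pi.sub_apply, Pi.single_eq_of_ne (Finset.ne_of_mem_erase hl), Nat.sub_zero]
  rw [move_val h]
  simp only [Pi.add_apply, pow_add, Finset.prod_mul_distrib]
  rw [h1, h2, mul_comm]

lemma wt_eq_prod (i : Idx n k) : Multiplicative.ofAdd (wt i) =
    ∏ j : Fin (n + 1), Multiplicative.ofAdd (j : ℕ) ^ i.1 j := by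
  rw [wt, ofAdd_sum]
  refine Finset.prod_congr rfl fun j _ => ?_
  rw [← ofAdd_nsmul, smul_eq_mul, mul_comm]

lemma wt_move {i : Idx n k} {j : Fin (n + 1)} (h : i.1 j ≠ 0) (m : Fin (n + 1)) :
    wt (move i j m) + j = wt i + m := by
  apply Multiplicative.ofAdd.injective
  obtain ⟨c, hc⟩ := Nat.exists_eq_succ_of_ne_zero h
  rw [ofAdd_add, ofAdd_add, wt_eq_prod, wt_eq_prod, prod_move h,
    ← Finset.mul_prod_erase Finset.univ (fun l : Fin (n + 1) => Multiplicative.ofAdd (l : ℕ) ^ i.1 l)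
      (Finset.mem_univ j), hc, Nat.succ_sub_one, pow_succ]
  ac_rfl

/-- The matrix of the connection on `H^n(𝒞_{p^r})` in the basis `e_0, …, e_n`. -/
def connMat (ha : 1 ≤ a) (hD : IsDworkRoot p (gam p a g)) {r : ℕ} (hr : r ≤ a)
    (j m : Fin (n + 1)) : Or p a n r g :=
  (hnBasis ha hD hr).repr (connHom hD hr (eCls p a n r g j)) m

/-- A derivation with matrix `c` on the variables, applied to a monomial. -/
lemma derivation_mono {R A S : Type*} [CommRing R] [CommRing A] [CommRing S] [Algebra R S]
    [Algebra A S] (D : Derivation R S S) (x : Fin (n + 1) → S) (c : Fin (n + 1) → Fin (n + 1) → A)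
    (hD : ∀ j, D (x j) = ∑ m, c j m • x m) (i : Idx n k) : D (∏ l, x l ^ i.1 l) =
      ∑ j, ∑ m, ((i.1 j : A) * c j m) • ∏ l, x l ^ (move i j m).1 l := by
  rw [derivation_prod]
  refine Finset.sum_congr rfl fun j _ => ?_
  rcases eq_or_ne (i.1 j) 0 with h | h
  · rw [← Finset.mul_prod_erase _ _ (Finset.mem_univ j), Function.update_self, h, pow_zero,
      Derivation.map_one_eq_zero, zero_mul]
    simp
  · rw [← Finset.mul_prod_erase _ _ (Finset.mem_univ j), Function.update_self,
      Finset.prod_congr rfl fun l hl => Function.update_of_ne (Finset.ne_of_mem_erase hl) _ _,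
      Derivation.leibniz_pow, hD, Finset.smul_sum, Finset.smul_sum, Finset.sum_mul]
    refine Finset.sum_congr rfl fun m _ => ?_
    rw [prod_move h, nsmul_eq_mul, smul_eq_mul, Algebra.smul_def, Algebra.smul_def, map_mul,
      map_natCast]
    ring

lemma symConnHom_eMono (ha : 1 ≤ a) (hD : IsDworkRoot p (gam p a g)) {r : ℕ} (hr : r ≤ a)
    (i : Idx n k) : symConnHom k hD hr (eMono p a n k r g i) =
      ∑ j, ∑ m, ((i.1 j : Or p a n r g) * connMat ha hD hr j m) • eMono p a n k r g (move i j m) := by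
  refine skVal_injective ?_
  rw [skVal_symConnHom, skVal_eMono, derivation_mono _ _ (connMat ha hD hr) fun j => ?_]
  · simp only [map_sum, map_smul, skVal_eMono]
  · rw [symDer_ι]
    conv_lhs => rw [← (hnBasis ha hD hr).sum_repr (connHom hD hr _), map_sum]
    refine Finset.sum_congr rfl fun m _ => ?_
    rw [map_smul, hnBasis_apply]
    rfl

/-- `ψ_t (∑ a(s) t^s) = ∑ a(ps) t^s`. -/
def psiS (p : ℕ) [Fact p.Prime] : PowerSeries (PadicAlgCl p) →+ PowerSeries (PadicAlgCl p) :=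
  AddMonoidHom.mk' (fun f => PowerSeries.mk fun s => PowerSeries.coeff (p * s) f) fun f h => by
    ext s
    simp

lemma coeff_psiS (f : PowerSeries (PadicAlgCl p)) (s : ℕ) :
    PowerSeries.coeff s (psiS p f) = PowerSeries.coeff (p * s) f := by
  rw [psiS, AddMonoidHom.mk'_apply, PowerSeries.coeff_mk]

/-- The projection formula for `ψ_t` and `t ↦ t^p`. -/
lemma psiS_mul_expand (f h : PowerSeries (PadicAlgCl p)) :
    psiS p (f * PowerSeries.expand p hp.1.ne_zero h) = psiS p f * h := by
  ext s
  rw [coeff_psiS, mul_comm f, mul_comm _ h, PowerSeries.coeff_mul, PowerSeries.coeff_mul,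
    Finset.Nat.sum_antidiagonal_eq_sum_range_succ_mk, Finset.Nat.sum_antidiagonal_eq_sum_range_succ_mk]
  symm
  refine Finset.sum_of_injOn (fun m => p * m) ?_ ?_ ?_ ?_
  · intro m _ m' _ h
    exact Nat.eq_of_mul_eq_mul_left hp.1.pos h
  · intro m hm
    simp only [Finset.coe_range, Set.mem_Iio] at hm ⊢
    have := Nat.mul_le_mul_left p (Nat.lt_succ_iff.1 hm)
    omega
  · intro m hm hnot
    dsimp only
    rw [PowerSeries.coeff_expand, if_neg, zero_mul]
    rintro ⟨k, rfl⟩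
    refine hnot ⟨k, ?_, rfl⟩
    rw [Finset.mem_range, Nat.lt_succ_iff] at hm
    simp only [Finset.coe_range, Set.mem_Iio]
    exact Nat.lt_succ_of_le (Nat.le_of_mul_le_mul_left hm hp.1.pos)
  · intro m _
    dsimp only
    rw [PowerSeries.coeff_expand, if_pos (dvd_mul_right _ _), Nat.mul_div_cancel_left _ hp.1.pos,
      coeff_psiS, Nat.mul_sub]

lemma psiS_tdS (f : PowerSeries (PadicAlgCl p)) :
    psiS p (tdS f) = PowerSeries.C (p : PadicAlgCl p) * tdS (psiS p f) := by
  ext s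
  rw [coeff_psiS, PowerSeries.coeff_C_mul, tdS, tdS, PowerSeries.coeff_mk, PowerSeries.coeff_mk,
    coeff_psiS]
  push_cast
  ring

lemma gpow_one_mul (ha : 1 ≤ a) (s : ℕ) : gpow p a n 1 g (p * s) = gpow p a n 0 g s := by
  have hpa : p ^ a = p ^ (a - 1) * p := by rw [← pow_succ, Nat.sub_add_cancel ha]
  rw [gpow, gpow, Nat.sub_zero, hpa]
  congr 1
  ring

lemma nco_psiS (ha : 1 ≤ a) (f : PowerSeries (PadicAlgCl p)) (s : ℕ) :
    nco p a n 0 g (psiS p f) s = nco p a n 1 g f (p * s) := by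
  rw [nco, nco, coeff_psiS, gpow_one_mul ha]

lemma psiS_mem (ha : 1 ≤ a) (hD : IsDworkRoot p (gam p a g)) (ζ : Or p a n 1 g) :
    psiS p (ζ : PowerSeries (PadicAlgCl p)) ∈ Or p a n 0 g := by
  have hg := g_ne_zero hD
  refine ⟨fun s => nco p a n 1 g ζ (p * s), fun s => nco_mem hg ζ _,
    (nco_tendsto hg ζ).comp (tendsto_id.const_mul_atTop' hp.1.pos), ?_⟩
  rw [← tser_nco hg 0 (psiS p (ζ : PowerSeries (PadicAlgCl p)))]
  congr 1
  funext s
  exact nco_psiS ha _ s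

/-- `ψ_t : 𝒪_p → 𝒪_1`. -/
def psiO (ha : 1 ≤ a) (hD : IsDworkRoot p (gam p a g)) : Or p a n 1 g →+ Or p a n 0 g :=
  AddMonoidHom.mk' (fun ζ => ⟨psiS p ζ, psiS_mem ha hD ζ⟩) fun _ _ =>
    Subtype.ext (map_add (psiS p) _ _)

lemma coe_psiO (ha : 1 ≤ a) (hD : IsDworkRoot p (gam p a g)) (ζ : Or p a n 1 g) :
    ((psiO ha hD ζ : Or p a n 0 g) : PowerSeries (PadicAlgCl p)) = psiS p ζ := rfl

lemma psiO_tdO (ha : 1 ≤ a) (hD : IsDworkRoot p (gam p a g)) (ζ : Or p a n 1 g) :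
    psiO ha hD (tdO 1 ζ) = p * tdO 0 (psiO ha hD ζ) := Subtype.ext (by
  rw [coe_psiO, coe_tdO, psiS_tdS, Subring.coe_mul, coe_tdO, coe_psiO, map_natCast]
  rfl)

lemma psiO_constHom_mul (ha : 1 ≤ a) (hD : IsDworkRoot p (gam p a g)) (c : Oq p a g)
    (ζ : Or p a n 1 g) : psiO ha hD (constHom p a n 1 g c * ζ) = constHom p a n 0 g c * psiO ha hD ζ :=
  Subtype.ext (by
    rw [coe_psiO, Subring.coe_mul, Subring.coe_mul, coe_constHom, coe_constHom, coe_psiO]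
    ext s
    rw [coeff_psiS, PowerSeries.coeff_C_mul, PowerSeries.coeff_C_mul, coeff_psiS])

lemma coe_connMat_one (ha : 1 ≤ a) (hD : IsDworkRoot p (gam p a g)) (j m : Fin (n + 1)) :
    (connMat ha hD ha j m : PowerSeries (PadicAlgCl p)) = PowerSeries.expand p hp.1.ne_zero
      (PowerSeries.C (p : PadicAlgCl p) *
        ((connMat ha hD (Nat.zero_le a) j m : Or p a n 0 g) : PowerSeries (PadicAlgCl p))) := by
  have hg := g_ne_zero hD
  ext s
  have h := conn_repr_frob (n := n) ha hD j m s
  rw [nco, div_eq_iff (gpow_ne_zero hg 1 s)] at h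
  rw [connMat, h, PowerSeries.coeff_expand]
  split_ifs with hs
  · obtain ⟨t, rfl⟩ := hs
    rw [Nat.mul_div_cancel_left _ hp.1.pos, gpow_one_mul ha, PowerSeries.coeff_C_mul, nco, mul_assoc,
      div_mul_cancel₀ _ (gpow_ne_zero hg 0 t)]
    rfl
  · rw [zero_mul]

lemma psiO_mul_connMat (ha : 1 ≤ a) (hD : IsDworkRoot p (gam p a g)) (ζ : Or p a n 1 g)
    (c : ℕ) (j m : Fin (n + 1)) : psiO ha hD (ζ * ((c : Or p a n 1 g) * connMat ha hD ha j m)) =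
      (p : Or p a n 0 g) * (psiO ha hD ζ * ((c : Or p a n 0 g) * connMat ha hD (Nat.zero_le a) j m)) := Subtype.ext (by
  have h1 : ((ζ * ((c : Or p a n 1 g) * connMat ha hD ha j m) : Or p a n 1 g) :
      PowerSeries (PadicAlgCl p)) = (ζ : PowerSeries (PadicAlgCl p)) *
        PowerSeries.expand p hp.1.ne_zero
        (PowerSeries.C (c : PadicAlgCl p) * (PowerSeries.C (p : PadicAlgCl p) *
        ((connMat ha hD (Nat.zero_le a) j m : Or p a n 0 g) : PowerSeries (PadicAlgCl p)))) := by
    rw [map_mul (PowerSeries.expand p hp.1.ne_zero), ← coe_connMat_one, map_natCast, map_natCast]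
    rfl
  rw [coe_psiO, h1, psiS_mul_expand, map_natCast, map_natCast]
  change _ = (p : PowerSeries (PadicAlgCl p)) * (psiS p ζ * ((c : PowerSeries (PadicAlgCl p)) *
    ((connMat ha hD (Nat.zero_le a) j m : Or p a n 0 g) : PowerSeries (PadicAlgCl p))))
  ring)

/-- The map `ψ_t` on the symmetric power. -/
def psiHom (k : ℕ) (ha : 1 ≤ a) (hD : IsDworkRoot p (gam p a g)) :
    Sk p a n k 1 g →+ Sk p a n k 0 g :=
  AddMonoidHom.mk' (fun x => ∑ i, psiO ha hD ((skBasis k ha hD ha).repr x i) • eMono p a n k 0 g i)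
    fun x y => by
      simp only [map_add, Finsupp.add_apply, add_smul, Finset.sum_add_distrib]

lemma psiHom_apply (ha : 1 ≤ a) (hD : IsDworkRoot p (gam p a g)) (x : Sk p a n k 1 g) :
    psiHom k ha hD x =
      ∑ i, psiO ha hD ((skBasis k ha hD ha).repr x i) • eMono p a n k 0 g i := rfl

lemma psiHom_smul_eMono (ha : 1 ≤ a) (hD : IsDworkRoot p (gam p a g)) (ζ : Or p a n 1 g)
    (i : Idx n k) : psiHom k ha hD (ζ • eMono p a n k 1 g i) = psiO ha hD ζ • eMono p a n k 0 g i := by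
  classical
  rw [psiHom_apply, ← skBasis_apply ha hD ha, map_smul, Module.Basis.repr_self,
    Finset.sum_eq_single i]
  · simp
  · intro l _ hl
    simp [hl.symm]
  · intro h; exact absurd (Finset.mem_univ i) h

lemma psiHom_const_smul (ha : 1 ≤ a) (hD : IsDworkRoot p (gam p a g)) (c : Oq p a g)
    (x : Sk p a n k 1 g) : psiHom k ha hD (c • x) = c • psiHom k ha hD x := by
  rw [oq_smul_sk, oq_smul_sk, psiHom_apply, psiHom_apply, Finset.smul_sum]
  refine Finset.sum_congr rfl fun i _ => ?_
  rw [map_smul, Finsupp.smul_apply, smul_eq_mul, psiO_constHom_mul, mul_smul]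

/-- The defining property of `psi` is satisfiable, and so `psi` has it. -/
theorem isPsi_psi (ha : 1 ≤ a) (hD : IsDworkRoot p (gam p a g)) :
    IsPsi p a n k g (psi p a n k g) := by
  refine Classical.epsilon_spec (p := IsPsi p a n k g)
    ⟨{ toFun := psiHom k ha hD, map_add' := map_add _,
       map_smul' := psiHom_const_smul ha hD }, fun ζ i => ⟨psiO ha hD ζ, fun s => ?_, ?_⟩⟩
  · rw [coe_psiO, coeff_psiS]
  · exact psiHom_smul_eMono ha hD ζ i

lemma psi_eq (ha : 1 ≤ a) (hD : IsDworkRoot p (gam p a g)) (x : Sk p a n k 1 g) :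
    psi p a n k g x = psiHom k ha hD x := by
  conv_lhs => rw [sk_eq_sum ha hD ha x, map_sum]
  rw [psiHom_apply]
  refine Finset.sum_congr rfl fun i _ => ?_
  obtain ⟨η, h1, h2⟩ := isPsi_psi (k := k) ha hD ((skBasis k ha hD ha).repr x i) i
  rw [h2]
  congr 1
  refine Subtype.ext ?_
  ext s
  rw [h1, coe_psiO, coeff_psiS]

/-- `ψ_t ∂_{t^p} = p ∂_t ψ_t`. -/
lemma psiHom_symConnHom (ha : 1 ≤ a) (hD : IsDworkRoot p (gam p a g)) (x : Sk p a n k 1 g) :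
    psiHom k ha hD (symConnHom k hD ha x) =
      (p : Or p a n 0 g) • symConnHom k hD (Nat.zero_le a) (psiHom k ha hD x) := by
  rw [sk_eq_sum ha hD ha x]
  simp only [map_sum, Finset.smul_sum]
  refine Finset.sum_congr rfl fun i _ => ?_
  rw [symConnHom_smul, symConnHom_eMono ha hD, psiHom_smul_eMono, symConnHom_smul,
    symConnHom_eMono ha hD, map_add, psiHom_smul_eMono, psiO_tdO, smul_add, mul_smul]
  congr 1
  simp only [Finset.smul_sum, map_sum]
  refine Finset.sum_congr rfl fun j _ => Finset.sum_congr rfl fun m _ => ?_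
  rw [smul_smul, psiHom_smul_eMono, psiO_mul_connMat, mul_smul, mul_smul]

/-- `β_{k,1} ∂_t = p ∂_t β_{k,1}`. -/
lemma beta_symConn (hk : 1 ≤ k) (ha : 1 ≤ a) (hD : IsDworkRoot p (gam p a g)) (x : Sk p a n k 0 g) :
    beta p a n k g (symConn p a n k g x) =
      symConn p a n k g ((p : Oq p a g) • beta p a n k g x) := by
  have h : ∀ y, beta p a n k g y = psiHom k ha hD (symFrobHom k ha hD y) := fun y => by
    rw [beta, LinearMap.comp_apply, symFrob_eq hk ha hD, psi_eq ha hD]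
  rw [map_smul, h, h, symConn_eq hk hD, symConn_eq hk hD, symFrobHom_symConnHom, psiHom_symConnHom,
    oq_smul_sk, map_natCast]

/-- `β_{k,1}` maps the image of `∂_t` into itself, so that `betaBar` has its defining property. -/
theorem isBetaBar_betaBar (hk : 1 ≤ k) (ha : 1 ≤ a) (hD : IsDworkRoot p (gam p a g)) :
    IsBetaBar p a n k g (betaBar p a n k g) := by
  refine Classical.epsilon_spec (p := IsBetaBar p a n k g)
    ⟨Submodule.mapQ _ _ (beta p a n k g) ?_, fun s => Submodule.mapQ_apply _ _ _ _⟩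
  rintro _ ⟨x, rfl⟩
  rw [Submodule.mem_comap, beta_symConn hk ha hD]
  exact ⟨_, rfl⟩

lemma nco_mul_le {r : ℕ} {ζ η : Or p a n r g} {R : ℝ} (hR : 0 < R) {d e : ℕ}
    (hζ : ∀ s, ‖nco p a n r g ζ s‖ * R ^ ((n + 1) * s + d) ≤ 1)
    (hη : ∀ s, ‖nco p a n r g η s‖ * R ^ ((n + 1) * s + e) ≤ 1) (hg : g ≠ 0) (s : ℕ) :
    ‖nco p a n r g (ζ * η : Or p a n r g) s‖ * R ^ ((n + 1) * s + (d + e)) ≤ 1 := by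
  have h0 : ∀ m : ℕ, 0 < R ^ m := fun m => by positivity
  rw [Subring.coe_mul, ← tser_nco hg r (ζ : PowerSeries (PadicAlgCl p)),
    ← tser_nco hg r (η : PowerSeries (PadicAlgCl p)), tser_mul, nco_tser hg, ← le_div_iff₀ (h0 _)]
  refine conv_le (by positivity) fun x hx => ?_
  rw [Finset.HasAntidiagonal.mem_antidiagonal] at hx
  rw [le_div_iff₀ (h0 _), ← hx, show (n + 1) * (x.1 + x.2) + (d + e) =
    ((n + 1) * x.1 + d) + ((n + 1) * x.2 + e) by ring, pow_add]
  calc _ = (‖nco p a n r g ζ x.1‖ * R ^ ((n + 1) * x.1 + d)) *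
        (‖nco p a n r g η x.2‖ * R ^ ((n + 1) * x.2 + e)) := by ring
    _ ≤ 1 * 1 := mul_le_mul (hζ _) (hη _) (by positivity) zero_le_one
    _ = 1 := one_mul _

lemma nco_one_le {r : ℕ} {R : ℝ} (s : ℕ) :
    ‖nco p a n r g (1 : Or p a n r g) s‖ * R ^ ((n + 1) * s + 0) ≤ 1 := by
  rw [nco, Subring.coe_one, PowerSeries.coeff_one]
  split_ifs with h
  · subst h
    simp [gpow]
  · simp

lemma nco_sum {κ : Type*} (F : Finset κ) {r : ℕ} (ζ : κ → Or p a n r g) (s : ℕ) :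
    nco p a n r g (∑ i ∈ F, ζ i : Or p a n r g) s = ∑ i ∈ F, nco p a n r g (ζ i) s := by
  simp only [nco, ← Finset.sum_div]
  congr 1
  rw [AddSubmonoidClass.coe_finsetSum, map_sum]

lemma repr_symProd (ha : 1 ≤ a) (hD : IsDworkRoot p (gam p a g)) {r : ℕ} (hr : r ≤ a)
    (v : Fin k → Hn p a n r g) (i : Idx n k) :
    (skBasis k ha hD hr).repr (symProd p a n k r g v) i =
      ∑ σ : Fin k → Fin (n + 1) with countIdx σ = i, ∏ l, (hnBasis ha hD hr).repr (v l) (σ l) := by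
  classical
  rw [symProd_eq_sum ha hD hr, map_sum, Finsupp.finsetSum_apply, Finset.sum_filter]
  refine Finset.sum_congr rfl fun σ _ => ?_
  rw [← skBasis_apply ha hD hr, map_smul, Module.Basis.repr_self, Finsupp.smul_apply,
    Finsupp.single_apply]
  split_ifs <;> simp

lemma eMono_eq_symProd (i : Idx n k) : ∃ σ : Fin k → Fin (n + 1), ∀ r,
    eMono p a n k r g i = symProd p a n k r g fun l => eCls p a n r g (σ l) := by
  obtain ⟨σ, hσ⟩ : ∃ σ : Fin k → Fin (n + 1), countIdx σ = i := by
    obtain ⟨σ, hσ⟩ := exists_prod_eq (A := Multiplicative (Fin (n + 1) → ℕ)) i.1 i.2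
    refine ⟨σ, Subtype.ext (funext fun j => ?_)⟩
    have h := hσ fun j => Multiplicative.ofAdd (Pi.single j 1)
    rw [prod_countIdx σ fun j => Multiplicative.ofAdd (Pi.single j 1 : Fin (n + 1) → ℕ)] at h
    have h2 := congrFun (congrArg Multiplicative.toAdd h) j
    simpa [toAdd_prod, Pi.single_apply] using h2
  refine ⟨σ, fun r => skVal_injective ?_⟩
  rw [skVal_symProd, skVal_eMono, ← hσ, ← prod_countIdx σ]

/-- The growth of the coordinates of `β_{k,1}(e^i)`. -/
lemma norm_beta_repr_le (hk : 1 ≤ k) (ha : 1 ≤ a) (hD : IsDworkRoot p (gam p a g)) {R : ℝ}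
    (hR : 1 ≤ R) (hRp : R ^ p < p) (i l : Idx n k) (s : ℕ) :
    ‖nco p a n 0 g ((skBasis k ha hD (Nat.zero_le a)).repr
      (beta p a n k g (eMono p a n k 0 g i)) l) s‖ * (R ^ p) ^ ((n + 1) * s + wt l) ≤ 1 := by
  have hg := g_ne_zero hD
  have hR0 : 0 < R := by linarith
  obtain ⟨τ, hτ⟩ := eMono_eq_symProd (p := p) (a := a) (g := g) i
  rw [beta, LinearMap.comp_apply, symFrob_eq hk ha hD, psi_eq ha hD, psiHom_apply, repr_sum_eMono,
    coe_psiO, nco_psiS ha, hτ, symFrobHom_symProd, repr_symProd, nco_sum, ← pow_mul,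
    ← le_div_iff₀ (by positivity)]
  refine IsUltrametricDist.norm_sum_le_of_forall_le_of_nonneg (by positivity) fun σ hσ => ?_
  rw [le_div_iff₀ (by positivity), ← (Finset.mem_filter.1 hσ).2, wt_countIdx]
  have key : ∀ F : Finset (Fin k), ∀ s, ‖nco p a n 1 g (∏ l ∈ F, (hnBasis ha hD ha).repr
      (frobHom ha hD (eCls p a n 0 g (τ l))) (σ l) : Or p a n 1 g) s‖ *
        R ^ ((n + 1) * s + ∑ l ∈ F, p * (σ l : ℕ)) ≤ 1 := by
    classical
    intro F
    induction F using Finset.induction_on with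
    | empty => intro s; exact nco_one_le s
    | insert l F hl ih =>
      intro s
      rw [Finset.prod_insert hl, Finset.sum_insert hl]
      exact nco_mul_le hR0 (norm_frob_repr_le ha hD hR hRp _ _) ih hg s
  have := key Finset.univ (p * s)
  rw [← Finset.mul_sum] at this
  rwa [show p * ((n + 1) * s + ∑ l, (σ l : ℕ)) = (n + 1) * (p * s) + p * ∑ l, (σ l : ℕ) by ring]

end SymmetricFrobenius

/-! ### Diagonalisation of the reduced connection -/

section Reduced

/-- The diagonal derivation with eigenvalue `λ_m` on `Y_m`. -/
def diagDer {R : Type*} [CommRing R] {N : ℕ} (lam : Fin N → R) :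
    Derivation R (MvPolynomial (Fin N) R) (MvPolynomial (Fin N) R) :=
  MvPolynomial.mkDerivation R fun m => MvPolynomial.C (lam m) * MvPolynomial.X m

lemma diagDer_monomial {R : Type*} [CommRing R] {N : ℕ} (lam : Fin N → R) (s : Fin N →₀ ℕ) (c : R) :
    diagDer lam (MvPolynomial.monomial s c) =
      MvPolynomial.monomial s ((∑ m, (s m : R) * lam m) * c) := by
  rw [diagDer, MvPolynomial.mkDerivation_monomial, Finsupp.sum_fintype _ _ (by simp), Finset.sum_mul,
    map_sum, Finset.smul_sum]
  refine Finset.sum_congr rfl fun m _ => ?_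
  rcases eq_or_ne (s m) 0 with h | h
  · simp [h]
  · have h1 : s - Finsupp.single m 1 + Finsupp.single m 1 = s := by
      refine tsub_add_cancel_of_le (Finsupp.single_le_iff.2 (Nat.one_le_iff_ne_zero.2 h))
    rw [MvPolynomial.C_mul_X_eq_monomial, smul_eq_mul, MvPolynomial.monomial_mul, h1,
      MvPolynomial.smul_monomial, smul_eq_mul]
    congr 1
    ring

lemma coeff_diagDer {R : Type*} [CommRing R] {N : ℕ} (lam : Fin N → R)
    (P : MvPolynomial (Fin N) R) (s : Fin N →₀ ℕ) :
    MvPolynomial.coeff s (diagDer lam P) = (∑ m, (s m : R) * lam m) * MvPolynomial.coeff s P := by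
  classical
  induction P using MvPolynomial.induction_on' with
  | monomial u c =>
    rw [diagDer_monomial, MvPolynomial.coeff_monomial, MvPolynomial.coeff_monomial]
    split_ifs with h
    · rw [h]
    · rw [mul_zero]
  | add P Q hP hQ => rw [map_add, MvPolynomial.coeff_add, MvPolynomial.coeff_add, hP, hQ, mul_add]

variable {F κ : Type} [Field F] [Field κ] {n k : ℕ}

/-- The map `F[t] → κ(τ)` with `t ↦ τ^{n+1}`. -/
def rootHom (n : ℕ) (f : F →+* κ) : Polynomial F →+* RatFunc κ :=
  (algebraMap (Polynomial κ) (RatFunc κ)).comp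
    ((Polynomial.expand κ (n + 1)).toRingHom.comp (Polynomial.mapRingHom f))

lemma rootHom_X (f : F →+* κ) : rootHom n f Polynomial.X = RatFunc.X ^ (n + 1) := by
  simp [rootHom, RatFunc.algebraMap_X]

lemma rootHom_injective (f : F →+* κ) : Function.Injective (rootHom n f) :=
  (RatFunc.algebraMap_injective κ).comp ((Polynomial.expand_injective (Nat.succ_pos n)).comp
    (Polynomial.map_injective f f.injective))

/-- The linear substitution `ē_j ↦ ∑_m λ_m^j Y_m`, over the base change `t ↦ τ^{n+1}`. -/
def diagHom (f : F →+* κ) (lam : Fin (n + 1) → RatFunc κ) :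
    MvPolynomial (Fin (n + 1)) (Polynomial F) →+* MvPolynomial (Fin (n + 1)) (RatFunc κ) :=
  MvPolynomial.eval₂Hom (MvPolynomial.C.comp (rootHom n f))
    fun j => ∑ m, MvPolynomial.C (lam m ^ (j : ℕ)) * MvPolynomial.X m

lemma diagHom_X (f : F →+* κ) (lam : Fin (n + 1) → RatFunc κ) (j : Fin (n + 1)) :
    diagHom f lam (MvPolynomial.X j) =
      ∑ m, MvPolynomial.C (lam m ^ (j : ℕ)) * MvPolynomial.X m := MvPolynomial.eval₂Hom_X' _ _ _

lemma diagHom_C (f : F →+* κ) (lam : Fin (n + 1) → RatFunc κ) (c : Polynomial F) :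
    diagHom f lam (MvPolynomial.C c) = MvPolynomial.C (rootHom n f c) := MvPolynomial.eval₂Hom_C _ _ _

/-- A Vandermonde substitution is injective. -/
lemma diagHom_injective (f : F →+* κ) {lam : Fin (n + 1) → RatFunc κ}
    (hlam : Function.Injective lam) : Function.Injective (diagHom f lam) := by
  let V := Matrix.vandermonde lam
  have hV : IsUnit V.det := (Matrix.det_vandermonde_ne_zero_iff.2 hlam).isUnit
  -- The inverse substitution is given by the inverse of the Vandermonde matrix.
  let ψ : MvPolynomial (Fin (n + 1)) (RatFunc κ) →ₐ[RatFunc κ]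
    MvPolynomial (Fin (n + 1)) (RatFunc κ) :=
    MvPolynomial.aeval fun m => ∑ j, MvPolynomial.C (V⁻¹ j m) * MvPolynomial.X j
  have h : (ψ : _ →+* _).comp (diagHom f lam) = MvPolynomial.map (rootHom n f) := by
    refine MvPolynomial.ringHom_ext (fun c => ?_) fun j => ?_
    · rw [RingHom.comp_apply, diagHom_C, MvPolynomial.map_C]
      exact MvPolynomial.aeval_C _ _
    · rw [RingHom.comp_apply, diagHom_X, MvPolynomial.map_X, map_sum]
      have h1 : ∀ m, (ψ : _ →+* _) (MvPolynomial.C (lam m ^ (j : ℕ)) * MvPolynomial.X m) =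
          ∑ l, MvPolynomial.C (V⁻¹ l m * V m j) * MvPolynomial.X l := by
        intro m
        rw [map_mul, RingHom.coe_coe, MvPolynomial.aeval_X, MvPolynomial.aeval_C,
          MvPolynomial.algebraMap_eq, Finset.mul_sum]
        refine Finset.sum_congr rfl fun l _ => ?_
        rw [map_mul, show V m j = lam m ^ (j : ℕ) from Matrix.vandermonde_apply _ _ _]
        ring
      rw [Finset.sum_congr rfl fun m _ => h1 m, Finset.sum_comm]
      have h2 : ∀ l, ∑ m, MvPolynomial.C (V⁻¹ l m * V m j) *
          (MvPolynomial.X l : MvPolynomial (Fin (n + 1)) (RatFunc κ)) =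
          MvPolynomial.C ((1 : Matrix (Fin (n + 1)) (Fin (n + 1)) (RatFunc κ)) l j) *
            MvPolynomial.X l := by
        intro l
        rw [← Finset.sum_mul, ← map_sum, ← Matrix.mul_apply, Matrix.nonsing_inv_mul _ hV]
      rw [Finset.sum_congr rfl fun l _ => h2 l, Finset.sum_eq_single j]
      · simp
      · intro l _ hl
        simp [Matrix.one_apply_ne hl]
      · intro h; exact absurd (Finset.mem_univ j) h
  have hinj : Function.Injective ((ψ : MvPolynomial (Fin (n + 1)) (RatFunc κ) →+*
      MvPolynomial (Fin (n + 1)) (RatFunc κ)).comp (diagHom f lam)) := by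
    rw [h]
    exact MvPolynomial.map_injective _ (rootHom_injective f)
  rw [RingHom.coe_comp] at hinj
  exact hinj.of_comp

/-- The substitution diagonalises the connection. -/
lemma diagHom_redNabla (f : F →+* κ) {lam : Fin (n + 1) → RatFunc κ}
    (hlam : ∀ m, lam m ^ (n + 1) = RatFunc.X ^ (n + 1))
    (Q : MvPolynomial (Fin (n + 1)) (Polynomial F)) :
    diagHom f lam (redNabla F n Q) = diagDer lam (diagHom f lam Q) := by
  have hX : ∀ j : Fin (n + 1), diagHom f lam (redG F n j) =
      ∑ m, MvPolynomial.C (lam m ^ ((j : ℕ) + 1)) * MvPolynomial.X m := by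
    intro j
    rw [redG]
    split_ifs with hj
    · rw [map_mul, diagHom_C, diagHom_X, rootHom_X, hj, Finset.mul_sum]
      refine Finset.sum_congr rfl fun m _ => ?_
      rw [Fin.val_last, hlam, Fin.val_zero, pow_zero, map_one, one_mul]
    · rw [diagHom_X]
      have : ((j + 1 : Fin (n + 1)) : ℕ) = j + 1 := Fin.val_add_one_of_lt (Fin.lt_last_iff_ne_last.2 hj)
      rw [this]
  induction Q using MvPolynomial.induction_on with
  | C c =>
    rw [diagHom_C, redNabla, MvPolynomial.derivation_C, map_zero, diagDer,
      MvPolynomial.derivation_C]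
  | add P Q hP hQ => rw [map_add, map_add, map_add, map_add, hP, hQ]
  | mul_X P j hP =>
    rw [Derivation.leibniz, map_add, smul_eq_mul, smul_eq_mul, map_mul, map_mul, hP, map_mul,
      Derivation.leibniz, smul_eq_mul, smul_eq_mul, redNabla, MvPolynomial.mkDerivation_X, hX]
    congr 2
    rw [diagHom_X, map_sum]
    refine Finset.sum_congr rfl fun m _ => ?_
    rw [Derivation.leibniz, diagDer, MvPolynomial.derivation_C, smul_zero, add_zero,
      MvPolynomial.mkDerivation_X, smul_eq_mul, ← mul_assoc, ← map_mul, pow_succ]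

lemma degree_sum_eq {P : MvPolynomial (Fin (n + 1)) (RatFunc κ)} (hP : P.IsHomogeneous k)
    {s : Fin (n + 1) →₀ ℕ} (hs : MvPolynomial.coeff s P ≠ 0) : ∑ j, s j = k := by
  have h := hP.coeff_eq_zero (d := s)
  rw [← Finsupp.degree_eq_sum]
  by_contra hne
  exact hs (h hne)

/-- The condition `d_k(n, p) = 0` makes the reduced connection injective on `S̄_k`. -/
theorem redNabla_injective {p : ℕ} [Fact p.Prime] (f : F →+* AlgebraicClosure (ZMod p))
    {ζ : AlgebraicClosure (ZMod p)} (hζ : IsPrimitiveRoot ζ (n + 1)) (hd : dk p n k ζ = 0)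
    {Q : MvPolynomial (Fin (n + 1)) (Polynomial F)} (hQ : Q ∈ RedSym F n k)
    (h0 : redNabla F n Q = 0) : Q = 0 := by
  let κ := AlgebraicClosure (ZMod p)
  -- The eigenvalues of `Ḡ` are the roots `λ_m = ζ^m τ` of `λ^{n+1} = τ^{n+1} = t`, and those of the
  -- connection on the symmetric power are `τ ∑_m i_m ζ^m`.
  let lam : Fin (n + 1) → RatFunc κ := fun m => RatFunc.C (ζ ^ (m : ℕ)) * RatFunc.X
  have hX0 : (RatFunc.X : RatFunc κ) ≠ 0 := RatFunc.X_ne_zero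
  have hlam1 : Function.Injective lam := fun m m' h => by
    have h1 := RatFunc.C_injective (mul_right_cancel₀ hX0 h)
    exact Fin.ext (hζ.pow_inj m.2 m'.2 h1)
  have hlam2 : ∀ m, lam m ^ (n + 1) = RatFunc.X ^ (n + 1) := fun m => by
    rw [mul_pow, ← map_pow, ← pow_mul, mul_comm (m : ℕ), pow_mul, hζ.pow_eq_one, one_pow, map_one,
      one_mul]
  have hhom : (diagHom f lam Q).IsHomogeneous k := by
    have h := ((MvPolynomial.mem_homogeneousSubmodule k Q).1 hQ).eval₂
      (MvPolynomial.C.comp (rootHom n f))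
      (fun j : Fin (n + 1) => ∑ m, MvPolynomial.C (lam m ^ (j : ℕ)) * MvPolynomial.X m)
      (fun c => MvPolynomial.isHomogeneous_C _ _)
      (fun j => MvPolynomial.IsHomogeneous.sum _ _ _ fun m _ => MvPolynomial.isHomogeneous_C_mul_X _ _)
    rwa [one_mul] at h
  have hzero : diagDer lam (diagHom f lam Q) = 0 := by
    rw [← diagHom_redNabla f hlam2, h0, map_zero]
  refine diagHom_injective f hlam1 ?_
  rw [map_zero]
  ext s
  rw [MvPolynomial.coeff_zero]
  by_contra hs
  have hk := degree_sum_eq hhom hs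
  have h1 := congrArg (MvPolynomial.coeff s) hzero
  rw [coeff_diagDer, MvPolynomial.coeff_zero] at h1
  have h2 : ∑ m, (s m : RatFunc κ) * lam m = 0 := (mul_eq_zero.1 h1).resolve_right hs
  have h3 : RatFunc.C (∑ m : Fin (n + 1), (s m : κ) * ζ ^ (m : ℕ)) * RatFunc.X = 0 := by
    rw [← h2, map_sum, Finset.sum_mul]
    refine Finset.sum_congr rfl fun m _ => ?_
    rw [map_mul, map_natCast, mul_assoc]
  have h4 := (mul_eq_zero.1 h3).resolve_right hX0
  rw [map_eq_zero] at h4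
  have h5 : IsEmpty {i : Idx n k // ∑ j : Fin (n + 1),
      (i.1 j : AlgebraicClosure (ZMod p)) * ζ ^ (j : ℕ) = 0} := Finite.card_eq_zero_iff.1 hd
  exact h5.elim ⟨⟨s, hk⟩, h4⟩

end Reduced

/-! ### The graded reduced complex -/

section Graded

variable {n k : ℕ}

/-- The degree of `T^s e^i`, where `T` has degree `n + 1` and `e_j` has degree `j`. -/
def sdeg (l : Idx n k × ℕ) : ℕ := (n + 1) * l.2 + wt l.1

/-- The action on coordinates `f(i, s)` of the linear derivation with
`e_j ↦ ∑_m (∑_s c(j, m, s) T^s) e_m`. -/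
def connAct {A : Type*} [CommRing A] (k : ℕ) (c : Fin (n + 1) → Fin (n + 1) → ℕ → A) :
    (Idx n k × ℕ → A) →ₗ[A] (Idx n k × ℕ → A) where
  toFun f l := ∑ i : Idx n k, ∑ j, ∑ m, open Classical in if move i j m = l.1 then
    (i.1 j : A) * ∑ x ∈ Finset.HasAntidiagonal.antidiagonal l.2, f (i, x.1) * c j m x.2 else 0
  map_add' f f' := by
    funext l
    simp only [Pi.add_apply, ← Finset.sum_add_distrib]
    refine Finset.sum_congr rfl fun i _ => Finset.sum_congr rfl fun j _ =>
      Finset.sum_congr rfl fun m _ => ?_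
    split_ifs
    · rw [← mul_add, ← Finset.sum_add_distrib]
      simp only [add_mul]
    · rw [add_zero]
  map_smul' c f := by
    funext l
    simp only [Pi.smul_apply, smul_eq_mul, RingHom.id_apply, Finset.mul_sum]
    refine Finset.sum_congr rfl fun i _ => Finset.sum_congr rfl fun j _ =>
      Finset.sum_congr rfl fun m _ => ?_
    split_ifs
    · rw [Finset.mul_sum]
      exact Finset.sum_congr rfl fun x _ => by ring
    · rw [mul_zero]

lemma connAct_apply {A : Type*} [CommRing A] (c : Fin (n + 1) → Fin (n + 1) → ℕ → A)
    (f : Idx n k × ℕ → A) (l : Idx n k × ℕ) : connAct k c f l =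
      ∑ i : Idx n k, ∑ j, ∑ m, open Classical in if move i j m = l.1 then
        (i.1 j : A) * ∑ x ∈ Finset.HasAntidiagonal.antidiagonal l.2, f (i, x.1) * c j m x.2 else 0 :=
  rfl

/-- The coefficients of `Ḡ`. -/
def lead (A : Type*) [CommRing A] (j m : Fin (n + 1)) (s : ℕ) : A :=
  if (n + 1) * s + (m : ℕ) = j + 1 then 1 else 0

lemma connAct_map {A A' : Type*} [CommRing A] [CommRing A'] (φ : A →+* A')
    (c : Fin (n + 1) → Fin (n + 1) → ℕ → A) (f : Idx n k × ℕ → A) (l : Idx n k × ℕ) :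
    φ (connAct k c f l) = connAct k (fun j m s => φ (c j m s)) (fun e => φ (f e)) l := by
  simp only [connAct_apply, map_sum, apply_ite φ, map_mul, map_natCast, map_zero]

lemma map_lead {A A' : Type*} [CommRing A] [CommRing A'] (φ : A →+* A') :
    (fun (j m : Fin (n + 1)) s => φ (lead A j m s)) = lead A' := by
  funext j m s
  rw [lead, lead, apply_ite φ, map_one, map_zero]

lemma sdeg_move {i : Idx n k} {j : Fin (n + 1)} (h : i.1 j ≠ 0) (m : Fin (n + 1)) (s s' : ℕ) :
    sdeg (move i j m, s + s') + j = sdeg (i, s) + ((n + 1) * s' + m) := by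
  have := wt_move h m
  unfold sdeg
  dsimp only
  rw [mul_add]
  omega

/-- The leading part of the connection raises the degree by one. -/
lemma connAct_lead_eq_zero {A : Type*} [CommRing A] {f : Idx n k × ℕ → A} {l : Idx n k × ℕ}
    (h : ∀ e, sdeg e + 1 = sdeg l → f e = 0) : connAct k (lead A) f l = 0 := by
  rw [connAct_apply]
  refine Finset.sum_eq_zero fun i _ => Finset.sum_eq_zero fun j _ => Finset.sum_eq_zero fun m _ => ?_
  split_ifs with hl
  · rcases eq_or_ne (i.1 j) 0 with hj | hj
    · rw [hj, Nat.cast_zero, zero_mul]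
    · rw [Finset.sum_eq_zero, mul_zero]
      intro x hx
      rw [Finset.HasAntidiagonal.mem_antidiagonal] at hx
      rw [lead]
      split_ifs with hc
      · rw [h, zero_mul]
        have h1 := sdeg_move hj m x.1 x.2
        rw [hl, hx, hc] at h1
        have h2 : sdeg l = sdeg (l.1, l.2) := rfl
        omega
      · rw [mul_zero]
  · rfl

lemma finite_sdeg_le (d : ℕ) : {l : Idx n k × ℕ | sdeg l ≤ d}.Finite := by
  refine (Set.finite_univ.prod (Set.finite_Iic d)).subset fun l hl => ⟨Set.mem_univ _, ?_⟩
  rw [Set.mem_ofPred_eq, sdeg] at hl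
  rw [Set.mem_Iic]
  nlinarith [Nat.zero_le (n * l.2), Nat.zero_le (wt l.1)]

/-! ### Coordinates on the reduced symmetric power -/

variable {F : Type} [Field F]

/-- The coordinates of a polynomial of degree `k` in the basis `t^s ē^i`. -/
def redCoord (Q : MvPolynomial (Fin (n + 1)) (Polynomial F)) (l : Idx n k × ℕ) : F :=
  (MvPolynomial.coeff (Finsupp.equivFunOnFinite.symm l.1.1) Q).coeff l.2

lemma redMono_val (i : Idx n k) : (redMono F i : MvPolynomial (Fin (n + 1)) (Polynomial F)) =
    MvPolynomial.monomial (Finsupp.equivFunOnFinite.symm i.1) 1 := by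
  rw [MvPolynomial.monomial_eq, MvPolynomial.C_1, one_mul, Finsupp.prod_fintype _ _ (by simp)]
  rfl

lemma coeff_smul_redMono (q : Polynomial F) (i l : Idx n k) :
    MvPolynomial.coeff (Finsupp.equivFunOnFinite.symm l.1)
      (q • (redMono F i : MvPolynomial (Fin (n + 1)) (Polynomial F))) =
        open Classical in if i = l then q else 0 := by
  classical
  rw [redMono_val, MvPolynomial.coeff_smul, MvPolynomial.coeff_monomial, smul_eq_mul, mul_ite, mul_one,
    mul_zero]
  refine if_congr ?_ rfl rfl
  rw [Finsupp.equivFunOnFinite.symm.injective.eq_iff, Subtype.ext_iff]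

lemma eq_of_coeff_eq {Q Q' : MvPolynomial (Fin (n + 1)) (Polynomial F)} (hQ : Q ∈ RedSym F n k)
    (hQ' : Q' ∈ RedSym F n k) (h : ∀ l : Idx n k,
      MvPolynomial.coeff (Finsupp.equivFunOnFinite.symm l.1) Q =
        MvPolynomial.coeff (Finsupp.equivFunOnFinite.symm l.1) Q') : Q = Q' := by
  ext1 s
  by_cases hs : ∑ j, s j = k
  · have := h ⟨s, hs⟩
    simpa using this
  · have hs' : s.degree ≠ k := by rwa [Finsupp.degree_eq_sum]
    rw [((MvPolynomial.mem_homogeneousSubmodule k Q).1 hQ).coeff_eq_zero hs',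
      ((MvPolynomial.mem_homogeneousSubmodule k Q').1 hQ').coeff_eq_zero hs']

lemma red_eq_sum {Q : MvPolynomial (Fin (n + 1)) (Polynomial F)} (hQ : Q ∈ RedSym F n k) :
    Q = ∑ i : Idx n k, MvPolynomial.coeff (Finsupp.equivFunOnFinite.symm i.1) Q •
      (redMono F i : MvPolynomial (Fin (n + 1)) (Polynomial F)) := by
  refine eq_of_coeff_eq hQ (sum_mem fun i _ => Submodule.smul_mem _ _ (redMono F i).2) fun l => ?_
  rw [MvPolynomial.coeff_sum]
  simp only [coeff_smul_redMono]
  rw [Finset.sum_ite_eq' Finset.univ l, if_pos (Finset.mem_univ l)]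

/-- The matrix of `Ḡ`. -/
def redMat (F : Type) [Field F] (j m : Fin (n + 1)) : Polynomial F :=
  if j = Fin.last n then (if m = 0 then Polynomial.X else 0) else if m = j + 1 then 1 else 0

lemma redG_eq_sum (j : Fin (n + 1)) : redG F n j = ∑ m, redMat F j m • MvPolynomial.X m := by
  rw [redG]
  unfold redMat
  split_ifs with h
  · simp only [ite_smul, zero_smul]
    rw [Finset.sum_ite_eq' Finset.univ (0 : Fin (n + 1)), if_pos (Finset.mem_univ _),
      MvPolynomial.smul_eq_C_mul]
  · simp only [ite_smul, zero_smul, one_smul]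
    rw [Finset.sum_ite_eq' Finset.univ (j + 1), if_pos (Finset.mem_univ _)]

lemma coeff_redMat (j m : Fin (n + 1)) (s : ℕ) : (redMat F j m).coeff s = lead F j m s := by
  have hm := m.2
  have hj := j.2
  rw [redMat, lead]
  split_ifs with h1 h2 h3 h3 h2 h3 h3
  · subst h1 h2
    rw [Fin.val_last, Fin.val_zero, add_zero] at h3
    have : s = 1 := Nat.eq_of_mul_eq_mul_left (Nat.succ_pos n) (by rw [h3, mul_one])
    rw [this, Polynomial.coeff_X_one]
  · subst h1 h2
    rw [Polynomial.coeff_X, if_neg]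
    rintro rfl
    simp at h3
  · subst h1
    rw [Fin.val_last] at h3
    have hm0 : (m : ℕ) ≠ 0 := fun h => h2 (Fin.ext h)
    rcases s with _ | s
    · omega
    · rw [mul_add] at h3
      omega
  · exact Polynomial.coeff_zero _
  · rw [h2] at h3
    have h4 : ((j + 1 : Fin (n + 1)) : ℕ) = j + 1 :=
      Fin.val_add_one_of_lt (Fin.lt_last_iff_ne_last.2 h1)
    have : s = 0 := by
      rw [h4] at h3
      have : (n + 1) * s = 0 := by omega
      simpa using this
    rw [this, Polynomial.coeff_one_zero]
  · rw [Polynomial.coeff_one, if_neg]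
    rintro rfl
    refine h3 ?_
    rw [h2, Fin.val_add_one_of_lt (Fin.lt_last_iff_ne_last.2 h1), mul_zero, zero_add]
  · have hjn : (j : ℕ) ≠ n := fun h => h1 (Fin.ext h)
    rcases s with _ | s
    · refine absurd (Fin.ext ?_) h2
      rw [Fin.val_add_one_of_lt (Fin.lt_last_iff_ne_last.2 h1)]
      omega
    · rw [mul_add] at h3
      omega
  · exact Polynomial.coeff_zero _

/-- The reduced connection in coordinates. -/
lemma redCoord_redNabla {Q : MvPolynomial (Fin (n + 1)) (Polynomial F)} (hQ : Q ∈ RedSym F n k)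
    (l : Idx n k × ℕ) :
    redCoord (redNabla F n Q) l = connAct k (lead F) (redCoord Q) l := by
  have h1 : ∀ i : Idx n k, redNabla F n (redMono F i : MvPolynomial (Fin (n + 1)) (Polynomial F)) =
      ∑ j, ∑ m, ((i.1 j : Polynomial F) * redMat F j m) •
        (redMono F (move i j m) : MvPolynomial (Fin (n + 1)) (Polynomial F)) := fun i =>
    derivation_mono (redNabla F n) MvPolynomial.X (redMat F) (fun j => by
      rw [redNabla, MvPolynomial.mkDerivation_X, redG_eq_sum]) i
  rw [redCoord, connAct_apply]
  conv_lhs => rw [red_eq_sum hQ]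
  simp only [map_sum, Derivation.map_smul, h1, Finset.smul_sum, smul_smul, MvPolynomial.coeff_sum,
    coeff_smul_redMono, Polynomial.finsetSum_coeff]
  refine Finset.sum_congr rfl fun i _ => Finset.sum_congr rfl fun j _ =>
    Finset.sum_congr rfl fun m _ => ?_
  split_ifs
  · rw [mul_left_comm, Polynomial.coeff_natCast_mul, Polynomial.coeff_mul]
    simp only [coeff_redMat]
    rfl
  · exact Polynomial.coeff_zero _

lemma redNabla_mem {Q : MvPolynomial (Fin (n + 1)) (Polynomial F)} (hQ : Q ∈ RedSym F n k) :
    redNabla F n Q ∈ RedSym F n k := by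
  rw [red_eq_sum hQ, map_sum]
  refine sum_mem fun i _ => ?_
  rw [Derivation.map_smul]
  refine Submodule.smul_mem _ _ ?_
  have := derivation_mono (redNabla F n) MvPolynomial.X (redMat F) (fun j => by
      rw [redNabla, MvPolynomial.mkDerivation_X, redG_eq_sum]) i
  have h2 : redNabla F n (redMono F i : MvPolynomial (Fin (n + 1)) (Polynomial F)) = _ := this
  rw [h2]
  exact sum_mem fun j _ => sum_mem fun m _ => Submodule.smul_mem _ _ (redMono F (move i j m)).2

lemma exists_redCoord_eq {f : Idx n k × ℕ → F} {N : ℕ} (hf : ∀ e, N ≤ e.2 → f e = 0) :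
    ∃ Q ∈ RedSym F n k, ∀ l, redCoord Q l = f l := by
  refine ⟨∑ i : Idx n k, (∑ s ∈ Finset.range N, Polynomial.monomial s (f (i, s))) •
    (redMono F i : MvPolynomial (Fin (n + 1)) (Polynomial F)),
    sum_mem fun i _ => Submodule.smul_mem _ _ (redMono F i).2, fun l => ?_⟩
  rw [redCoord, MvPolynomial.coeff_sum]
  simp only [coeff_smul_redMono]
  rw [Finset.sum_ite_eq' Finset.univ l.1, if_pos (Finset.mem_univ _), Polynomial.finsetSum_coeff]
  simp only [Polynomial.coeff_monomial]
  rw [Finset.sum_ite_eq' (Finset.range N) l.2]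
  split_ifs with h
  · rfl
  · exact (hf l (by simpa using h)).symm

lemma eq_of_redCoord_eq {Q Q' : MvPolynomial (Fin (n + 1)) (Polynomial F)} (hQ : Q ∈ RedSym F n k)
    (hQ' : Q' ∈ RedSym F n k) (h : ∀ l : Idx n k × ℕ, redCoord Q l = redCoord Q' l) : Q = Q' :=
  eq_of_coeff_eq hQ hQ' fun l => Polynomial.ext fun s => h (l, s)

end Graded

/-! ### Constant bases and integral matrices -/

section ConstantBasis

variable {n k : ℕ} {B : Set (Idx n k)}

instance (B : Set (Idx n k)) : Fintype B := Fintype.ofFinite _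

/-- The vector `∑_{i ∈ B} b_i e^i`, in coordinates. -/
def constEmb {A : Type*} [CommRing A] (B : Set (Idx n k)) : (B → A) →ₗ[A] (Idx n k × ℕ → A) where
  toFun b l := open Classical in if h : l.1 ∈ B ∧ l.2 = 0 then b ⟨l.1, h.1⟩ else 0
  map_add' b b' := by
    funext l
    rw [Pi.add_apply]
    split_ifs
    · rfl
    · rw [add_zero]
  map_smul' c b := by
    funext l
    rw [Pi.smul_apply, RingHom.id_apply]
    split_ifs
    · rfl
    · rw [smul_zero]

lemma constEmb_apply {A : Type*} [CommRing A] (b : B → A) (l : Idx n k × ℕ) :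
    constEmb B b l = open Classical in if h : l.1 ∈ B ∧ l.2 = 0 then b ⟨l.1, h.1⟩ else 0 := rfl

/-- The unknowns of the equation `∇ η + ∑_{i ∈ B} b_i e^i = f`: the coordinates of `η` and of `b`. -/
abbrev Unk (B : Set (Idx n k)) : Type := (Idx n k × ℕ) ⊕ B

/-- The degree of the monomials to which an unknown contributes, for the connection `Ḡ`. -/
def udeg : Unk B → ℕ := Sum.elim (fun e => sdeg e + 1) fun b => wt b.1

/-- The map `(η, b) ↦ ∇ η + ∑_{i ∈ B} b_i e^i`, for a linear connection with matrix `c`. -/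
def solMap {A : Type*} [CommRing A] (B : Set (Idx n k)) (c : Fin (n + 1) → Fin (n + 1) → ℕ → A) :
    (Unk B → A) →ₗ[A] (Idx n k × ℕ → A) :=
  connAct k c ∘ₗ LinearMap.funLeft _ _ Sum.inl + constEmb B ∘ₗ LinearMap.funLeft _ _ Sum.inr

lemma solMap_apply {A : Type*} [CommRing A] (c : Fin (n + 1) → Fin (n + 1) → ℕ → A)
    (z : Unk B → A) (l : Idx n k × ℕ) : solMap B c z l =
      connAct k c (fun e => z (Sum.inl e)) l + constEmb B (fun b => z (Sum.inr b)) l := rfl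

lemma solMap_map {A A' : Type*} [CommRing A] [CommRing A'] (φ : A →+* A') (z : Unk B → A)
    (l : Idx n k × ℕ) : φ (solMap B (lead A) z l) = solMap B (lead A') (fun x => φ (z x)) l := by
  rw [solMap_apply, solMap_apply, map_add, connAct_map, map_lead, constEmb_apply, constEmb_apply,
    apply_dite φ, map_zero]

/-- The equation is graded. -/
lemma solMap_lead_eq_zero {A : Type*} [CommRing A] {z : Unk B → A} {l : Idx n k × ℕ}
    (h : ∀ x, udeg x = sdeg l → z x = 0) : solMap B (lead A) z l = 0 := by
  rw [solMap_apply, connAct_lead_eq_zero fun e he => h (Sum.inl e) he, zero_add, constEmb_apply]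
  split_ifs with hl
  · exact h (Sum.inr ⟨l.1, hl.1⟩) (by simp [udeg, sdeg, hl.2])
  · rfl

lemma solMap_lead_congr {A : Type*} [CommRing A] {z z' : Unk B → A} {l : Idx n k × ℕ}
    (h : ∀ x, udeg x = sdeg l → z x = z' x) : solMap B (lead A) z l = solMap B (lead A) z' l := by
  rw [← sub_eq_zero, ← Pi.sub_apply, ← map_sub]
  exact solMap_lead_eq_zero fun x hx => by rw [Pi.sub_apply, h x hx, sub_self]

lemma finite_udeg_le (d : ℕ) : {x : Unk B | udeg x ≤ d}.Finite := by
  have h1 : (Sum.inl '' {l : Idx n k × ℕ | sdeg l ≤ d} ∪ Set.range Sum.inr : Set (Unk B)).Finite :=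
    ((finite_sdeg_le d).image _).union (Set.finite_range _)
  refine h1.subset ?_
  rintro (e | b) hx
  · refine Or.inl ⟨e, ?_, rfl⟩
    rw [Set.mem_ofPred_eq] at hx ⊢
    simp only [udeg, Sum.elim_inl] at hx
    omega
  · exact Or.inr ⟨b, rfl⟩

/-- The unknowns of degree `d`. -/
abbrev UnkD (B : Set (Idx n k)) (d : ℕ) : Type := {x : Unk B // udeg x = d}

/-- The monomials of degree `d`. -/
abbrev MonD (n k d : ℕ) : Type := {l : Idx n k × ℕ // sdeg l = d}

instance (d : ℕ) : Finite (UnkD B d) := ((finite_udeg_le d).subset fun _ hx => le_of_eq hx).to_subtype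

instance (d : ℕ) : Finite (MonD n k d) :=
  ((finite_sdeg_le d).subset fun _ hx => le_of_eq hx).to_subtype

instance (d : ℕ) : Fintype (UnkD B d) := Fintype.ofFinite _

instance (d : ℕ) : Fintype (MonD n k d) := Fintype.ofFinite _

/-- The integral matrix of the equation in degree `d`. -/
def solMat (B : Set (Idx n k)) (d : ℕ) : Matrix (MonD n k d) (UnkD B d) ℤ := fun l x =>
  open Classical in solMap B (lead ℤ) (Pi.single x.1 1) l.1

lemma solMap_eq_mulVec {A : Type*} [CommRing A] (z : Unk B → A) {d : ℕ} (l : MonD n k d) :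
    solMap B (lead A) z l.1 =
      ((solMat B d).map (Int.castRingHom A)).mulVec (fun x : UnkD B d => z x.1) l := by
  classical
  have h1 : solMap B (lead A) z l.1 =
      solMap B (lead A) (∑ x : UnkD B d, z x.1 • Pi.single x.1 1) l.1 := by
    refine solMap_lead_congr fun x hx => ?_
    rw [l.2] at hx
    rw [Finset.sum_apply, Finset.sum_eq_single ⟨x, hx⟩]
    · simp
    · intro y _ hy
      rw [Pi.smul_apply, Pi.single_eq_of_ne (fun h => hy (Subtype.ext h.symm)), smul_zero]
    · intro h; exact absurd (Finset.mem_univ _) h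
  rw [h1, map_sum, Finset.sum_apply, Matrix.mulVec, dotProduct]
  refine Finset.sum_congr rfl fun x _ => ?_
  rw [map_smul, Pi.smul_apply, smul_eq_mul, mul_comm, Matrix.map_apply, solMat, solMap_map]
  congr 1
  refine congrFun (congrArg (solMap B (lead A)) (funext fun y => ?_)) l.1
  rcases eq_or_ne y x.1 with rfl | h
  · simp
  · simp [h]

variable {F : Type} [Field F]

/-- The vector `∑_{i ∈ B} b_i ē^i`. -/
def constVec (b : B → F) : RedSym F n k := ∑ i, b i • redMono F i.1

lemma redCoord_constVec (b : B → F) (l : Idx n k × ℕ) :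
    redCoord (constVec b : MvPolynomial (Fin (n + 1)) (Polynomial F)) l = constEmb B b l := by
  classical
  have h1 : (constVec b : MvPolynomial (Fin (n + 1)) (Polynomial F)) = ∑ i : B,
      Polynomial.C (b i) • (redMono F i.1 : MvPolynomial (Fin (n + 1)) (Polynomial F)) := by
    rw [constVec, Submodule.coe_sum]
    refine Finset.sum_congr rfl fun i _ => ?_
    rw [← mul_one (Polynomial.C (b i)), ← Polynomial.smul_eq_C_mul, smul_assoc, one_smul]
    rfl
  rw [h1, redCoord, MvPolynomial.coeff_sum, constEmb_apply]
  simp only [coeff_smul_redMono, Polynomial.finsetSum_coeff]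
  obtain ⟨l, s⟩ := l
  split_ifs with hl
  · obtain ⟨hl, rfl⟩ : l ∈ B ∧ s = 0 := hl
    rw [Finset.sum_eq_single ⟨l, hl⟩]
    · rw [if_pos rfl, Polynomial.coeff_C_zero]
    · intro b _ hb
      rw [if_neg fun h => hb (Subtype.ext h), Polynomial.coeff_zero]
    · intro h; exact absurd (Finset.mem_univ _) h
  · refine Finset.sum_eq_zero fun i _ => ?_
    split_ifs with hi
    · have : s ≠ 0 := fun h => hl ⟨hi ▸ i.2, h⟩
      rw [Polynomial.coeff_C_of_ne_zero this]
    · exact Polynomial.coeff_zero _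

lemma mkQ_constVec (b : B → F) : (redImage F n k).mkQ (constVec b) = ∑ i, b i • redCls F i.1 := by
  rw [constVec, map_sum]
  refine Finset.sum_congr rfl fun i _ => ?_
  rw [LinearMap.map_smul_of_tower]
  rfl

lemma redCoord_add (Q Q' : MvPolynomial (Fin (n + 1)) (Polynomial F)) (l : Idx n k × ℕ) :
    redCoord (Q + Q') l = redCoord Q l + redCoord Q' l := by
  rw [redCoord, MvPolynomial.coeff_add, Polynomial.coeff_add]
  rfl

lemma redCoord_zero (l : Idx n k × ℕ) :
    redCoord (0 : MvPolynomial (Fin (n + 1)) (Polynomial F)) l = 0 := by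
  rw [redCoord, MvPolynomial.coeff_zero, Polynomial.coeff_zero]

/-- Modulo `p`, the equation has only the trivial finitely supported solution. -/
lemma solMap_injective (hB : IsConstantBasis F B) (hinj : ∀ Q ∈ RedSym F n k,
    redNabla F n Q = 0 → Q = 0) {z : Unk B → F} {N : ℕ} (hz : ∀ e, N ≤ e.2 → z (Sum.inl e) = 0)
    (h0 : ∀ l, solMap B (lead F) z l = 0) : z = 0 := by
  obtain ⟨Q, hQ, hQz⟩ := exists_redCoord_eq (f := fun e => z (Sum.inl e)) hz
  have hQz' : (redCoord Q : Idx n k × ℕ → F) = fun e => z (Sum.inl e) := funext hQz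
  let b : B → F := fun i => z (Sum.inr i)
  have hsum : redNabla F n Q + (constVec b : MvPolynomial (Fin (n + 1)) (Polynomial F)) = 0 := by
    refine eq_of_redCoord_eq (k := k) (add_mem (redNabla_mem hQ) (constVec b).2) (zero_mem _) fun l => ?_
    rw [redCoord_add, redCoord_redNabla hQ, redCoord_constVec, redCoord_zero, hQz']
    exact h0 l
  have hcls : ∑ i, b i • redCls F i.1 = 0 := by
    rw [← mkQ_constVec, Submodule.mkQ_apply, Submodule.Quotient.mk_eq_zero]
    refine ⟨-Q, neg_mem hQ, ?_⟩
    rw [map_neg]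
    exact neg_eq_of_add_eq_zero_right hsum
  have hb := Fintype.linearIndependent_iff.1 hB.1 b hcls
  have hb0 : b = 0 := funext hb
  have hQ0 : Q = 0 := by
    refine hinj Q hQ ?_
    rw [hb0] at hsum
    simpa [constVec] using hsum
  funext x
  rcases x with e | i
  · rw [← hQz e, hQ0, redCoord_zero]
    rfl
  · exact hb i

/-- Modulo `p`, the equation can be solved for finitely supported right hand sides. -/
lemma solMap_surjective (hB : IsConstantBasis F B) {y : Idx n k × ℕ → F} {N : ℕ}
    (hy : ∀ e, N ≤ e.2 → y e = 0) : ∃ z : Unk B → F, ∀ l, solMap B (lead F) z l = y l := by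
  obtain ⟨f, hf, hfy⟩ := exists_redCoord_eq hy
  have h1 : (redImage F n k).mkQ ⟨f, hf⟩ ∈
      Submodule.span F (Set.range fun i : B => redCls F i.1) := by
    rw [hB.2]; trivial
  obtain ⟨b, hb⟩ := (Submodule.mem_span_range_iff_exists_fun F).1 h1
  rw [← mkQ_constVec, ← sub_eq_zero, ← map_sub, Submodule.mkQ_apply,
    Submodule.Quotient.mk_eq_zero] at hb
  obtain ⟨Q, hQ, hQf⟩ := hb
  have hQf' : redNabla F n Q = (constVec b : MvPolynomial (Fin (n + 1)) (Polynomial F)) - f := hQf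
  refine ⟨Sum.elim (-(redCoord Q : Idx n k × ℕ → F)) b, fun l => ?_⟩
  have h2 : f = redNabla F n (-Q) + (constVec b : MvPolynomial (Fin (n + 1)) (Polynomial F)) := by
    rw [map_neg, hQf']; abel
  have h3 : (redCoord (-Q) : Idx n k × ℕ → F) = -redCoord Q := by
    funext l
    rw [redCoord, MvPolynomial.coeff_neg, Polynomial.coeff_neg]
    rfl
  rw [← hfy l, h2, redCoord_add, redCoord_redNabla (neg_mem hQ), redCoord_constVec, h3]
  rfl

/-- In each degree the matrix of the equation is invertible modulo `p`. -/
lemma mulVec_bijective (hB : IsConstantBasis F B) (hinj : ∀ Q ∈ RedSym F n k,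
    redNabla F n Q = 0 → Q = 0) (d : ℕ) :
    Function.Bijective ((solMat B d).map (Int.castRingHom F)).mulVecLin := by
  classical
  constructor
  · rw [injective_iff_map_eq_zero]
    intro z hz
    -- Extension by zero to the unknowns of the other degrees.
    let z' : Unk B → F := fun x => if h : udeg x = d then z ⟨x, h⟩ else 0
    have hz'0 : z' = 0 := by
      refine solMap_injective hB hinj (N := d) (fun e he => dif_neg ?_) fun l => ?_
      · simp only [udeg, Sum.elim_inl, sdeg]
        nlinarith [Nat.zero_le (n * e.2), Nat.zero_le (wt e.1)]
      · by_cases hl : sdeg l = d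
        · rw [solMap_eq_mulVec z' ⟨l, hl⟩]
          have : (fun x : UnkD B d => z' x.1) = z := funext fun x => dif_pos x.2
          rw [this]
          exact congrFun hz ⟨l, hl⟩
        · exact solMap_lead_eq_zero fun x hx => dif_neg fun h => hl (hx ▸ h)
    funext x
    have := congrFun hz'0 x.1
    rwa [show z' x.1 = z x from dif_pos x.2] at this
  · intro y
    let y' : Idx n k × ℕ → F := fun l => if h : sdeg l = d then y ⟨l, h⟩ else 0
    obtain ⟨z, hz⟩ := solMap_surjective hB (y := y') (N := d + 1) fun e he => dif_neg (by
      rw [sdeg]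
      nlinarith [Nat.zero_le (n * e.2), Nat.zero_le (wt e.1)])
    refine ⟨fun x => z x.1, funext fun l => ?_⟩
    rw [Matrix.mulVecLin_apply, ← solMap_eq_mulVec, hz]
    exact dif_pos l.2

/-- An integral matrix that is invertible over a field of characteristic `p` has an inverse with
denominator prime to `p`. -/
lemma exists_int_inverse {p : ℕ} [CharP F p] {m m' : Type*} [Fintype m] [Fintype m']
    [DecidableEq m] [DecidableEq m'] (M : Matrix m m' ℤ)
    (hM : Function.Bijective (M.map (Int.castRingHom F)).mulVecLin) :
    ∃ (N : Matrix m' m ℤ) (D : ℤ), ¬ (p : ℤ) ∣ D ∧ M * N = D • 1 ∧ N * M = D • 1 := by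
  -- The matrix is square, and the denominator is its determinant.
  have hcard : Fintype.card m' = Fintype.card m := by
    have := (LinearEquiv.ofBijective _ hM).finrank_eq
    simpa using this
  let e : m' ≃ m := Fintype.equivOfCardEq hcard
  let S : Matrix m m ℤ := M.reindex (Equiv.refl m) e
  have hS : M = S.reindex (Equiv.refl m) e.symm := by
    ext i j
    simp [S]
  refine ⟨S.adjugate.reindex e.symm (Equiv.refl m), S.det, fun hdvd => ?_, ?_, ?_⟩
  · have h1 : (S.map (Int.castRingHom F)).det = 0 := by
      rw [← RingHom.mapMatrix_apply, ← RingHom.map_det]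
      exact (CharP.intCast_eq_zero_iff F p _).2 hdvd
    obtain ⟨v, hv, hv0⟩ := Matrix.exists_mulVec_eq_zero_iff.2 h1
    refine hv ?_
    have h2 : (fun j => v (e j)) = (0 : m' → F) := hM.1 (by
      rw [map_zero, Matrix.mulVecLin_apply, ← hv0]
      funext i
      rw [Matrix.mulVec, dotProduct, Matrix.mulVec, dotProduct, ← e.sum_comp]
      refine Finset.sum_congr rfl fun j _ => ?_
      simp [S])
    funext j
    have := congrFun h2 (e.symm j)
    simpa using this
  · conv_lhs => rw [hS]
    rw [Matrix.reindex_apply, Matrix.reindex_apply, Matrix.submatrix_mul_equiv, Matrix.mul_adjugate]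
    ext i j
    rfl
  · conv_lhs => rw [hS]
    rw [Matrix.reindex_apply, Matrix.reindex_apply, Matrix.submatrix_mul_equiv, Matrix.adjugate_mul]
    ext i j
    rw [Matrix.submatrix_apply, Matrix.smul_apply, Matrix.smul_apply, Matrix.one_apply, Matrix.one_apply]
    simp

end ConstantBasis

/-! ### The cokernel of the connection on the symmetric power -/

section Cokernel

variable {n k : ℕ} {B : Set (Idx n k)} {p : ℕ} [hp : Fact p.Prime]
  {L : IntermediateField ℚ_[p] (PadicAlgCl p)} {c : Fin (n + 1) → Fin (n + 1) → ℕ → PadicAlgCl p}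

lemma norm_intCast_eq_one {D : ℤ} (hD : ¬ (p : ℤ) ∣ D) : ‖(D : PadicAlgCl p)‖ = 1 := by
  refine le_antisymm (norm_intCast_le_one p D) ?_
  have hcop : IsCoprime (p : ℤ) D :=
    (Nat.prime_iff_prime_int.1 hp.1).coprime_iff_not_dvd.2 hD
  obtain ⟨u, v, huv⟩ := hcop
  by_contra! hlt
  have h1 : ‖((u * p + v * D : ℤ) : PadicAlgCl p)‖ < 1 := by
    push_cast
    refine (IsUltrametricDist.norm_add_le_max _ _).trans_lt (max_lt ?_ ?_)
    · rw [norm_mul, norm_prime]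
      exact mul_lt_one_of_nonneg_of_lt_one_right (norm_intCast_le_one p u) (by positivity)
        (inv_lt_one_of_one_lt₀ one_lt_prime)
    · rw [norm_mul]
      exact mul_lt_one_of_nonneg_of_lt_one_right (norm_intCast_le_one p v) (norm_nonneg _) hlt
  rw [huv] at h1
  simp at h1

/-- In each degree the leading part of the equation has an integral inverse, up to a denominator
prime to `p`. -/
def LeadInvertible (p : ℕ) (B : Set (Idx n k)) : Prop :=
  open Classical in ∀ d, ∃ (N : Matrix (UnkD B d) (MonD n k d) ℤ) (D : ℤ), (¬ ((p : ℤ) ∣ D)) ∧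
    (solMat B d * N = D • (1 : Matrix (MonD n k d) (MonD n k d) ℤ)) ∧
      (N * solMat B d = D • (1 : Matrix (UnkD B d) (UnkD B d) ℤ))

/-- The monomials are values of the leading part, with integral coefficients. -/
lemma LeadInvertible.exists_lead_single (hM : LeadInvertible p B)
    (L : IntermediateField ℚ_[p] (PadicAlgCl p)) (l : Idx n k × ℕ) :
    ∃ z : Unk B → PadicAlgCl p, (∀ x, z x ∈ L) ∧ (∀ x, ‖z x‖ ≤ 1) ∧
      (∀ x, udeg x ≠ sdeg l → z x = 0) ∧ solMap B (lead (PadicAlgCl p)) z = Pi.single l 1 := by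
  classical
  obtain ⟨N, D, hpD, hN, -⟩ := hM (sdeg l)
  have hD1 := norm_intCast_eq_one hpD
  have hD0 : (D : PadicAlgCl p) ≠ 0 := by rw [← norm_pos_iff, hD1]; exact one_pos
  -- The column of the inverse matrix that belongs to `l`.
  let z : Unk B → PadicAlgCl p := fun x =>
    if h : udeg x = sdeg l then (N ⟨x, h⟩ ⟨l, rfl⟩ : PadicAlgCl p) / D else 0
  refine ⟨z, fun x => ?_, fun x => ?_, fun x hx => dif_neg hx, funext fun l' => ?_⟩
  · dsimp only [z]
    split_ifs
    · exact div_mem (intCast_mem _ _) (intCast_mem _ _)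
    · exact zero_mem _
  · dsimp only [z]
    split_ifs
    · rw [norm_div, hD1, div_one]
      exact norm_intCast_le_one p _
    · simp
  · by_cases hl : sdeg l' = sdeg l
    · have h1 := solMap_eq_mulVec z (⟨l', hl⟩ : MonD n k (sdeg l))
      dsimp only at h1
      rw [h1, Matrix.mulVec, dotProduct]
      have h2 := congrFun (congrFun hN ⟨l', hl⟩) ⟨l, rfl⟩
      rw [Matrix.mul_apply] at h2
      have h3 : ∀ x : UnkD B (sdeg l), z x.1 = (N x ⟨l, rfl⟩ : PadicAlgCl p) / D :=
        fun x => dif_pos x.2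
      simp only [h3, Matrix.map_apply, eq_intCast, ← mul_div_assoc]
      rw [← Finset.sum_div, div_eq_iff hD0]
      have h4 := congrArg (Int.cast : ℤ → PadicAlgCl p) h2
      push_cast at h4
      rw [h4, Matrix.smul_apply, Matrix.one_apply, Pi.single_apply]
      by_cases hll : l' = l
      · subst hll
        simp
      · rw [if_neg hll, if_neg fun h => hll (congrArg Subtype.val h)]
        simp
    · rw [Pi.single_eq_of_ne (fun h => hl (by rw [h]))]
      exact solMap_lead_eq_zero fun x hx => dif_neg fun h => hl (by rw [← hx, h])

/-- In each degree, a solution is no larger than the value of the leading part. -/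
lemma LeadInvertible.norm_le (hM : LeadInvertible p B) {z : Unk B → PadicAlgCl p} {C : ℝ} (hC : 0 ≤ C)
    {d : ℕ} (hz : ∀ l, sdeg l = d → ‖solMap B (lead (PadicAlgCl p)) z l‖ ≤ C) {x : Unk B}
    (hx : udeg x = d) : ‖z x‖ ≤ C := by
  classical
  obtain ⟨N, D, hpD, -, hN⟩ := hM d
  -- Apply the inverse matrix to the values; `D` is a unit.
  have h1 : (D : PadicAlgCl p) * z x = ∑ l : MonD n k d,
      (N ⟨x, hx⟩ l : PadicAlgCl p) * solMap B (lead (PadicAlgCl p)) z l.1 := by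
    simp only [solMap_eq_mulVec, Matrix.mulVec, dotProduct, Finset.mul_sum]
    rw [Finset.sum_comm]
    have h2 : ∀ y : UnkD B d, ∑ l : MonD n k d, (N ⟨x, hx⟩ l : PadicAlgCl p) *
        ((solMat B d).map (Int.castRingHom (PadicAlgCl p)) l y * z y.1) =
        ((D • (1 : Matrix (UnkD B d) (UnkD B d) ℤ)) ⟨x, hx⟩ y : ℤ) * z y.1 := by
      intro y
      rw [← hN, Matrix.mul_apply]
      push_cast
      rw [Finset.sum_mul]
      exact Finset.sum_congr rfl fun l _ => by rw [Matrix.map_apply, eq_intCast, mul_assoc]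
    rw [Finset.sum_congr rfl fun y _ => h2 y, Finset.sum_eq_single ⟨x, hx⟩]
    · rw [Matrix.smul_apply, Matrix.one_apply_eq]
      simp
    · intro y _ hy
      rw [Matrix.smul_apply, Matrix.one_apply_ne hy.symm]
      simp
    · intro h; exact absurd (Finset.mem_univ _) h
  have h2 : ‖z x‖ = ‖(D : PadicAlgCl p) * z x‖ := by
    rw [norm_mul, norm_intCast_eq_one hpD, one_mul]
  rw [h2, h1]
  refine IsUltrametricDist.norm_sum_le_of_forall_le_of_nonneg hC fun l _ => ?_
  rw [norm_mul]
  exact (mul_le_of_le_one_left (norm_nonneg _) (norm_intCast_le_one p _)).trans (hz l.1 l.2)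

lemma norm_connAct_le {f : Idx n k × ℕ → PadicAlgCl p} {l : Idx n k × ℕ} {δ : ℝ} (hδ : 0 ≤ δ)
    (h : ∀ i j m x, i.1 j ≠ 0 → move i j m = l.1 → x ∈ Finset.HasAntidiagonal.antidiagonal l.2 →
      ‖f (i, x.1)‖ * ‖c j m x.2‖ ≤ δ) : ‖connAct k c f l‖ ≤ δ := by
  rw [connAct_apply]
  refine IsUltrametricDist.norm_sum_le_of_forall_le_of_nonneg hδ fun i _ =>
    IsUltrametricDist.norm_sum_le_of_forall_le_of_nonneg hδ fun j _ =>
    IsUltrametricDist.norm_sum_le_of_forall_le_of_nonneg hδ fun m _ => ?_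
  split_ifs with hl
  · rcases eq_or_ne (i.1 j) 0 with hj | hj
    · rw [hj, Nat.cast_zero, zero_mul, norm_zero]
      exact hδ
    · rw [norm_mul]
      refine (mul_le_of_le_one_left (norm_nonneg _) (norm_natCast_le_one p _)).trans ?_
      refine IsUltrametricDist.norm_sum_le_of_forall_le_of_nonneg hδ fun x hx => ?_
      rw [norm_mul]
      exact h i j m x hj hl hx
  · rw [norm_zero]
    exact hδ

/-- The matrix `c` is a perturbation of the matrix of `Ḡ`. -/
structure NearLead (L : IntermediateField ℚ_[p] (PadicAlgCl p))
    (c : Fin (n + 1) → Fin (n + 1) → ℕ → PadicAlgCl p) : Prop where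
  mem : ∀ j m s, c j m s ∈ L
  le : ∀ P : ℝ, 1 ≤ P → P < p → ∀ j m s,
    ‖c j m s - lead (PadicAlgCl p) j m s‖ * P ^ ((n + 1) * s + (m : ℕ)) ≤ P / p * P ^ ((j : ℕ) + 1)

lemma connAct_sub (c c' : Fin (n + 1) → Fin (n + 1) → ℕ → PadicAlgCl p)
    (f : Idx n k × ℕ → PadicAlgCl p) :
    connAct k c f - connAct k c' f = connAct k (fun j m s => c j m s - c' j m s) f := by
  funext l
  simp only [Pi.sub_apply, connAct_apply, ← Finset.sum_sub_distrib]
  refine Finset.sum_congr rfl fun i _ => Finset.sum_congr rfl fun j _ =>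
    Finset.sum_congr rfl fun m _ => ?_
  split_ifs
  · rw [← mul_sub, ← Finset.sum_sub_distrib]
    simp only [mul_sub]
  · rw [sub_zero]

/-- The connection differs from `Ḡ` by a small operator, for the weights `P^{deg}`. -/
lemma ball_connAct_sub (hc : NearLead L c) {P : ℝ} (hP : 1 ≤ P) (hPp : P < p) {C : ℝ} (hC : 0 < C)
    {f : Idx n k × ℕ → PadicAlgCl p} (hf : Ball L Set.univ (fun e => P ^ (sdeg e + 1)) C f) :
    Ball L Set.univ (fun l => P ^ sdeg l) (P / p * C)
      (connAct k c f - connAct k (lead (PadicAlgCl p)) f) := by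
  have hp0 : (0 : ℝ) < p := by exact_mod_cast hp.1.pos
  have hP0 : 0 < P := by linarith
  have hlead : ∀ (j m : Fin (n + 1)) (s : ℕ), lead (PadicAlgCl p) j m s ∈ L := fun j m s => by
    rw [lead]
    split_ifs
    · exact one_mem _
    · exact zero_mem _
  rw [connAct_sub]
  set ε := fun (j m : Fin (n + 1)) s => c j m s - lead (PadicAlgCl p) j m s with hε
  have hpow : ∀ (i : Idx n k) (j m : Fin (n + 1)) (x : ℕ × ℕ) (l : Idx n k × ℕ), i.1 j ≠ 0 →
      move i j m = l.1 → x ∈ Finset.HasAntidiagonal.antidiagonal l.2 →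
      sdeg l + ((j : ℕ) + 1) = (sdeg (i, x.1) + 1) + ((n + 1) * x.2 + m) := by
    intro i j m x l hj hl hx
    rw [Finset.HasAntidiagonal.mem_antidiagonal] at hx
    have h1 := sdeg_move hj m x.1 x.2
    rw [hl, hx] at h1
    have h2 : sdeg l = sdeg (l.1, l.2) := rfl
    omega
  refine ⟨fun l => ?_, fun l hl => absurd (Set.mem_univ l) hl, fun l => ?_, fun η hη => ?_⟩
  · rw [connAct_apply]
    refine sum_mem fun i _ => sum_mem fun j _ => sum_mem fun m _ => ?_
    split_ifs
    · exact mul_mem (natCast_mem _ _) (sum_mem fun x _ => mul_mem (hf.1 _)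
        (sub_mem (hc.mem _ _ _) (hlead _ _ _)))
    · exact zero_mem _
  · rw [← le_div_iff₀ (by positivity)]
    refine norm_connAct_le (by positivity) fun i j m x hj hl hx => ?_
    rw [le_div_iff₀ (by positivity)]
    have h1 := hf.2.2.1 (i, x.1)
    have h2 := hc.le P hP hPp j m x.2
    have h3 : P ^ sdeg l * P ^ ((j : ℕ) + 1) =
        P ^ (sdeg (i, x.1) + 1) * P ^ ((n + 1) * x.2 + (m : ℕ)) := by
      rw [← pow_add, ← pow_add, hpow i j m x l hj hl hx]
    refine le_of_mul_le_mul_right ?_ (show 0 < P ^ ((j : ℕ) + 1) by positivity)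
    calc ‖f (i, x.1)‖ * ‖ε j m x.2‖ * P ^ sdeg l * P ^ ((j : ℕ) + 1)
        = (‖f (i, x.1)‖ * P ^ (sdeg (i, x.1) + 1)) *
          (‖ε j m x.2‖ * P ^ ((n + 1) * x.2 + (m : ℕ))) := by
          rw [mul_assoc, h3]; ring
      _ ≤ C * (P / p * P ^ ((j : ℕ) + 1)) := mul_le_mul h1 h2 (by positivity) hC.le
      _ = P / p * C * P ^ ((j : ℕ) + 1) := by ring
  · -- A slightly larger weight shows that the convolutions tend to zero.
    obtain ⟨P', hP1, hP2⟩ := exists_between hPp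
    have hP'0 : 0 < P' := hP0.trans hP1
    set K : ℝ := P' / p * P' ^ (n + 1) with hK
    have hK0 : 0 < K := by positivity
    have hr1 : P / P' < 1 := (div_lt_one hP'0).2 hP1
    obtain ⟨N, hN⟩ := exists_pow_lt_of_lt_one (show 0 < η / (C * K) by positivity) hr1
    have hfin : (Set.image2 (fun (e : Idx n k × ℕ) (y : Idx n k × ℕ) => (y.1, e.2 + y.2))
        {e | η < ‖f e‖ * P ^ (sdeg e + 1)} (Set.univ ×ˢ Set.Iio N)).Finite :=
      Set.Finite.image2 _ (hf.2.2.2 η hη) (Set.finite_univ.prod (Set.finite_Iio N))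
    refine hfin.subset fun l hl => ?_
    rw [Set.mem_ofPred_eq] at hl
    have hex : ∃ i j m, ∃ x : ℕ × ℕ, i.1 j ≠ 0 ∧ move i j m = l.1 ∧
        x ∈ Finset.HasAntidiagonal.antidiagonal l.2 ∧
        η / P ^ sdeg l < ‖f (i, x.1)‖ * ‖ε j m x.2‖ := by
      by_contra! hcon
      have := norm_connAct_le (c := ε) (f := f) (l := l) (δ := η / P ^ sdeg l) (by positivity) hcon
      rw [le_div_iff₀ (by positivity)] at this
      exact absurd this (not_le.2 hl)
    obtain ⟨i, j, m, x, hj, hm, hx, hlt⟩ := hex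
    have h1 := hf.2.2.1 (i, x.1)
    have h2 := hc.le P hP hPp j m x.2
    have h2' := hc.le P' (hP.trans hP1.le) hP2 j m x.2
    have h3 : P ^ sdeg l * P ^ ((j : ℕ) + 1) =
        P ^ (sdeg (i, x.1) + 1) * P ^ ((n + 1) * x.2 + (m : ℕ)) := by
      rw [← pow_add, ← pow_add, hpow i j m x l hj hm hx]
    rw [div_lt_iff₀ (by positivity)] at hlt
    have hj0 : 0 < P ^ ((j : ℕ) + 1) := by positivity
    have h4 : η * P ^ ((j : ℕ) + 1) < (‖f (i, x.1)‖ * P ^ (sdeg (i, x.1) + 1)) *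
          (‖ε j m x.2‖ * P ^ ((n + 1) * x.2 + (m : ℕ))) := by
      calc η * P ^ ((j : ℕ) + 1) < ‖f (i, x.1)‖ * ‖ε j m x.2‖ * P ^ sdeg l * P ^ ((j : ℕ) + 1) :=
            mul_lt_mul_of_pos_right hlt hj0
        _ = _ := by rw [mul_assoc, h3]; ring
    refine ⟨(i, x.1), ?_, (l.1, x.2), ⟨Set.mem_univ _, ?_⟩, ?_⟩
    · rw [Set.mem_ofPred_eq]
      have h5 := h4.trans_le (mul_le_mul_of_nonneg_left h2 (by positivity))
      have hq1 : P / p ≤ 1 := (div_le_one hp0).2 hPp.le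
      have h6 : η * P ^ ((j : ℕ) + 1) <
          ‖f (i, x.1)‖ * P ^ (sdeg (i, x.1) + 1) * P ^ ((j : ℕ) + 1) :=
        h5.trans_le (mul_le_mul_of_nonneg_left (mul_le_of_le_one_left hj0.le hq1) (by positivity))
      exact lt_of_mul_lt_mul_right h6 hj0.le
    · rw [Set.mem_Iio]
      by_contra! hcon
      have h5 : ‖ε j m x.2‖ * P ^ ((n + 1) * x.2 + (m : ℕ)) ≤ K * (P / P') ^ N := by
        have e1 : ‖ε j m x.2‖ * P ^ ((n + 1) * x.2 + (m : ℕ)) =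
            ‖ε j m x.2‖ * P' ^ ((n + 1) * x.2 + (m : ℕ)) * (P / P') ^ ((n + 1) * x.2 + (m : ℕ)) := by
          rw [div_pow, mul_assoc, mul_div_cancel₀ _ (by positivity)]
        rw [e1]
        refine mul_le_mul (h2'.trans ?_) ?_ (by positivity) hK0.le
        · refine mul_le_mul_of_nonneg_left ?_ (by positivity)
          exact pow_le_pow_right₀ (hP.trans hP1.le) (by have := j.2; omega)
        · refine pow_le_pow_of_le_one (by positivity) hr1.le ?_
          nlinarith [Nat.zero_le (n * x.2), Nat.zero_le (m : ℕ)]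
      have h6 : η * 1 < C * (K * (P / P') ^ N) :=
        (mul_le_mul_of_nonneg_left (one_le_pow₀ hP) hη.le).trans_lt
          (h4.trans_le (mul_le_mul h1 h5 (by positivity) hC.le))
      rw [lt_div_iff₀ (by positivity)] at hN
      nlinarith
    · rw [Finset.HasAntidiagonal.mem_antidiagonal] at hx
      exact Prod.ext rfl hx

/-- The term `t ∂η/∂t`, in coordinates. -/
def tdAct (p : ℕ) [Fact p.Prime] (B : Set (Idx n k)) :
    (Unk B → PadicAlgCl p) →ₗ[PadicAlgCl p] (Idx n k × ℕ → PadicAlgCl p) where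
  toFun z l := (l.2 : PadicAlgCl p) * z (Sum.inl l)
  map_add' _ _ := funext fun _ => mul_add _ _ _
  map_smul' _ _ := funext fun _ => mul_left_comm _ _ _

/-- The map `(η, b) ↦ ∂_t η + ∑_{i ∈ B} b_i e^i`, in coordinates. -/
def cokMap (B : Set (Idx n k)) (c : Fin (n + 1) → Fin (n + 1) → ℕ → PadicAlgCl p) :
    (Unk B → PadicAlgCl p) →ₗ[PadicAlgCl p] (Idx n k × ℕ → PadicAlgCl p) :=
  tdAct p B + solMap B c

lemma cokMap_apply (z : Unk B → PadicAlgCl p) (l : Idx n k × ℕ) : cokMap B c z l =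
    (l.2 : PadicAlgCl p) * z (Sum.inl l) + (connAct k c (fun e => z (Sum.inl e)) l +
      constEmb B (fun b => z (Sum.inr b)) l) := rfl

lemma continuous_cokMap : Continuous (cokMap B c) := by
  refine continuous_pi fun l => ?_
  simp only [cokMap_apply, connAct_apply, constEmb_apply]
  refine (continuous_const.mul (continuous_apply (Sum.inl l : Unk B))).add (Continuous.add ?_ ?_)
  · refine continuous_finsetSum _ fun i _ => continuous_finsetSum _ fun j _ =>
      continuous_finsetSum _ fun m _ => ?_
    split_ifs
    · have h : Continuous fun z : Unk B → PadicAlgCl p =>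
          ∑ x ∈ Finset.HasAntidiagonal.antidiagonal l.2, z (Sum.inl (i, x.1)) * c j m x.2 :=
        continuous_finsetSum _ fun x _ =>
          (continuous_apply (Sum.inl (i, x.1) : Unk B)).mul continuous_const
      exact continuous_const.mul h
    · exact continuous_const
  · split_ifs
    · exact continuous_apply (Sum.inr _ : Unk B)
    · exact continuous_const

/-- The leading part of the equation, including `t ∂/∂t`, can be solved integrally. -/
lemma LeadInvertible.exists_single (hM : LeadInvertible p B)
    (L : IntermediateField ℚ_[p] (PadicAlgCl p)) (d : ℕ) : ∀ l : Idx n k × ℕ, sdeg l = d →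
      ∃ z : Unk B → PadicAlgCl p, (∀ x, z x ∈ L) ∧ (∀ x, ‖z x‖ ≤ 1) ∧
        (∀ x, d < udeg x → z x = 0) ∧
        cokMap B (lead (PadicAlgCl p)) z = Pi.single l 1 := by
  classical
  induction d using Nat.strong_induction_on with
  | _ d ih =>
  intro l hl
  -- Solve without `t ∂/∂t`. The error `t ∂z₀/∂t` is a combination of monomials of lower degree, which
  -- are reached by induction.
  obtain ⟨z₀, h1, h2, h3, h4⟩ := hM.exists_lead_single L l
  have hZ : ∀ e : Idx n k × ℕ, ∃ z : Unk B → PadicAlgCl p, sdeg e < d → (∀ x, z x ∈ L) ∧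
      (∀ x, ‖z x‖ ≤ 1) ∧ (∀ x, sdeg e < udeg x → z x = 0) ∧
      cokMap B (lead (PadicAlgCl p)) z = Pi.single e 1 := by
    intro e
    by_cases he : sdeg e < d
    · obtain ⟨z, hz⟩ := ih _ he e rfl
      exact ⟨z, fun _ => hz⟩
    · exact ⟨0, fun h => absurd h he⟩
  choose Z hZ using hZ
  let S : Finset (Idx n k × ℕ) := (finite_sdeg_le d).toFinset.filter fun e => sdeg e < d
  have hS : ∀ e, e ∈ S ↔ sdeg e < d := fun e => by
    simp only [S, Finset.mem_filter, Set.Finite.mem_toFinset, Set.mem_ofPred_eq]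
    exact ⟨fun h => h.2, fun h => ⟨h.le, h⟩⟩
  let a : Idx n k × ℕ → PadicAlgCl p := fun e => (e.2 : PadicAlgCl p) * z₀ (Sum.inl e)
  have hae : ∀ e, e ∉ S → a e = 0 := fun e he => by
    rw [hS] at he
    have : z₀ (Sum.inl e) = 0 := h3 _ (by
      simp only [udeg, Sum.elim_inl]
      omega)
    simp only [a, this, mul_zero]
  have htd : tdAct p B z₀ = ∑ e ∈ S, a e • Pi.single e 1 := by
    funext l'
    rw [Finset.sum_apply]
    simp only [Pi.smul_apply, Pi.single_apply, smul_eq_mul, mul_ite, mul_one, mul_zero,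
      Finset.sum_ite_eq]
    split_ifs with h
    · rfl
    · exact hae l' h
  refine ⟨z₀ - ∑ e ∈ S, a e • Z e, fun x => ?_, fun x => ?_, fun x hx => ?_, ?_⟩
  · rw [Pi.sub_apply, Finset.sum_apply]
    exact sub_mem (h1 x) (sum_mem fun e he => mul_mem (mul_mem (natCast_mem _ _) (h1 _))
      ((hZ e ((hS e).1 he)).1 x))
  · rw [Pi.sub_apply, Finset.sum_apply, sub_eq_add_neg]
    refine (IsUltrametricDist.norm_add_le_max _ _).trans (max_le (h2 x) ?_)
    rw [norm_neg]
    refine IsUltrametricDist.norm_sum_le_of_forall_le_of_nonneg zero_le_one fun e he => ?_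
    rw [Pi.smul_apply, smul_eq_mul, norm_mul]
    refine mul_le_one₀ ?_ (norm_nonneg _) ((hZ e ((hS e).1 he)).2.1 x)
    rw [norm_mul]
    exact mul_le_one₀ (norm_natCast_le_one p _) (norm_nonneg _) (h2 _)
  · rw [Pi.sub_apply, Finset.sum_apply, h3 x (by omega), Finset.sum_eq_zero, sub_zero]
    intro e he
    have he' := (hS e).1 he
    rw [Pi.smul_apply, (hZ e he').2.2.1 x (by omega), smul_zero]
  · rw [map_sub, map_sum]
    have h5 : cokMap B (lead (PadicAlgCl p)) z₀ = tdAct p B z₀ + Pi.single l 1 := by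
      rw [← h4]; rfl
    rw [h5, htd, Finset.sum_congr rfl fun e he => (by
      rw [map_smul, (hZ e ((hS e).1 he)).2.2.2] :
        cokMap B (lead (PadicAlgCl p)) (a e • Z e) = a e • Pi.single e 1)]
    abel

lemma cokMap_sub_lead (z : Unk B → PadicAlgCl p) :
    cokMap B c z - cokMap B (lead (PadicAlgCl p)) z =
      connAct k c (fun e => z (Sum.inl e)) -
        connAct k (lead (PadicAlgCl p)) (fun e => z (Sum.inl e)) := by
  funext l
  simp only [Pi.sub_apply, cokMap_apply]
  ring

lemma ball_cokMap_sub (hc : NearLead L c) {P : ℝ} (hP : 1 ≤ P) (hPp : P < p) {C : ℝ} (hC : 0 < C)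
    {z : Unk B → PadicAlgCl p} (hz : Ball L Set.univ (fun x => P ^ udeg x) C z) :
    Ball L Set.univ (fun l => P ^ sdeg l) (P / p * C)
      (cokMap B c z - cokMap B (lead (PadicAlgCl p)) z) := by
  rw [cokMap_sub_lead]
  refine ball_connAct_sub hc hP hPp hC ?_
  have := hz.comp_injective (f := Sum.inl) Sum.inl_injective
  rw [Set.preimage_univ] at this
  exact this

/-- Every element is congruent to a combination of the `e^i`, `i ∈ B`, modulo the image of the
connection, with control on the growth. -/
theorem exists_cokMap_eq (hL : IsComplete (L : Set (PadicAlgCl p))) (hM : LeadInvertible p B)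
    (hc : NearLead L c) {P : ℝ} (hP : 1 ≤ P) (hPp : P < p) {C : ℝ} (hC : 0 < C)
    {y : Idx n k × ℕ → PadicAlgCl p} (hy : Ball L Set.univ (fun l => P ^ sdeg l) C y) :
    ∃ z : Unk B → PadicAlgCl p, Ball L Set.univ (fun x => P ^ udeg x) C z ∧ cokMap B c z = y := by
  classical
  have hp0 : (0 : ℝ) < p := by exact_mod_cast hp.1.pos
  have hP0 : 0 < P := by linarith
  choose R hR1 hR2 hR3 hR4 using fun l => hM.exists_single L (sdeg l) l rfl
  refine solve_of_perturbation hL (fun x => by positivity) (fun l => by positivity) (cokMap B c)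
    (cokMap B (lead (PadicAlgCl p))) continuous_cokMap (δ := P / p) (by positivity)
    ((div_lt_one hp0).2 hPp) R (fun l _ => ?_) (fun l _ => hR4 l)
    (fun C hC z hz => ball_cokMap_sub hc hP hPp hC hz) hC hy
  refine Ball.of_finite (hR1 l) (fun x hx => absurd (Set.mem_univ x) hx) (fun x => ?_)
    ((finite_udeg_le (sdeg l)).subset fun x hx => ?_)
  · by_cases hx : sdeg l < udeg x
    · rw [hR3 l x hx, norm_zero, zero_mul]
      positivity
    · exact (mul_le_of_le_one_left (by positivity) (hR2 l x)).trans
        (pow_le_pow_right₀ hP (not_lt.1 hx))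
  · rw [Set.mem_ofPred_eq]
    by_contra! hcon
    exact hx (hR3 l x hcon)

/-- The `e^i`, `i ∈ B`, are independent modulo the image of the connection, and the connection is
injective. -/
theorem eq_zero_of_cokMap_eq_zero (hM : LeadInvertible p B) (hc : NearLead L c) {C : ℝ} (hC : 0 < C)
    {z : Unk B → PadicAlgCl p} (hz : Ball L Set.univ (fun x => (1 : ℝ) ^ udeg x) C z)
    (h0 : cokMap B c z = 0) : z = 0 := by
  have hp0 : (0 : ℝ) < p := by exact_mod_cast hp.1.pos
  refine eq_zero_of_contract (δ := 1 / p) (fun x => by positivity) hC (by positivity)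
    ((div_lt_one hp0).2 one_lt_prime) hz fun C hC hz => ?_
  obtain ⟨F, hF, -, -⟩ := hz.truncate (show 0 < 1 / p * C by positivity)
  by_contra! hcon
  obtain ⟨x, hx⟩ := hcon
  -- Compare the parts of the largest degree in which `z` is not small.
  obtain ⟨x₀, hx₀, hmax⟩ := F.exists_max_image udeg ⟨x, (hF x).2 hx⟩
  have hsmall : ∀ x, udeg x₀ < udeg x → ‖z x‖ ≤ 1 / p * C := fun x hx => by
    by_contra! hlt
    have := hmax x ((hF x).2 (by rwa [one_pow, mul_one]))
    omega
  have hb := ball_cokMap_sub hc le_rfl one_lt_prime hC hz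
  have hle : ‖z x₀‖ ≤ 1 / p * C := by
    refine hM.norm_le (by positivity) (d := udeg x₀) (fun l hl => ?_) rfl
    have h1 := hb.2.2.1 l
    dsimp only at h1
    rw [one_pow, mul_one, h0, zero_sub, Pi.neg_apply, norm_neg] at h1
    have h2 : solMap B (lead (PadicAlgCl p)) z l =
        cokMap B (lead (PadicAlgCl p)) z l - (l.2 : PadicAlgCl p) * z (Sum.inl l) := by
      rw [cokMap_apply, solMap_apply]
      ring
    rw [h2, sub_eq_add_neg]
    refine (IsUltrametricDist.norm_add_le_max _ _).trans (max_le h1 ?_)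
    rw [norm_neg, norm_mul]
    refine (mul_le_of_le_one_left (norm_nonneg _) (norm_natCast_le_one p _)).trans (hsmall _ ?_)
    simp only [udeg, Sum.elim_inl] at hl ⊢
    omega
  have := (hF x₀).1 hx₀
  rw [one_pow, mul_one] at this
  exact absurd hle (not_le.2 this)

end Cokernel

/-! ### The Frobenius on the cohomology of the symmetric power -/

section Main

variable {p a n k : ℕ} [hp : Fact p.Prime] {g : PadicAlgCl p} {B : Set (Idx n k)}

/-- The existence of a constant basis over `𝔽_q` and the injectivity of the reduced connection
provide integral inverses in all degrees, as the matrices have entries in `ℤ`. -/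
lemma leadInvertible {ζ : AlgebraicClosure (ZMod p)} (hζ : IsPrimitiveRoot ζ (n + 1))
    (hd : dk p n k ζ = 0) (hB : IsConstantBasis (GaloisField p a) B) : LeadInvertible p B := by
  classical
  intro d
  let f : GaloisField p a →+* AlgebraicClosure (ZMod p) :=
    (IsAlgClosed.lift : GaloisField p a →ₐ[ZMod p] AlgebraicClosure (ZMod p)).toRingHom
  exact exists_int_inverse (F := GaloisField p a) (solMat B d)
    (mulVec_bijective hB (fun Q hQ h0 => redNabla_injective f hζ hd hQ h0) d)

/-- The coefficients of the matrix of the connection. -/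
def connCo (ha : 1 ≤ a) (hD : IsDworkRoot p (gam p a g)) (j m : Fin (n + 1)) (s : ℕ) :
    PadicAlgCl p := nco p a n 0 g (connMat ha hD (Nat.zero_le a) j m : Or p a n 0 g) s

lemma nearLead_connCo (ha : 1 ≤ a) (hD : IsDworkRoot p (gam p a g)) :
    NearLead (Lq p a g) (connCo (n := n) ha hD) where
  mem j m s := (nco_mem (g_ne_zero hD) (connMat ha hD (Nat.zero_le a) j m : Or p a n 0 g) s).1
  le _ hP hPp j m s := norm_conn_repr_sub_le ha hD hP hPp j m s

lemma nco_mul (hg : g ≠ 0) {r : ℕ} (ζ η : Or p a n r g) (s : ℕ) :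
    nco p a n r g (ζ * η : Or p a n r g) s = ∑ x ∈ Finset.HasAntidiagonal.antidiagonal s,
      nco p a n r g ζ x.1 * nco p a n r g η x.2 := by
  rw [Subring.coe_mul, ← tser_nco hg r (ζ : PowerSeries (PadicAlgCl p)),
    ← tser_nco hg r (η : PowerSeries (PadicAlgCl p)), tser_mul, nco_tser hg, nco_tser hg,
    nco_tser hg]
  rfl

lemma nco_natCast_mul {r : ℕ} (c : ℕ) (ζ : Or p a n r g) (s : ℕ) :
    nco p a n r g ((c : Or p a n r g) * ζ : Or p a n r g) s = c * nco p a n r g ζ s := by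
  rw [← nsmul_eq_mul, nco, AddSubmonoidClass.coe_nsmul, map_nsmul, nsmul_eq_mul, mul_div_assoc]
  rfl

lemma nco_tdO {r : ℕ} (ζ : Or p a n r g) (s : ℕ) :
    nco p a n r g (tdO r ζ) s = s * nco p a n r g ζ s := by
  rw [nco, coe_tdO, tdS, PowerSeries.coeff_mk, mul_div_assoc]
  rfl

/-- The normalised coefficients of the coordinates in the basis `e^i` of the symmetric power. -/
def coordS (ha : 1 ≤ a) (hD : IsDworkRoot p (gam p a g)) :
    Sk p a n k 0 g →+ (Idx n k × ℕ → PadicAlgCl p) :=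
  AddMonoidHom.mk'
    (fun x l => nco p a n 0 g ((skBasis k ha hD (Nat.zero_le a)).repr x l.1 : Or p a n 0 g) l.2)
    fun x y => funext fun l => by
      rw [map_add, Finsupp.add_apply, nco, Subring.coe_add, map_add, add_div]
      rfl

lemma coordS_apply (ha : 1 ≤ a) (hD : IsDworkRoot p (gam p a g)) (x : Sk p a n k 0 g)
    (l : Idx n k × ℕ) : coordS ha hD x l =
      nco p a n 0 g ((skBasis k ha hD (Nat.zero_le a)).repr x l.1 : Or p a n 0 g) l.2 := rfl

lemma coordS_injective (ha : 1 ≤ a) (hD : IsDworkRoot p (gam p a g)) :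
    Function.Injective (coordS (n := n) (k := k) ha hD) := by
  intro x y h
  refine (skBasis k ha hD (Nat.zero_le a)).repr.injective (Finsupp.ext fun i => Subtype.ext ?_)
  have hg := g_ne_zero hD
  rw [← tser_nco (a := a) (n := n) hg 0 (((skBasis k ha hD (Nat.zero_le a)).repr x i : Or p a n 0 g) :
    PowerSeries (PadicAlgCl p)), ← tser_nco (a := a) (n := n) hg 0
    (((skBasis k ha hD (Nat.zero_le a)).repr y i : Or p a n 0 g) : PowerSeries (PadicAlgCl p))]
  congr 1
  exact funext fun s => congrFun h (i, s)

lemma coordS_smul_eMono (ha : 1 ≤ a) (hD : IsDworkRoot p (gam p a g)) (ζ : Or p a n 0 g)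
    (i : Idx n k) (l : Idx n k × ℕ) : coordS ha hD (ζ • eMono p a n k 0 g i) l =
      if i = l.1 then nco p a n 0 g ζ l.2 else 0 := by
  rw [coordS_apply, ← skBasis_apply ha hD (Nat.zero_le a), map_smul, Module.Basis.repr_self,
    Finsupp.smul_apply, Finsupp.single_apply, smul_eq_mul]
  split_ifs
  · rw [mul_one]
  · rw [mul_zero, nco, Subring.coe_zero, map_zero, zero_div]

/-- In coordinates, the connection is `t ∂/∂t` plus the action of its matrix. -/
lemma coordS_symConnHom (ha : 1 ≤ a) (hD : IsDworkRoot p (gam p a g)) (x : Sk p a n k 0 g)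
    (l : Idx n k × ℕ) : coordS ha hD (symConnHom k hD (Nat.zero_le a) x) l =
      (l.2 : PadicAlgCl p) * coordS ha hD x l + connAct k (connCo ha hD) (coordS ha hD x) l := by
  have hg := g_ne_zero hD
  have h1 : ∀ i (ζ : Or p a n 0 g), coordS ha hD (symConnHom k hD (Nat.zero_le a)
      (ζ • eMono p a n k 0 g i)) l = (if i = l.1 then (l.2 : PadicAlgCl p) * nco p a n 0 g ζ l.2 else 0) +
        ∑ j, ∑ m, if move i j m = l.1 then (i.1 j : PadicAlgCl p) *
          ∑ x ∈ Finset.HasAntidiagonal.antidiagonal l.2,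
            nco p a n 0 g ζ x.1 * connCo ha hD j m x.2 else 0 := fun i ζ => by
    rw [symConnHom_smul, symConnHom_eMono ha hD, Finset.smul_sum, map_add, Pi.add_apply,
      coordS_smul_eMono, nco_tdO, map_sum, Finset.sum_apply]
    congr 1
    refine Finset.sum_congr rfl fun j _ => ?_
    rw [Finset.smul_sum, map_sum, Finset.sum_apply]
    refine Finset.sum_congr rfl fun m _ => ?_
    rw [smul_smul, coordS_smul_eMono, mul_left_comm, nco_natCast_mul, nco_mul hg]
    rfl
  conv_lhs => rw [sk_eq_sum ha hD (Nat.zero_le a) x]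
  rw [map_sum, map_sum, Finset.sum_apply, Finset.sum_congr rfl fun i _ => h1 i _,
    Finset.sum_add_distrib, Finset.sum_ite_eq' Finset.univ l.1, if_pos (Finset.mem_univ _),
    connAct_apply]
  rfl

lemma nco_constHom (c : Oq p a g) (s : ℕ) :
    nco p a n 0 g (constHom p a n 0 g c) s = if s = 0 then (c : PadicAlgCl p) else 0 := by
  rw [nco, coe_constHom, PowerSeries.coeff_C]
  split_ifs with h
  · rw [h, gpow, mul_zero, mul_zero, pow_zero, div_one]
  · exact zero_div _

lemma coordS_sum_const (ha : 1 ≤ a) (hD : IsDworkRoot p (gam p a g)) (b : B → Oq p a g)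
    (l : Idx n k × ℕ) : coordS ha hD (∑ i : B, b i • eMono p a n k 0 g i.1) l =
      constEmb B (fun i => (b i : PadicAlgCl p)) l := by
  simp only [oq_smul_sk, map_sum, Finset.sum_apply, coordS_smul_eMono, nco_constHom]
  rw [constEmb_apply]
  by_cases h : l.1 ∈ B ∧ l.2 = 0
  · rw [dif_pos h, Finset.sum_eq_single ⟨l.1, h.1⟩]
    · rw [if_pos rfl, if_pos h.2]
    · exact fun i _ hi => if_neg fun h => hi (Subtype.ext h)
    · intro h; exact absurd (Finset.mem_univ _) h
  · rw [dif_neg h]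
    refine Finset.sum_eq_zero fun i _ => ?_
    split_ifs with h1 h2
    · exact absurd ⟨h1 ▸ i.2, h2⟩ h
    all_goals rfl

lemma coordS_solution (ha : 1 ≤ a) (hD : IsDworkRoot p (gam p a g)) (η : Sk p a n k 0 g)
    (b : B → Oq p a g) : coordS ha hD (symConnHom k hD (Nat.zero_le a) η +
        ∑ i : B, b i • eMono p a n k 0 g i.1) =
      cokMap B (connCo ha hD) (Sum.elim (coordS ha hD η) fun i => (b i : PadicAlgCl p)) := by
  funext l
  rw [map_add, Pi.add_apply, coordS_symConnHom, coordS_sum_const, cokMap_apply]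
  simp only [Sum.elim_inl, Sum.elim_inr, add_assoc]

lemma finite_lt_norm_coordS (ha : 1 ≤ a) (hD : IsDworkRoot p (gam p a g)) (x : Sk p a n k 0 g)
    {ε : ℝ} (hε : 0 < ε) : {l | ε < ‖coordS ha hD x l‖}.Finite := by
  have h : ∀ i : Idx n k, {s | ε < ‖coordS ha hD x (i, s)‖}.Finite := fun i => by
    have h1 := nco_tendsto (g_ne_zero hD) ((skBasis k ha hD (Nat.zero_le a)).repr x i)
    rw [Metric.tendsto_atTop] at h1
    obtain ⟨N, hN⟩ := h1 ε hε
    refine (Set.finite_Iio N).subset fun s hs => ?_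
    rw [Set.mem_ofPred_eq] at hs
    by_contra hcon
    have := hN s (not_lt.1 hcon)
    rw [dist_zero_right] at this
    exact absurd this (not_lt.2 hs.le)
  refine (Set.finite_iUnion fun i => (h i).image (Prod.mk i)).subset fun l hl => ?_
  exact Set.mem_iUnion.2 ⟨l.1, l.2, hl, rfl⟩

lemma coordS_mem (ha : 1 ≤ a) (hD : IsDworkRoot p (gam p a g)) (x : Sk p a n k 0 g)
    (l : Idx n k × ℕ) : coordS ha hD x l ∈ Oq p a g := nco_mem (g_ne_zero hD) _ _

lemma ball_coordS (ha : 1 ≤ a) (hD : IsDworkRoot p (gam p a g)) (x : Sk p a n k 0 g) :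
    Ball (Lq p a g) Set.univ (fun l => (1 : ℝ) ^ sdeg l) 1 (coordS ha hD x) := by
  refine ⟨fun l => (coordS_mem ha hD x l).1, fun l hl => absurd (Set.mem_univ l) hl, fun l => ?_,
    fun ε hε => ?_⟩
  · dsimp only
    rw [one_pow, mul_one]
    exact (coordS_mem ha hD x l).2
  · simp only [one_pow, mul_one]
    exact finite_lt_norm_coordS ha hD x hε

lemma exists_coordS_eq (ha : 1 ≤ a) (hD : IsDworkRoot p (gam p a g)) {f : Idx n k × ℕ → PadicAlgCl p}
    (hf : ∀ l, f l ∈ Oq p a g) (hf0 : ∀ ε : ℝ, 0 < ε → {l | ε < ‖f l‖}.Finite) :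
    ∃ x : Sk p a n k 0 g, coordS ha hD x = f := by
  have h0 : ∀ i, Tendsto (fun s => f (i, s)) atTop (𝓝 0) := fun i => by
    rw [← Nat.cofinite_eq_atTop, Metric.tendsto_nhds]
    intro ε hε
    have h1 := (hf0 (ε / 2) (half_pos hε)).preimage (f := Prod.mk i)
      (Prod.mk_right_injective i).injOn
    filter_upwards [h1.compl_mem_cofinite] with s hs
    rw [dist_zero_right]
    have : ¬ (ε / 2 < ‖f (i, s)‖) := hs
    linarith
  refine ⟨∑ i, (mkOr 0 (fun s => f (i, s)) (fun s => hf _) (h0 i) : Or p a n 0 g) • eMono p a n k 0 g i,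
    funext fun l => ?_⟩
  rw [coordS_apply, repr_sum_eMono]
  exact congrFun (nco_tser (g_ne_zero hD) 0 fun s => f (l.1, s)) l.2

/-- Every element of the symmetric power is congruent to a combination of the `e^i`, `i ∈ B`, modulo
the image of the connection, with control on the coefficients. -/
lemma exists_solution (ha : 1 ≤ a) (hD : IsDworkRoot p (gam p a g)) (hM : LeadInvertible p B)
    {P : ℝ} (hP : 1 ≤ P) (hPp : P < p) {x : Sk p a n k 0 g}
    (hx : Ball (Lq p a g) Set.univ (fun l => P ^ sdeg l) 1 (coordS ha hD x)) :
    ∃ (η : Sk p a n k 0 g) (b : B → Oq p a g),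
      x = symConnHom k hD (Nat.zero_le a) η + ∑ i : B, b i • eMono p a n k 0 g i.1 ∧
        ∀ i : B, ‖(b i : PadicAlgCl p)‖ * P ^ wt i.1 ≤ 1 := by
  obtain ⟨z, hz, hzx⟩ := exists_cokMap_eq (isComplete_Lq ha) hM (nearLead_connCo ha hD) hP hPp
    one_pos hx
  have hz1 : ∀ u, z u ∈ Oq p a g := fun u => ⟨hz.1 u,
    (le_mul_of_one_le_right (norm_nonneg _) (one_le_pow₀ hP)).trans (hz.2.2.1 u)⟩
  obtain ⟨η, hη⟩ := exists_coordS_eq (k := k) ha hD (f := fun e => z (Sum.inl e))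
    (fun l => hz1 _) fun ε hε => by
      refine ((hz.2.2.2 ε hε).preimage (f := Sum.inl) Sum.inl_injective.injOn).subset fun l hl => ?_
      exact lt_of_lt_of_le hl (le_mul_of_one_le_right (norm_nonneg _) (one_le_pow₀ hP))
  refine ⟨η, fun i => ⟨z (Sum.inr i), hz1 _⟩, coordS_injective ha hD ?_,
    fun i => hz.2.2.1 (Sum.inr i)⟩
  rw [coordS_solution, hη, ← hzx]
  congr 1
  exact funext fun u => by rcases u with u | u <;> rfl

/-- The image of the connection contains no nonzero combination of the `e^i`, `i ∈ B`. -/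
lemma eq_zero_of_solution (ha : 1 ≤ a) (hD : IsDworkRoot p (gam p a g)) (hM : LeadInvertible p B)
    {η : Sk p a n k 0 g} {b : B → Oq p a g}
    (h : symConnHom k hD (Nat.zero_le a) η + ∑ i : B, b i • eMono p a n k 0 g i.1 = 0) : b = 0 := by
  have h1 := coordS_solution ha hD η b
  rw [h, map_zero] at h1
  have h2 := eq_zero_of_cokMap_eq_zero (L := Lq p a g) hM (nearLead_connCo ha hD) one_pos
    ⟨fun u => ?_, fun u hu => absurd (Set.mem_univ u) hu, fun u => ?_, fun ε hε => ?_⟩ h1.symm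
  · exact funext fun i => Subtype.ext (congrFun h2 (Sum.inr i))
  · rcases u with u | u
    · exact (coordS_mem ha hD η u).1
    · exact (b u).2.1
  · dsimp only
    rw [one_pow, mul_one]
    rcases u with u | u
    · exact (coordS_mem ha hD η u).2
    · exact (b u).2.2
  · simp only [one_pow, mul_one]
    refine (((finite_lt_norm_coordS ha hD η hε).image Sum.inl).union
      (Set.finite_range Sum.inr)).subset fun u hu => ?_
    rcases u with u | u
    · exact Or.inl ⟨u, hu, rfl⟩
    · exact Or.inr ⟨u, rfl⟩

lemma cls1_symConnHom (hk : 1 ≤ k) (hD : IsDworkRoot p (gam p a g)) (η : Sk p a n k 0 g) :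
    cls1 p a n k g (symConnHom k hD (Nat.zero_le a) η) = 0 := by
  rw [← symConn_eq hk hD, cls1, Submodule.mkQ_apply, Submodule.Quotient.mk_eq_zero]
  exact ⟨η, rfl⟩

/-- The classes of the `e^i`, `i ∈ B`, form a basis of the cohomology. -/
lemma exists_h1Basis (hk : 1 ≤ k) (ha : 1 ≤ a) (hD : IsDworkRoot p (gam p a g))
    (hM : LeadInvertible p B) : ∃ b : Module.Basis B (Oq p a g) (H1 p a n k g),
      ∀ i : B, b i = cls1 p a n k g (eMono p a n k 0 g i.1) := by
  refine ⟨Module.Basis.mk (v := fun i : B => cls1 p a n k g (eMono p a n k 0 g i.1)) ?_ ?_,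
    fun i => Module.Basis.mk_apply _ _ _⟩
  · rw [Fintype.linearIndependent_iff]
    intro b hb
    simp only [← map_smul] at hb
    rw [← map_sum, cls1, Submodule.mkQ_apply, Submodule.Quotient.mk_eq_zero] at hb
    obtain ⟨η, hη⟩ := hb
    rw [symConn_eq hk hD] at hη
    refine congrFun (eq_zero_of_solution ha hD hM (η := -η) (b := b) ?_)
    rw [map_neg, hη, neg_add_cancel]
  · rintro y -
    obtain ⟨x, rfl⟩ := Submodule.mkQ_surjective _ y
    obtain ⟨η, b, hx, -⟩ := exists_solution ha hD hM le_rfl one_lt_prime (ball_coordS ha hD x)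
    change cls1 p a n k g x ∈ _
    rw [hx, map_add, cls1_symConnHom hk, zero_add, map_sum]
    refine sum_mem fun i _ => ?_
    rw [map_smul]
    exact Submodule.smul_mem _ _ (Submodule.subset_span ⟨i, rfl⟩)

/-- The coordinates of `β_{k,1}(e^i)` decrease faster than those of the `P`-bounded elements, for
every `P < p`. -/
lemma ball_coordS_beta (hk : 1 ≤ k) (ha : 1 ≤ a) (hD : IsDworkRoot p (gam p a g)) {P : ℝ}
    (hP : 1 ≤ P) (hPp : P < p) (i : Idx n k) : Ball (Lq p a g) Set.univ (fun l => P ^ sdeg l) 1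
      (coordS ha hD (beta p a n k g (eMono p a n k 0 g i))) := by
  -- The bound for a larger `P'` provides the convergence to zero for `P`.
  obtain ⟨P', h1, h2⟩ := exists_between hPp
  have hP0 : 0 < P := by linarith
  have hP'0 : 0 < P' := by linarith
  have hR : (P' ^ (p : ℝ)⁻¹) ^ p = P' := Real.rpow_inv_natCast_pow hP'0.le hp.1.ne_zero
  have hbd : ∀ l, ‖coordS ha hD (beta p a n k g (eMono p a n k 0 g i)) l‖ * P' ^ sdeg l ≤ 1 :=
    fun l => by
      have := norm_beta_repr_le (n := n) hk ha hD (R := P' ^ (p : ℝ)⁻¹)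
        (Real.one_le_rpow (hP.trans h1.le) (by positivity)) (by rwa [hR]) i l.1 l.2
      rwa [hR] at this
  have hr1 : P / P' < 1 := (div_lt_one hP'0).2 h1
  have hle : ∀ l, ‖coordS ha hD (beta p a n k g (eMono p a n k 0 g i)) l‖ * P ^ sdeg l ≤
      (P / P') ^ sdeg l := fun l => by
    rw [div_pow, le_div_iff₀ (by positivity), mul_right_comm]
    exact mul_le_of_le_one_left (by positivity) (hbd l)
  refine ⟨fun l => (coordS_mem ha hD _ l).1, fun l hl => absurd (Set.mem_univ l) hl,
    fun l => (hle l).trans (pow_le_one₀ (by positivity) hr1.le), fun ε hε => ?_⟩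
  obtain ⟨N, hN⟩ := exists_pow_lt_of_lt_one hε hr1
  refine (finite_sdeg_le N).subset fun l hl => ?_
  rw [Set.mem_ofPred_eq] at hl ⊢
  by_contra! hcon
  have := pow_le_pow_of_le_one (by positivity) hr1.le hcon.le
  linarith [hle l]

/-- The bound for the matrix of the Frobenius. -/
lemma norm_repr_betaBar_le (hk : 1 ≤ k) (ha : 1 ≤ a) (hD : IsDworkRoot p (gam p a g))
    (hM : LeadInvertible p B) (b : Module.Basis B (Oq p a g) (H1 p a n k g))
    (hb : ∀ i : B, b i = cls1 p a n k g (eMono p a n k 0 g i.1)) (i j : B) :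
    ‖(b.repr (betaBar p a n k g (b i)) j : PadicAlgCl p)‖ ≤ (p : ℝ) ^ (-(wt j.1 : ℤ)) := by
  have key : ∀ P : ℝ, 1 ≤ P → P < p →
      ‖(b.repr (betaBar p a n k g (b i)) j : PadicAlgCl p)‖ * P ^ wt j.1 ≤ 1 := by
    intro P hP hPp
    obtain ⟨η, c, hx, hc⟩ := exists_solution ha hD hM hP hPp (ball_coordS_beta hk ha hD hP hPp i.1)
    have h1 : betaBar p a n k g (b i) = ∑ l, c l • b l := by
      rw [hb i, isBetaBar_betaBar hk ha hD, hx, map_add, cls1_symConnHom hk, zero_add, map_sum]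
      exact Finset.sum_congr rfl fun l _ => by rw [map_smul, hb]
    rw [h1, Module.Basis.repr_sum_self]
    exact hc j
  have hp0 : (0 : ℝ) < p := by exact_mod_cast hp.1.pos
  rw [zpow_neg, zpow_natCast, ← one_div, le_div_iff₀ (by positivity)]
  -- Let `P` tend to `p`.
  have hcont : Continuous fun P : ℝ =>
      ‖(b.repr (betaBar p a n k g (b i)) j : PadicAlgCl p)‖ * P ^ wt j.1 := by fun_prop
  refine le_of_tendsto (hcont.continuousWithinAt (s := Set.Iio (p : ℝ)) (x := p)) ?_
  filter_upwards [Ioo_mem_nhdsLT (one_lt_prime (p := p))] with P hP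
  exact key P hP.1.le hP.2

end Main

end

end HyperKloosterman

theorem theorem5p5 (p a n k : ℕ) [Fact p.Prime] (ha : 1 ≤ a) (hn : 1 ≤ n) (hk : 1 ≤ k)
    (γ g : PadicAlgCl p) (hγ : HyperKloosterman.IsDworkRoot p γ) (hg : g ^ p ^ a = γ)
    (ζ : AlgebraicClosure (ZMod p)) (hζ : IsPrimitiveRoot ζ (n + 1))
    (hd : HyperKloosterman.dk p n k ζ = 0)
    (B : Set (HyperKloosterman.Idx n k)) (hB : HyperKloosterman.IsConstantBasis (GaloisField p a) B) :
    HyperKloosterman.OperatorsExist p a n k g ∧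
    ∃ b : Module.Basis B (HyperKloosterman.Oq p a g) (HyperKloosterman.H1 p a n k g),
      (∀ i : B, b i =
        HyperKloosterman.cls1 p a n k g (HyperKloosterman.eMono p a n k 0 g i.1)) ∧
      ∀ i j : B,
        ‖(b.repr (HyperKloosterman.betaBar p a n k g (b i)) j : PadicAlgCl p)‖ ≤
          (p : ℝ) ^ (-(HyperKloosterman.wt j.1 : ℤ)) := by
  subst hg
  have hD : HyperKloosterman.IsDworkRoot p (HyperKloosterman.gam p a g) := hγ
  have hM := HyperKloosterman.leadInvertible hζ hd hB
  obtain ⟨b, hb⟩ := HyperKloosterman.exists_h1Basis hk ha hD hM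
  exact ⟨⟨HyperKloosterman.isConn_conn hD, HyperKloosterman.isFrob_frob ha hD,
    HyperKloosterman.isSymConn_symConn hD, HyperKloosterman.isSymFrob_symFrob ha hD,
    HyperKloosterman.isPsi_psi ha hD, HyperKloosterman.isBetaBar_betaBar hk ha hD⟩, b, hb,
    HyperKloosterman.norm_repr_betaBar_le hk ha hD hM b hb⟩
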